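/- Notation. For $k\ge 2$ let $[k]$ be the set of colours and $\Delta^k$ the simplex of probability vectors on $[k]$. For $y\in[1/k,1]$ and $l\in[k]$ let $s(y,l)\in\Delta^k$ have entry $y$ at $l$ and $(1-y)/(k-1)$ elsewhere. A law $\mu$ on $[1/k,1]$ is identified with the law $\hat\mu$ of $s(Y,L)$, where $Y\sim\mu$ and $L$ is uniform on $[k]$ and independent of $Y$. Put $(\Pi_l\nu)(dx)=kx^{(l)}\nu(dx)$ for a law $\nu$ on $\Delta^k$. For an offspring law $\xi$ on $\mathbb{Z}_{\ge0}$ let $\Gamma^\xi\nu$ be the law of the vector $$\Bigl(\prod_{i=1}^{b}\bigl(1-X_i^{(m-L_i+1)}\bigr)\Big/\sum_{m'=1}^k\prod_{i=1}^{b}\bigl(1-X_i^{(m'-L_i+1)}\bigr)\Bigr)_{m\in[k]},$$ where $b\sim\xi$, the $L_i$ are i.i.d. uniform on $\{2,\dots,k\}$, the $X_i$ are i.i.d. of law $\nu$, all independent, and coordinates are read modulo $k$. Let $\Gamma_s^\xi\nu=\frac1k\sum_{l}\Gamma^\xi\Pi_l\nu$, and let $\|\Gamma^\xi_s\mu\|_\infty$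 be the law of the largest entry of a vector of law $\Gamma_s^\xi\hat\mu$. A law $\nu$ dominates $\mu$ by $\varepsilon$ if for every $x$ either $\mu((-\infty,x])=1$, or $\nu((-\infty,x])=0$, or $\nu((-\infty,x])+\varepsilon\le\mu((-\infty,x])$. Say that $(d,k)$ is $c$-good with $\mu$ if $\mu$ is a law on $[1/k,1]$, $\mu\ne\delta_{1/k}$, and $\|\Gamma_s^{\mathrm{Pois}(d)}\mu\|_\infty$ dominates $\mu$ by $c/\log k$. Let $\mathrm{tPois}(d',d)$ be the law of $D'\mathbf 1\{D'\le d\}$ with $D'\sim\mathrm{Pois}(d')$. For laws $\mu_1,\mu_2$ on $[1/k,1]$ with distribution functions $G_1,G_2$ put $$q_{\mu_1,\mu_2}(y,u)=\inf\{x\ge 1/k: G_2(x)\ge G_1(y-)+u(G_1(y)-G_1(y-))\},\qquad \tilde q_{\mu_1,\mu_2}(y,u)=\frac{k\,(y-q_{\mu_1,\mu_2}(y,u))}{ky-1}.$$ Estimator. Let $T$ be the first $n$ levels of the $d$-ary tree with root $\rho$ and level-$n$ vertices $L_n$, let $\sigma$ be a uniformly random proper $k$-colouring of $T$, let $\mathsf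 U=(U_v)_{v\in T}$ be an array of independent uniform variables on $[0,1]$ (each $U_v$ supplying finitely many independent uniform variables), and let $\mathsf D=(D_v)_{v\in T}$ be an array of independent $\xi$-distributed variables, $\xi=\mathrm{tPois}(d',d)$; $\sigma,\mathsf U,\mathsf D$ are independent. Given $\mu$, define arrays $\widetilde{\mathsf B}_v$ indexed by the vertices $w$ of the subtree $T_v$, with entries $(p_w,\eta_{w,v})\in\mathbb{R}\times[k]$ or $(\star,\star)$, from the leaves upwards. All random choices below use $U_v$, independently. * If $v\in L_n$, put $p_v=\tilde q_{\delta_1,\mu}(1,\cdot)$ (second argument uniform), and let $\pi_v^2$ be, with probability $p_v$, a uniform permutation of $[k]$ and otherwise the identity. Set $\widetilde{\mathsf B}_v=(p_v,\pi^2_v(\sigma_v))$. * If $v\notin L_n$ has offspring $u_1,\dots,u_d$, let $\widetilde{\mathsf P}_{u_i}=(P(\sigma_{u_i}=l\mid\widetilde{\mathsf B}_{u_i}))_{l}$ and $$\widetilde{\mathsf P}^\circ_v=\Bigl(\prod_{i\le D_v}(1-\widetilde{\mathsf P}_{u_i}^{(l)})\Big/\sum_{m}\prod_{i\le D_v}(1-\widetilde{\mathsf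 P}_{u_i}^{(m)})\Bigr)_{l\in[k]}.$$ Let $l_v$ be a uniformly chosen maximising coordinate of $\widetilde{\mathsf P}^\circ_v$, let $p_v=\tilde q_{\mu_1,\mu}(\|\widetilde{\mathsf P}^\circ_v\|_\infty,\cdot)$ with $\mu_1=\|\Gamma_s^\xi\mu\|_\infty$, let $\pi_v^1$ be a uniform permutation fixing $l_v$, and let $\pi_v^2$ be, with probability $p_v$, a uniform permutation and otherwise the identity. Set the entry of $\widetilde{\mathsf B}_v$ at $v$ to $(p_v,\pi^2_v(l_v))$; for $w\in T_{u_i}$ with $i\le D_v$ keep $p_w$ and set $\eta_{w,v}=\pi_v^2\pi_v^1(\eta_{w,u_i})$ (entries $(\star,\star)$ stay); for $w\in T_{u_i}$ with $i>D_v$ set the entry to $(\star,\star)$. Theorem. There are constants $\beta^0<1$, $c>0$ and $k_0$ such that the following hold. (i) For all $k>k_0$ and all real $d\ge k(\log k+\log\log k+\beta^0)$ there is a $\mu$ with which $(d,k)$ is $c$-good. (ii) Let $\beta^*\in(\beta^0,1)$, let $k\ge2$ and $d\ge0$ be integers, and let $d'$ be the larger of $0$ and $\lfloor d-(\beta^*-\beta^0)k\rfloor$.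 Suppose that $(d',k)$ is $c$-good with $\mu$ and that $P(\mathrm{Pois}(d')>d)<c/(k\log k)$. Then, for every $n$, the array $\widetilde{\mathsf B}_\rho$ constructed above from $\mu$ on the $n$-level $d$-ary tree is a measurable function of $(\sigma_{L_n},\mathsf U,\mathsf D)$, and $$\liminf_{n\to\infty}\mathbb E\sup_{l\in[k]}\Bigl|P\bigl(\sigma_\rho=l\mid\widetilde{\mathsf B}_\rho(\sigma_{L_n},\mathsf U,\mathsf D)\bigr)-\frac1k\Bigr|>0 .$$ -/

import Mathlib

open MeasureTheory ProbabilityTheory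
open scoped ENNReal NNReal

noncomputable section

namespace TreeColouring

/-! ### The truncated `d`-ary tree and the colouring model on it -/

/-- Vertices of the first `n` levels of the `d`-ary tree: words over `Fin d` of length at most `n`.
The root is `[]`, the offspring of `w` are the words `w ++ [i]`, and the word `i :: w` is the vertex
`w` of the subtree hanging from the `i`-th offspring of the root. -/
abbrev Vertex (d n : ℕ) : Type := {w : List (Fin d) // w.length ≤ n}

/-- The set `L_n` of vertices at level `n`. -/
abbrev Leaf (d n : ℕ) : Type := {w : List (Fin d) // w.length = n}

instance (d n : ℕ) : Finite (Vertex d n) := (List.finite_length_le (Fin d) n).to_subtype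

instance (d n : ℕ) : Fintype (Vertex d n) := Fintype.ofFinite _

def root (d n : ℕ) : Vertex d n := ⟨[], Nat.zero_le n⟩

/-- The vertex `w` of the `i`-th principal subtree, as a vertex of the whole tree. -/
def Vertex.below {d n : ℕ} (i : Fin d) (w : Vertex d n) : Vertex d (n + 1) :=
  ⟨i :: w.1, Nat.succ_le_succ w.2⟩

def Leaf.below {d n : ℕ} (i : Fin d) (w : Leaf d n) : Leaf d (n + 1) :=
  ⟨i :: w.1, congrArg Nat.succ w.2⟩

def Leaf.toVertex {d n : ℕ} (w : Leaf d n) : Vertex d n := ⟨w.1, w.2.le⟩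

/-- Proper `k`-colourings of the first `n` levels of the `d`-ary tree. -/
def properColourings (k d n : ℕ) : Set (Vertex d n → Fin k) :=
  {σ | ∀ v w : Vertex d n, (∃ i : Fin d, w.1 = v.1 ++ [i]) → σ v ≠ σ w}

/-- The `k`-colouring model: the uniform measure on proper colourings. -/
def colouringMeasure (k d n : ℕ) : Measure (Vertex d n → Fin k) :=
  uniformOn (properColourings k d n)

/-! ### Offspring distributions -/

/-- The law `tPois(d', d)` of `D' · 1{D' ≤ d}` with `D' ∼ Pois(d')`. -/
def truncPoisson (d' : ℝ≥0) (d : ℕ) : Measure ℕ :=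
  (poissonMeasure d').map (fun m => if m ≤ d then m else 0)

instance (d' : ℝ≥0) (d : ℕ) : IsProbabilityMeasure (truncPoisson d' d) :=
  Measure.isProbabilityMeasure_map (Measurable.of_discrete).aemeasurable

/-! ### The distributional tree recursion on the simplex -/

/-- The vector with entry `y` at colour `l` and all other entries equal to `(1 - y) / (k - 1)`. -/
def starVec (k : ℕ) (y : ℝ) (l : Fin k) : Fin k → ℝ :=
  fun m => if m = l then y else (1 - y) / ((k : ℝ) - 1)

/-- The symmetric law on star-shaped vectors that corresponds to a law `μ` on `[1/k, 1]`:
the largest entry has law `μ` and sits at an independent uniform colour. -/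
def symmLift (k : ℕ) (μ : Measure ℝ) : Measure (Fin k → ℝ) :=
  (μ.prod (uniformOn (Set.univ : Set (Fin k)))).map (fun z => starVec k z.1 z.2)

/-- The tilted law `(Π_l ν)(dx) = k x_l ν(dx)`. -/
def tilt (k : ℕ) (l : Fin k) (ν : Measure (Fin k → ℝ)) : Measure (Fin k → ℝ) :=
  ν.withDensity (fun x => ENNReal.ofReal ((k : ℝ) * x l))

/-- One step of the posterior recursion. The `b` offspring come with relative colours `(z i).1` and
posterior vectors `(z i).2`; indices of colours are read modulo `k`. -/
def combine (k : ℕ) {b : ℕ} (z : Fin b → Fin k × (Fin k → ℝ)) : Fin k → ℝ :=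
  fun m => (∏ i, (1 - (z i).2 (m - (z i).1))) / ∑ m', ∏ i, (1 - (z i).2 (m' - (z i).1))

/-- The operator `Γ` with offspring law `ξ`: the number `b` of offspring has law `ξ`; given `b`, the
relative colours of the offspring are i.i.d. uniform on the nonzero residues modulo `k` (so that the
numbers of offspring of the various colours are multinomial), and the vectors are i.i.d. of
law `ν`, independently of the colours. -/
def treeOp (k : ℕ) [NeZero k] (ξ : Measure ℕ) (ν : Measure (Fin k → ℝ)) : Measure (Fin k → ℝ) :=
  ξ.bind (fun b =>
    (Measure.pi (fun _ : Fin b => (uniformOn {l : Fin k | l ≠ 0}).prod ν)).map (combine k))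

/-- The symmetrised operator `Γ_s ν = (1/k) ∑_l Γ (Π_l ν)`. -/
def treeOpSymm (k : ℕ) [NeZero k] (ξ : Measure ℕ) (ν : Measure (Fin k → ℝ)) :
    Measure (Fin k → ℝ) :=
  (k : ℝ≥0∞)⁻¹ • ∑ l : Fin k, treeOp k ξ (tilt k l ν)

/-- The transformation `Λ ∘ Γ_s` on laws on `[1/k, 1]`: the law of the largest entry (the norm of
`Fin k → ℝ` is the sup norm) of a vector of law `Γ_s μ`. -/
def maxOp (k : ℕ) [NeZero k] (ξ : Measure ℕ) (μ : Measure ℝ) : Measure ℝ :=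
  (treeOpSymm k ξ (symmLift k μ)).map (fun x => ‖x‖)

/-- `ν` stochastically dominates `μ` by `ε`. -/
def DominatesBy (ε : ℝ) (ν μ : Measure ℝ) : Prop :=
  ∀ x : ℝ, μ (Set.Iic x) = 1 ∨ ν (Set.Iic x) = 0 ∨
    ν (Set.Iic x) + ENNReal.ofReal ε ≤ μ (Set.Iic x)

/-- `μ` is a nontrivial law on `[1/k, 1]`, and for the Poisson offspring law of mean `d` its image
under `Λ ∘ Γ_s` dominates it by `c / log k`. -/
structure IsDominated (c : ℝ) (k : ℕ) [NeZero k] (d : ℝ≥0) (μ : Measure ℝ) : Prop where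
  isProbabilityMeasure : IsProbabilityMeasure μ
  supported : μ (Set.Icc (1 / (k : ℝ)) 1) = 1
  nontrivial : μ ≠ Measure.dirac (1 / (k : ℝ))
  dominates : DominatesBy (c / Real.log k) (maxOp k (poissonMeasure d) μ) μ

/-! ### Reducing one law to a smaller one -/

/-- The function `q` that reduces `μ₁` to `μ₂`: if `Y ∼ μ₁` and `U` is an independent uniform
variable, then `q(Y, U) ∼ μ₂`. With `G₁, G₂` the distribution functions,
`q(y,u) = inf {x ≥ 1/k : G₂(x) ≥ G₁(y-) + u (G₁(y) - G₁(y-))}`. -/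
def reduceFn (k : ℕ) (μ₁ μ₂ : Measure ℝ) (y u : ℝ) : ℝ :=
  sInf {x : ℝ | 1 / (k : ℝ) ≤ x ∧
    μ₁.real (Set.Iio y) + u * (μ₁.real (Set.Iic y) - μ₁.real (Set.Iio y)) ≤ μ₂.real (Set.Iic x)}

/-- The weight `p` with `(1 - p) y + p / k = q(y, u)`. -/
def mixWeight (k : ℕ) (μ₁ μ₂ : Measure ℝ) (y u : ℝ) : ℝ :=
  (k : ℝ) * (y - reduceFn k μ₁ μ₂ y u) / ((k : ℝ) * y - 1)

/-! ### Sampling from finite sets with uniform variables -/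

/-- The element of `S` number `⌊u |S|⌋` in a fixed enumeration; it is uniform on `S` when `u` is
uniform on `[0,1]`. -/
def pick {α : Type*} (S : Finset α) (hS : S.Nonempty) (u : unitInterval) : α :=
  (S.equivFin.symm ⟨min ⌊(u : ℝ) * S.card⌋₊ (S.card - 1),
    lt_of_le_of_lt (min_le_right _ _) (Nat.sub_lt hS.card_pos one_pos)⟩ : S)

/-- A sample of `ν₁(l)`, the uniform law on the permutations of the colours that fix `l`. -/
def samplePermFixing {k : ℕ} (l : Fin k) (u : unitInterval) : Equiv.Perm (Fin k) :=
  pick (Finset.univ.filter (fun π : Equiv.Perm (Fin k) => π l = l)) ⟨1, by simp⟩ u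

open scoped Classical in
/-- A sample of `ν₂(p)`: a uniform permutation with probability `p`, otherwise the identity. -/
def samplePermMix {k : ℕ} (p : ℝ) (u u' : unitInterval) : Equiv.Perm (Fin k) :=
  if (u : ℝ) < p then pick (Finset.univ : Finset (Equiv.Perm (Fin k))) Finset.univ_nonempty u'
  else 1

open scoped Classical in
/-- The set of colours at which the vector `x` is largest. -/
def argmaxSet {k : ℕ} (x : Fin k → ℝ) : Finset (Fin k) :=
  Finset.univ.filter (fun l => ∀ m, x m ≤ x l)

theorem argmaxSet_nonempty {k : ℕ} [NeZero k] (x : Fin k → ℝ) : (argmaxSet x).Nonempty := by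
  obtain ⟨l, hl⟩ := Finite.exists_max x
  exact ⟨l, by simpa [argmaxSet] using hl⟩

/-! ### Alice's recursive algorithm and Bob's information -/

/-- The uniform variables at a vertex: component `0` breaks ties, `1` chooses the mixing weight,
`2` samples the permutation fixing a colour, `3` and `4` sample the mixing permutation. -/
abbrev Seed : Type := Fin 5 → unitInterval

/-- What Bob is told at a single vertex: either the pair (mixing weight, colour) or, at an erased
vertex, the symbol `Sum.inr ()`, which plays the role of `(⋆, ⋆)`. -/
abbrev Entry (k : ℕ) : Type := (ℝ × Fin k) ⊕ Unit

/-- An array of Bob's entries indexed by the vertices of the tree. -/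
abbrev Info (k d n : ℕ) : Type := Vertex d n → Entry k

/-- Rules that compute Bob's array from the colours of the leaves, the array `U` of uniform
variables and the array `D` of numbers of retained offspring. -/
abbrev InfoRule (k d n : ℕ) : Type :=
  (Leaf d n → Fin k) → (Vertex d n → Seed) → (Vertex d n → ℕ) → Info k d n

/-- The joint outcome: a colouring of the tree, the array `U` and the array `D`. -/
abbrev Outcome (k d n : ℕ) : Type :=
  (Vertex d n → Fin k) × (Vertex d n → Seed) × (Vertex d n → ℕ)

/-- The joint law: a uniform proper colouring, independent uniform variables and independent
`ξ`-distributed numbers, the three being independent of each other. -/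
def law (k d n : ℕ) (ξ : Measure ℕ) : Measure (Outcome k d n) :=
  (colouringMeasure k d n).prod
    ((Measure.pi fun _ => Measure.pi fun _ => (volume : Measure unitInterval)).prod
      (Measure.pi fun _ => ξ))

instance (k d n : ℕ) (ξ : Measure ℕ) [IsProbabilityMeasure ξ] : IsFiniteMeasure (law k d n ξ) := by
  have : IsFiniteMeasure (colouringMeasure k d n) := by
    unfold colouringMeasure; infer_instance
  unfold law; infer_instance

/-- The array that the rule `B` produces from the colours of the leaves, `U` and `D`. -/
def observed {k d n : ℕ} (B : InfoRule k d n) (ω : Outcome k d n) : Info k d n :=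
  B (fun w => ω.1 w.toVertex) ω.2.1 ω.2.2

def rootColour {k d n : ℕ} (ω : Outcome k d n) : Fin k := ω.1 (root d n)

/-- Bob's belief: the conditional law of the colour of the root given the array that the rule `B`
produces, as a function of that array. -/
def belief {k d n : ℕ} [NeZero k] (ξ : Measure ℕ) [IsProbabilityMeasure ξ] (B : InfoRule k d n)
    (b : Info k d n) : Fin k → ℝ :=
  fun l => (condDistrib rootColour (observed B) (law k d n ξ) b).real {l}

/-- Permute the colour in an entry; the symbol for erased vertices stays. -/
def Entry.permute {k : ℕ} (π : Equiv.Perm (Fin k)) : Entry k → Entry k :=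
  Sum.map (fun e => (e.1, π e.2)) id

/-- Alice's action on a tree that consists of one leaf of colour `η`. -/
def leafStep (k d : ℕ) (μ : Measure ℝ) : InfoRule k d 0 := fun η U _ _ =>
  let l := η ⟨[], rfl⟩
  let p := mixWeight k (Measure.dirac 1) μ 1 (U (root d 0) 1)
  Sum.inl (p, samplePermMix p (U (root d 0) 3) (U (root d 0) 4) l)

/-- Bob's belief at a vertex before Alice acts there, from the beliefs `P i` at the offspring `i`
of which the first `D` are retained. -/
def priorBelief {k d : ℕ} (D : ℕ) (P : Fin d → Fin k → ℝ) : Fin k → ℝ :=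
  fun l => (∏ i with i.val < D, (1 - P i l)) / ∑ m, ∏ i with i.val < D, (1 - P i m)

/-- Alice's action at the root of a tree of height `n + 1`, given the rule `B` that she uses on
trees of height `n`. -/
def innerStep (k d n : ℕ) [NeZero k] (μ : Measure ℝ) (ξ : Measure ℕ) [IsProbabilityMeasure ξ]
    (B : InfoRule k d n) : InfoRule k d (n + 1) := fun η U D =>
  let Bsub : Fin d → Info k d n := fun i =>
    B (fun w => η (w.below i)) (fun w => U (w.below i)) (fun w => D (w.below i))
  let r := root d (n + 1)
  let P := priorBelief (D r) (fun i => belief ξ B (Bsub i))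
  let l := pick (argmaxSet P) (argmaxSet_nonempty P) (U r 0)
  let p := mixWeight k (maxOp k ξ μ) μ ‖P‖ (U r 1)
  let π₁ := samplePermFixing l (U r 2)
  let π₂ := samplePermMix p (U r 3) (U r 4)
  fun v => match v with
    | ⟨[], _⟩ => Sum.inl (p, π₂ l)
    | ⟨i :: w, h⟩ =>
      if i.val < D r then (Bsub i ⟨w, Nat.le_of_succ_le_succ h⟩).permute (π₂ * π₁)
      else Sum.inr ()

/-- The array that Alice finally gives to Bob, as a function of the colours of the leaves, of `U`
and of `D`. -/
def bobInfo (k d : ℕ) [NeZero k] (μ : Measure ℝ) (ξ : Measure ℕ) [IsProbabilityMeasure ξ] :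
    (n : ℕ) → InfoRule k d n
  | 0 => leafStep k d μ
  | n + 1 => innerStep k d n μ ξ (bobInfo k d μ ξ n)

/-- `E sup_l |P(σ_ρ = l | B) - 1/k|` for the array `B` given by a rule. -/
def advantage {k d n : ℕ} (ξ : Measure ℕ) (B : InfoRule k d n) : ℝ :=
  ∫ ω, (⨆ l : Fin k,
    |condExp (MeasurableSpace.comap (observed B) inferInstance) (law k d n ξ)
        (Set.indicator (rootColour ⁻¹' {l}) (fun _ => (1 : ℝ))) ω - 1 / (k : ℝ)|) ∂(law k d n ξ)

end TreeColouring

end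

/-! Existence of a dominated law. Describe a law on `[1/k, 1]` as the law of `1 - Z(W)` with `W`
uniform on `[0, 1]`, so that `Z` is an error probability. Given its true colour, an offspring has a
belief that points to this colour with probability `1 - Z` and otherwise to a uniform wrong one
(`map_childVec`). One step of the recursion is therefore a functional of a Poisson sample of
independent marks (`treeOp_poisson_apply`).

Let `Z = 0.51` on a core of mass `1 / log k`, and let `Z` be a step function elsewhere, in the tail.
A wrong colour is a serious rival only if all offspring of that colour lie in the core. For `d = k
(log k + log log k + β)` the expected number of rivals is about `exp (1 - β) / log k`, so at `β = 1`
the rivals reproduce the core. A single rival leaves the larger of two entries near `1/2`, hence an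
error below `0.51`. Two rivals, or a rival together with a large contribution of other colours, have
probability of order `1 / (log k)^2`.

The colours that are not rivals contribute a sum `T` to the likelihood ratio, and the error is at
most `T / (1 + T)`. Quarter powers are subadditive, so `T^(1/4)` is controlled colour by colour. Its
mean is a multiple of the integral over the tail of `(1 - z) z^(1/4) + z`, a quantity controlled in
turn by `T^(1/4)`. If core offspring carried no information, the multiplier would be about one at `β
= 1`. With error `0.51` their quarter moment is at most `0.939`, and the multiplier drops to about
`exp (-0.058)`, which absorbs the losses `1.054` and `1.001` of the estimates. This strict room
allows `β` slightly below one and a domination by a positive multiple of `1 / log k`. The upper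
bounds for likelihood ratios are monotone in `Z` (`ratioBound_mono`), so a suitable step function
arises as a fixed point of an order-preserving map on a finite set (`exists_fixed_profile`,
`isDominated_profile`).

Reconstruction. The truncation of the Poisson law costs less than the margin of domination
(`dominates_truncPoisson`). By induction on the height the algorithm is `Calibrated`: the posterior
given Bob's array is equivariant under permutations of the colours, is a star-shaped vector, and its
largest entry has law exactly `μ`. Given the colour `c` of the root, the subtrees are independent
and conditioned to avoid `c`. Hence the posterior before Alice acts is the normalised product of the
factors `1 - P i c`, and its largest entry has law `maxOp k ξ μ` (`map_norm_familyLaw`). The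
permutation fixing the reported colour makes the posterior star-shaped, and the mixing permutation
lowers its peak to a quantile transform of law `μ` (`lintegral_blend`, `map_reduceFn`). The
advantage is then the same positive number, the integral of `y - 1/k` against `μ`, at every height.
-/

noncomputable section
namespace TreeColouring

/-! ### Poisson samples of independent marks -/

section PoissonSample

variable {M : Type*} [MeasurableSpace M]

/-- The law of a Poisson number of independent marks of law `ϖ`. -/
def poissonSample (d : ℝ≥0) (ϖ : Measure M) : Measure (Σ b : ℕ, Fin b → M) :=
  Measure.sum fun b => poissonMeasure d {b} • (Measure.pi fun _ : Fin b => ϖ).map (Sigma.mk b)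

theorem measurable_sigma {ι α : Type*} {X : ι → Type*} [∀ i, MeasurableSpace (X i)]
    [MeasurableSpace α] {f : (Σ i, X i) → α} (h : ∀ i, Measurable fun x => f ⟨i, x⟩) :
    Measurable f := by
  intro s hs
  exact MeasurableSpace.measurableSet_iInf.2 fun i => h i hs

theorem measurable_sigmaMk {ι : Type*} {X : ι → Type*} [∀ i, MeasurableSpace (X i)] (i : ι) :
    Measurable (Sigma.mk i : X i → Σ i, X i) := fun _ hs =>
  MeasurableSpace.measurableSet_iInf.1 hs i

theorem lintegral_poissonSample (d : ℝ≥0) (ϖ : Measure M) {f : (Σ b : ℕ, Fin b → M) → ℝ≥0∞}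
    (hf : Measurable f) :
    ∫⁻ x, f x ∂(poissonSample d ϖ) =
      ∑' b, poissonMeasure d {b} * ∫⁻ v, f ⟨b, v⟩ ∂(Measure.pi fun _ : Fin b => ϖ) := by
  rw [poissonSample, lintegral_sum_measure]
  congr 1
  ext b
  rw [lintegral_smul_measure, lintegral_map hf (measurable_sigmaMk b), smul_eq_mul]

theorem poissonSample_apply (d : ℝ≥0) (ϖ : Measure M) {s : Set (Σ b : ℕ, Fin b → M)}
    (hs : MeasurableSet s) :
    poissonSample d ϖ s =
      ∑' b, poissonMeasure d {b} * (Measure.pi fun _ : Fin b => ϖ) {v | (⟨b, v⟩ : Σ b : ℕ, Fin b → M) ∈ s} := by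
  rw [poissonSample, Measure.sum_apply _ hs]
  congr 1
  ext b
  rw [Measure.smul_apply, Measure.map_apply (measurable_sigmaMk b) hs, smul_eq_mul]
  rfl

instance (d : ℝ≥0) (ϖ : Measure M) [IsProbabilityMeasure ϖ] :
    IsProbabilityMeasure (poissonSample d ϖ) := by
  constructor
  rw [poissonSample_apply _ _ MeasurableSet.univ]
  simp only [Set.mem_univ, Set.ofPred_true, measure_univ, mul_one]
  have := lintegral_countable' (μ := poissonMeasure d) (fun _ => 1)
  simpa using this.symm

theorem lintegral_pi_prod {n : ℕ} (ϖ : Measure M) [IsProbabilityMeasure ϖ]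
    (f : Fin n → M → ℝ≥0∞) (hf : ∀ i, Measurable (f i)) :
    ∫⁻ v, ∏ i, f i (v i) ∂(Measure.pi fun _ : Fin n => ϖ) = ∏ i, ∫⁻ m, f i m ∂ϖ := by
  have hind : iIndepFun (fun (i : Fin n) (v : Fin n → M) => f i (v i))
      (Measure.pi fun _ : Fin n => ϖ) :=
    iIndepFun_pi (X := fun i => f i) (fun i => (hf i).aemeasurable)
  have := lintegral_prod_eq_prod_lintegral_of_indepFun (s := Finset.univ)
    (X := fun (i : Fin n) (v : Fin n → M) => f i (v i)) hind
    (fun i => (hf i).comp (measurable_pi_apply i))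
  have h2 : (∫⁻ v, ∏ i, f i (v i) ∂(Measure.pi fun _ : Fin n => ϖ)) =
      ∏ i, ∫⁻ v, f i (v i) ∂(Measure.pi fun _ : Fin n => ϖ) := by
    simpa using this
  rw [h2]
  refine Finset.prod_congr rfl fun i _ => ?_
  exact (measurePreserving_eval (fun _ : Fin n => ϖ) i).lintegral_comp (hf i)

/-- The generating function of the Poisson law at `1 + x`. Every product over the marks of a Poisson
sample is thereby worth `exp (d * x)`, with `x` the excess over one of the integral of a single
factor. -/
theorem tsum_poissonMeasure_mul_pow (d : ℝ≥0) {x : ℝ} (hx : 0 ≤ 1 + x) :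
    ∑' b, poissonMeasure d {b} * ENNReal.ofReal (1 + x) ^ b
      = ENNReal.ofReal (Real.exp (d * x)) := by
  have hs : HasSum (fun b : ℕ => Real.exp (-d) * (d : ℝ) ^ b / (b.factorial : ℝ) * (1 + x) ^ b)
      (Real.exp (d * x)) := by
    have := (NormedSpace.expSeries_div_hasSum_exp ((d : ℝ) * (1 + x))).mul_left (Real.exp (-d))
    rw [← Real.exp_eq_exp_ℝ, ← Real.exp_add] at this
    have h1 : (fun b : ℕ => Real.exp (-d) * (d : ℝ) ^ b / (b.factorial : ℝ) * (1 + x) ^ b) =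
        fun b : ℕ => Real.exp (-d) * (((d : ℝ) * (1 + x)) ^ b / (b.factorial : ℝ)) := by
      ext b; rw [mul_pow]; ring
    rw [h1, show (d : ℝ) * x = -d + d * (1 + x) by ring]
    exact this
  rw [← hs.tsum_eq, ENNReal.ofReal_tsum_of_nonneg (fun b => by positivity) hs.summable]
  congr 1
  ext b
  rw [poissonMeasure_singleton, ENNReal.ofReal_mul (by positivity), ENNReal.ofReal_pow hx]

theorem measurable_prod_marks {f : M → ℝ≥0∞} (hf : Measurable f) :
    Measurable fun v : Σ b : ℕ, Fin b → M => ∏ i, f (v.2 i) := by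
  refine measurable_sigma fun b => ?_
  have : Measurable fun v : Fin b → M => ∏ i, f (v i) :=
    Finset.measurable_fun_prod _ fun i _ => hf.comp (measurable_pi_apply i)
  exact this

theorem lintegral_poissonSample_prod_le (d : ℝ≥0) (ϖ : Measure M) [IsProbabilityMeasure ϖ]
    {f : M → ℝ≥0∞} (hf : Measurable f) {x : ℝ} (hx : 0 ≤ 1 + x)
    (h : ∫⁻ m, f m ∂ϖ ≤ ENNReal.ofReal (1 + x)) :
    ∫⁻ v, ∏ i, f (v.2 i) ∂(poissonSample d ϖ) ≤ ENNReal.ofReal (Real.exp (d * x)) := by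
  rw [lintegral_poissonSample _ _ (measurable_prod_marks hf),
    ← tsum_poissonMeasure_mul_pow d hx]
  refine ENNReal.tsum_le_tsum fun b => ?_
  gcongr
  rw [lintegral_pi_prod ϖ (fun _ => f) (fun _ => hf), Finset.prod_const, Finset.card_univ,
    Fintype.card_fin]
  gcongr

theorem tsum_poissonMeasure_mul_nat_mul_pow (d : ℝ≥0) {x : ℝ} (hx : 0 ≤ 1 + x) :
    ∑' b, poissonMeasure d {b} * (b * ENNReal.ofReal (1 + x) ^ (b - 1))
      = d * ENNReal.ofReal (Real.exp (d * x)) := by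
  -- The term `b = 0` vanishes, and the index shift turns `(b + 1) * P(b + 1)` into `d * P(b)`.
  rw [tsum_eq_zero_add' ENNReal.summable, ← tsum_poissonMeasure_mul_pow d hx,
    ← ENNReal.tsum_mul_left]
  simp only [Nat.cast_zero, zero_mul, mul_zero, zero_add, Nat.add_sub_cancel]
  congr 1
  ext b
  rw [← mul_assoc, ← mul_assoc]
  congr 1
  rw [poissonMeasure_singleton, poissonMeasure_singleton,
    show (d : ℝ≥0∞) = ENNReal.ofReal (d : ℝ) by simp,
    show ((b + 1 : ℕ) : ℝ≥0∞) = ENNReal.ofReal ((b + 1 : ℕ) : ℝ) by rw [ENNReal.ofReal_natCast],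
    ← ENNReal.ofReal_mul (by positivity), ← ENNReal.ofReal_mul (by positivity)]
  congr 1
  rw [Nat.factorial_succ]
  push_cast
  have : (b.factorial : ℝ) ≠ 0 := by positivity
  field_simp
  ring

/-- A Mecke-type bound: sum over the index of a mark in `B`. That mark contributes `d * H`, and the
others form again a full Poisson product. -/
theorem lintegral_poissonSample_prod_indicator_le (d : ℝ≥0) (ϖ : Measure M)
    [IsProbabilityMeasure ϖ] {f : M → ℝ≥0∞} (hf : Measurable f) {B : Set M}
    (hB : MeasurableSet B) {x : ℝ} (hx : 0 ≤ 1 + x) {H : ℝ≥0∞}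
    (h : ∫⁻ m, f m ∂ϖ ≤ ENNReal.ofReal (1 + x)) (hH : ∫⁻ m in B, f m ∂ϖ ≤ H) :
    ∫⁻ v, (∏ i, f (v.2 i)) * {v : Σ b : ℕ, Fin b → M | ∃ i, v.2 i ∈ B}.indicator 1 v
        ∂(poissonSample d ϖ) ≤ d * H * ENNReal.ofReal (Real.exp (d * x)) := by
  classical
  have hms : MeasurableSet {v : Σ b : ℕ, Fin b → M | ∃ i, v.2 i ∈ B} := by
    refine MeasurableSpace.measurableSet_iInf.2 fun b => ?_
    change MeasurableSet {v : Fin b → M | ∃ i, v i ∈ B}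
    rw [Set.ofPred_exists]
    exact MeasurableSet.iUnion fun i => measurable_pi_apply i hB
  have hm : Measurable fun v : Σ b : ℕ, Fin b → M => ∏ i, f (v.2 i) := measurable_prod_marks hf
  rw [lintegral_poissonSample _ _ (hm.fun_mul (measurable_one.indicator hms)),
    mul_comm (d : ℝ≥0∞), mul_assoc,
    ← tsum_poissonMeasure_mul_nat_mul_pow d hx, ← ENNReal.tsum_mul_left]
  refine ENNReal.tsum_le_tsum fun b => ?_
  rw [mul_left_comm]
  gcongr
  -- The `j`-th summand requires the `j`-th mark to lie in `B` and leaves the other factors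
  -- unchanged.
  let g : Fin b → Fin b → M → ℝ≥0∞ := fun j i => if i = j then B.indicator f else f
  have hg : ∀ j i, Measurable (g j i) := fun j i => by
    simp only [g]; split_ifs
    exacts [hf.indicator hB, hf]
  calc ∫⁻ v : Fin b → M, (∏ i, f (v i)) *
          {v : Σ b : ℕ, Fin b → M | ∃ i, v.2 i ∈ B}.indicator 1 ⟨b, v⟩
          ∂(Measure.pi fun _ : Fin b => ϖ)
      ≤ ∫⁻ v : Fin b → M, ∑ j, ∏ i, g j i (v i) ∂(Measure.pi fun _ : Fin b => ϖ) := by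
        refine lintegral_mono fun v => ?_
        by_cases hv : ∃ i, v i ∈ B
        · rw [Set.indicator_of_mem (by exact hv)]
          obtain ⟨j, hj⟩ := hv
          rw [Pi.one_apply, mul_one]
          refine le_trans (le_of_eq ?_) (Finset.single_le_sum (f := fun j => ∏ i, g j i (v i))
            (fun _ _ => zero_le) (Finset.mem_univ j))
          refine Finset.prod_congr rfl fun i _ => ?_
          simp only [g]
          split_ifs with hij
          · rw [Set.indicator_of_mem (by rw [hij]; exact hj)]
          · rfl
        · rw [Set.indicator_of_notMem (by exact hv), mul_zero]
          exact zero_le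
    _ = ∑ j, ∏ i, ∫⁻ m, g j i m ∂ϖ := by
        have hm' : ∀ j ∈ (Finset.univ : Finset (Fin b)),
            Measurable fun v : Fin b → M => ∏ i, g j i (v i) := fun j _ =>
          Finset.measurable_fun_prod _ fun i _ => (hg j i).comp (measurable_pi_apply i)
        rw [lintegral_finsetSum _ hm']
        exact Finset.sum_congr rfl fun j _ => lintegral_pi_prod ϖ (g j) (hg j)
    _ ≤ ∑ j : Fin b, H * ENNReal.ofReal (1 + x) ^ (b - 1) := by
        refine Finset.sum_le_sum fun j _ => ?_
        rw [← Finset.mul_prod_erase _ _ (Finset.mem_univ j)]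
        refine mul_le_mul' ?_ ?_
        · simp only [g, if_true]
          rwa [lintegral_indicator hB]
        · calc ∏ i ∈ Finset.univ.erase j, ∫⁻ m, g j i m ∂ϖ
              ≤ ∏ i ∈ Finset.univ.erase j, ENNReal.ofReal (1 + x) := by
                refine Finset.prod_le_prod' fun i hi => ?_
                simp only [g, if_neg (Finset.ne_of_mem_erase hi)]
                exact h
            _ = _ := by simp
    _ = _ := by simp; ring

theorem poissonSample_exists_mem_eq_zero (d : ℝ≥0) (ϖ : Measure M) [IsProbabilityMeasure ϖ]
    {B : Set M} (hB : MeasurableSet B) (h0 : ϖ B = 0) :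
    poissonSample d ϖ {v | ∃ i, v.2 i ∈ B} = 0 := by
  have hms : MeasurableSet {v : Σ b : ℕ, Fin b → M | ∃ i, v.2 i ∈ B} := by
    refine MeasurableSpace.measurableSet_iInf.2 fun b => ?_
    change MeasurableSet {v : Fin b → M | ∃ i, v i ∈ B}
    rw [Set.ofPred_exists]
    exact MeasurableSet.iUnion fun i => measurable_pi_apply i hB
  have := lintegral_poissonSample_prod_indicator_le d ϖ (f := fun _ => 1) measurable_const hB
    (x := 0) (H := 0) (by norm_num) (by simp) (by simp [h0])
  simpa [lintegral_indicator_one hms] using this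

end PoissonSample

end TreeColouring
end
noncomputable section
namespace TreeColouring

theorem lintegral_uniformOn {α : Type*} [MeasurableSpace α] [MeasurableSingletonClass α]
    (s : Finset α) (f : α → ℝ≥0∞) :
    ∫⁻ x, f x ∂(uniformOn (s : Set α)) = (s.card : ℝ≥0∞)⁻¹ * ∑ x ∈ s, f x := by
  rw [uniformOn, ProbabilityTheory.cond, lintegral_smul_measure, lintegral_finset, smul_eq_mul,
    Measure.count_apply_finset]
  simp

/-! ### Sampling a tilted star-shaped vector -/

/-- The uniform law on the nonzero colours. -/
def nonzeroUnif (k : ℕ) [NeZero k] : Measure (Fin k) := uniformOn {l : Fin k | l ≠ 0}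

theorem lintegral_nonzeroUnif (k : ℕ) [NeZero k] (f : Fin k → ℝ≥0∞) :
    ∫⁻ x, f x ∂(nonzeroUnif k) = ((k - 1 : ℕ) : ℝ≥0∞)⁻¹ * ∑ x ∈ Finset.univ.erase 0, f x := by
  have : {l : Fin k | l ≠ 0} = ((Finset.univ.erase 0 : Finset (Fin k)) : Set (Fin k)) := by
    ext; simp
  rw [nonzeroUnif, this, lintegral_uniformOn]
  simp

theorem isProbabilityMeasure_nonzeroUnif {k : ℕ} [NeZero k] (hk : 2 ≤ k) :
    IsProbabilityMeasure (nonzeroUnif k) :=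
  isProbabilityMeasure_uniformOn (Set.toFinite _) ⟨⟨1, hk⟩, fun h => by
    have := congrArg Fin.val h
    simp at this⟩

/-- The uniform law on `[0, 1]`. -/
def unifI : Measure ℝ := volume.restrict (Set.Icc 0 1)

instance : IsProbabilityMeasure unifI := ⟨by simp [unifI]⟩

theorem unifI_Ioo {z : ℝ} (hz : z ≤ 1) : unifI {u | 0 < u ∧ u < z} = ENNReal.ofReal z := by
  have h : {u : ℝ | 0 < u ∧ u < z} = Set.Ioo 0 z := rfl
  rw [unifI, h, Measure.restrict_apply measurableSet_Ioo, Set.inter_eq_self_of_subset_left,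
    Real.volume_Ioo, sub_zero]
  exact fun u hu => ⟨hu.1.le, hu.2.le.trans hz⟩

theorem lintegral_unifI_ite {z : ℝ} (h0 : 0 ≤ z) (h1 : z ≤ 1) (A B : ℝ≥0∞) :
    ∫⁻ u, (if 0 < u ∧ u < z then A else B) ∂unifI =
      ENNReal.ofReal (1 - z) * B + ENNReal.ofReal z * A := by
  have hm : MeasurableSet {u : ℝ | 0 < u ∧ u < z} := measurableSet_Ioo
  have := lintegral_add_compl (μ := unifI) (fun u => if 0 < u ∧ u < z then A else B) hm
  rw [← this, setLIntegral_congr_fun (f := fun u => if 0 < u ∧ u < z then A else B) (g := fun _ => A) hm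
      (fun u hu => if_pos hu),
    setLIntegral_congr_fun (f := fun u => if 0 < u ∧ u < z then A else B) (g := fun _ => B)
      hm.compl (fun u hu => if_neg hu), setLIntegral_const,
    setLIntegral_const, prob_compl_eq_one_sub hm, unifI_Ioo h1, add_comm, mul_comm A, mul_comm B,
    ENNReal.ofReal_sub _ h0, ENNReal.ofReal_one]

/-- The randomness attached to an offspring: its relative colour, a uniform variable that selects
the confidence, a uniform variable that decides whether its belief points to the right colour, and
the relative position of a wrong colour. -/
abbrev Mark (k : ℕ) : Type := Fin k × ℝ × ℝ × Fin k

def markLaw (k : ℕ) [NeZero k] : Measure (Mark k) :=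
  (nonzeroUnif k).prod (unifI.prod (unifI.prod (nonzeroUnif k)))

theorem isProbabilityMeasure_markLaw {k : ℕ} [NeZero k] (hk : 2 ≤ k) :
    IsProbabilityMeasure (markLaw k) := by
  have := isProbabilityMeasure_nonzeroUnif hk
  unfold markLaw; infer_instance

instance (k : ℕ) [NeZero k] : SFinite (nonzeroUnif k) := by
  unfold nonzeroUnif; infer_instance

theorem lintegral_markLaw (k : ℕ) [NeZero k] {f : Mark k → ℝ≥0∞} (hf : Measurable f) :
    ∫⁻ m, f m ∂(markLaw k) = ∫⁻ w, ∫⁻ u, ((k - 1 : ℕ) : ℝ≥0∞)⁻¹ * ∑ z ∈ Finset.univ.erase 0,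
      (((k - 1 : ℕ) : ℝ≥0∞)⁻¹ * ∑ h ∈ Finset.univ.erase 0, f (z, w, u, h)) ∂unifI ∂unifI := by
  have h1 : ∀ z : Fin k, Measurable fun p : ℝ × ℝ =>
      ((k - 1 : ℕ) : ℝ≥0∞)⁻¹ * ∑ h ∈ Finset.univ.erase 0, f (z, p.1, p.2, h) := fun z => by
    refine Measurable.const_mul ?_ _
    refine Finset.measurable_fun_sum _ fun h _ => ?_
    fun_prop
  rw [markLaw, lintegral_prod _ hf.aemeasurable, lintegral_nonzeroUnif]
  have h2 : ∀ z : Fin k, ∫⁻ y, f (z, y) ∂(unifI.prod (unifI.prod (nonzeroUnif k))) =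
      ∫⁻ w, ∫⁻ u, ((k - 1 : ℕ) : ℝ≥0∞)⁻¹ * ∑ h ∈ Finset.univ.erase 0, f (z, w, u, h)
        ∂unifI ∂unifI := fun z => by
    rw [lintegral_prod _ (by fun_prop)]
    refine lintegral_congr fun w => ?_
    rw [lintegral_prod _ (by fun_prop)]
    refine lintegral_congr fun u => ?_
    rw [lintegral_nonzeroUnif]
  simp_rw [h2]
  have h3 : ∀ z : Fin k, Measurable fun w : ℝ => ∫⁻ u, ((k - 1 : ℕ) : ℝ≥0∞)⁻¹ *
      ∑ h ∈ Finset.univ.erase 0, f (z, w, u, h) ∂unifI := fun z =>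
    Measurable.lintegral_prod_right' (f := fun p : ℝ × ℝ => ((k - 1 : ℕ) : ℝ≥0∞)⁻¹ *
      ∑ h ∈ Finset.univ.erase 0, f (z, p.1, p.2, h)) (h1 z)
  rw [← lintegral_finsetSum _ (fun z _ => h3 z), ← lintegral_const_mul _
    (Finset.measurable_fun_sum _ fun z _ => h3 z)]
  refine lintegral_congr fun w => ?_
  have h4 : ∀ z : Fin k, Measurable fun u : ℝ => ((k - 1 : ℕ) : ℝ≥0∞)⁻¹ *
      ∑ h ∈ Finset.univ.erase 0, f (z, w, u, h) := fun z =>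
    (h1 z).comp (measurable_const.prodMk measurable_id)
  rw [← lintegral_finsetSum _ (fun z _ => h4 z), ← lintegral_const_mul _
    (Finset.measurable_fun_sum _ fun z _ => h4 z)]

/-- The belief about an offspring, when its parent has colour `l` and the probability of a wrong
guess is the function `Z` of the first uniform variable. -/
def childVec {k : ℕ} [NeZero k] (Z : ℝ → ℝ) (l : Fin k) (m : ℝ × ℝ × Fin k) : Fin k → ℝ :=
  starVec k (1 - Z m.1) (if 0 < m.2.1 ∧ m.2.1 < Z m.1 then l + m.2.2 else l)

theorem measurable_starVec (k : ℕ) : Measurable fun z : ℝ × Fin k => starVec k z.1 z.2 := by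
  refine measurable_pi_lambda _ fun m => ?_
  unfold starVec
  refine Measurable.ite ?_ (by fun_prop) (by fun_prop)
  exact (measurable_snd (measurableSet_singleton m)).congr (by ext; simp [eq_comm])

theorem measurable_childVec {k : ℕ} [NeZero k] {Z : ℝ → ℝ} (hZ : Measurable Z) (l : Fin k) :
    Measurable (childVec Z l) := by
  have h : Measurable fun m : ℝ × ℝ × Fin k =>
      (if 0 < m.2.1 ∧ m.2.1 < Z m.1 then l + m.2.2 else l) := ?_
  · exact (measurable_starVec k).comp
      ((measurable_const.sub (hZ.comp measurable_fst)).prodMk h)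
  have h2 : MeasurableSet {m : ℝ × ℝ × Fin k | 0 < m.2.1 ∧ m.2.1 < Z m.1} :=
    (measurableSet_lt measurable_const (measurable_fst.comp measurable_snd)).inter
      (measurableSet_lt (measurable_fst.comp measurable_snd) (hZ.comp measurable_fst))
  exact Measurable.ite h2 ((Measurable.of_discrete (f := fun x => l + x)).comp
    (measurable_snd.comp measurable_snd)) measurable_const

theorem lintegral_symmLift {k : ℕ} [NeZero k] (μ : Measure ℝ) [SFinite μ]
    {F : (Fin k → ℝ) → ℝ≥0∞} (hF : Measurable F) :
    ∫⁻ x, F x ∂(symmLift k μ) = ∫⁻ y, (k : ℝ≥0∞)⁻¹ * ∑ l, F (starVec k y l) ∂μ := by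
  have hu : (Set.univ : Set (Fin k)) = ((Finset.univ : Finset (Fin k)) : Set (Fin k)) := by simp
  have : SFinite (uniformOn (Set.univ : Set (Fin k))) := by infer_instance
  rw [symmLift, lintegral_map hF (measurable_starVec k),
    lintegral_prod (fun z : ℝ × Fin k => F (starVec k z.1 z.2))
      (hF.comp (measurable_starVec k)).aemeasurable]
  refine lintegral_congr fun y => ?_
  rw [hu, lintegral_uniformOn]
  simp

theorem lintegral_tilt {k : ℕ} [NeZero k] (l : Fin k) (ν : Measure (Fin k → ℝ))
    {F : (Fin k → ℝ) → ℝ≥0∞} (hF : Measurable F) :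
    ∫⁻ x, F x ∂(tilt k l ν) = ∫⁻ x, ENNReal.ofReal (k * x l) * F x ∂ν := by
  rw [tilt, lintegral_withDensity_eq_lintegral_mul _ (by fun_prop) hF]
  rfl

/-- Under the uniform position of the peak, the tilt by `k * x l` gives the position `l` total
weight `1 - z` and each other position weight `z / (k - 1)`. This is the guess encoded by the marks:
right with probability `1 - z`, otherwise shifted by a uniform nonzero `h`. -/
theorem map_childVec {k : ℕ} [NeZero k] (hk : 2 ≤ k) {Z : ℝ → ℝ} (hZ : Measurable Z)
    (h0 : ∀ w, 0 ≤ Z w) (h1 : ∀ w, Z w ≤ 1) (l : Fin k) :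
    (unifI.prod (unifI.prod (nonzeroUnif k))).map (childVec Z l) =
      tilt k l (symmLift k (unifI.map fun w => 1 - Z w)) := by
  have hm := measurable_childVec hZ l
  have hk0 : (k : ℝ) ≠ 0 := by positivity
  have hk1 : (0 : ℝ) < (k : ℝ) - 1 := by
    have : (2 : ℝ) ≤ k := by exact_mod_cast hk
    linarith
  refine Measure.ext_of_lintegral _ fun F hF => ?_
  rw [lintegral_map hF hm, lintegral_tilt _ _ hF, lintegral_symmLift _ (by fun_prop),
    lintegral_map (by
      refine Measurable.const_mul (Finset.measurable_fun_sum _ fun l' _ => ?_) _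
      have : Measurable fun y : ℝ => starVec k y l' :=
        (measurable_starVec k).comp (measurable_id.prodMk measurable_const)
      fun_prop) (by fun_prop), 
    lintegral_prod (fun m => F (childVec Z l m)) (hF.comp hm).aemeasurable]
  refine lintegral_congr fun w => ?_
  rw [lintegral_prod _ (by fun_prop)]
  simp only [lintegral_nonzeroUnif, childVec]
  have h2 : ∀ u : ℝ, ((k - 1 : ℕ) : ℝ≥0∞)⁻¹ * ∑ h ∈ Finset.univ.erase 0,
      F (starVec k (1 - Z w) (if 0 < u ∧ u < Z w then l + h else l)) =
      if 0 < u ∧ u < Z w then ((k - 1 : ℕ) : ℝ≥0∞)⁻¹ * ∑ h ∈ Finset.univ.erase 0,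
        F (starVec k (1 - Z w) (l + h)) else F (starVec k (1 - Z w) l) := fun u => by
    split_ifs
    · rfl
    · rw [Finset.sum_const, Finset.card_erase_of_mem (Finset.mem_univ _), Finset.card_univ,
        Fintype.card_fin, nsmul_eq_mul, ← mul_assoc, ENNReal.inv_mul_cancel, one_mul]
      · exact Nat.cast_ne_zero.2 (by omega)
      · exact ENNReal.natCast_ne_top _
  simp_rw [h2]
  rw [lintegral_unifI_ite (h0 w) (h1 w)]
  have h3 : ∑ h ∈ Finset.univ.erase (0 : Fin k), F (starVec k (1 - Z w) (l + h)) =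
      ∑ l' ∈ Finset.univ.erase l, F (starVec k (1 - Z w) l') := by
    refine Finset.sum_nbij' (fun h => l + h) (fun l' => l' - l) ?_ ?_ ?_ ?_ ?_
    · intro h hh; simp at hh ⊢; exact hh
    · intro h hh; simp at hh ⊢; exact sub_ne_zero.2 hh
    · intro h _; simp
    · intro h _; simp
    · intro h _; rfl
  rw [h3, ← Finset.add_sum_erase _ _ (Finset.mem_univ l), mul_add]
  congr 1
  · rw [← mul_assoc]
    congr 1
    rw [starVec, if_pos rfl, ENNReal.ofReal_mul (by positivity), ENNReal.ofReal_natCast,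
      ← mul_assoc, ENNReal.inv_mul_cancel (by simpa using NeZero.ne k) (by simp), one_mul]
  · have h4 : ∀ l' ∈ Finset.univ.erase l, ENNReal.ofReal (k * starVec k (1 - Z w) l' l) *
        F (starVec k (1 - Z w) l') = (k * (((k - 1 : ℕ) : ℝ≥0∞)⁻¹ * ENNReal.ofReal (Z w))) *
        F (starVec k (1 - Z w) l') := by
      intro l' hl'
      congr 1
      rw [starVec, if_neg (Finset.ne_of_mem_erase hl').symm, sub_sub_cancel,
        ENNReal.ofReal_mul (by positivity), ENNReal.ofReal_natCast,
        ENNReal.ofReal_div_of_pos hk1, div_eq_mul_inv, mul_comm (ENNReal.ofReal (Z w))]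
      congr 3
      rw [← ENNReal.ofReal_natCast, Nat.cast_sub (by omega), Nat.cast_one]
    rw [Finset.sum_congr rfl h4, ← Finset.mul_sum, ← mul_assoc, ← mul_assoc, ← mul_assoc,
      ← mul_assoc, ENNReal.inv_mul_cancel (by simpa using NeZero.ne k) (by simp), one_mul,
      mul_comm (ENNReal.ofReal (Z w))]

end TreeColouring
end
noncomputable section
namespace TreeColouring

/-! ### The recursion as a function of a Poisson sample of marks -/

theorem measurable_shift {k : ℕ} [NeZero k] (m : Fin k) :
    Measurable fun p : Fin k × (Fin k → ℝ) => p.2 (m - p.1) := by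
  refine measurable_from_prod_countable_right fun z => ?_
  exact measurable_pi_apply (m - z)

theorem measurable_combine (k : ℕ) [NeZero k] (b : ℕ) :
    Measurable (combine k : (Fin b → Fin k × (Fin k → ℝ)) → Fin k → ℝ) := by
  have h : ∀ m : Fin k, Measurable fun z : Fin b → Fin k × (Fin k → ℝ) =>
      ∏ i, (1 - (z i).2 (m - (z i).1)) := fun m =>
    Finset.measurable_fun_prod _ fun i _ =>
      measurable_const.sub ((measurable_shift m).comp (measurable_pi_apply i))
  exact measurable_pi_lambda _ fun m =>
    (h m).div (Finset.measurable_fun_sum _ fun m' _ => h m')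

theorem treeOp_apply (k : ℕ) [NeZero k] (ξ : Measure ℕ) (ν : Measure (Fin k → ℝ))
    {E : Set (Fin k → ℝ)} (hE : MeasurableSet E) :
    treeOp k ξ ν E = ∑' b, ξ {b} *
      (Measure.pi fun _ : Fin b => (nonzeroUnif k).prod ν) (combine k ⁻¹' E) := by
  rw [treeOp, Measure.bind_apply hE (Measurable.of_discrete).aemeasurable, lintegral_countable']
  congr 1
  ext b
  rw [Measure.map_apply (measurable_combine k b) hE, mul_comm]
  rfl

theorem maxOp_Iic (k : ℕ) [NeZero k] (ξ : Measure ℕ) (μ : Measure ℝ) (x : ℝ) :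
    maxOp k ξ μ (Set.Iic x) =
      (k : ℝ≥0∞)⁻¹ * ∑ l, treeOp k ξ (tilt k l (symmLift k μ)) {p | ‖p‖ ≤ x} := by
  rw [maxOp, Measure.map_apply measurable_norm measurableSet_Iic, treeOpSymm, Measure.smul_apply,
    Measure.finsetSum_apply, smul_eq_mul]
  rfl

/-- The vector that results from a sample of marks when the true colour is `l`. -/
def sampleVec {k : ℕ} [NeZero k] (Z : ℝ → ℝ) (l : Fin k) (v : Σ b : ℕ, Fin b → Mark k) :
    Fin k → ℝ :=
  combine k fun i => ((v.2 i).1, childVec Z l (v.2 i).2)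

theorem measurable_markVec {k : ℕ} [NeZero k] {Z : ℝ → ℝ} (hZ : Measurable Z) (l : Fin k) :
    Measurable fun m : Mark k => (m.1, childVec Z l m.2) :=
  measurable_fst.prodMk ((measurable_childVec hZ l).comp measurable_snd)

theorem measurable_sampleVec {k : ℕ} [NeZero k] {Z : ℝ → ℝ} (hZ : Measurable Z) (l : Fin k) :
    Measurable (sampleVec Z l) :=
  measurable_sigma fun b => (measurable_combine k b).comp
    (measurable_pi_lambda _ fun i => (measurable_markVec hZ l).comp (measurable_pi_apply i))

/-- Realises the recursion for all profiles `Z` on one probability space. Different profiles become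
comparable sample by sample, which the monotone fixed-point argument needs. -/
theorem treeOp_poisson_apply {k : ℕ} [NeZero k] (hk : 2 ≤ k) (d : ℝ≥0) {Z : ℝ → ℝ}
    (hZ : Measurable Z) (h0 : ∀ w, 0 ≤ Z w) (h1 : ∀ w, Z w ≤ 1) (l : Fin k)
    {E : Set (Fin k → ℝ)} (hE : MeasurableSet E) :
    treeOp k (poissonMeasure d) (tilt k l (symmLift k (unifI.map fun w => 1 - Z w))) E =
      poissonSample d (markLaw k) (sampleVec Z l ⁻¹' E) := by
  have := isProbabilityMeasure_nonzeroUnif hk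
  have := isProbabilityMeasure_markLaw hk
  have hp : (nonzeroUnif k).prod (tilt k l (symmLift k (unifI.map fun w => 1 - Z w))) =
      (markLaw k).map fun m => (m.1, childVec Z l m.2) := by
    rw [← map_childVec hk hZ h0 h1 l]
    have := Measure.map_prod_map (nonzeroUnif k) (unifI.prod (unifI.prod (nonzeroUnif k)))
      measurable_id (measurable_childVec hZ l)
    rw [Measure.map_id] at this
    exact this
  rw [treeOp_apply _ _ _ hE, poissonSample_apply _ _ (measurable_sampleVec hZ l hE), hp]
  congr 1
  ext b
  congr 1
  have hpm : IsProbabilityMeasure ((markLaw k).map fun m => (m.1, childVec Z l m.2)) :=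
    Measure.isProbabilityMeasure_map (measurable_markVec hZ l).aemeasurable
  have hpi : Measurable fun (x : Fin b → Mark k) i => ((x i).1, childVec Z l (x i).2) :=
    measurable_pi_lambda _ fun i => (measurable_markVec hZ l).comp (measurable_pi_apply i)
  rw [← Measure.pi_map_pi (μ := fun _ : Fin b => markLaw k)
    (f := fun _ m => (m.1, childVec Z l m.2)) (fun _ => (measurable_markVec hZ l).aemeasurable),
    Measure.map_apply hpi (measurable_combine k b hE)]
  rfl

/-! ### Likelihood ratios -/

/-- The likelihood ratio of two colours contributed by an offspring whose belief points to one of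
them and whose probability of a wrong guess is `z`. -/
def likelihood (k : ℕ) (z : ℝ) : ℝ := z / (1 - z / ((k : ℝ) - 1))

open scoped Classical in
/-- An upper bound, increasing in `Z`, for the factor that an offspring contributes to the
likelihood ratio of the relative colours `e` and `0`. It is exact for the offspring whose first
uniform variable is at least `a`. -/
def ratioBound {k : ℕ} [NeZero k] (a : ℝ) (Z : ℝ → ℝ) (e : Fin k) (m : Mark k) : ℝ :=
  if 0 < m.2.2.1 ∧ m.2.2.1 < Z m.2.1 then
    if a ≤ m.2.1 then
      if m.1 + m.2.2.2 = e then likelihood k (Z m.2.1)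
      else if m.1 + m.2.2.2 = 0 then (likelihood k (Z m.2.1))⁻¹ else 1
    else if m.1 + m.2.2.2 = 0 then (m.2.2.1)⁻¹ else 1
  else if m.1 = e then likelihood k (Z m.2.1) else 1

theorem div_lt_one_of_le {k : ℕ} (hk : 2 ≤ k) {z : ℝ} (h1 : z ≤ 1 - 1 / (k : ℝ)) :
    1 / (k : ℝ) ≤ 1 - z / ((k : ℝ) - 1) := by
  have hk' : (2 : ℝ) ≤ k := by exact_mod_cast hk
  have : z / ((k : ℝ) - 1) ≤ 1 / k := by
    rw [div_le_iff₀ (by linarith)]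
    calc z ≤ 1 - 1 / (k : ℝ) := h1
      _ = 1 / k * (k - 1) := by field_simp
  have h2 : 1 / (k : ℝ) ≤ 1 / 2 := one_div_le_one_div_of_le (by norm_num) hk'
  linarith

theorem likelihood_pos {k : ℕ} (hk : 2 ≤ k) {z : ℝ} (h0 : 0 < z) (h1 : z ≤ 1 - 1 / (k : ℝ)) :
    0 < likelihood k z := by
  have := div_lt_one_of_le hk h1
  have hk' : (0 : ℝ) < 1 / k := by positivity
  exact div_pos h0 (by linarith)

theorem likelihood_le_one {k : ℕ} (hk : 2 ≤ k) {z : ℝ} (h1 : z ≤ 1 - 1 / (k : ℝ)) :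
    likelihood k z ≤ 1 := by
  have h2 := div_lt_one_of_le hk h1
  have hk' : (2 : ℝ) ≤ k := by exact_mod_cast hk
  have hk'' : (0 : ℝ) < 1 / k := by positivity
  rw [likelihood, div_le_one (by linarith)]
  have : z / ((k : ℝ) - 1) ≤ 1 / k := by
    rw [div_le_iff₀ (by linarith)]
    calc z ≤ 1 - 1 / (k : ℝ) := h1
      _ = 1 / k * (k - 1) := by field_simp
  linarith

theorem likelihood_mono {k : ℕ} (hk : 2 ≤ k) {z z' : ℝ} (h0 : 0 < z) (h : z ≤ z')
    (h1 : z' ≤ 1 - 1 / (k : ℝ)) : likelihood k z ≤ likelihood k z' := by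
  have h2 := div_lt_one_of_le hk h1
  have hk' : (2 : ℝ) ≤ k := by exact_mod_cast hk
  have hk'' : (0 : ℝ) < 1 / k := by positivity
  unfold likelihood
  have : z / ((k : ℝ) - 1) ≤ z' / ((k : ℝ) - 1) := by
    apply div_le_div_of_nonneg_right h; linarith
  gcongr <;> linarith

theorem ratioBound_pos {k : ℕ} [NeZero k] (hk : 2 ≤ k) (a : ℝ) {Z : ℝ → ℝ} (h0 : ∀ w, 0 < Z w)
    (h1 : ∀ w, Z w ≤ 1 - 1 / (k : ℝ)) (e : Fin k) (m : Mark k) : 0 < ratioBound a Z e m := by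
  have := likelihood_pos hk (h0 m.2.1) (h1 m.2.1)
  unfold ratioBound
  split_ifs with h <;> first | exact one_pos | positivity | exact inv_pos.2 h.1

/-- Enlarging `Z` turns right guesses outside the core into wrong ones and raises the likelihood
ratio of the remaining right guesses. Both raise the bound: a right guess has factor at most one, a
wrong guess at least one, and the factor `u⁻¹` of a harmful wrong guess does not involve `Z`. The
exact factor `(likelihood k z)⁻¹` would decrease in `z`; the bound avoids this by forgetting part of
the information. -/
theorem ratioBound_mono {k : ℕ} [NeZero k] (hk : 2 ≤ k) {a : ℝ} {Z Z' : ℝ → ℝ}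
    (h0 : ∀ w, 0 < Z w) (hle : ∀ w, Z w ≤ Z' w) (hcore : ∀ w, a ≤ w → Z w = Z' w)
    (h1 : ∀ w, Z' w ≤ 1 - 1 / (k : ℝ)) (e : Fin k) (m : Mark k) :
    ratioBound a Z e m ≤ ratioBound a Z' e m := by
  rcases le_or_gt a m.2.1 with ha | ha
  · unfold ratioBound
    rw [hcore _ ha]
  · have hl := likelihood_mono hk (h0 m.2.1) (hle m.2.1) (h1 _)
    have hl' := likelihood_le_one hk ((hle m.2.1).trans (h1 _))
    have hk1 : 1 / (k : ℝ) ≥ 0 := by positivity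
    have hzz := hle m.2.1
    have hz1 := h1 m.2.1
    unfold ratioBound
    rw [if_neg (not_le.2 ha), if_neg (not_le.2 ha)]
    by_cases hw : 0 < m.2.2.1 ∧ m.2.2.1 < Z m.2.1
    · have hw' : 0 < m.2.2.1 ∧ m.2.2.1 < Z' m.2.1 := ⟨hw.1, hw.2.trans_le hzz⟩
      simp only [if_pos hw, if_pos hw', le_refl]
    · rw [if_neg hw]
      by_cases hw' : 0 < m.2.2.1 ∧ m.2.2.1 < Z' m.2.1
      · rw [if_pos hw']
        have h3 : (1 : ℝ) ≤ (m.2.2.1)⁻¹ := (one_le_inv₀ hw'.1).2 (by linarith [hw'.2])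
        split_ifs <;> linarith
      · rw [if_neg hw']
        split_ifs
        · exact hl
        · exact le_rfl

theorem one_sub_childVec_pos {k : ℕ} [NeZero k] (hk : 2 ≤ k) {Z : ℝ → ℝ} (h0 : ∀ w, 0 < Z w)
    (h1 : ∀ w, Z w ≤ 1 - 1 / (k : ℝ)) (l j : Fin k) (m : ℝ × ℝ × Fin k) :
    0 < 1 - childVec Z l m j := by
  have h2 := div_lt_one_of_le hk (h1 m.1)
  have hk'' : (0 : ℝ) < 1 / k := by positivity
  unfold childVec starVec
  split_ifs <;> first | linarith [h0 m.1] | (rw [sub_sub_cancel]; linarith)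

/-- A star-shaped belief distinguishes the relative colours `e` and `0` only if it points to one of
them. Pointing to `e` gives the factor `likelihood`, pointing to `0` its inverse, anything else one.
Outside the core these factors are relaxed upwards. -/
theorem one_sub_childVec_le {k : ℕ} [NeZero k] (hk : 2 ≤ k) (a : ℝ) {Z : ℝ → ℝ}
    (h0 : ∀ w, 0 < Z w) (h1 : ∀ w, Z w ≤ 1 - 1 / (k : ℝ)) (l : Fin k) {e : Fin k} (he : e ≠ 0)
    (m : Mark k) (hm : m.1 ≠ 0) :
    1 - childVec Z l m.2 (l + e - m.1) ≤
      ratioBound a Z e m * (1 - childVec Z l m.2 (l - m.1)) := by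
  obtain ⟨z, w, u, h⟩ := m
  simp only at hm
  have h2 := div_lt_one_of_le hk (h1 w)
  have hk'' : (0 : ℝ) < 1 / k := by positivity
  have hz := h0 w
  have hden : (0 : ℝ) < 1 - Z w / ((k : ℝ) - 1) := by linarith
  have hlk : likelihood k (Z w) * (1 - Z w / ((k : ℝ) - 1)) = Z w := by
    rw [likelihood, div_mul_cancel₀ _ hden.ne']
  have hlp := likelihood_pos hk hz (h1 w)
  have hl1 := likelihood_le_one hk (h1 w)
  have hli : (likelihood k (Z w))⁻¹ * Z w = 1 - Z w / ((k : ℝ) - 1) := by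
    rw [likelihood, inv_div, div_mul_cancel₀ _ hz.ne']
  have e1 : l + e - z = l ↔ z = e := by
    rw [sub_eq_iff_eq_add, add_right_inj, eq_comm]
  have e2 : l - z = l ↔ z = 0 := by simp
  have e3 : l + e - z = l + h ↔ z + h = e := by
    rw [sub_eq_iff_eq_add, add_assoc, add_right_inj, add_comm h z, eq_comm]
  have e4 : l - z = l + h ↔ z + h = 0 := by
    rw [sub_eq_iff_eq_add, add_assoc, left_eq_add, add_comm h z]
  unfold childVec starVec ratioBound
  simp only
  by_cases hw : 0 < u ∧ u < Z w
  · simp only [if_pos hw, e3, e4, sub_sub_cancel]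
    by_cases he' : z + h = e
    · have hne : z + h ≠ 0 := by rw [he']; exact he
      simp only [if_pos he', if_neg hne]
      split_ifs
      · rw [hlk]; linarith
      · have := mul_le_of_le_one_left hden.le hl1
        rw [hlk] at this
        linarith
    · simp only [if_neg he']
      by_cases h0' : z + h = 0
      · simp only [if_pos h0', sub_sub_cancel]
        split_ifs
        · rw [hli]
        -- The inverse likelihood is at most `1 / Z`, which is at most `1 / u` because the guess is
        -- wrong only for `u < Z`.
        · calc 1 - Z w / ((k : ℝ) - 1) = (likelihood k (Z w))⁻¹ * Z w := hli.symm
            _ = (1 - Z w / ((k : ℝ) - 1)) * ((Z w)⁻¹ * Z w) := by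
                rw [likelihood, inv_div]; ring
            _ ≤ 1 * (u⁻¹ * Z w) := by
                have : 0 ≤ Z w / ((k : ℝ) - 1) := by
                  have hk' : (2 : ℝ) ≤ k := by exact_mod_cast hk
                  exact div_nonneg hz.le (by linarith)
                have hu := hw.1
                have hu2 := hw.2.le
                gcongr
                linarith
            _ = u⁻¹ * Z w := one_mul _
      · simp only [if_neg h0']
        split_ifs <;> simp
  · simp only [if_neg hw, e1, e2, if_neg hm, sub_sub_cancel]
    split_ifs
    · rw [hlk]; linarith
    · rw [one_mul]

end TreeColouring
end
noncomputable section
namespace TreeColouring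

/-! ### Deterministic lower bounds for the largest entry of the posterior -/

section Deterministic

variable {k : ℕ} [NeZero k]

/-- An upper bound for the likelihood ratio of the relative colours `e` and `0`. -/
def weightBound (a : ℝ) (Z : ℝ → ℝ) (e : Fin k) (v : Σ b : ℕ, Fin b → Mark k) : ℝ :=
  ∏ i, ratioBound a Z e (v.2 i)

/-- All offspring of relative colour `e` have their first uniform variable at least `a`. -/
def AllCore (a : ℝ) (e : Fin k) (v : Σ b : ℕ, Fin b → Mark k) : Prop :=
  ∀ i, (v.2 i).1 = e → a ≤ (v.2 i).2.1

open scoped Classical in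
/-- The sum of the bounds over the colours for which not all offspring are in the core. -/
def tailSum (a : ℝ) (Z : ℝ → ℝ) (v : Σ b : ℕ, Fin b → Mark k) : ℝ :=
  ∑ e ∈ Finset.univ.erase 0, if AllCore a e v then 0 else weightBound a Z e v

theorem weightBound_pos (hk : 2 ≤ k) (a : ℝ) {Z : ℝ → ℝ} (h0 : ∀ w, 0 < Z w)
    (h1 : ∀ w, Z w ≤ 1 - 1 / (k : ℝ)) (e : Fin k) (v : Σ b : ℕ, Fin b → Mark k) :
    0 < weightBound a Z e v :=
  Finset.prod_pos fun _ _ => ratioBound_pos hk a h0 h1 e _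

theorem tailSum_nonneg (hk : 2 ≤ k) (a : ℝ) {Z : ℝ → ℝ} (h0 : ∀ w, 0 < Z w)
    (h1 : ∀ w, Z w ≤ 1 - 1 / (k : ℝ)) (v : Σ b : ℕ, Fin b → Mark k) :
    0 ≤ tailSum a Z v := by
  refine Finset.sum_nonneg fun e _ => ?_
  split_ifs
  · exact le_rfl
  · exact (weightBound_pos hk a h0 h1 e v).le

theorem tailSum_mono (hk : 2 ≤ k) {a : ℝ} {Z Z' : ℝ → ℝ}
    (h0 : ∀ w, 0 < Z w) (hle : ∀ w, Z w ≤ Z' w) (hcore : ∀ w, a ≤ w → Z w = Z' w)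
    (h1 : ∀ w, Z' w ≤ 1 - 1 / (k : ℝ)) (v : Σ b : ℕ, Fin b → Mark k) :
    tailSum a Z v ≤ tailSum a Z' v := by
  refine Finset.sum_le_sum fun e _ => ?_
  split_ifs
  · exact le_rfl
  · exact Finset.prod_le_prod
      (fun i _ => (ratioBound_pos hk a h0 (fun w => (hle w).trans (h1 w)) e _).le)
      fun i _ => ratioBound_mono hk h0 hle hcore h1 e _

/-- The unnormalised posterior probability of colour `m`. -/
def rawWeight (Z : ℝ → ℝ) (l m : Fin k) (v : Σ b : ℕ, Fin b → Mark k) : ℝ :=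
  ∏ i, (1 - childVec Z l (v.2 i).2 (m - (v.2 i).1))

theorem rawWeight_pos (hk : 2 ≤ k) {Z : ℝ → ℝ} (h0 : ∀ w, 0 < Z w)
    (h1 : ∀ w, Z w ≤ 1 - 1 / (k : ℝ)) (l m : Fin k) (v : Σ b : ℕ, Fin b → Mark k) :
    0 < rawWeight Z l m v :=
  Finset.prod_pos fun _ _ => one_sub_childVec_pos hk h0 h1 _ _ _

theorem rawWeight_le (hk : 2 ≤ k) (a : ℝ) {Z : ℝ → ℝ} (h0 : ∀ w, 0 < Z w)
    (h1 : ∀ w, Z w ≤ 1 - 1 / (k : ℝ)) (l : Fin k) {e : Fin k} (he : e ≠ 0)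
    (v : Σ b : ℕ, Fin b → Mark k) (hv : ∀ i, (v.2 i).1 ≠ 0) :
    rawWeight Z l (l + e) v ≤ weightBound a Z e v * rawWeight Z l l v := by
  rw [rawWeight, weightBound, rawWeight, ← Finset.prod_mul_distrib]
  exact Finset.prod_le_prod (fun i _ => (one_sub_childVec_pos hk h0 h1 _ _ _).le)
    fun i _ => one_sub_childVec_le hk a h0 h1 l he _ (hv i)

theorem sampleVec_apply (Z : ℝ → ℝ) (l m : Fin k) (v : Σ b : ℕ, Fin b → Mark k) :
    sampleVec Z l v m = rawWeight Z l m v / ∑ m', rawWeight Z l m' v := rfl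

theorem sum_rawWeight (Z : ℝ → ℝ) (l : Fin k) (v : Σ b : ℕ, Fin b → Mark k) :
    ∑ m, rawWeight Z l m v =
      rawWeight Z l l v + ∑ e ∈ Finset.univ.erase 0, rawWeight Z l (l + e) v := by
  rw [← Equiv.sum_comp (Equiv.addLeft l), ← Finset.add_sum_erase _ _ (Finset.mem_univ (0 : Fin k))]
  simp

theorem le_norm_sampleVec (Z : ℝ → ℝ) (l m : Fin k) (v : Σ b : ℕ, Fin b → Mark k) :
    sampleVec Z l v m ≤ ‖sampleVec Z l v‖ :=
  (le_abs_self _).trans (norm_le_pi_norm (sampleVec Z l v) m)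

/-- Without rivals, every wrong colour is counted in `tailSum`, so the true colour already has
posterior probability at least `1 / (1 + tailSum)`. -/
theorem one_le_mul_norm_sampleVec (hk : 2 ≤ k) (a : ℝ) {Z : ℝ → ℝ} (h0 : ∀ w, 0 < Z w)
    (h1 : ∀ w, Z w ≤ 1 - 1 / (k : ℝ)) (l : Fin k)
    (v : Σ b : ℕ, Fin b → Mark k) (hv : ∀ i, (v.2 i).1 ≠ 0)
    (hno : ∀ e, e ≠ 0 → ¬ AllCore a e v) :
    1 ≤ (1 + tailSum a Z v) * ‖sampleVec Z l v‖ := by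
  have hp := fun m => rawWeight_pos hk h0 h1 l m v
  have hs : 0 < ∑ m, rawWeight Z l m v := Finset.sum_pos (fun m _ => hp m) Finset.univ_nonempty
  have ht := tailSum_nonneg hk a h0 h1 v
  have h3 : ∑ m, rawWeight Z l m v ≤ (1 + tailSum a Z v) * rawWeight Z l l v := by
    rw [sum_rawWeight, add_mul, one_mul, tailSum, Finset.sum_mul]
    gcongr with e he
    have he' := Finset.ne_of_mem_erase he
    rw [if_neg (hno e he')]
    exact rawWeight_le hk a h0 h1 l he' v hv
  calc (1 : ℝ) ≤ (1 + tailSum a Z v) * sampleVec Z l v l := by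
        rw [sampleVec_apply, ← mul_div_assoc, le_div_iff₀ hs, one_mul]
        exact h3
    _ ≤ _ := by
        gcongr
        exact le_norm_sampleVec Z l l v

/-- With a single rival `e₁` all other wrong colours are counted in `tailSum`. The true colour and
the rival then share at least `1 / (1 + tailSum)`, and the larger of the two has half of it. No
bound on the weight of the rival is needed. -/
theorem one_le_two_mul_norm_sampleVec (hk : 2 ≤ k) (a : ℝ) {Z : ℝ → ℝ} (h0 : ∀ w, 0 < Z w)
    (h1 : ∀ w, Z w ≤ 1 - 1 / (k : ℝ)) (l : Fin k)
    (v : Σ b : ℕ, Fin b → Mark k) (hv : ∀ i, (v.2 i).1 ≠ 0) {e₁ : Fin k} (he₁ : e₁ ≠ 0)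
    (hno : ∀ e, e ≠ 0 → e ≠ e₁ → ¬ AllCore a e v) :
    1 ≤ 2 * (1 + tailSum a Z v) * ‖sampleVec Z l v‖ := by
  classical
  have hp := fun m => rawWeight_pos hk h0 h1 l m v
  have hs : 0 < ∑ m, rawWeight Z l m v := Finset.sum_pos (fun m _ => hp m) Finset.univ_nonempty
  have ht := tailSum_nonneg hk a h0 h1 v
  have hm : e₁ ∈ Finset.univ.erase (0 : Fin k) := by simpa using he₁
  have h3 : ∑ m, rawWeight Z l m v ≤
      (1 + tailSum a Z v) * (rawWeight Z l l v + rawWeight Z l (l + e₁) v) := by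
    have h4 : ∑ e ∈ (Finset.univ.erase (0 : Fin k)).erase e₁, rawWeight Z l (l + e) v ≤
        tailSum a Z v * rawWeight Z l l v := by
      rw [tailSum, Finset.sum_mul]
      refine (Finset.sum_le_sum (g := fun e => (if AllCore a e v then 0 else weightBound a Z e v) *
        rawWeight Z l l v) fun e he => ?_).trans (Finset.sum_le_sum_of_subset_of_nonneg
          (Finset.erase_subset _ _) fun e _ _ => mul_nonneg ?_ (hp l).le)
      · have he1 := Finset.ne_of_mem_erase he
        have he2 := Finset.ne_of_mem_erase (Finset.mem_of_mem_erase he)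
        simp only [if_neg (hno e he2 he1)]
        exact rawWeight_le hk a h0 h1 l he2 v hv
      · split_ifs
        · exact le_rfl
        · exact (weightBound_pos hk a h0 h1 e v).le
    rw [sum_rawWeight, ← Finset.add_sum_erase _ _ hm]
    have := mul_nonneg ht (hp (l + e₁)).le
    linarith
  have h5 : rawWeight Z l l v + rawWeight Z l (l + e₁) v ≤
      2 * ‖sampleVec Z l v‖ * ∑ m, rawWeight Z l m v := by
    have h6 := le_norm_sampleVec Z l l v
    have h7 := le_norm_sampleVec Z l (l + e₁) v
    rw [sampleVec_apply, div_le_iff₀ hs] at h6 h7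
    linarith
  have h8 : ∑ m, rawWeight Z l m v ≤
      (2 * (1 + tailSum a Z v) * ‖sampleVec Z l v‖) * ∑ m, rawWeight Z l m v := by
    calc _ ≤ _ := h3
      _ ≤ (1 + tailSum a Z v) * (2 * ‖sampleVec Z l v‖ * ∑ m, rawWeight Z l m v) := by gcongr
      _ = _ := by ring
  exact le_of_mul_le_mul_right (by rwa [one_mul]) hs

end Deterministic

/-! ### Measurability -/

section Measurability

variable {k : ℕ} [NeZero k]

theorem measurable_likelihood (k : ℕ) : Measurable (likelihood k) := by
  unfold likelihood; fun_prop

theorem measurable_ratioBound (a : ℝ) {Z : ℝ → ℝ} (hZ : Measurable Z) (e : Fin k) :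
    Measurable (ratioBound a Z e : Mark k → ℝ) := by
  have hl : Measurable fun m : Mark k => likelihood k (Z m.2.1) :=
    (measurable_likelihood k).comp (hZ.comp (measurable_fst.comp measurable_snd))
  have hu : Measurable fun m : Mark k => m.2.2.1 := by fun_prop
  have hsum : Measurable fun m : Mark k => m.1 + m.2.2.2 :=
    (Measurable.of_discrete (f := fun p : Fin k × Fin k => p.1 + p.2)).comp
      (measurable_fst.prodMk (measurable_snd.comp (measurable_snd.comp measurable_snd)))
  have hw : MeasurableSet {m : Mark k | 0 < m.2.2.1 ∧ m.2.2.1 < Z m.2.1} :=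
    (measurableSet_lt measurable_const hu).inter
      (measurableSet_lt hu (hZ.comp (measurable_fst.comp measurable_snd)))
  have ha : MeasurableSet {m : Mark k | a ≤ m.2.1} :=
    measurableSet_le measurable_const (measurable_fst.comp measurable_snd)
  have hse : ∀ c : Fin k, MeasurableSet {m : Mark k | m.1 + m.2.2.2 = c} := fun c =>
    hsum (measurableSet_singleton c)
  have hze : MeasurableSet {m : Mark k | m.1 = e} := measurable_fst (measurableSet_singleton e)
  unfold ratioBound
  exact Measurable.ite hw (Measurable.ite ha (Measurable.ite (hse e) hl
    (Measurable.ite (hse 0) hl.inv measurable_const))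
    (Measurable.ite (hse 0) hu.inv measurable_const)) (Measurable.ite hze hl measurable_const)

theorem measurable_weightBound (a : ℝ) {Z : ℝ → ℝ} (hZ : Measurable Z) (e : Fin k) :
    Measurable (weightBound a Z e) := by
  refine measurable_sigma fun b => ?_
  have : Measurable fun v : Fin b → Mark k => ∏ i, ratioBound a Z e (v i) :=
    Finset.measurable_fun_prod _ fun i _ =>
      (measurable_ratioBound a hZ e).comp (measurable_pi_apply i)
  exact this

/-- The marks of relative colour `e` outside the core. -/
def tailMarks (a : ℝ) (e : Fin k) : Set (Mark k) := {m | m.1 = e ∧ m.2.1 < a}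

omit [NeZero k] in
theorem measurableSet_tailMarks (a : ℝ) (e : Fin k) : MeasurableSet (tailMarks a e) :=
  (measurable_fst (measurableSet_singleton e)).inter
    (measurableSet_lt (measurable_fst.comp measurable_snd) measurable_const)

omit [NeZero k] in
theorem not_allCore_iff (a : ℝ) (e : Fin k) (v : Σ b : ℕ, Fin b → Mark k) :
    ¬ AllCore a e v ↔ ∃ i, v.2 i ∈ tailMarks a e := by
  simp [AllCore, tailMarks]

theorem measurableSet_exists_mark {M : Type*} [MeasurableSpace M] {B : Set M}
    (hB : MeasurableSet B) : MeasurableSet {v : Σ b : ℕ, Fin b → M | ∃ i, v.2 i ∈ B} := by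
  refine MeasurableSpace.measurableSet_iInf.2 fun b => ?_
  change MeasurableSet {v : Fin b → M | ∃ i, v i ∈ B}
  rw [Set.ofPred_exists]
  exact MeasurableSet.iUnion fun i => measurable_pi_apply i hB

omit [NeZero k] in
theorem measurableSet_allCore (a : ℝ) (e : Fin k) :
    MeasurableSet {v : Σ b : ℕ, Fin b → Mark k | AllCore a e v} := by
  have h : {v : Σ b : ℕ, Fin b → Mark k | AllCore a e v} =
      {v : Σ b : ℕ, Fin b → Mark k | ∃ i, v.2 i ∈ tailMarks a e}ᶜ := by
    ext v
    rw [Set.mem_compl_iff, Set.mem_ofPred_eq, Set.mem_ofPred_eq, ← not_allCore_iff, not_not]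
  rw [h]
  exact (measurableSet_exists_mark (measurableSet_tailMarks a e)).compl

theorem measurable_tailSum (a : ℝ) {Z : ℝ → ℝ} (hZ : Measurable Z) :
    Measurable (tailSum a Z : (Σ b : ℕ, Fin b → Mark k) → ℝ) :=
  Finset.measurable_fun_sum _ fun e _ =>
    Measurable.ite (measurableSet_allCore a e) measurable_const (measurable_weightBound a hZ e)

end Measurability

end TreeColouring
end
noncomputable section
namespace TreeColouring

/-! ### Moments of the contribution of a single offspring -/

/-- The concave function that measures the tail of the law of the error probability. -/
def tailWeight (z : ℝ) : ℝ := (1 - z) * z ^ (1 / 4 : ℝ) + z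

/-- The term `4 / 3 * z ^ (3 / 4)` is the integral of `u ^ (-1 / 4)` over `(0, z)`: the factor `u⁻¹`
of a wrong guess is not integrable, but its quarter power is. -/
theorem lintegral_unifI_ite_rpow {z : ℝ} (h0 : 0 ≤ z) (h1 : z ≤ 1) {A B c : ℝ} (hA : 0 ≤ A)
    (hB : 0 ≤ B) (hc : 0 ≤ c) :
    ∫⁻ u, ENNReal.ofReal (if 0 < u ∧ u < z then A + c * u ^ (-(1 / 4) : ℝ) else B) ∂unifI =
      ENNReal.ofReal ((1 - z) * B + z * A + c * (4 / 3 * z ^ (3 / 4 : ℝ))) := by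
  have hm : MeasurableSet {u : ℝ | 0 < u ∧ u < z} := measurableSet_Ioo
  have e1 : ∀ u : ℝ, ENNReal.ofReal (if 0 < u ∧ u < z then A + c * u ^ (-(1 / 4) : ℝ) else B) =
      (if 0 < u ∧ u < z then ENNReal.ofReal A else ENNReal.ofReal B) + ENNReal.ofReal c *
        {u : ℝ | 0 < u ∧ u < z}.indicator (fun u => ENNReal.ofReal (u ^ (-(1 / 4) : ℝ))) u := by
    intro u
    by_cases hu : 0 < u ∧ u < z
    · have : (0 : ℝ) ≤ u ^ (-(1 / 4) : ℝ) := Real.rpow_nonneg hu.1.le _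
      rw [if_pos hu, if_pos hu, Set.indicator_of_mem (by exact hu), ENNReal.ofReal_add hA
        (by positivity), ENNReal.ofReal_mul hc]
    · rw [if_neg hu, if_neg hu, Set.indicator_of_notMem (by exact hu), mul_zero, add_zero]
  have e2 : ∫⁻ u in {u : ℝ | 0 < u ∧ u < z}, ENNReal.ofReal (u ^ (-(1 / 4) : ℝ)) ∂unifI =
      ENNReal.ofReal (4 / 3 * z ^ (3 / 4 : ℝ)) := by
    have hsub : {u : ℝ | 0 < u ∧ u < z} ∩ Set.Icc 0 1 = Set.Ioo 0 z := by
      ext u; constructor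
      · exact fun h => h.1
      · exact fun h => ⟨h, h.1.le, h.2.le.trans h1⟩
    rw [unifI, Measure.restrict_restrict hm, hsub, Measure.restrict_congr_set Ioo_ae_eq_Ioc]
    have hint : IntervalIntegrable (fun u : ℝ => u ^ (-(1 / 4) : ℝ)) volume 0 z :=
      intervalIntegral.intervalIntegrable_rpow' (by norm_num)
    rw [intervalIntegrable_iff_integrableOn_Ioc_of_le h0] at hint
    rw [← ofReal_integral_eq_lintegral_ofReal hint]
    · congr 1
      rw [← intervalIntegral.integral_of_le h0, integral_rpow (Or.inl (by norm_num))]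
      norm_num
      ring
    · refine (ae_restrict_mem measurableSet_Ioc).mono fun u hu => ?_
      exact Real.rpow_nonneg hu.1.le _
  simp_rw [e1]
  rw [lintegral_add_left (Measurable.ite hm measurable_const measurable_const),
    lintegral_unifI_ite h0 h1, lintegral_const_mul _ (Measurable.indicator (by fun_prop) hm),
    lintegral_indicator hm, e2, ← ENNReal.ofReal_mul hc, ← ENNReal.ofReal_mul (by linarith),
    ← ENNReal.ofReal_mul h0, ← ENNReal.ofReal_add (by nlinarith) (by positivity),
    ← ENNReal.ofReal_add (by have : 0 ≤ (1 - z) * B := mul_nonneg (by linarith) hB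
                             positivity) (by positivity)]

section Sums

variable {k : ℕ} [NeZero k]

theorem sum_erase_ite_add_eq_zero {z : Fin k} (hz : z ≠ 0) (c : ℝ) :
    ∑ h ∈ Finset.univ.erase (0 : Fin k), (if z + h = 0 then c else 0) = c := by
  rw [Finset.sum_eq_single (-z)]
  · simp
  · intro b _ hb
    rw [if_neg]
    intro h; exact hb (eq_neg_of_add_eq_zero_right h)
  · intro h; simp [hz] at h

theorem sum_erase_ite_add_eq {z e : Fin k} (c : ℝ) :
    ∑ h ∈ Finset.univ.erase (0 : Fin k), (if z + h = e then c else 0) =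
      if z = e then 0 else c := by
  by_cases h : z = e
  · rw [if_pos h]
    refine Finset.sum_eq_zero fun b hb => if_neg ?_
    rw [h]
    simpa using Finset.ne_of_mem_erase hb
  · rw [if_neg h, Finset.sum_eq_single (e - z)]
    · simp
    · intro b _ hb
      rw [if_neg]
      rintro rfl; simp at hb
    · intro h'; simp [sub_ne_zero.2 (Ne.symm h)] at h'

theorem sum_erase_ite_eq {e : Fin k} (he : e ≠ 0) (c : ℝ) :
    ∑ z ∈ Finset.univ.erase (0 : Fin k), (if z = e then c else 0) = c := by
  rw [Finset.sum_ite_eq' _ e, if_pos (by simpa using he)]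

theorem card_erase_cast (hk : 2 ≤ k) :
    ((Finset.univ.erase (0 : Fin k)).card : ℝ) = (k : ℝ) - 1 := by
  rw [Finset.card_erase_of_mem (Finset.mem_univ _), Finset.card_univ, Fintype.card_fin,
    Nat.cast_sub (by omega), Nat.cast_one]

end Sums

section Cases

variable {k : ℕ} [NeZero k] (a : ℝ) (Z : ℝ → ℝ) (e : Fin k)

theorem ratioBound_rpow_right {w u : ℝ} (hw : ¬ (0 < u ∧ u < Z w)) (z h : Fin k) (s : ℝ) :
    ratioBound a Z e (z, w, u, h) ^ s =
      1 + (if z = e then likelihood k (Z w) ^ s - 1 else 0) := by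
  unfold ratioBound
  simp only [if_neg hw]
  split_ifs <;> simp

theorem ratioBound_rpow_wrong_core {w u : ℝ} (hw : 0 < u ∧ u < Z w) (ha : a ≤ w) {e : Fin k}
    (he : e ≠ 0) (z h : Fin k) (s : ℝ) :
    ratioBound a Z e (z, w, u, h) ^ s =
      1 + (if z + h = e then likelihood k (Z w) ^ s - 1 else 0) +
        (if z + h = 0 then (likelihood k (Z w))⁻¹ ^ s - 1 else 0) := by
  unfold ratioBound
  simp only [if_pos hw, if_pos ha]
  by_cases h1 : z + h = e
  · have : z + h ≠ 0 := by rwa [h1]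
    rw [if_pos h1, if_pos h1, if_neg this]; ring
  · rw [if_neg h1, if_neg h1]
    split_ifs <;> simp

theorem ratioBound_rpow_wrong_tail {w u : ℝ} (hw : 0 < u ∧ u < Z w) (ha : w < a)
    (z h : Fin k) (s : ℝ) :
    ratioBound a Z e (z, w, u, h) ^ s =
      1 + (if z + h = 0 then (u⁻¹) ^ s - 1 else 0) := by
  unfold ratioBound
  simp only [if_pos hw, if_neg (not_le.2 ha)]
  split_ifs <;> simp

end Cases

section Average

variable {k : ℕ} [NeZero k]

/-- The average over the relative colour of the offspring and of its wrong guess. -/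
def markAverage (f : Fin k → Fin k → ℝ) : ℝ :=
  ((k : ℝ) - 1)⁻¹ * ∑ z ∈ Finset.univ.erase 0, (((k : ℝ) - 1)⁻¹ * ∑ h ∈ Finset.univ.erase 0, f z h)

theorem ofReal_markAverage (hk : 2 ≤ k) {f : Fin k → Fin k → ℝ} (hf : ∀ z h, 0 ≤ f z h) :
    ((k - 1 : ℕ) : ℝ≥0∞)⁻¹ * ∑ z ∈ Finset.univ.erase 0, (((k - 1 : ℕ) : ℝ≥0∞)⁻¹ *
      ∑ h ∈ Finset.univ.erase 0, ENNReal.ofReal (f z h)) = ENNReal.ofReal (markAverage f) := by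
  have hk1 : (0 : ℝ) < (k : ℝ) - 1 := by
    have : (2 : ℝ) ≤ k := by exact_mod_cast hk
    linarith
  have hc : ((k - 1 : ℕ) : ℝ≥0∞)⁻¹ = ENNReal.ofReal (((k : ℝ) - 1)⁻¹) := by
    rw [ENNReal.ofReal_inv_of_pos hk1, ← ENNReal.ofReal_natCast, Nat.cast_sub (by omega),
      Nat.cast_one]
  have h1 : ∀ z, 0 ≤ ∑ h ∈ Finset.univ.erase (0 : Fin k), f z h := fun z =>
    Finset.sum_nonneg fun h _ => hf z h
  rw [markAverage, hc, ENNReal.ofReal_mul (by positivity), ENNReal.ofReal_sum_of_nonneg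
    (fun z _ => mul_nonneg (by positivity) (h1 z))]
  congr 1
  refine Finset.sum_congr rfl fun z _ => ?_
  rw [ENNReal.ofReal_mul (by positivity), ENNReal.ofReal_sum_of_nonneg (fun h _ => hf z h)]

theorem markAverage_right (hk : 2 ≤ k) (a : ℝ) (Z : ℝ → ℝ) {e : Fin k} (he : e ≠ 0) {w u : ℝ}
    (hw : ¬ (0 < u ∧ u < Z w)) (s : ℝ) :
    markAverage (fun z h : Fin k => ratioBound a Z e (z, w, u, h) ^ s) =
      1 + ((k : ℝ) - 1)⁻¹ * (likelihood k (Z w) ^ s - 1) := by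
  have hk1 : (k : ℝ) - 1 ≠ 0 := by
    have : (2 : ℝ) ≤ k := by exact_mod_cast hk
    linarith
  simp only [markAverage, ratioBound_rpow_right a Z e hw, Finset.sum_const, nsmul_eq_mul,
    card_erase_cast hk, inv_mul_cancel_left₀ hk1, Finset.sum_add_distrib, sum_erase_ite_eq he]
  field_simp

theorem markAverage_wrong_core (hk : 2 ≤ k) (a : ℝ) (Z : ℝ → ℝ) {e : Fin k} (he : e ≠ 0)
    {w u : ℝ} (hw : 0 < u ∧ u < Z w) (ha : a ≤ w) (s : ℝ) :
    markAverage (fun z h : Fin k => ratioBound a Z e (z, w, u, h) ^ s) =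
      1 + ((k : ℝ) - 1)⁻¹ * ((1 - ((k : ℝ) - 1)⁻¹) * (likelihood k (Z w) ^ s - 1) +
        ((likelihood k (Z w))⁻¹ ^ s - 1)) := by
  have hk1 : (k : ℝ) - 1 ≠ 0 := by
    have : (2 : ℝ) ≤ k := by exact_mod_cast hk
    linarith
  have h1 : ∀ z ∈ Finset.univ.erase (0 : Fin k), ((k : ℝ) - 1)⁻¹ * ∑ h ∈ Finset.univ.erase 0,
      ratioBound a Z e (z, w, u, h) ^ s = 1 + ((k : ℝ) - 1)⁻¹ *
        ((likelihood k (Z w) ^ s - 1) + ((likelihood k (Z w))⁻¹ ^ s - 1)) -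
        (if z = e then ((k : ℝ) - 1)⁻¹ * (likelihood k (Z w) ^ s - 1) else 0) := by
    intro z hz
    simp only [ratioBound_rpow_wrong_core a Z hw ha he, Finset.sum_add_distrib, Finset.sum_const,
      nsmul_eq_mul, card_erase_cast hk, sum_erase_ite_add_eq_zero (Finset.ne_of_mem_erase hz),
      sum_erase_ite_add_eq]
    split_ifs <;> field_simp <;> ring
  rw [markAverage, Finset.sum_congr rfl h1, Finset.sum_sub_distrib, sum_erase_ite_eq he,
    Finset.sum_const, nsmul_eq_mul, card_erase_cast hk]
  field_simp
  ring

theorem markAverage_wrong_tail (hk : 2 ≤ k) (a : ℝ) (Z : ℝ → ℝ) (e : Fin k)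
    {w u : ℝ} (hw : 0 < u ∧ u < Z w) (ha : w < a) (s : ℝ) :
    markAverage (fun z h : Fin k => ratioBound a Z e (z, w, u, h) ^ s) =
      1 + ((k : ℝ) - 1)⁻¹ * ((u⁻¹) ^ s - 1) := by
  have hk1 : (k : ℝ) - 1 ≠ 0 := by
    have : (2 : ℝ) ≤ k := by exact_mod_cast hk
    linarith
  have h1 : ∀ z ∈ Finset.univ.erase (0 : Fin k), ((k : ℝ) - 1)⁻¹ * ∑ h ∈ Finset.univ.erase 0,
      ratioBound a Z e (z, w, u, h) ^ s = 1 + ((k : ℝ) - 1)⁻¹ * ((u⁻¹) ^ s - 1) := by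
    intro z hz
    simp only [ratioBound_rpow_wrong_tail a Z e hw ha, Finset.sum_add_distrib, Finset.sum_const,
      nsmul_eq_mul, card_erase_cast hk, sum_erase_ite_add_eq_zero (Finset.ne_of_mem_erase hz)]
    field_simp
  rw [markAverage, Finset.sum_congr rfl h1, Finset.sum_const, nsmul_eq_mul, card_erase_cast hk]
  field_simp

theorem markAverage_tailMarks_right (hk : 2 ≤ k) (a : ℝ) (Z : ℝ → ℝ) {e : Fin k} (he : e ≠ 0)
    {w u : ℝ} (hw : ¬ (0 < u ∧ u < Z w)) (s : ℝ) :
    markAverage (fun z h : Fin k => if z = e then ratioBound a Z e (z, w, u, h) ^ s else 0) =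
      ((k : ℝ) - 1)⁻¹ * likelihood k (Z w) ^ s := by
  have hk1 : (k : ℝ) - 1 ≠ 0 := by
    have : (2 : ℝ) ≤ k := by exact_mod_cast hk
    linarith
  have h1 : ∀ z h : Fin k, (if z = e then ratioBound a Z e (z, w, u, h) ^ s else 0) =
      if z = e then likelihood k (Z w) ^ s else 0 := by
    intro z h
    rw [ratioBound_rpow_right a Z e hw]
    split_ifs <;> simp
  simp only [markAverage, h1, Finset.sum_const, nsmul_eq_mul, card_erase_cast hk,
    inv_mul_cancel_left₀ hk1, sum_erase_ite_eq he]

theorem markAverage_tailMarks_wrong (hk : 2 ≤ k) (a : ℝ) (Z : ℝ → ℝ) {e : Fin k} (he : e ≠ 0)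
    {w u : ℝ} (hw : 0 < u ∧ u < Z w) (ha : w < a) (s : ℝ) :
    markAverage (fun z h : Fin k => if z = e then ratioBound a Z e (z, w, u, h) ^ s else 0) =
      ((k : ℝ) - 1)⁻¹ * (1 + ((k : ℝ) - 1)⁻¹ * ((u⁻¹) ^ s - 1)) := by
  have hk1 : (k : ℝ) - 1 ≠ 0 := by
    have : (2 : ℝ) ≤ k := by exact_mod_cast hk
    linarith
  have h1 : ∀ z ∈ Finset.univ.erase (0 : Fin k), ((k : ℝ) - 1)⁻¹ * ∑ h ∈ Finset.univ.erase 0,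
      (if z = e then ratioBound a Z e (z, w, u, h) ^ s else 0) =
      if z = e then 1 + ((k : ℝ) - 1)⁻¹ * ((u⁻¹) ^ s - 1) else 0 := by
    intro z hz
    by_cases hze : z = e
    · simp only [if_pos hze]
      simp only [ratioBound_rpow_wrong_tail a Z e hw ha, Finset.sum_add_distrib, Finset.sum_const,
        nsmul_eq_mul, card_erase_cast hk, sum_erase_ite_add_eq_zero (Finset.ne_of_mem_erase hz)]
      field_simp
    · simp [hze]
  rw [markAverage, Finset.sum_congr rfl h1, sum_erase_ite_eq he]

end Average

end TreeColouring
end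
noncomputable section
namespace TreeColouring

theorem tailWeight_eq {z : ℝ} (h0 : 0 ≤ z) :
    tailWeight z = (1 - (z ^ (1 / 4 : ℝ)) ^ 4) * z ^ (1 / 4 : ℝ) + (z ^ (1 / 4 : ℝ)) ^ 4 := by
  have : (z ^ (1 / 4 : ℝ)) ^ 4 = z := by
    rw [← Real.rpow_natCast, ← Real.rpow_mul h0]; norm_num
  rw [this, tailWeight]

theorem tailWeight_nonneg {z : ℝ} (h0 : 0 ≤ z) (h1 : z ≤ 1) : 0 ≤ tailWeight z :=
  add_nonneg (mul_nonneg (by linarith) (Real.rpow_nonneg h0 _)) h0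

/-- With `v = z ^ (1 / 4)` the difference of the two sides is `v * (1 - v ^ 2) + v ^ 4 * (1 - v)`.
-/
theorem rpow_three_fourths_le_tailWeight {z : ℝ} (h0 : 0 ≤ z) (h1 : z ≤ 1) :
    z ^ (3 / 4 : ℝ) ≤ tailWeight z := by
  have hv : 0 ≤ z ^ (1 / 4 : ℝ) := Real.rpow_nonneg h0 _
  have hv1 : z ^ (1 / 4 : ℝ) ≤ 1 := Real.rpow_le_one h0 h1 (by norm_num)
  have h3 : z ^ (3 / 4 : ℝ) = (z ^ (1 / 4 : ℝ)) ^ 3 := by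
    rw [← Real.rpow_natCast, ← Real.rpow_mul h0]; norm_num
  rw [tailWeight_eq h0, h3]
  set v := z ^ (1 / 4 : ℝ)
  have h4 : 0 ≤ v * ((1 - v) * (1 + v)) := by
    have : 0 ≤ 1 - v := by linarith
    positivity
  have h5 : 0 ≤ v ^ 4 * (1 - v) := mul_nonneg (by positivity) (by linarith)
  nlinarith

theorem likelihood_rpow_le {k : ℕ} (hk : 3 ≤ k) {z : ℝ} (h0 : 0 ≤ z) (h1 : z ≤ 1)  :
    likelihood k z ^ (1 / 4 : ℝ) ≤ z ^ (1 / 4 : ℝ) * (1 + 2 * ((k : ℝ) - 1)⁻¹) := by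
  have hk' : (3 : ℝ) ≤ k := by exact_mod_cast hk
  have hκ : (0 : ℝ) < (k : ℝ) - 1 := by linarith
  have hi : ((k : ℝ) - 1)⁻¹ ≤ 1 / 2 := by
    rw [inv_le_comm₀ hκ (by norm_num)]; linarith
  have hi0 : 0 < ((k : ℝ) - 1)⁻¹ := by positivity
  have hz : z / ((k : ℝ) - 1) ≤ ((k : ℝ) - 1)⁻¹ := by
    rw [div_eq_mul_inv]; exact mul_le_of_le_one_left hi0.le h1
  have hl : likelihood k z ≤ z * (1 + 2 * ((k : ℝ) - 1)⁻¹) := by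
    rw [likelihood, div_le_iff₀ (by linarith), mul_assoc]
    refine le_mul_of_one_le_right h0 ?_
    nlinarith
  have hb : (1 : ℝ) ≤ 1 + 2 * ((k : ℝ) - 1)⁻¹ := by linarith
  have hl0 : 0 ≤ likelihood k z := div_nonneg h0 (by linarith)
  calc likelihood k z ^ (1 / 4 : ℝ) ≤ (z * (1 + 2 * ((k : ℝ) - 1)⁻¹)) ^ (1 / 4 : ℝ) :=
        Real.rpow_le_rpow hl0 hl (by norm_num)
    _ = z ^ (1 / 4 : ℝ) * (1 + 2 * ((k : ℝ) - 1)⁻¹) ^ (1 / 4 : ℝ) :=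
        Real.mul_rpow h0 (by linarith)
    _ ≤ _ := by
        have : 0 ≤ z ^ (1 / 4 : ℝ) := Real.rpow_nonneg h0 _
        gcongr
        calc (1 + 2 * ((k : ℝ) - 1)⁻¹) ^ (1 / 4 : ℝ) ≤ (1 + 2 * ((k : ℝ) - 1)⁻¹) ^ (1 : ℝ) :=
              Real.rpow_le_rpow_of_exponent_le hb (by norm_num)
          _ = _ := Real.rpow_one _

/-- The exact quarter moment of a right guess, with a wrong guess counted as one, agrees with
`tailWeight` up to a factor that tends to one with `k`. This is where the form of `tailWeight` comes
from. -/
theorem rpow_le_tailWeight_aux {k : ℕ} (hk : 3 ≤ k) {z : ℝ} (h0 : 0 ≤ z) (h1 : z ≤ 1) :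
    (1 - z) * likelihood k z ^ (1 / 4 : ℝ) + z ≤
      (1 + 2 * ((k : ℝ) - 1)⁻¹) * tailWeight z := by
  have hk' : (3 : ℝ) ≤ k := by exact_mod_cast hk
  have hi0 : 0 ≤ ((k : ℝ) - 1)⁻¹ := inv_nonneg.2 (by linarith)
  have h2 := mul_le_mul_of_nonneg_left (likelihood_rpow_le hk h0 h1) (sub_nonneg.2 h1)
  unfold tailWeight
  have h3 : 0 ≤ 2 * ((k : ℝ) - 1)⁻¹ * z := by positivity
  linarith

/-! ### Quarter moments of a single factor, outside and inside the core -/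

section Moments

variable {k : ℕ} [NeZero k] (hk : 4 ≤ k) {a : ℝ} (ha0 : 0 ≤ a) (ha1 : a ≤ 1) {Z : ℝ → ℝ}
  (hZ : Measurable Z) (h0 : ∀ w, 0 < Z w) (h1 : ∀ w, Z w ≤ 1 - 1 / (k : ℝ))

include hk h0 h1 in
-- A right guess matters only if the offspring has colour `e`, a wrong guess only if it points to
-- `0`; each has probability `1 / (k - 1)`. The constant `3 = 5/3 + 4/3` is crude, since this term
-- only enters the exponential rate multiplied by a small tail moment.
theorem lintegral_markAverage_tail {e : Fin k} (he : e ≠ 0) {w : ℝ} (hw : w < a) :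
    ∫⁻ u, ENNReal.ofReal (markAverage fun z h : Fin k =>
        ratioBound a Z e (z, w, u, h) ^ (1 / 4 : ℝ)) ∂unifI ≤
      ENNReal.ofReal (1 - ((k : ℝ) - 1)⁻¹) +
        ENNReal.ofReal (3 * ((k : ℝ) - 1)⁻¹) * ENNReal.ofReal (tailWeight (Z w)) := by
  have hk' : (4 : ℝ) ≤ k := by exact_mod_cast hk
  have hκ : (0 : ℝ) < (k : ℝ) - 1 := by linarith
  have hi : ((k : ℝ) - 1)⁻¹ ≤ 1 / 3 := by
    rw [inv_le_comm₀ hκ (by norm_num)]; linarith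
  have hi0 : 0 < ((k : ℝ) - 1)⁻¹ := by positivity
  have hz := h0 w
  have hz1 : Z w ≤ 1 := (h1 w).trans (by have : 0 ≤ 1 / (k : ℝ) := by positivity
                                         linarith)
  have hl := (likelihood_pos (by omega) hz (h1 w))
  have hlr : 0 ≤ likelihood k (Z w) ^ (1 / 4 : ℝ) := Real.rpow_nonneg hl.le _
  have e1 : ∀ u, markAverage (fun z h : Fin k => ratioBound a Z e (z, w, u, h) ^ (1 / 4 : ℝ)) =
      if 0 < u ∧ u < Z w then (1 - ((k : ℝ) - 1)⁻¹) + ((k : ℝ) - 1)⁻¹ * u ^ (-(1 / 4) : ℝ)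
      else 1 + ((k : ℝ) - 1)⁻¹ * (likelihood k (Z w) ^ (1 / 4 : ℝ) - 1) := by
    intro u
    split_ifs with hu
    · rw [markAverage_wrong_tail (by omega) a Z e hu hw, Real.inv_rpow hu.1.le,
        ← Real.rpow_neg hu.1.le]
      ring
    · rw [markAverage_right (by omega) a Z he hu]
  simp_rw [e1]
  have hB : 0 ≤ 1 + ((k : ℝ) - 1)⁻¹ * (likelihood k (Z w) ^ (1 / 4 : ℝ) - 1) := by
    have := mul_nonneg hi0.le hlr
    linarith
  rw [lintegral_unifI_ite_rpow hz.le hz1 (by linarith) hB hi0.le,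
    ← ENNReal.ofReal_mul (by positivity), ← ENNReal.ofReal_add (by linarith)
      (mul_nonneg (by positivity) (tailWeight_nonneg hz.le hz1))]
  refine ENNReal.ofReal_le_ofReal ?_
  have h5 := rpow_le_tailWeight_aux (k := k) (by omega) hz.le hz1
  have h6 := rpow_three_fourths_le_tailWeight hz.le hz1
  have h7 := tailWeight_nonneg hz.le hz1
  have h8 : (1 - Z w) * likelihood k (Z w) ^ (1 / 4 : ℝ) + 4 / 3 * Z w ^ (3 / 4 : ℝ) ≤
      3 * tailWeight (Z w) := by
    have : (1 + 2 * ((k : ℝ) - 1)⁻¹) * tailWeight (Z w) ≤ (1 + 2 * (1 / 3)) * tailWeight (Z w) := by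
      gcongr
    linarith
  have h9 := mul_le_mul_of_nonneg_left h8 hi0.le
  linarith

include hk h0 h1 in
-- Unlike the bound for all tail offspring, this one must be sharp to leading order: it is the
-- linear factor of the recursion for the tail. A wrong guess pointing to `0` costs a second factor
-- `1 / (k - 1)`, so it only appears in the correction.
theorem lintegral_markAverage_tailMarks {e : Fin k} (he : e ≠ 0) {w : ℝ} (hw : w < a) :
    ∫⁻ u, ENNReal.ofReal (markAverage fun z h : Fin k =>
        if z = e then ratioBound a Z e (z, w, u, h) ^ (1 / 4 : ℝ) else 0) ∂unifI ≤
      ENNReal.ofReal (((k : ℝ) - 1)⁻¹ * (1 + 4 * ((k : ℝ) - 1)⁻¹)) *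
        ENNReal.ofReal (tailWeight (Z w)) := by
  have hk' : (4 : ℝ) ≤ k := by exact_mod_cast hk
  have hκ : (0 : ℝ) < (k : ℝ) - 1 := by linarith
  have hi : ((k : ℝ) - 1)⁻¹ ≤ 1 / 3 := by
    rw [inv_le_comm₀ hκ (by norm_num)]; linarith
  have hi0 : 0 < ((k : ℝ) - 1)⁻¹ := by positivity
  have hz := h0 w
  have hz1 : Z w ≤ 1 := (h1 w).trans (by have : 0 ≤ 1 / (k : ℝ) := by positivity
                                         linarith)
  have hl := (likelihood_pos (by omega) hz (h1 w))
  have hlr : 0 ≤ likelihood k (Z w) ^ (1 / 4 : ℝ) := Real.rpow_nonneg hl.le _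
  have e1 : ∀ u, markAverage (fun z h : Fin k =>
      if z = e then ratioBound a Z e (z, w, u, h) ^ (1 / 4 : ℝ) else 0) =
      if 0 < u ∧ u < Z w then ((k : ℝ) - 1)⁻¹ * (1 - ((k : ℝ) - 1)⁻¹) +
        (((k : ℝ) - 1)⁻¹ * ((k : ℝ) - 1)⁻¹) * u ^ (-(1 / 4) : ℝ)
      else ((k : ℝ) - 1)⁻¹ * likelihood k (Z w) ^ (1 / 4 : ℝ) := by
    intro u
    split_ifs with hu
    · rw [markAverage_tailMarks_wrong (by omega) a Z he hu hw, Real.inv_rpow hu.1.le,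
        ← Real.rpow_neg hu.1.le]
      ring
    · rw [markAverage_tailMarks_right (by omega) a Z he hu]
  simp_rw [e1]
  rw [lintegral_unifI_ite_rpow hz.le hz1 (mul_nonneg hi0.le (by linarith))
    (by positivity) (by positivity), ← ENNReal.ofReal_mul (by positivity)]
  refine ENNReal.ofReal_le_ofReal ?_
  have h5 := rpow_le_tailWeight_aux (k := k) (by omega) hz.le hz1
  have h6 := rpow_three_fourths_le_tailWeight hz.le hz1
  have h7 := tailWeight_nonneg hz.le hz1
  rw [mul_assoc]
  have h8 : (1 - Z w) * likelihood k (Z w) ^ (1 / 4 : ℝ) + Z w * (1 - ((k : ℝ) - 1)⁻¹) +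
      ((k : ℝ) - 1)⁻¹ * (4 / 3 * Z w ^ (3 / 4 : ℝ)) ≤
      (1 + 4 * ((k : ℝ) - 1)⁻¹) * tailWeight (Z w) := by
    have h9 := mul_le_mul_of_nonneg_left h6 hi0.le
    have h10 := mul_nonneg hi0.le h7
    have h11 := mul_nonneg hi0.le hz.le
    linarith
  have h9 := mul_le_mul_of_nonneg_left h8 hi0.le
  linarith

include hk h0 h1 in
-- In the core the likelihood ratios are exact. `U₀` bounds their quarter moment, and its value
-- below one is the information that core offspring still carry.
theorem lintegral_markAverage_core {z₀ : ℝ} {U₀ : ℝ} (hcore : ∀ w, a ≤ w → Z w = z₀)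
    (hU : (1 - z₀) * (likelihood k z₀ ^ (1 / 4 : ℝ) - 1) +
      z₀ * ((1 - ((k : ℝ) - 1)⁻¹) * (likelihood k z₀ ^ (1 / 4 : ℝ) - 1) +
        ((likelihood k z₀)⁻¹ ^ (1 / 4 : ℝ) - 1)) ≤ U₀ - 1)
    (hU0 : 0 ≤ U₀) {e : Fin k} (he : e ≠ 0) {w : ℝ} (hw : a ≤ w) :
    ∫⁻ u, ENNReal.ofReal (markAverage fun z h : Fin k =>
        ratioBound a Z e (z, w, u, h) ^ (1 / 4 : ℝ)) ∂unifI ≤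
      ENNReal.ofReal (1 - ((k : ℝ) - 1)⁻¹) + ENNReal.ofReal (((k : ℝ) - 1)⁻¹ * U₀) := by
  have hk' : (4 : ℝ) ≤ k := by exact_mod_cast hk
  have hκ : (0 : ℝ) < (k : ℝ) - 1 := by linarith
  have hi : ((k : ℝ) - 1)⁻¹ ≤ 1 / 3 := by
    rw [inv_le_comm₀ hκ (by norm_num)]; linarith
  have hi0 : 0 < ((k : ℝ) - 1)⁻¹ := by positivity
  have hz := h0 w
  have hz1 : Z w ≤ 1 := (h1 w).trans (by have : 0 ≤ 1 / (k : ℝ) := by positivity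
                                         linarith)
  have hl := (likelihood_pos (by omega) hz (h1 w))
  rw [hcore w hw] at hz hz1 hl
  set ρ := likelihood k z₀
  have hlr : 0 ≤ ρ ^ (1 / 4 : ℝ) := Real.rpow_nonneg hl.le _
  have hlr' : 0 ≤ ρ⁻¹ ^ (1 / 4 : ℝ) := Real.rpow_nonneg (inv_nonneg.2 hl.le) _
  have e1 : ∀ u, ENNReal.ofReal (markAverage fun z h : Fin k =>
      ratioBound a Z e (z, w, u, h) ^ (1 / 4 : ℝ)) =
      if 0 < u ∧ u < z₀ then ENNReal.ofReal (1 + ((k : ℝ) - 1)⁻¹ *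
        ((1 - ((k : ℝ) - 1)⁻¹) * (ρ ^ (1 / 4 : ℝ) - 1) + (ρ⁻¹ ^ (1 / 4 : ℝ) - 1)))
      else ENNReal.ofReal (1 + ((k : ℝ) - 1)⁻¹ * (ρ ^ (1 / 4 : ℝ) - 1)) := by
    intro u
    split_ifs with hu
    · rw [markAverage_wrong_core (by omega) a Z he (by rwa [hcore w hw]) hw, hcore w hw]
    · rw [markAverage_right (by omega) a Z he (by rwa [hcore w hw]), hcore w hw]
  simp_rw [e1]
  have hA : 0 ≤ 1 + ((k : ℝ) - 1)⁻¹ *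
        ((1 - ((k : ℝ) - 1)⁻¹) * (ρ ^ (1 / 4 : ℝ) - 1) + (ρ⁻¹ ^ (1 / 4 : ℝ) - 1)) := by
    have h3 : 0 ≤ ((k : ℝ) - 1)⁻¹ * ((1 - ((k : ℝ) - 1)⁻¹) * ρ ^ (1 / 4 : ℝ)) :=
      mul_nonneg hi0.le (mul_nonneg (by linarith) hlr)
    have h4 := mul_nonneg hi0.le hlr'
    nlinarith
  have hB : 0 ≤ 1 + ((k : ℝ) - 1)⁻¹ * (ρ ^ (1 / 4 : ℝ) - 1) := by
    have := mul_nonneg hi0.le hlr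
    linarith
  rw [lintegral_unifI_ite hz.le hz1, ← ENNReal.ofReal_mul (by linarith),
    ← ENNReal.ofReal_mul hz.le, ← ENNReal.ofReal_add (mul_nonneg (by linarith) hB) (by positivity),
    ← ENNReal.ofReal_add (by linarith) (by positivity)]
  refine ENNReal.ofReal_le_ofReal ?_
  have := mul_le_mul_of_nonneg_left hU hi0.le
  linarith

theorem measurable_ratioBound_rpow (a : ℝ) {Z : ℝ → ℝ} (hZ : Measurable Z) (e : Fin k) :
    Measurable fun m : Mark k => ENNReal.ofReal (ratioBound a Z e m ^ (1 / 4 : ℝ)) :=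
  ((measurable_ratioBound a hZ e).pow_const _).ennreal_ofReal

theorem unifI_Iio {a : ℝ} (ha1 : a ≤ 1) : unifI (Set.Iio a) = ENNReal.ofReal a := by
  have : Set.Iio a ∩ Set.Icc 0 1 = Set.Ico 0 a := by
    ext x; constructor
    · exact fun h => ⟨h.2.1, h.1⟩
    · exact fun h => ⟨h.2, h.1, h.2.le.trans ha1⟩
  rw [unifI, Measure.restrict_apply measurableSet_Iio, this, Real.volume_Ico, sub_zero]

theorem unifI_Ici {a : ℝ} (ha0 : 0 ≤ a) (ha1 : a ≤ 1) : unifI (Set.Ici a) = ENNReal.ofReal (1 - a) := by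
  have : Set.Ici a = (Set.Iio a)ᶜ := by simp
  rw [this, prob_compl_eq_one_sub measurableSet_Iio, unifI_Iio ha1,
    ENNReal.ofReal_sub _ ha0, ENNReal.ofReal_one]

include hk ha0 ha1 hZ h0 h1 in
-- An offspring of uninvolved colour contributes one, hence the base `1 - 1 / (k - 1)`. The rest is
-- `1 / (k - 1)` times the tail moment `3 * I` and the core moment `U₀ * (1 - a)`.
theorem lintegral_ratioBound_le {z₀ U₀ I : ℝ} (hI0 : 0 ≤ I)
    (hI : ∫⁻ w in Set.Iio a, ENNReal.ofReal (tailWeight (Z w)) ∂unifI ≤ ENNReal.ofReal I)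
    (hcore : ∀ w, a ≤ w → Z w = z₀)
    (hU : (1 - z₀) * (likelihood k z₀ ^ (1 / 4 : ℝ) - 1) +
      z₀ * ((1 - ((k : ℝ) - 1)⁻¹) * (likelihood k z₀ ^ (1 / 4 : ℝ) - 1) +
        ((likelihood k z₀)⁻¹ ^ (1 / 4 : ℝ) - 1)) ≤ U₀ - 1)
    (hU0 : 0 ≤ U₀) {e : Fin k} (he : e ≠ 0) :
    ∫⁻ m, ENNReal.ofReal (ratioBound a Z e m ^ (1 / 4 : ℝ)) ∂(markLaw k) ≤
      ENNReal.ofReal (1 + ((k : ℝ) - 1)⁻¹ * (-1 + 3 * I + U₀ * (1 - a))) := by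
  have hk' : (4 : ℝ) ≤ k := by exact_mod_cast hk
  have hκ : (0 : ℝ) < (k : ℝ) - 1 := by linarith
  have hi : ((k : ℝ) - 1)⁻¹ ≤ 1 / 3 := by
    rw [inv_le_comm₀ hκ (by norm_num)]; linarith
  have hi0 : 0 < ((k : ℝ) - 1)⁻¹ := by positivity
  have hmt : Measurable fun w => ENNReal.ofReal (tailWeight (Z w)) := by
    unfold tailWeight; fun_prop
  rw [lintegral_markLaw _ (measurable_ratioBound_rpow a hZ e)]
  calc _ ≤ ∫⁻ w, (ENNReal.ofReal (1 - ((k : ℝ) - 1)⁻¹) +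
        ((Set.Iio a).indicator (fun w => ENNReal.ofReal (3 * ((k : ℝ) - 1)⁻¹) *
          ENNReal.ofReal (tailWeight (Z w))) w +
          (Set.Ici a).indicator (fun _ => ENNReal.ofReal (((k : ℝ) - 1)⁻¹ * U₀)) w)) ∂unifI := by
        refine lintegral_mono fun w => ?_
        simp_rw [ofReal_markAverage (k := k) (by omega) (f := fun z h =>
          ratioBound a Z e (z, w, _, h) ^ (1 / 4 : ℝ)) (fun z h =>
          Real.rpow_nonneg (ratioBound_pos (by omega) a h0 h1 e _).le _)]
        rcases lt_or_ge w a with hw | hw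
        · rw [Set.indicator_of_mem (by exact hw), Set.indicator_of_notMem (by simpa using hw),
            add_zero]
          exact lintegral_markAverage_tail hk h0 h1 he hw
        · rw [Set.indicator_of_notMem (by simpa using hw), Set.indicator_of_mem (by exact hw),
            zero_add]
          exact lintegral_markAverage_core hk h0 h1 hcore hU hU0 he hw
    _ = ENNReal.ofReal (1 - ((k : ℝ) - 1)⁻¹) + (ENNReal.ofReal (3 * ((k : ℝ) - 1)⁻¹) *
          (∫⁻ w in Set.Iio a, ENNReal.ofReal (tailWeight (Z w)) ∂unifI) +
          ENNReal.ofReal (((k : ℝ) - 1)⁻¹ * U₀) * ENNReal.ofReal (1 - a)) := by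
        rw [lintegral_add_left measurable_const, lintegral_const, measure_univ, mul_one,
          lintegral_add_left ((hmt.const_mul _).indicator measurableSet_Iio),
          lintegral_indicator measurableSet_Iio, lintegral_const_mul _ hmt,
          lintegral_indicator measurableSet_Ici, setLIntegral_const, unifI_Ici ha0 ha1]
    _ ≤ ENNReal.ofReal (1 - ((k : ℝ) - 1)⁻¹) + (ENNReal.ofReal (3 * ((k : ℝ) - 1)⁻¹) *
          ENNReal.ofReal I + ENNReal.ofReal (((k : ℝ) - 1)⁻¹ * U₀) * ENNReal.ofReal (1 - a)) := by
        gcongr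
    _ = _ := by
        have : 0 ≤ 1 - a := by linarith
        rw [← ENNReal.ofReal_mul (by positivity), ← ENNReal.ofReal_mul (by positivity),
          ← ENNReal.ofReal_add (by positivity) (by positivity),
          ← ENNReal.ofReal_add (by linarith) (by positivity)]
        congr 1
        ring

include hk hZ h0 h1 in
theorem setLIntegral_tailMarks_ratioBound_le {I : ℝ}
    (hI : ∫⁻ w in Set.Iio a, ENNReal.ofReal (tailWeight (Z w)) ∂unifI ≤ ENNReal.ofReal I)
    {e : Fin k} (he : e ≠ 0) :
    ∫⁻ m in tailMarks a e, ENNReal.ofReal (ratioBound a Z e m ^ (1 / 4 : ℝ)) ∂(markLaw k) ≤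
      ENNReal.ofReal (((k : ℝ) - 1)⁻¹ * (1 + 4 * ((k : ℝ) - 1)⁻¹) * I) := by
  have hk' : (4 : ℝ) ≤ k := by exact_mod_cast hk
  have hκ : (0 : ℝ) < (k : ℝ) - 1 := by linarith
  have hi0 : 0 < ((k : ℝ) - 1)⁻¹ := by positivity
  have hmt : Measurable fun w => ENNReal.ofReal (tailWeight (Z w)) := by
    unfold tailWeight; fun_prop
  have hind : ∀ z w u h, (tailMarks a e).indicator (fun m : Mark k =>
      ENNReal.ofReal (ratioBound a Z e m ^ (1 / 4 : ℝ))) (z, w, u, h) =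
      if w < a then ENNReal.ofReal
        (if z = e then ratioBound a Z e (z, w, u, h) ^ (1 / 4 : ℝ) else 0) else 0 := by
    intro z w u h
    by_cases hw : w < a
    · by_cases hz : z = e
      · rw [Set.indicator_of_mem (show ((z, w, u, h) : Mark k) ∈ tailMarks a e from ⟨hz, hw⟩),
          if_pos hw, if_pos hz]
      · rw [Set.indicator_of_notMem (fun hh => hz hh.1), if_pos hw, if_neg hz, ENNReal.ofReal_zero]
    · rw [Set.indicator_of_notMem (fun hh => hw hh.2), if_neg hw]
  rw [← lintegral_indicator (measurableSet_tailMarks a e), lintegral_markLaw _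
    ((measurable_ratioBound_rpow a hZ e).indicator (measurableSet_tailMarks a e))]
  simp_rw [hind]
  calc _ ≤ ∫⁻ w, (Set.Iio a).indicator (fun w => ENNReal.ofReal (((k : ℝ) - 1)⁻¹ *
        (1 + 4 * ((k : ℝ) - 1)⁻¹)) * ENNReal.ofReal (tailWeight (Z w))) w ∂unifI := by
        refine lintegral_mono fun w => ?_
        rcases lt_or_ge w a with hw | hw
        · have hav := fun u => ofReal_markAverage (k := k) (by omega) (f := fun z h =>
            if z = e then ratioBound a Z e (z, w, u, h) ^ (1 / 4 : ℝ) else 0) (fun z h => by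
              split_ifs
              exacts [Real.rpow_nonneg (ratioBound_pos (by omega) a h0 h1 e _).le _, le_rfl])
          simp only [if_pos hw, hav]
          rw [Set.indicator_of_mem (by exact hw)]
          exact lintegral_markAverage_tailMarks hk h0 h1 he hw
        · simp [if_neg (not_lt.2 hw)]
    _ = ENNReal.ofReal (((k : ℝ) - 1)⁻¹ * (1 + 4 * ((k : ℝ) - 1)⁻¹)) *
          (∫⁻ w in Set.Iio a, ENNReal.ofReal (tailWeight (Z w)) ∂unifI) := by
        rw [lintegral_indicator measurableSet_Iio, lintegral_const_mul _ hmt]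
    _ ≤ _ := by
        rw [ENNReal.ofReal_mul (p := ((k : ℝ) - 1)⁻¹ * (1 + 4 * ((k : ℝ) - 1)⁻¹)) (by positivity)]
        gcongr

end Moments

end TreeColouring
end
noncomputable section
namespace TreeColouring

/-! ### Probability estimates for the recursion -/

section AvoidingMarks

variable {M : Type*} [MeasurableSpace M]

/-- Avoiding `B` replaces each factor by its restriction to the complement of `B`, and the
generating function applies again. -/
theorem setLIntegral_poissonSample_forall_notMem_le (d : ℝ≥0) (ϖ : Measure M)
    [IsProbabilityMeasure ϖ] {f : M → ℝ≥0∞} (hf : Measurable f) {B : Set M}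
    (hB : MeasurableSet B) {x : ℝ} (hx : 0 ≤ 1 + x)
    (h : ∫⁻ m in Bᶜ, f m ∂ϖ ≤ ENNReal.ofReal (1 + x)) :
    ∫⁻ v in {v : Σ b : ℕ, Fin b → M | ∀ i, v.2 i ∉ B}, ∏ i, f (v.2 i) ∂(poissonSample d ϖ) ≤
      ENNReal.ofReal (Real.exp (d * x)) := by
  have hms : MeasurableSet {v : Σ b : ℕ, Fin b → M | ∀ i, v.2 i ∉ B} := by
    have := (measurableSet_exists_mark hB).compl
    refine this.congr ?_
    ext; simp
  rw [← lintegral_indicator hB.compl] at h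
  refine le_trans ?_ (lintegral_poissonSample_prod_le d ϖ (hf.indicator hB.compl) hx h)
  rw [← lintegral_indicator hms]
  refine lintegral_mono fun v => ?_
  by_cases hv : ∀ i, v.2 i ∉ B
  · rw [Set.indicator_of_mem (by exact hv)]
    refine le_of_eq (Finset.prod_congr rfl fun i _ => ?_)
    rw [Set.indicator_of_mem (by exact hv i)]
  · rw [Set.indicator_of_notMem (by exact hv)]
    exact zero_le

theorem poissonSample_forall_notMem_le (d : ℝ≥0) (ϖ : Measure M)
    [IsProbabilityMeasure ϖ] {B : Set M} (hB : MeasurableSet B) {x : ℝ} (hx0 : 0 ≤ x)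
    (hx : x ≤ 1) (h : ϖ B = ENNReal.ofReal x) :
    poissonSample d ϖ {v : Σ b : ℕ, Fin b → M | ∀ i, v.2 i ∉ B} ≤
      ENNReal.ofReal (Real.exp (-(d * x))) := by
  have := setLIntegral_poissonSample_forall_notMem_le d ϖ (f := fun _ => 1) measurable_const hB
    (x := -x) (by linarith) (by
      rw [setLIntegral_one, prob_compl_eq_one_sub hB, h, ← ENNReal.ofReal_one,
        ← ENNReal.ofReal_sub _ hx0]
      rfl)
  simpa [mul_neg] using this

end AvoidingMarks

/-! ### Probability of rivals and moments of the weights of wrong colours -/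

section Estimates

variable {k : ℕ} [NeZero k] (hk : 4 ≤ k) {a : ℝ} (ha0 : 0 ≤ a) (ha1 : a ≤ 1)

include hk ha1 in
theorem markLaw_tailMarks {e : Fin k} (he : e ≠ 0) :
    markLaw k (tailMarks a e) = ENNReal.ofReal (((k : ℝ) - 1)⁻¹ * a) := by
  have hk' : (4 : ℝ) ≤ k := by exact_mod_cast hk
  have := isProbabilityMeasure_nonzeroUnif (k := k) (by omega)
  have hset : tailMarks a e = ({e} : Set (Fin k)) ×ˢ (Set.Iio a ×ˢ (Set.univ : Set (ℝ × Fin k))) := by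
    ext m; simp [tailMarks]
  have hn : nonzeroUnif k {e} = ENNReal.ofReal ((k : ℝ) - 1)⁻¹ := by
    rw [← lintegral_indicator_one (measurableSet_singleton e), lintegral_nonzeroUnif,
      ENNReal.ofReal_inv_of_pos (by linarith)]
    have : ∑ x ∈ Finset.univ.erase 0, ({e} : Set (Fin k)).indicator (1 : Fin k → ℝ≥0∞) x = 1 := by
      rw [Finset.sum_eq_single e]
      · simp
      · intro b _ hb; simp [hb]
      · intro h; simp [he] at h
    rw [this, mul_one]
    congr 1
    rw [← ENNReal.ofReal_natCast, Nat.cast_sub (by omega), Nat.cast_one]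
  rw [hset, markLaw, Measure.prod_prod, Measure.prod_prod, measure_univ, mul_one, unifI_Iio ha1, hn,
    ENNReal.ofReal_mul (by have : (0:ℝ) < (k : ℝ) - 1 := by linarith
                           positivity)]

omit [NeZero k] in
theorem allCore_iff (a : ℝ) (e : Fin k) (v : Σ b : ℕ, Fin b → Mark k) :
    AllCore a e v ↔ ∀ i, v.2 i ∉ tailMarks a e := by
  rw [← not_iff_not, not_allCore_iff]; simp

include hk ha0 ha1 in
theorem poissonSample_allCore_le (d : ℝ≥0) {e : Fin k} (he : e ≠ 0) :
    poissonSample d (markLaw k) {v | AllCore a e v} ≤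
      ENNReal.ofReal (Real.exp (-(d * (((k : ℝ) - 1)⁻¹ * a)))) := by
  have hk' : (4 : ℝ) ≤ k := by exact_mod_cast hk
  have hi : ((k : ℝ) - 1)⁻¹ ≤ 1 / 3 := by
    rw [inv_le_comm₀ (by linarith) (by norm_num)]; linarith
  have hi0 : 0 < ((k : ℝ) - 1)⁻¹ := inv_pos.2 (by linarith)
  have := isProbabilityMeasure_markLaw (k := k) (by omega)
  have h := poissonSample_forall_notMem_le d (markLaw k) (measurableSet_tailMarks a e)
    (by positivity) (by nlinarith) (markLaw_tailMarks hk ha1 he)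
  simpa only [allCore_iff] using h

include hk ha0 ha1 in
-- Tail marks of two colours are disjoint sets of marks, so the events of avoiding them are
-- independent under the Poisson law and the bounds multiply.
theorem poissonSample_allCore_allCore_le (d : ℝ≥0) {e e' : Fin k} (he : e ≠ 0) (he' : e' ≠ 0)
    (hne : e ≠ e') :
    poissonSample d (markLaw k) {v | AllCore a e v ∧ AllCore a e' v} ≤
      ENNReal.ofReal (Real.exp (-(d * (((k : ℝ) - 1)⁻¹ * a)))) ^ 2 := by
  have hk' : (4 : ℝ) ≤ k := by exact_mod_cast hk
  have hi : ((k : ℝ) - 1)⁻¹ ≤ 1 / 3 := by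
    rw [inv_le_comm₀ (by linarith) (by norm_num)]; linarith
  have hi0 : 0 < ((k : ℝ) - 1)⁻¹ := inv_pos.2 (by linarith)
  have := isProbabilityMeasure_markLaw (k := k) (by omega)
  have hd : Disjoint (tailMarks a e) (tailMarks a e') :=
    Set.disjoint_left.2 fun m hm hm' => hne (hm.1.symm.trans hm'.1)
  have h := poissonSample_forall_notMem_le d (markLaw k)
    ((measurableSet_tailMarks a e).union (measurableSet_tailMarks a e'))
    (x := ((k : ℝ) - 1)⁻¹ * a + ((k : ℝ) - 1)⁻¹ * a)
    (by positivity) (by nlinarith) (by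
      rw [measure_union hd (measurableSet_tailMarks a e'), markLaw_tailMarks hk ha1 he,
        markLaw_tailMarks hk ha1 he', ENNReal.ofReal_add (by positivity) (by positivity)])
  rw [← ENNReal.ofReal_pow (Real.exp_pos _).le, ← Real.exp_nat_mul]
  convert h using 3
  · simp only [allCore_iff, Set.mem_union, not_or, forall_and]
  · push_cast; ring_nf

variable {Z : ℝ → ℝ} (hZ : Measurable Z) (h0 : ∀ w, 0 < Z w)
  (h1 : ∀ w, Z w ≤ 1 - 1 / (k : ℝ))

theorem ofReal_weightBound_rpow (hk : 2 ≤ k) (h0 : ∀ w, 0 < Z w)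
    (h1 : ∀ w, Z w ≤ 1 - 1 / (k : ℝ)) (e : Fin k) (v : Σ b : ℕ, Fin b → Mark k) :
    ENNReal.ofReal (weightBound a Z e v ^ (1 / 4 : ℝ)) =
      ∏ i, ENNReal.ofReal (ratioBound a Z e (v.2 i) ^ (1 / 4 : ℝ)) := by
  have hp := fun i => (ratioBound_pos hk a h0 h1 e (v.2 i))
  rw [← ENNReal.ofReal_prod_of_nonneg fun i _ => Real.rpow_nonneg (hp i).le _, weightBound,
    Real.finsetProd_rpow _ _ fun i _ => (hp i).le]

/-- A bound for the exponential rate at which the moments of the weights decay. -/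
def MomentBound (k : ℕ) [NeZero k] (a : ℝ) (Z : ℝ → ℝ) (x : ℝ) : Prop :=
  ∀ e : Fin k, e ≠ 0 → ∫⁻ m, ENNReal.ofReal (ratioBound a Z e m ^ (1 / 4 : ℝ)) ∂(markLaw k) ≤
    ENNReal.ofReal (1 + ((k : ℝ) - 1)⁻¹ * x)

variable {x : ℝ} (hx : -1 ≤ x) (hmom : MomentBound k a Z x)

include hk hZ h0 h1 hx hmom in
-- The Mecke-type bound for the tail marks of colour `e`: one such mark contributes `d * H`, the
-- rest of the sample the moment of the full weight.
theorem lintegral_weightBound_not_allCore_le (d : ℝ≥0) {H : ℝ} {e : Fin k} (he : e ≠ 0)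
    (hH : ∫⁻ m in tailMarks a e, ENNReal.ofReal (ratioBound a Z e m ^ (1 / 4 : ℝ)) ∂(markLaw k) ≤
      ENNReal.ofReal H) :
    ∫⁻ v in {v | ¬ AllCore a e v}, ENNReal.ofReal (weightBound a Z e v ^ (1 / 4 : ℝ))
      ∂(poissonSample d (markLaw k)) ≤
      ENNReal.ofReal (d * H * Real.exp (d * (((k : ℝ) - 1)⁻¹ * x))) := by
  have hk' : (4 : ℝ) ≤ k := by exact_mod_cast hk
  have hi : ((k : ℝ) - 1)⁻¹ ≤ 1 / 3 := by
    rw [inv_le_comm₀ (by linarith) (by norm_num)]; linarith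
  have hi0 : 0 < ((k : ℝ) - 1)⁻¹ := inv_pos.2 (by linarith)
  have := isProbabilityMeasure_markLaw (k := k) (by omega)
  have h := lintegral_poissonSample_prod_indicator_le d (markLaw k)
    (measurable_ratioBound_rpow a hZ e) (measurableSet_tailMarks a e) (by nlinarith)
    (hmom e he) hH
  rw [ENNReal.ofReal_mul' (Real.exp_pos _).le, ENNReal.ofReal_mul (by positivity),
    ENNReal.ofReal_coe_nnreal]
  refine le_trans (le_of_eq ?_) h
  have hms : MeasurableSet {v : Σ b : ℕ, Fin b → Mark k | ¬ AllCore a e v} :=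
    (measurableSet_allCore a e).compl
  rw [← lintegral_indicator hms]
  refine lintegral_congr fun v => ?_
  simp_rw [ofReal_weightBound_rpow (by omega : 2 ≤ k) h0 h1, not_allCore_iff]
  by_cases hv : ∃ i, v.2 i ∈ tailMarks a e
  · rw [Set.indicator_of_mem (by exact hv), Set.indicator_of_mem (by exact hv)]; simp
  · rw [Set.indicator_of_notMem (by exact hv), Set.indicator_of_notMem (by exact hv)]; simp

/-- A right guess for a colour other than `e` says nothing about `e`, and a wrong guess in the tail
was relaxed to a factor at least one. Forbidding such marks therefore lowers the moment of the
weight of `e` by at least their mass. -/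
theorem one_le_ratioBound_of_mem_tailMarks (h1 : ∀ w, Z w ≤ 1 - 1 / (k : ℝ)) {e e₁ : Fin k}
    (hne : e ≠ e₁) {m : Mark k} (hm : m ∈ tailMarks a e₁) : 1 ≤ ratioBound a Z e m := by
  unfold ratioBound
  split_ifs with h2 h3 h4 h5 h6 h7
  · exact absurd hm.2 (not_lt.2 h3)
  · exact absurd hm.2 (not_lt.2 h3)
  · exact absurd hm.2 (not_lt.2 h3)
  · refine (one_le_inv₀ h2.1).2 (h2.2.le.trans ((h1 _).trans ?_))
    have : 0 ≤ 1 / (k : ℝ) := by positivity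
    linarith
  · exact le_rfl
  · exact absurd (h7.symm.trans hm.1) hne
  · exact le_rfl

include hk ha0 ha1 hZ h0 h1 hx hmom in
-- Excluding the tail marks of `e₁` removes at least mass `a / (k - 1)` from the single-mark
-- integral, hence `a` from the rate `x`. The presence of a rival and the weight of another colour
-- thus decouple up to constants.
theorem setLIntegral_allCore_weightBound_le (d : ℝ≥0) {e e₁ : Fin k} (he : e ≠ 0) (he₁ : e₁ ≠ 0)
    (hne : e ≠ e₁) :
    ∫⁻ v in {v | AllCore a e₁ v}, ENNReal.ofReal (weightBound a Z e v ^ (1 / 4 : ℝ))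
      ∂(poissonSample d (markLaw k)) ≤
      ENNReal.ofReal (Real.exp (d * (((k : ℝ) - 1)⁻¹ * (x - a)))) := by
  have hk' : (4 : ℝ) ≤ k := by exact_mod_cast hk
  have hi : ((k : ℝ) - 1)⁻¹ ≤ 1 / 3 := by
    rw [inv_le_comm₀ (by linarith) (by norm_num)]; linarith
  have hi0 : 0 < ((k : ℝ) - 1)⁻¹ := inv_pos.2 (by linarith)
  have := isProbabilityMeasure_markLaw (k := k) (by omega)
  have h := setLIntegral_poissonSample_forall_notMem_le d (markLaw k)
    (measurable_ratioBound_rpow a hZ e) (measurableSet_tailMarks a e₁)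
    (x := ((k : ℝ) - 1)⁻¹ * (x - a)) (by nlinarith) ?_
  · simp_rw [ofReal_weightBound_rpow (by omega : 2 ≤ k) h0 h1, allCore_iff]
    exact h
  have hB : ENNReal.ofReal (((k : ℝ) - 1)⁻¹ * a) ≤
      ∫⁻ m in tailMarks a e₁, ENNReal.ofReal (ratioBound a Z e m ^ (1 / 4 : ℝ)) ∂(markLaw k) := by
    rw [← markLaw_tailMarks hk ha1 he₁, ← setLIntegral_one]
    refine setLIntegral_mono (measurable_ratioBound_rpow a hZ e) fun m hm => ?_
    rw [ENNReal.one_le_ofReal]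
    exact Real.one_le_rpow (one_le_ratioBound_of_mem_tailMarks h1 hne hm) (by norm_num)
  rw [show 1 + ((k : ℝ) - 1)⁻¹ * (x - a) = 1 + ((k : ℝ) - 1)⁻¹ * x - ((k : ℝ) - 1)⁻¹ * a by ring,
    ENNReal.ofReal_sub _ (by positivity)]
  refine ENNReal.le_sub_of_add_le_right ENNReal.ofReal_ne_top ((add_le_add_right hB _).trans ?_)
  rw [add_comm, lintegral_add_compl _ (measurableSet_tailMarks a e₁)]
  exact hmom e he

end Estimates

end TreeColouring
end
noncomputable section
namespace TreeColouring

/-! ### The lower tail of the largest entry of the posterior -/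

section NormBound

variable {k : ℕ} [NeZero k] (hk : 4 ≤ k) {a : ℝ} (ha0 : 0 ≤ a) (ha1 : a ≤ 1)
  {Z : ℝ → ℝ} (hZ : Measurable Z) (h0 : ∀ w, 0 < Z w) (h1 : ∀ w, Z w ≤ 1 - 1 / (k : ℝ))
  {x : ℝ} (hx : -1 ≤ x) (hmom : MomentBound k a Z x)

theorem ofReal_natCast_sub_one (k : ℕ) [NeZero k] :
    ((k - 1 : ℕ) : ℝ≥0∞) = ENNReal.ofReal ((k : ℝ) - 1) := by
  rw [← ENNReal.ofReal_natCast, Nat.cast_sub NeZero.one_le, Nat.cast_one]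

theorem sub_one_nonneg (k : ℕ) [NeZero k] : (0 : ℝ) ≤ (k : ℝ) - 1 := by
  have : (1 : ℝ) ≤ k := by exact_mod_cast (NeZero.one_le : 1 ≤ k)
  linarith

theorem measure_biUnion_erase_le {α : Type*} [MeasurableSpace α] (P : Measure α)
    (E : Fin k → Set α) {b : ℝ} (h : ∀ e, e ≠ 0 → P (E e) ≤ ENNReal.ofReal b) :
    P (⋃ e ∈ Finset.univ.erase (0 : Fin k), E e) ≤ ENNReal.ofReal (((k : ℝ) - 1) * b) := by
  refine (measure_biUnion_finset_le _ _).trans ?_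
  refine (Finset.sum_le_card_nsmul _ _ _ fun e he => h e (Finset.ne_of_mem_erase he)).trans ?_
  rw [Finset.card_erase_of_mem (Finset.mem_univ _), Finset.card_univ, Fintype.card_fin,
    nsmul_eq_mul, ofReal_natCast_sub_one, ENNReal.ofReal_mul (sub_one_nonneg k)]

include hk ha0 ha1 in
theorem poissonSample_exists_allCore_le (d : ℝ≥0) :
    poissonSample d (markLaw k) (⋃ e ∈ Finset.univ.erase (0 : Fin k), {v | AllCore a e v}) ≤
      ENNReal.ofReal (((k : ℝ) - 1) * Real.exp (-(d * (((k : ℝ) - 1)⁻¹ * a)))) :=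
  measure_biUnion_erase_le _ _ fun _ he => poissonSample_allCore_le hk ha0 ha1 d he

include hk ha0 ha1 in
theorem poissonSample_two_allCore_le (d : ℝ≥0) :
    poissonSample d (markLaw k) (⋃ e ∈ Finset.univ.erase (0 : Fin k),
      ⋃ e' ∈ Finset.univ.erase (0 : Fin k), {v | e ≠ e' ∧ AllCore a e v ∧ AllCore a e' v}) ≤
      ENNReal.ofReal ((((k : ℝ) - 1) * Real.exp (-(d * (((k : ℝ) - 1)⁻¹ * a)))) ^ 2) := by
  refine (measure_biUnion_erase_le _ _ fun e he => measure_biUnion_erase_le _ _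
    (b := Real.exp (-(d * (((k : ℝ) - 1)⁻¹ * a))) ^ 2) fun e' he' => ?_).trans (le_of_eq ?_)
  · by_cases hne : e = e'
    · simp [hne]
    · simp only [ne_eq, hne, not_false_eq_true, true_and]
      rw [ENNReal.ofReal_pow (Real.exp_pos _).le]
      exact poissonSample_allCore_allCore_le hk ha0 ha1 d he he' hne
  · congr 1; ring

include hk ha0 ha1 hZ h0 h1 hx hmom in
-- Markov's inequality for the quarter power of the remaining weights on the event that `e₁` is a
-- rival, then a union bound over `e₁`. The product form shows that the two atypical events are
-- nearly independent.
theorem poissonSample_allCore_inter_le (d : ℝ≥0) :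
    poissonSample d (markLaw k) (⋃ e₁ ∈ Finset.univ.erase (0 : Fin k),
      {v | AllCore a e₁ v ∧ 1 / 100 < tailSum a Z v}) ≤
      ENNReal.ofReal (4 * (((k : ℝ) - 1) * Real.exp (-(d * (((k : ℝ) - 1)⁻¹ * a)))) *
        (((k : ℝ) - 1) * Real.exp (d * (((k : ℝ) - 1)⁻¹ * x)))) := by
  classical
  refine (measure_biUnion_erase_le _ _
    (b := 4 * (((k : ℝ) - 1) * Real.exp (d * (((k : ℝ) - 1)⁻¹ * (x - a))))) fun e₁ he₁ => ?_).trans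
      (le_of_eq ?_)
  swap
  · congr 1
    rw [show (d : ℝ) * (((k : ℝ) - 1)⁻¹ * (x - a)) =
      -(d * (((k : ℝ) - 1)⁻¹ * a)) + d * (((k : ℝ) - 1)⁻¹ * x) by ring, Real.exp_add]
    ring
  set P := poissonSample d (markLaw k)
  have hpos := weightBound_pos (k := k) (by omega) a h0 h1
  have hmw : ∀ e : Fin k, Measurable fun v => ENNReal.ofReal (weightBound a Z e v ^ (1 / 4 : ℝ)) :=
    fun e => ((measurable_weightBound a hZ e).pow_const _).ennreal_ofReal
  let F : (Σ b : ℕ, Fin b → Mark k) → ℝ≥0∞ := fun v =>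
    ∑ e ∈ (Finset.univ.erase (0 : Fin k)).erase e₁, ENNReal.ofReal (weightBound a Z e v ^ (1 / 4 : ℝ))
  have hF : Measurable F := Finset.measurable_fun_sum _ fun e _ => hmw e
  have hle : ∀ v, AllCore a e₁ v → 1 / 100 < tailSum a Z v → 1 ≤ 4 * F v := by
    intro v hv hT
    have hT2 : tailSum a Z v ≤
        ∑ e ∈ (Finset.univ.erase (0 : Fin k)).erase e₁, weightBound a Z e v := by
      rw [tailSum, ← Finset.add_sum_erase _ _ (Finset.mem_erase.2 ⟨he₁, Finset.mem_univ e₁⟩),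
        if_pos hv, zero_add]
      refine Finset.sum_le_sum fun e _ => ?_
      split_ifs
      exacts [(hpos e v).le, le_rfl]
    have hsum : (∑ e ∈ (Finset.univ.erase (0 : Fin k)).erase e₁, weightBound a Z e v) ^ (1 / 4 : ℝ)
        ≤ ∑ e ∈ (Finset.univ.erase (0 : Fin k)).erase e₁, weightBound a Z e v ^ (1 / 4 : ℝ) :=
      Finset.le_sum_of_subadditive_on_pred (fun x : ℝ => x ^ (1 / 4 : ℝ)) (fun x => 0 ≤ x)
        (by norm_num) (fun x y hx hy => Real.rpow_add_le_add_rpow hx hy (by norm_num) (by norm_num))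
        (fun x y hx hy => add_nonneg hx hy) _ fun e _ => (hpos e v).le
    -- The factor `4` comes from `(1 / 4) ^ 4 = 1 / 256 ≤ 1 / 100`.
    have h100 : (1 / 4 : ℝ) ≤ (1 / 100 : ℝ) ^ (1 / 4 : ℝ) := by
      calc (1 / 4 : ℝ) = ((1 / 4 : ℝ) ^ (4 : ℕ)) ^ (1 / 4 : ℝ) := by
            rw [← Real.rpow_natCast, ← Real.rpow_mul (by norm_num)]; norm_num
        _ ≤ _ := Real.rpow_le_rpow (by norm_num) (by norm_num) (by norm_num)
    have h3 : (1 / 100 : ℝ) ^ (1 / 4 : ℝ) ≤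
        (∑ e ∈ (Finset.univ.erase (0 : Fin k)).erase e₁, weightBound a Z e v) ^ (1 / 4 : ℝ) :=
      Real.rpow_le_rpow (by norm_num) (hT.le.trans hT2) (by norm_num)
    simp only [F]
    rw [← ENNReal.ofReal_sum_of_nonneg fun e _ => Real.rpow_nonneg (hpos e v).le _,
      show (4 : ℝ≥0∞) = ENNReal.ofReal 4 by simp, ← ENNReal.ofReal_mul (by norm_num),
      ENNReal.one_le_ofReal]
    linarith
  have hms : MeasurableSet {v : Σ b : ℕ, Fin b → Mark k | AllCore a e₁ v} :=
    measurableSet_allCore a e₁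
  have hms2 : MeasurableSet {v : Σ b : ℕ, Fin b → Mark k |
      AllCore a e₁ v ∧ 1 / 100 < tailSum a Z v} :=
    hms.inter (measurableSet_lt measurable_const (measurable_tailSum a hZ))
  calc P {v | AllCore a e₁ v ∧ 1 / 100 < tailSum a Z v}
      ≤ ∫⁻ v in {v | AllCore a e₁ v}, 4 * F v ∂P := by
        rw [← lintegral_indicator_one hms2, ← lintegral_indicator hms]
        refine lintegral_mono fun v => ?_
        by_cases hv : AllCore a e₁ v ∧ 1 / 100 < tailSum a Z v
        · rw [Set.indicator_of_mem (by exact hv), Set.indicator_of_mem (by exact hv.1)]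
          exact hle v hv.1 hv.2
        · rw [Set.indicator_of_notMem (by exact hv)]; exact zero_le
    _ = 4 * ∑ e ∈ (Finset.univ.erase (0 : Fin k)).erase e₁, ∫⁻ v in {v | AllCore a e₁ v},
          ENNReal.ofReal (weightBound a Z e v ^ (1 / 4 : ℝ)) ∂P := by
        rw [lintegral_const_mul _ hF, lintegral_finsetSum _ fun e _ => hmw e]
    _ ≤ 4 * ∑ e ∈ (Finset.univ.erase (0 : Fin k)).erase e₁,
          ENNReal.ofReal (Real.exp (d * (((k : ℝ) - 1)⁻¹ * (x - a)))) := by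
        gcongr with e he
        exact setLIntegral_allCore_weightBound_le hk ha0 ha1 hZ h0 h1 hx hmom d
          (Finset.ne_of_mem_erase (Finset.mem_of_mem_erase he)) he₁ (Finset.ne_of_mem_erase he)
    _ ≤ 4 * ∑ e ∈ (Finset.univ.erase (0 : Fin k)),
          ENNReal.ofReal (Real.exp (d * (((k : ℝ) - 1)⁻¹ * (x - a)))) := by
        gcongr
        exact Finset.erase_subset _ _
    _ = _ := by
        rw [Finset.sum_const, Finset.card_erase_of_mem (Finset.mem_univ _), Finset.card_univ,
          Fintype.card_fin, nsmul_eq_mul, ofReal_natCast_sub_one,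
          ENNReal.ofReal_mul (p := 4) (by norm_num), ENNReal.ofReal_mul (sub_one_nonneg k)]
        simp

include hk in
theorem poissonSample_exists_zero (d : ℝ≥0) :
    poissonSample d (markLaw k) {v | ∃ i, (v.2 i).1 = 0} = 0 := by
  have := isProbabilityMeasure_markLaw (k := k) (by omega)
  have hB : MeasurableSet {m : Mark k | m.1 = 0} := measurable_fst (measurableSet_singleton 0)
  refine poissonSample_exists_mem_eq_zero d (markLaw k) (B := {m | m.1 = 0}) hB ?_
  have hset : {m : Mark k | m.1 = 0} = ({0} : Set (Fin k)) ×ˢ Set.univ := by ext; simp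
  rw [hset, markLaw, Measure.prod_prod, ← lintegral_indicator_one (measurableSet_singleton _),
    lintegral_nonzeroUnif, Finset.sum_eq_zero]
  · simp
  · intro e he
    rw [Set.indicator_of_notMem (by simpa using he)]

include hk ha0 ha1 hZ h0 h1 hx hmom in
-- Three cases. Without a rival the error is at most `T / (1 + T)`. With one rival and `T ≤ 1 / 100`
-- the largest entry is at least `1 / 2.02 > 0.495`, so this event costs something only at error
-- levels below `0.505`. Two rivals, or a rival with `T > 1 / 100`, are charged by their small
-- probabilities.
theorem poissonSample_norm_le (d : ℝ≥0) (l : Fin k) {x₀ ζ : ℝ} (hxζ : x₀ < 1 - ζ) :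
    poissonSample d (markLaw k) {v | ‖sampleVec Z l v‖ ≤ x₀} ≤
      poissonSample d (markLaw k) {v | ζ < tailSum a Z v / (1 + tailSum a Z v)} +
      ENNReal.ofReal ((((k : ℝ) - 1) * Real.exp (-(d * (((k : ℝ) - 1)⁻¹ * a)))) ^ 2 +
        4 * (((k : ℝ) - 1) * Real.exp (-(d * (((k : ℝ) - 1)⁻¹ * a)))) *
        (((k : ℝ) - 1) * Real.exp (d * (((k : ℝ) - 1)⁻¹ * x))) +
        if ζ < 0.505 then ((k : ℝ) - 1) * Real.exp (-(d * (((k : ℝ) - 1)⁻¹ * a))) else 0) := by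
  set P := poissonSample d (markLaw k)
  set B₀ := ((k : ℝ) - 1) * Real.exp (-(d * (((k : ℝ) - 1)⁻¹ * a)))
  set B₁ := ((k : ℝ) - 1) * Real.exp (d * (((k : ℝ) - 1)⁻¹ * x))
  have hB₀ : 0 ≤ B₀ := mul_nonneg (sub_one_nonneg k) (Real.exp_pos _).le
  have hB₁ : 0 ≤ B₁ := mul_nonneg (sub_one_nonneg k) (Real.exp_pos _).le
  -- A rival is charged only below the level `0.505`; above it the mere presence of one rival cannot
  -- cause the error.
  let E : Set (Σ b : ℕ, Fin b → Mark k) :=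
    if ζ < 0.505 then ⋃ e ∈ Finset.univ.erase (0 : Fin k), {v | AllCore a e v} else ∅
  have hE : P E ≤ ENNReal.ofReal (if ζ < 0.505 then B₀ else 0) := by
    simp only [E]
    split_ifs
    · exact poissonSample_exists_allCore_le hk ha0 ha1 d
    · simp
  have hsub : {v : Σ b : ℕ, Fin b → Mark k | ‖sampleVec Z l v‖ ≤ x₀} ⊆
      {v | ζ < tailSum a Z v / (1 + tailSum a Z v)} ∪ (((⋃ e ∈ Finset.univ.erase (0 : Fin k),
        ⋃ e' ∈ Finset.univ.erase (0 : Fin k), {v | e ≠ e' ∧ AllCore a e v ∧ AllCore a e' v}) ∪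
        (⋃ e₁ ∈ Finset.univ.erase (0 : Fin k), {v | AllCore a e₁ v ∧ 1 / 100 < tailSum a Z v})) ∪
        (E ∪ {v | ∃ i, (v.2 i).1 = 0})) := by
    intro v hv
    have hv' : ‖sampleVec Z l v‖ ≤ x₀ := hv
    by_contra hcon
    simp only [Set.mem_union, not_or] at hcon
    obtain ⟨hT, ⟨h2, h3⟩, h4, h5⟩ := hcon
    have hz : ∀ i, (v.2 i).1 ≠ 0 := fun i hi => h5 ⟨i, hi⟩
    have hT0 := tailSum_nonneg (k := k) (by omega) a h0 h1 v
    by_cases hA : ∃ e₁, e₁ ≠ 0 ∧ AllCore a e₁ v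
    · obtain ⟨e₁, he₁, hA⟩ := hA
      have hζ : ¬ ζ < 0.505 := by
        intro hζ
        apply h4
        simp only [E, if_pos hζ, Set.mem_iUnion]
        exact ⟨e₁, Finset.mem_erase.2 ⟨he₁, Finset.mem_univ _⟩, hA⟩
      have hTs : tailSum a Z v ≤ 1 / 100 := by
        by_contra hTs
        apply h3
        simp only [Set.mem_iUnion]
        exact ⟨e₁, Finset.mem_erase.2 ⟨he₁, Finset.mem_univ _⟩, hA, not_le.1 hTs⟩
      have hno : ∀ e, e ≠ 0 → e ≠ e₁ → ¬ AllCore a e v := by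
        intro e he hne hAe
        apply h2
        simp only [Set.mem_iUnion]
        exact ⟨e, Finset.mem_erase.2 ⟨he, Finset.mem_univ _⟩, e₁,
          Finset.mem_erase.2 ⟨he₁, Finset.mem_univ _⟩, hne, hAe, hA⟩
      -- The numbers fit because `1 / (2 * 1.01) > 1 - 0.505`.
      have := one_le_two_mul_norm_sampleVec (by omega) a h0 h1 l v hz he₁ hno
      have hn := norm_nonneg (sampleVec Z l v)
      norm_num at hζ
      nlinarith
    · push Not at hA
      have := one_le_mul_norm_sampleVec (by omega) a h0 h1 l v hz hA
      apply hT
      change ζ < tailSum a Z v / (1 + tailSum a Z v)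
      rw [lt_div_iff₀ (by linarith)]
      nlinarith
  refine (measure_mono hsub).trans ((measure_union_le _ _).trans ?_)
  gcongr
  refine (measure_union_le _ _).trans ?_
  rw [ENNReal.ofReal_add (by positivity) (by split_ifs <;> [exact hB₀; exact le_rfl]),
    ENNReal.ofReal_add (by positivity) (by positivity)]
  refine add_le_add ((measure_union_le _ _).trans (add_le_add
    (poissonSample_two_allCore_le hk ha0 ha1 d)
    (poissonSample_allCore_inter_le hk ha0 ha1 hZ h0 h1 hx hmom d))) ?_
  refine (measure_union_le _ _).trans ?_
  rw [poissonSample_exists_zero hk d, add_zero]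
  exact hE

end NormBound

end TreeColouring
end
noncomputable section
namespace TreeColouring

/-! ### Analysis of the function `tailWeight` -/

section TailWeight

theorem tailWeight_eq' (z : ℝ) :
    tailWeight z = 1 - (1 - z ^ (1 / 4 : ℝ)) * (1 - z) := by
  rw [tailWeight]; ring

theorem tailWeight_le_one {z : ℝ} (h0 : 0 ≤ z) (h1 : z ≤ 1) : tailWeight z ≤ 1 := by
  rw [tailWeight_eq' z]
  have : z ^ (1 / 4 : ℝ) ≤ 1 := Real.rpow_le_one h0 h1 (by norm_num)
  nlinarith

theorem tailWeight_mono {z z' : ℝ} (h0 : 0 ≤ z) (h : z ≤ z') (h1 : z' ≤ 1) :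
    tailWeight z ≤ tailWeight z' := by
  rw [tailWeight_eq' z, tailWeight_eq' z']
  have h3 : z ^ (1 / 4 : ℝ) ≤ z' ^ (1 / 4 : ℝ) := Real.rpow_le_rpow h0 h (by norm_num)
  have h4 : z' ^ (1 / 4 : ℝ) ≤ 1 := Real.rpow_le_one (h0.trans h) h1 (by norm_num)
  gcongr; linarith

/-- Sublinear growth, a consequence of concavity at zero; here from `q ^ (1 / 4) ≤ q` and `1 - q * z
≤ 1 - z`. It bounds the loss from rounding up to the next grid point. -/
theorem tailWeight_mul_le {z q : ℝ} (h0 : 0 ≤ z) (hq : 1 ≤ q) (h1 : q * z ≤ 1) :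
    tailWeight (q * z) ≤ q * tailWeight z := by
  have hz : z ≤ q * z := le_mul_of_one_le_left h0 hq
  have hq4 : q ^ (1 / 4 : ℝ) ≤ q := by
    calc q ^ (1 / 4 : ℝ) ≤ q ^ (1 : ℝ) := Real.rpow_le_rpow_of_exponent_le hq (by norm_num)
      _ = q := Real.rpow_one q
  have hv : 0 ≤ z ^ (1 / 4 : ℝ) := Real.rpow_nonneg h0 _
  rw [tailWeight, tailWeight, Real.mul_rpow (by linarith) h0]
  have : (1 - q * z) * (q ^ (1 / 4 : ℝ) * z ^ (1 / 4 : ℝ)) ≤ (1 - z) * (q * z ^ (1 / 4 : ℝ)) := by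
    gcongr
    · linarith
  nlinarith

/-- With `R = T / (1 + T)` and `v = R ^ (1 / 4)` one has `T ^ (1 / 4) ≥ v * (1 + R / 4)` and
`tailWeight R = v * (1 + v ^ 3 - v ^ 4)`. The constant must be close to one, because it multiplies
the contraction factor of the tail recursion. -/
theorem tailWeight_div_le {T : ℝ} (hT : 0 ≤ T) :
    tailWeight (T / (1 + T)) ≤ 1.054 * T ^ (1 / 4 : ℝ) := by
  set R := T / (1 + T) with hR
  have hR0 : 0 ≤ R := by positivity
  have hR1 : R ≤ 1 := by rw [hR, div_le_one (by linarith)]; linarith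
  have hTR : T = R * (1 + T) := by rw [hR]; field_simp
  set v := R ^ (1 / 4 : ℝ) with hv
  have hv0 : 0 ≤ v := Real.rpow_nonneg hR0 _
  have hv4 : v ^ 4 = R := by
    rw [hv, ← Real.rpow_natCast, ← Real.rpow_mul hR0]; norm_num
  -- Here `1 + T = 1 / (1 - R)`, and `(1 - R) * (1 + R / 4) ^ 4 ≤ 1` by expansion.
  have hone : (1 + R / 4) ^ 4 ≤ 1 + T := by
    have h1 : (1 - R) * (1 + T) = 1 := by rw [hR]; field_simp; ring
    have h2 : (1 - R) * (1 + R / 4) ^ 4 ≤ 1 := by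
      have : (1 - R) * (1 + R / 4) ^ 4 =
        1 - (5 / 8 * R ^ 2 + 5 / 16 * R ^ 3 + 15 / 256 * R ^ 4 + 1 / 256 * R ^ 5) := by ring
      rw [this]
      have : 0 ≤ 5 / 8 * R ^ 2 + 5 / 16 * R ^ 3 + 15 / 256 * R ^ 4 + 1 / 256 * R ^ 5 := by positivity
      linarith
    have h3 : (1 + R / 4) ^ 4 * ((1 - R) * (1 + T)) ≤ 1 * (1 + T) := by
      have := mul_le_mul_of_nonneg_right h2 (by linarith : 0 ≤ 1 + T)
      linarith
    rw [h1] at h3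
    linarith
  have hlow : v * (1 + R / 4) ≤ T ^ (1 / 4 : ℝ) := by
    have h4 : (v * (1 + R / 4)) ^ 4 ≤ T := by
      rw [mul_pow, hv4, hTR]
      calc R * (1 + R / 4) ^ 4 ≤ R * (1 + T) := by gcongr
        _ = _ := by rw [← hTR]
    calc v * (1 + R / 4) = ((v * (1 + R / 4)) ^ (4 : ℕ)) ^ (1 / 4 : ℝ) := by
          rw [← Real.rpow_natCast, ← Real.rpow_mul (by positivity)]; norm_num
      _ ≤ _ := Real.rpow_le_rpow (by positivity) h4 (by norm_num)
  -- The coefficient is `1.2635 = 1 + 1.054 / 4`. The left side is largest near `v = 3 / (4 *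
  -- 1.2635) ≈ 0.5936`, with value about `0.0523`.
  have hpoly : v ^ 3 - 1.2635 * v ^ 4 ≤ 0.054 := by
    nlinarith [sq_nonneg (v ^ 2 - 0.3957 * v - 0.1175), sq_nonneg (v - 0.5936)]
  have hphi : tailWeight R = v * (1 + v ^ 3 - v ^ 4) := by
    rw [tailWeight, ← hv]; nth_rw 1 [← hv4]; rw [← hv4]; ring
  rw [hphi]
  calc v * (1 + v ^ 3 - v ^ 4) ≤ v * (1.054 * (1 + v ^ 4 / 4)) := by
        gcongr; linarith
    _ = 1.054 * (v * (1 + R / 4)) := by rw [hv4]; ring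
    _ ≤ _ := by gcongr

/-- A discrete layer-cake formula: the increments at the levels below `R` telescope to `tailWeight`
at the first grid point not below `R`, which exceeds `R` by a factor of at most `1.001`. -/
theorem sum_tailWeight_sub_le {ζ : ℕ → ℝ} (hζ0 : ∀ j, 0 < ζ j) (hζ1 : ∀ j, ζ j ≤ 1)
    (hζ : ∀ j, ζ (j + 1) ≤ 1.001 * ζ j) (hmono : Monotone ζ) {R : ℝ} (hR0 : 0 ≤ R) (hR1 : R ≤ 1)
    (n : ℕ) :
    ∑ j ∈ Finset.range n, (if ζ j < R then tailWeight (ζ (j + 1)) - tailWeight (ζ j) else 0) ≤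
      1.001 * tailWeight R := by
  have hpos := fun j => tailWeight_nonneg (hζ0 j).le (hζ1 j)
  have htel : ∀ n, ∑ j ∈ Finset.range n,
      (if ζ j < R then tailWeight (ζ (j + 1)) - tailWeight (ζ j) else 0) ≤
      tailWeight (ζ n) - tailWeight (ζ 0) := fun n => by
    rw [← Finset.sum_range_sub (fun j => tailWeight (ζ j))]
    refine Finset.sum_le_sum fun j _ => ?_
    split_ifs
    · exact le_rfl
    · exact sub_nonneg.2 (tailWeight_mono (hζ0 j).le (hmono j.le_succ) (hζ1 _))
  induction n with
  | zero => simp; exact mul_nonneg (by norm_num) (tailWeight_nonneg hR0 hR1)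
  | succ n ih =>
    by_cases h : ζ n < R
    · have h1 : tailWeight (ζ (n + 1)) ≤ 1.001 * tailWeight R := by
        by_cases h2 : 1.001 * ζ n ≤ 1
        · calc tailWeight (ζ (n + 1)) ≤ tailWeight (1.001 * ζ n) :=
                tailWeight_mono (hζ0 _).le (hζ n) h2
            _ ≤ 1.001 * tailWeight (ζ n) := tailWeight_mul_le (hζ0 n).le (by norm_num) h2
            _ ≤ _ := by
              gcongr
              exact tailWeight_mono (hζ0 n).le h.le hR1
        -- If `1.001 * ζ n` exceeds one, scaling `ζ n` would leave the unit interval; then `R`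
        -- itself is within the factor `1.001` of one.
        · have hge : 1 / 1.001 ≤ R := by
            rw [div_le_iff₀ (by norm_num)]; linarith
          have h3 : tailWeight 1 ≤ 1.001 * tailWeight (1 / 1.001) := by
            have := tailWeight_mul_le (z := 1 / 1.001) (q := 1.001) (by norm_num) (by norm_num)
              (by norm_num)
            norm_num at this ⊢
            exact this
          calc tailWeight (ζ (n + 1)) ≤ tailWeight 1 := tailWeight_mono (hζ0 _).le (hζ1 _) le_rfl
            _ ≤ 1.001 * tailWeight (1 / 1.001) := h3
            _ ≤ _ := by
              gcongr
              exact tailWeight_mono (by norm_num) hge hR1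
      linarith [htel (n + 1), hpos 0]
    · rw [Finset.sum_range_succ, if_neg h, add_zero]; exact ih

end TailWeight

/-! ### From the quarter moment of the weights back to the tail moment -/

section TailMoment

variable {k : ℕ} [NeZero k] (hk : 4 ≤ k) {a : ℝ}
  {Z : ℝ → ℝ} (hZ : Measurable Z) (h0 : ∀ w, 0 < Z w) (h1 : ∀ w, Z w ≤ 1 - 1 / (k : ℝ))
  {x : ℝ} (hx : -1 ≤ x) (hmom : MomentBound k a Z x)

include hk hZ h0 h1 hx hmom in
-- Quarter powers are subadditive, so the wrong colours can be treated one at a time. Colours whose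
-- offspring are all in the core do not enter `tailSum`, hence each term carries a factor `H` from a
-- tail mark. This makes the recursion homogeneous in the tail moment.
theorem lintegral_tailSum_rpow_le (d : ℝ≥0) {H : ℝ}
    (hH : ∀ e : Fin k, e ≠ 0 → ∫⁻ m in tailMarks a e,
      ENNReal.ofReal (ratioBound a Z e m ^ (1 / 4 : ℝ)) ∂(markLaw k) ≤ ENNReal.ofReal H) :
    ∫⁻ v, ENNReal.ofReal (tailSum a Z v ^ (1 / 4 : ℝ)) ∂(poissonSample d (markLaw k)) ≤
      ENNReal.ofReal (((k : ℝ) - 1) * (d * H * Real.exp (d * (((k : ℝ) - 1)⁻¹ * x)))) := by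
  classical
  have hpos := weightBound_pos (k := k) (by omega) a h0 h1
  have hms : ∀ e : Fin k, MeasurableSet {v : Σ b : ℕ, Fin b → Mark k | ¬ AllCore a e v} :=
    fun e => (measurableSet_allCore a e).compl
  have hmw : ∀ e : Fin k, Measurable fun v => ENNReal.ofReal (weightBound a Z e v ^ (1 / 4 : ℝ)) :=
    fun e => ((measurable_weightBound a hZ e).pow_const _).ennreal_ofReal
  calc _ ≤ ∫⁻ v, ∑ e ∈ Finset.univ.erase (0 : Fin k), {v | ¬ AllCore a e v}.indicator
        (fun v => ENNReal.ofReal (weightBound a Z e v ^ (1 / 4 : ℝ))) v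
        ∂(poissonSample d (markLaw k)) := by
        refine lintegral_mono fun v => ?_
        have hsum : tailSum a Z v ^ (1 / 4 : ℝ) ≤ ∑ e ∈ Finset.univ.erase (0 : Fin k),
            (if AllCore a e v then 0 else weightBound a Z e v) ^ (1 / 4 : ℝ) :=
          Finset.le_sum_of_subadditive_on_pred (fun x : ℝ => x ^ (1 / 4 : ℝ)) (fun x => 0 ≤ x)
            (by norm_num)
            (fun x y hx hy => Real.rpow_add_le_add_rpow hx hy (by norm_num) (by norm_num))
            (fun x y hx hy => add_nonneg hx hy) _ fun e _ => by
              split_ifs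
              exacts [le_rfl, (hpos e v).le]
        refine (ENNReal.ofReal_le_ofReal hsum).trans (le_of_eq ?_)
        rw [ENNReal.ofReal_sum_of_nonneg fun e _ => Real.rpow_nonneg (by
          split_ifs
          exacts [le_rfl, (hpos e v).le]) _]
        refine Finset.sum_congr rfl fun e _ => ?_
        by_cases hv : AllCore a e v
        · rw [if_pos hv, Set.indicator_of_notMem (by simpa using hv)]; norm_num
        · rw [if_neg hv, Set.indicator_of_mem (by exact hv)]
    _ = ∑ e ∈ Finset.univ.erase (0 : Fin k), ∫⁻ v in {v | ¬ AllCore a e v},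
          ENNReal.ofReal (weightBound a Z e v ^ (1 / 4 : ℝ)) ∂(poissonSample d (markLaw k)) := by
        rw [lintegral_finsetSum _ fun e _ => (hmw e).indicator (hms e)]
        exact Finset.sum_congr rfl fun e _ => lintegral_indicator (hms e) _
    _ ≤ ∑ e ∈ Finset.univ.erase (0 : Fin k),
          ENNReal.ofReal (d * H * Real.exp (d * (((k : ℝ) - 1)⁻¹ * x))) :=
        Finset.sum_le_sum fun e he => lintegral_weightBound_not_allCore_le hk hZ h0 h1 hx hmom d
          (Finset.ne_of_mem_erase he) (hH e (Finset.ne_of_mem_erase he))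
    _ = _ := by
        rw [Finset.sum_const, Finset.card_erase_of_mem (Finset.mem_univ _), Finset.card_univ,
          Fintype.card_fin, nsmul_eq_mul, ofReal_natCast_sub_one,
          ENNReal.ofReal_mul (sub_one_nonneg k)]

include hk hZ h0 h1 hx hmom in
-- Integrating the layer-cake bound over the sample and then inserting `tailWeight_div_le`: the tail
-- moment of the new error law is at most `1.001 * 1.054` times the quarter moment of `tailSum`.
theorem sum_tailWeight_mul_measure_le (d : ℝ≥0) {H : ℝ}
    (hH : ∀ e : Fin k, e ≠ 0 → ∫⁻ m in tailMarks a e,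
      ENNReal.ofReal (ratioBound a Z e m ^ (1 / 4 : ℝ)) ∂(markLaw k) ≤ ENNReal.ofReal H)
    {ζ : ℕ → ℝ} (hζ0 : ∀ j, 0 < ζ j) (hζ1 : ∀ j, ζ j ≤ 1)
    (hζ : ∀ j, ζ (j + 1) ≤ 1.001 * ζ j) (hmono : Monotone ζ) (n : ℕ) :
    ∑ j ∈ Finset.range n, ENNReal.ofReal (tailWeight (ζ (j + 1)) - tailWeight (ζ j)) *
      poissonSample d (markLaw k) {v | ζ j < tailSum a Z v / (1 + tailSum a Z v)} ≤
      ENNReal.ofReal (1.001 * 1.054 *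
        (((k : ℝ) - 1) * (d * H * Real.exp (d * (((k : ℝ) - 1)⁻¹ * x))))) := by
  classical
  have hmT := measurable_tailSum (k := k) a hZ
  have hms : ∀ j, MeasurableSet {v : Σ b : ℕ, Fin b → Mark k |
      ζ j < tailSum a Z v / (1 + tailSum a Z v)} := fun j =>
    measurableSet_lt measurable_const (hmT.div (measurable_const.add hmT))
  rw [ENNReal.ofReal_mul (by norm_num)]
  refine le_trans ?_ (mul_le_mul_right
    (lintegral_tailSum_rpow_le hk hZ h0 h1 hx hmom d hH) _)
  rw [← lintegral_const_mul _ (hmT.pow_const _).ennreal_ofReal]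
  simp_rw [← fun j => lintegral_indicator_one (μ := poissonSample d (markLaw k)) (hms j)]
  have hmi : ∀ j, Measurable ({v : Σ b : ℕ, Fin b → Mark k |
      ζ j < tailSum a Z v / (1 + tailSum a Z v)}.indicator (1 : (Σ b : ℕ, Fin b → Mark k) → ℝ≥0∞)) :=
    fun j => measurable_one.indicator (hms j)
  simp_rw [← fun j => lintegral_const_mul (μ := poissonSample d (markLaw k))
    (ENNReal.ofReal (tailWeight (ζ (j + 1)) - tailWeight (ζ j))) (hmi j)]
  rw [← lintegral_finsetSum _ fun j _ => (hmi j).const_mul _]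
  refine lintegral_mono fun v => ?_
  have hT := tailSum_nonneg (k := k) (by omega) a h0 h1 v
  set R := tailSum a Z v / (1 + tailSum a Z v) with hR
  have hR1 : R ≤ 1 := by rw [hR, div_le_one (by linarith)]; linarith
  have h2 := sum_tailWeight_sub_le hζ0 hζ1 hζ hmono (R := R) (by positivity) hR1 n
  have h3 := tailWeight_div_le hT
  rw [← ENNReal.ofReal_mul (by norm_num)]
  have h4 : ∀ j, ENNReal.ofReal (tailWeight (ζ (j + 1)) - tailWeight (ζ j)) *
      {v : Σ b : ℕ, Fin b → Mark k |
        ζ j < tailSum a Z v / (1 + tailSum a Z v)}.indicator (1 : (Σ b : ℕ, Fin b → Mark k) → ℝ≥0∞) v =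
      ENNReal.ofReal (if ζ j < R then tailWeight (ζ (j + 1)) - tailWeight (ζ j) else 0) := by
    intro j
    by_cases hj : ζ j < R
    · rw [Set.indicator_of_mem (by exact hj), if_pos hj]; simp
    · rw [Set.indicator_of_notMem (by exact hj), if_neg hj]; simp
  rw [Finset.sum_congr rfl fun j _ => h4 j, ← ENNReal.ofReal_sum_of_nonneg fun j _ => by
    split_ifs
    · exact sub_nonneg.2 (tailWeight_mono (hζ0 j).le (hmono j.le_succ) (hζ1 _))
    · exact le_rfl]
  refine ENNReal.ofReal_le_ofReal ?_
  linarith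

end TailMoment

end TreeColouring
end
noncomputable section
namespace TreeColouring

/-! ### Step profiles -/

section Profile

open scoped Classical in
/-- The number of thresholds `Q 0 ≥ Q 1 ≥ …` above `w`. -/
def stepIndex (N : ℕ) (Q : ℕ → ℝ) (w : ℝ) : ℕ := ((Finset.range N).filter fun j => w < Q j).card

/-- The step function with values in the grid `ζ` and thresholds `Q` below `a`, and with the constant
value `z₀` on the core. -/
def profile (ζ : ℕ → ℝ) (N : ℕ) (a z₀ : ℝ) (Q : ℕ → ℝ) (w : ℝ) : ℝ :=
  if w < a then ζ (stepIndex N Q w) else z₀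

theorem measurable_stepIndex (N : ℕ) (Q : ℕ → ℝ) : Measurable (stepIndex N Q) := by
  classical
  have : stepIndex N Q = fun w => ∑ j ∈ Finset.range N, if w < Q j then 1 else 0 := by
    ext w; rw [stepIndex, Finset.card_filter]
  rw [this]
  exact Finset.measurable_fun_sum _ fun j _ =>
    Measurable.ite (measurableSet_lt measurable_id measurable_const) measurable_const
      measurable_const

theorem measurable_profile (ζ : ℕ → ℝ) (N : ℕ) (a z₀ : ℝ) (Q : ℕ → ℝ) :
    Measurable (profile ζ N a z₀ Q) :=
  Measurable.ite (measurableSet_lt measurable_id measurable_const)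
    ((Measurable.of_discrete (f := ζ)).comp (measurable_stepIndex N Q)) measurable_const

theorem profile_mono {ζ : ℕ → ℝ} (hζ : Monotone ζ) (N : ℕ) (a z₀ : ℝ) {Q Q' : ℕ → ℝ} (h : Q ≤ Q')
    (w : ℝ) : profile ζ N a z₀ Q w ≤ profile ζ N a z₀ Q' w := by
  unfold profile
  split_ifs
  · refine hζ (Finset.card_le_card fun j hj => ?_)
    rw [Finset.mem_filter] at hj ⊢
    exact ⟨hj.1, hj.2.trans_le (h j)⟩
  · exact le_rfl

theorem stepIndex_succ {Q : ℕ → ℝ} (hQ : Antitone Q) (N : ℕ) (w : ℝ) :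
    stepIndex (N + 1) Q w = if w < Q N then N + 1 else stepIndex N Q w := by
  classical
  unfold stepIndex
  split_ifs with h
  · rw [Finset.filter_true_of_mem, Finset.card_range]
    intro j hj
    exact h.trans_le (hQ (Nat.lt_succ_iff.1 (Finset.mem_range.1 hj)))
  · rw [Finset.range_add_one, Finset.filter_insert, if_neg h]

theorem lt_stepIndex {Q : ℕ → ℝ} (hQ : Antitone Q) {N j : ℕ} (hj : j < N) {w : ℝ} (hw : w < Q j) :
    j < stepIndex N Q w := by
  induction N with
  | zero => omega
  | succ N ih =>
    rw [stepIndex_succ hQ]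
    split_ifs with h
    · omega
    · refine ih (lt_of_le_of_ne (Nat.lt_succ_iff.1 hj) ?_)
      rintro rfl
      exact h hw

/-- Summation by parts along the grid. It turns the integral of `tailWeight` over a step profile
into a function that is affine in the thresholds. -/
theorem tailWeight_stepIndex (ζ : ℕ → ℝ) {Q : ℕ → ℝ} (hQ : Antitone Q) (N : ℕ) (w : ℝ) :
    tailWeight (ζ (stepIndex N Q w)) = tailWeight (ζ 0) + ∑ j ∈ Finset.range N,
      (Set.Iio (Q j)).indicator (fun _ => tailWeight (ζ (j + 1)) - tailWeight (ζ j)) w := by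
  induction N with
  | zero => simp [stepIndex]
  | succ N ih =>
    rw [stepIndex_succ hQ]
    split_ifs with h
    · rw [Finset.sum_congr rfl (g := fun j => tailWeight (ζ (j + 1)) - tailWeight (ζ j)),
        Finset.sum_range_sub (fun j => tailWeight (ζ j))]
      · ring
      · intro j hj
        rw [Set.indicator_of_mem]
        exact h.trans_le (hQ (Nat.lt_succ_iff.1 (Finset.mem_range.1 hj)))
    · rw [ih, Finset.sum_range_succ, Set.indicator_of_notMem (by exact h), add_zero]

/-- The integral of the tail weight of a step profile outside the core, up to the mass of the
lowest step. -/
def profileMoment (ζ : ℕ → ℝ) (N : ℕ) (Q : ℕ → ℝ) : ℝ :=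
  tailWeight (ζ 0) + ∑ j ∈ Finset.range N, (tailWeight (ζ (j + 1)) - tailWeight (ζ j)) * Q j

theorem setLIntegral_tailWeight_profile_le {ζ : ℕ → ℝ} (hζ0 : ∀ j, 0 < ζ j) (hζ1 : ∀ j, ζ j ≤ 1)
    (hmono : Monotone ζ) (N : ℕ) {a : ℝ} (ha1 : a ≤ 1) (z₀ : ℝ) {Q : ℕ → ℝ} (hQ : Antitone Q)
    (hQ0 : ∀ j, 0 ≤ Q j) (hQa : ∀ j, Q j ≤ a) :
    ∫⁻ w in Set.Iio a, ENNReal.ofReal (tailWeight (profile ζ N a z₀ Q w)) ∂unifI ≤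
      ENNReal.ofReal (profileMoment ζ N Q) := by
  have hφ0 := tailWeight_nonneg (hζ0 0).le (hζ1 0)
  have hΔ : ∀ j, 0 ≤ tailWeight (ζ (j + 1)) - tailWeight (ζ j) := fun j =>
    sub_nonneg.2 (tailWeight_mono (hζ0 j).le (hmono j.le_succ) (hζ1 _))
  have hmi : ∀ j, Measurable ((Set.Iio (Q j)).indicator fun _ : ℝ =>
      ENNReal.ofReal (tailWeight (ζ (j + 1)) - tailWeight (ζ j))) := fun j =>
    measurable_const.indicator measurableSet_Iio
  calc _ ≤ ∫⁻ w in Set.Iio a, (ENNReal.ofReal (tailWeight (ζ 0)) + ∑ j ∈ Finset.range N,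
        (Set.Iio (Q j)).indicator
          (fun _ => ENNReal.ofReal (tailWeight (ζ (j + 1)) - tailWeight (ζ j))) w) ∂unifI := by
        refine setLIntegral_mono (measurable_const.add
          (Finset.measurable_fun_sum _ fun j _ => hmi j)) fun w hw => ?_
        rw [profile, if_pos (by exact hw), tailWeight_stepIndex ζ hQ,
          ENNReal.ofReal_add hφ0 (Finset.sum_nonneg fun j _ =>
            Set.indicator_nonneg (fun _ _ => hΔ j) _),
          ENNReal.ofReal_sum_of_nonneg fun j _ => Set.indicator_nonneg (fun _ _ => hΔ j) _]
        gcongr with j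
        by_cases h : w ∈ Set.Iio (Q j)
        · rw [Set.indicator_of_mem h, Set.indicator_of_mem h]
        · rw [Set.indicator_of_notMem h]; exact (by simp)
    _ ≤ ∫⁻ w, (ENNReal.ofReal (tailWeight (ζ 0)) + ∑ j ∈ Finset.range N,
        (Set.Iio (Q j)).indicator
          (fun _ => ENNReal.ofReal (tailWeight (ζ (j + 1)) - tailWeight (ζ j))) w) ∂unifI :=
        setLIntegral_le_lintegral _ _
    _ = _ := by
        rw [lintegral_add_left measurable_const, lintegral_finsetSum _ fun j _ => hmi j,
          profileMoment, ENNReal.ofReal_add hφ0 (Finset.sum_nonneg fun j _ =>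
            mul_nonneg (hΔ j) (hQ0 j)),
          ENNReal.ofReal_sum_of_nonneg fun j _ => mul_nonneg (hΔ j) (hQ0 j)]
        congr 1
        · simp
        · refine Finset.sum_congr rfl fun j _ => ?_
          rw [lintegral_indicator_const measurableSet_Iio, unifI_Iio ((hQa j).trans ha1),
            ENNReal.ofReal_mul (hΔ j)]

/-- Markov's inequality in summed form: all thresholds up to `j` are at least `Q j`. It prevents a
profile of small moment from having a large error on most of the tail. -/
theorem tailWeight_mul_le_profileMoment {ζ : ℕ → ℝ} (hζ0 : ∀ j, 0 < ζ j) (hζ1 : ∀ j, ζ j ≤ 1)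
    (hmono : Monotone ζ) {N : ℕ} {Q : ℕ → ℝ} (hQ : Antitone Q)
    (hQ0 : ∀ j, 0 ≤ Q j) (hQ1 : ∀ j, Q j ≤ 1) {j : ℕ} (hj : j < N) :
    tailWeight (ζ (j + 1)) * Q j ≤ profileMoment ζ N Q := by
  have hφ0 := tailWeight_nonneg (hζ0 0).le (hζ1 0)
  have hΔ : ∀ j, 0 ≤ tailWeight (ζ (j + 1)) - tailWeight (ζ j) := fun j =>
    sub_nonneg.2 (tailWeight_mono (hζ0 j).le (hmono j.le_succ) (hζ1 _))
  calc tailWeight (ζ (j + 1)) * Q j = tailWeight (ζ 0) * Q j + ∑ i ∈ Finset.range (j + 1),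
        (tailWeight (ζ (i + 1)) - tailWeight (ζ i)) * Q j := by
        rw [← Finset.sum_mul, Finset.sum_range_sub (fun j => tailWeight (ζ j))]; ring
    _ ≤ tailWeight (ζ 0) + ∑ i ∈ Finset.range (j + 1),
        (tailWeight (ζ (i + 1)) - tailWeight (ζ i)) * Q i := by
        refine add_le_add (mul_le_of_le_one_right hφ0 (hQ1 j)) (Finset.sum_le_sum fun i hi => ?_)
        exact mul_le_mul_of_nonneg_left (hQ (Nat.lt_succ_iff.1 (Finset.mem_range.1 hi))) (hΔ i)
    _ ≤ _ := by
        unfold profileMoment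
        exact add_le_add le_rfl (Finset.sum_le_sum_of_subset_of_nonneg (Finset.range_mono hj)
          fun i _ _ => mul_nonneg (hΔ i) (hQ0 i))

end Profile

/-! ### A fixed point of the recursion for the thresholds -/

section FixedPoint

variable {k : ℕ} [NeZero k]

/-- The probability that the sum of the bounds for the weights of the wrong colours exceeds the
level that corresponds to the error probability `z`. -/
def tailProb (d : ℝ≥0) (k : ℕ) [NeZero k] (a : ℝ) (Z : ℝ → ℝ) (z : ℝ) : ℝ :=
  (poissonSample d (markLaw k)).real {v | z < tailSum a Z v / (1 + tailSum a Z v)}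

/-- `T / (1 + T)` increases in `T`, and `tailSum` increases in the profile as long as the core is
kept fixed. -/
theorem tailProb_le_tailProb (hk : 2 ≤ k) (d : ℝ≥0) {a : ℝ} {Z Z' : ℝ → ℝ}
    (h0 : ∀ w, 0 < Z w) (hle : ∀ w, Z w ≤ Z' w) (hcore : ∀ w, a ≤ w → Z w = Z' w)
    (h1 : ∀ w, Z' w ≤ 1 - 1 / (k : ℝ)) {z z' : ℝ} (hz : z' ≤ z) :
    tailProb d k a Z z ≤ tailProb d k a Z' z' := by
  have := isProbabilityMeasure_markLaw (k := k) hk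
  refine measureReal_mono fun v (hv : z < _) => ?_
  refine hz.trans_lt (hv.trans_le ?_)
  have hT := tailSum_nonneg hk a h0 (fun w => (hle w).trans (h1 w)) v
  have hT' := tailSum_mono hk h0 hle hcore h1 v
  rw [div_le_div_iff₀ (by linarith) (by linarith)]
  nlinarith

/-- Restrict the thresholds to multiples of `h`, capped at `a`. Rounding up `tailProb + ε` is an
order-preserving map of a finite set. By `hstep` it keeps the moment below `I`, even with the
rounding error `h`. A maximal element among the antitone `q ≤ Ψ q` of moment at most `I` is fixed,
and being fixed gives the required inequality wherever the cap is not reached. -/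
theorem exists_fixed_profile (hk : 2 ≤ k) (d : ℝ≥0) {ζ : ℕ → ℝ} (hζ0 : ∀ j, 0 < ζ j)
    (hζ1 : ∀ j, ζ j ≤ 1 - 1 / (k : ℝ)) (hmono : Monotone ζ) (N : ℕ) {a z₀ : ℝ} (ha0 : 0 ≤ a)
    (ha1 : a ≤ 1) (hz₀ : 0 < z₀) (hz₁ : z₀ ≤ 1 - 1 / (k : ℝ)) {h ε I : ℝ} (hh : 0 < h) (hε : 0 ≤ ε)
    (hφ : tailWeight (ζ 0) ≤ I)
    (hstep : ∀ Q : ℕ → ℝ, Antitone Q → (∀ j, 0 ≤ Q j) → (∀ j, Q j ≤ a) → profileMoment ζ N Q ≤ I →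
      tailWeight (ζ 0) + ∑ j ∈ Finset.range N, (tailWeight (ζ (j + 1)) - tailWeight (ζ j)) *
        (tailProb d k a (profile ζ N a z₀ Q) (ζ j) + ε + h) ≤ I) :
    ∃ Q : ℕ → ℝ, Antitone Q ∧ (∀ j, 0 ≤ Q j) ∧ (∀ j, Q j ≤ a) ∧ profileMoment ζ N Q ≤ I ∧
      ∀ j < N, Q j = a ∨ tailProb d k a (profile ζ N a z₀ Q) (ζ j) + ε ≤ Q j := by
  classical
  have hk0 : (0 : ℝ) ≤ 1 / (k : ℝ) := by positivity
  have hΔ : ∀ j, 0 ≤ tailWeight (ζ (j + 1)) - tailWeight (ζ j) := fun j =>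
    sub_nonneg.2 (tailWeight_mono (hζ0 j).le (hmono j.le_succ) ((hζ1 _).trans (by linarith)))
  set M := ⌈1 / h⌉₊ with hM
  have hhM : 1 ≤ h * M := by
    have := Nat.le_ceil (1 / h)
    rw [div_le_iff₀ hh] at this
    linarith
  -- Integer data `q` encode the thresholds; beyond the last index the threshold is zero, so
  -- antitonicity persists on all of `ℕ`.
  let th : (Fin N → Fin (M + 1)) → ℕ → ℝ := fun q j =>
    if hj : j < N then min a (h * (q ⟨j, hj⟩ : ℕ)) else 0
  have hth0 : ∀ q j, 0 ≤ th q j := fun q j => by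
    simp only [th]; split_ifs
    exacts [le_min ha0 (by positivity), le_rfl]
  have htha : ∀ q j, th q j ≤ a := fun q j => by
    simp only [th]; split_ifs
    exacts [min_le_left _ _, ha0]
  have hthanti : ∀ q, Antitone q → Antitone (th q) := fun q hq i j hij => by
    by_cases hj : j < N
    · have hi : i < N := hij.trans_lt hj
      simp only [th, dif_pos hi, dif_pos hj]
      have : (q ⟨j, hj⟩ : ℕ) ≤ (q ⟨i, hi⟩ : ℕ) := hq (by exact hij)
      gcongr
    · simp only [th, dif_neg hj]
      exact hth0 q i
  have hthmono : ∀ q q', q ≤ q' → th q ≤ th q' := fun q q' hq j => by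
    simp only [th]
    split_ifs with hj
    · have : (q ⟨j, hj⟩ : ℕ) ≤ (q' ⟨j, hj⟩ : ℕ) := hq ⟨j, hj⟩
      gcongr
    · exact le_rfl
  let p : (Fin N → Fin (M + 1)) → ℕ → ℝ := fun q j =>
    tailProb d k a (profile ζ N a z₀ (th q)) (ζ j)
  have hZ0 : ∀ q w, 0 < profile ζ N a z₀ (th q) w := fun q w => by
    unfold profile; split_ifs
    exacts [hζ0 _, hz₀]
  have hZ1 : ∀ q w, profile ζ N a z₀ (th q) w ≤ 1 - 1 / (k : ℝ) := fun q w => by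
    unfold profile; split_ifs
    exacts [hζ1 _, hz₁]
  have hp : ∀ q q', q ≤ q' → ∀ i j, j ≤ i → p q i ≤ p q' j := fun q q' hq i j hij =>
    tailProb_le_tailProb hk d (hZ0 q) (profile_mono hmono N a z₀ (hthmono q q' hq))
      (fun w hw => by rw [profile, profile, if_neg (not_lt.2 hw), if_neg (not_lt.2 hw)])
      (hZ1 q') (hmono hij)
  have hp0 : ∀ q j, 0 ≤ p q j := fun q j => measureReal_nonneg
  let Ψ : (Fin N → Fin (M + 1)) → (Fin N → Fin (M + 1)) := fun q j =>
    ⟨min M ⌈(p q j + ε) / h⌉₊, Nat.lt_succ_of_le (min_le_left _ _)⟩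
  have hΨ : ∀ q q', q ≤ q' → Ψ q ≤ Ψ q' := fun q q' hq j => by
    change min M _ ≤ min M _
    have := hp q q' hq j j le_rfl
    gcongr
  have hΨanti : ∀ q, Antitone (Ψ q) := fun q i j hij => by
    change min M _ ≤ min M _
    have := hp q q le_rfl j i hij
    gcongr
  have hceil : ∀ q (j : ℕ), h * (⌈(p q j + ε) / h⌉₊ : ℝ) ≤ p q j + ε + h := fun q j => by
    have h1 := Nat.ceil_lt_add_one (a := (p q j + ε) / h)
      (div_nonneg (add_nonneg (hp0 q j) hε) hh.le)
    calc h * (⌈(p q j + ε) / h⌉₊ : ℝ) ≤ h * ((p q j + ε) / h + 1) := by gcongr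
      _ = _ := by field_simp
  have hΨmoment : ∀ q, Antitone q → profileMoment ζ N (th q) ≤ I →
      profileMoment ζ N (th (Ψ q)) ≤ I := fun q hq hqI => by
    refine le_trans ?_ (hstep (th q) (hthanti q hq) (hth0 q) (htha q) hqI)
    unfold profileMoment
    gcongr with j hj
    · exact hΔ j
    · have hj' := Finset.mem_range.1 hj
      simp only [th, dif_pos hj']
      refine (min_le_right _ _).trans (le_trans ?_ (hceil q j))
      gcongr
      exact min_le_right _ _
  let S : Set (Fin N → Fin (M + 1)) :=
    {q | Antitone q ∧ q ≤ Ψ q ∧ profileMoment ζ N (th q) ≤ I}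
  have hS : S.Nonempty := by
    refine ⟨0, fun _ _ _ => le_rfl, fun j => Fin.zero_le _, ?_⟩
    have : th 0 = 0 := by
      ext j; simp only [th]; split_ifs <;> simp [ha0]
    rw [this]
    simpa [profileMoment] using hφ
  -- Nonemptiness comes from zero thresholds, whose moment is only the lowest weight `tailWeight (ζ
  -- 0)`.
  obtain ⟨q, hq⟩ := (Set.toFinite S).exists_maximal hS
  have hfix : Ψ q = q := by
    have hmem : Ψ q ∈ S := ⟨hΨanti q, hΨ _ _ hq.prop.2.1, hΨmoment q hq.prop.1 hq.prop.2.2⟩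
    exact le_antisymm (hq.le_of_ge hmem hq.prop.2.1) hq.prop.2.1
  refine ⟨th q, hthanti q hq.prop.1, hth0 q, htha q, hq.prop.2.2, fun j hj => ?_⟩
  by_cases hcap : th q j = a
  · exact Or.inl hcap
  right
  have h1 : th q j = min a (h * (q ⟨j, hj⟩ : ℕ)) := by simp only [th, dif_pos hj]
  have h2 : (q ⟨j, hj⟩ : ℕ) = min M ⌈(p q j + ε) / h⌉₊ := by
    conv_lhs => rw [← hfix]
  have h3 : h * (q ⟨j, hj⟩ : ℕ) < a := by
    by_contra hcon
    rw [min_eq_left (not_lt.1 hcon)] at h1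
    exact hcap h1
  -- The truncation at `M` is not active, because `h * M ≥ 1 ≥ a` would force the threshold to its
  -- cap.
  have h4 : (q ⟨j, hj⟩ : ℕ) = ⌈(p q j + ε) / h⌉₊ := by
    rw [h2]
    refine min_eq_right (le_of_not_ge fun hle => ?_)
    rw [min_eq_left hle] at h2
    rw [h2] at h3
    linarith
  rw [h1, min_eq_right h3.le, h4]
  have := Nat.le_ceil ((p q j + ε) / h)
  rw [div_le_iff₀ hh] at this
  linarith

end FixedPoint

end TreeColouring
end
noncomputable section
namespace TreeColouring

/-! ### From a fixed profile to a dominated law -/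

section Domination

variable {k : ℕ} [NeZero k]

theorem one_le_mul_norm_sampleVec_card (hk : 2 ≤ k) {Z : ℝ → ℝ} (h0 : ∀ w, 0 < Z w)
    (h1 : ∀ w, Z w ≤ 1 - 1 / (k : ℝ)) (l : Fin k) (v : Σ b : ℕ, Fin b → Mark k) :
    1 / (k : ℝ) ≤ ‖sampleVec Z l v‖ := by
  have hpos : 0 < ∑ m, rawWeight Z l m v :=
    Finset.sum_pos (fun m _ => rawWeight_pos hk h0 h1 l m v) ⟨0, Finset.mem_univ _⟩
  have hsum : ∑ m, sampleVec Z l v m = 1 := by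
    simp_rw [sampleVec_apply]
    rw [← Finset.sum_div, div_self hpos.ne']
  have := Finset.sum_le_card_nsmul Finset.univ (sampleVec Z l v) ‖sampleVec Z l v‖
    fun m _ => le_norm_sampleVec Z l m v
  rw [hsum, Finset.card_univ, Fintype.card_fin, nsmul_eq_mul] at this
  have hk0 : (0 : ℝ) < k := by positivity
  rw [div_le_iff₀ hk0]
  linarith

theorem maxOp_poisson_Iic_le (hk : 2 ≤ k) (d : ℝ≥0) {Z : ℝ → ℝ} (hZ : Measurable Z)
    (h0 : ∀ w, 0 < Z w) (h1 : ∀ w, Z w ≤ 1) {x : ℝ} {B : ℝ≥0∞}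
    (h : ∀ l, poissonSample d (markLaw k) {v | ‖sampleVec Z l v‖ ≤ x} ≤ B) :
    maxOp k (poissonMeasure d) (unifI.map fun w => 1 - Z w) (Set.Iic x) ≤ B := by
  rw [maxOp_Iic]
  calc _ ≤ (k : ℝ≥0∞)⁻¹ * ∑ _l : Fin k, B := by
        gcongr with l
        rw [treeOp_poisson_apply hk d hZ (fun w => (h0 w).le) h1 l
          (measurableSet_le measurable_norm measurable_const)]
        exact h l
    _ = B := by
        rw [Finset.sum_const, Finset.card_univ, Fintype.card_fin, nsmul_eq_mul, ← mul_assoc,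
          ENNReal.inv_mul_cancel (by simpa using NeZero.ne k) (by simp), one_mul]

/-- Compare the two distribution functions at `y` through the grid cell of the error level `1 - y`.
The old law gives at least `Q j`, plus the core mass `1 - a` if the level is below `0.51`; the new
law gives at most `tailProb` plus the rival terms. At low levels the expected number of rivals is
paid by the core mass, at high levels the rivals are harmless. The additional `ε` in the thresholds
pays for the atypical events and for the margin `c / log k`. -/
theorem isDominated_profile (hk : 4 ≤ k) (d : ℝ≥0) {ζ : ℕ → ℝ} (hζ0 : ∀ j, 0 < ζ j)
    (hζ1 : ∀ j, ζ j ≤ 1 - 1 / (k : ℝ)) (hζ : ∀ j, ζ (j + 1) ≤ 1.001 * ζ j) (hmono : Monotone ζ)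
    {N : ℕ} (hζN : ζ N = 1 - 1 / (k : ℝ)) (hζ00 : ζ 0 ≤ 0.51) {a : ℝ} (ha0 : 0 ≤ a)
    (ha1 : a < 1) {Q : ℕ → ℝ} (hQ : Antitone Q) (hQ0 : ∀ j, 0 ≤ Q j) (hQa : ∀ j, Q j ≤ a)
    {x I ε c : ℝ} (hI : profileMoment ζ N Q ≤ I) (hIa : I < 0.51 * a) (hx : -1 ≤ x)
    (hmom : MomentBound k a (profile ζ N a 0.51 Q) x) (hc : 0 ≤ c / Real.log k)
    (hQP : ∀ j < N, Q j = a ∨ tailProb d k a (profile ζ N a 0.51 Q) (ζ j) + ε ≤ Q j)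
    (hsmall : (((k : ℝ) - 1) * Real.exp (-(d * (((k : ℝ) - 1)⁻¹ * a)))) ^ 2 +
        4 * (((k : ℝ) - 1) * Real.exp (-(d * (((k : ℝ) - 1)⁻¹ * a)))) *
        (((k : ℝ) - 1) * Real.exp (d * (((k : ℝ) - 1)⁻¹ * x))) + c / Real.log k ≤ ε)
    (hcore : ((k : ℝ) - 1) * Real.exp (-(d * (((k : ℝ) - 1)⁻¹ * a))) +
      ((((k : ℝ) - 1) * Real.exp (-(d * (((k : ℝ) - 1)⁻¹ * a)))) ^ 2 +
        4 * (((k : ℝ) - 1) * Real.exp (-(d * (((k : ℝ) - 1)⁻¹ * a)))) *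
        (((k : ℝ) - 1) * Real.exp (d * (((k : ℝ) - 1)⁻¹ * x))) + c / Real.log k) ≤ 1 - a + ε) :
    IsDominated c k d (unifI.map fun w => 1 - profile ζ N a 0.51 Q w) := by
  have hk' : (4 : ℝ) ≤ k := by exact_mod_cast hk
  have hkinv : 1 / (k : ℝ) ≤ 1 / 4 := one_div_le_one_div_of_le (by norm_num) hk'
  have hkinv0 : 0 < 1 / (k : ℝ) := by positivity
  set Z := profile ζ N a 0.51 Q with hZdef
  have hZ : Measurable Z := measurable_profile _ _ _ _ _
  have hm : Measurable fun w => 1 - Z w := measurable_const.sub hZ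
  have hZ0 : ∀ w, 0 < Z w := fun w => by
    rw [hZdef, profile]; split_ifs
    exacts [hζ0 _, by norm_num]
  have hZ1 : ∀ w, Z w ≤ 1 - 1 / (k : ℝ) := fun w => by
    rw [hZdef, profile]; split_ifs
    exacts [hζ1 _, by norm_num at hkinv ⊢; linarith]
  have hZcore : ∀ w, a ≤ w → Z w = 0.51 := fun w hw => by
    rw [hZdef, profile, if_neg (not_lt.2 hw)]
  have hprob : IsProbabilityMeasure (unifI.map fun w => 1 - Z w) :=
    Measure.isProbabilityMeasure_map hm.aemeasurable
  have hIic : ∀ y, (unifI.map fun w => 1 - Z w) (Set.Iic y) = unifI {w | 1 - y ≤ Z w} := fun y => by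
    rw [Measure.map_apply hm measurableSet_Iic]
    congr 1; ext w
    simp only [Set.mem_preimage, Set.mem_Iic, Set.mem_ofPred_eq]
    constructor <;> intro h <;> linarith
  set B₀ := ((k : ℝ) - 1) * Real.exp (-(d * (((k : ℝ) - 1)⁻¹ * a))) with hB₀def
  set B₁ := ((k : ℝ) - 1) * Real.exp (d * (((k : ℝ) - 1)⁻¹ * x)) with hB₁def
  have hB₀ : 0 ≤ B₀ := mul_nonneg (sub_one_nonneg k) (Real.exp_pos _).le
  have hB₁ : 0 ≤ B₁ := mul_nonneg (sub_one_nonneg k) (Real.exp_pos _).le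
  refine ⟨hprob, ?_, ?_, ?_⟩
  · rw [Measure.map_apply hm measurableSet_Icc]
    have : (fun w => 1 - Z w) ⁻¹' Set.Icc (1 / (k : ℝ)) 1 = Set.univ := by
      ext w
      simp only [Set.mem_preimage, Set.mem_Icc, Set.mem_univ, iff_true]
      exact ⟨by linarith [hZ1 w], by linarith [hZ0 w]⟩
    rw [this, measure_univ]
  · intro hμ
    have h1 := hIic (1 / (k : ℝ))
    rw [hμ, Measure.dirac_apply' _ measurableSet_Iic, Set.indicator_of_mem (by simp)] at h1
    -- On the core, which has positive mass, the error is `0.51`, strictly less than `1 - 1 / k`; so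
    -- the law is not the unit mass at `1 / k`.
    have h2 : unifI {w | 1 - 1 / (k : ℝ) ≤ Z w} ≤ unifI (Set.Iio a) := by
      refine measure_mono fun w hw => ?_
      replace hw : 1 - 1 / (k : ℝ) ≤ Z w := hw
      by_contra hcon
      rw [hZcore w (not_lt.1 hcon)] at hw
      norm_num at hw hkinv
      linarith
    rw [← h1, unifI_Iio ha1.le, Pi.one_apply, ENNReal.one_le_ofReal] at h2
    linarith
  intro y
  have hν : ∀ {B : ℝ≥0∞}, (∀ l, poissonSample d (markLaw k) {v | ‖sampleVec Z l v‖ ≤ y} ≤ B) →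
      maxOp k (poissonMeasure d) (unifI.map fun w => 1 - Z w) (Set.Iic y) ≤ B := fun h =>
    maxOp_poisson_Iic_le (by omega) d hZ hZ0 (fun w => (hZ1 w).trans (by linarith)) h
  by_cases hy : y < 1 / (k : ℝ)
  · refine Or.inr (Or.inl (le_antisymm (hν fun l => le_of_eq ?_) zero_le))
    rw [Set.eq_empty_of_forall_notMem (s := {v | ‖sampleVec Z l v‖ ≤ y}), measure_empty]
    intro v hv
    replace hv : ‖sampleVec Z l v‖ ≤ y := hv
    linarith [one_le_mul_norm_sampleVec_card (by omega) hZ0 hZ1 l v]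
  by_cases hy0 : 1 - y ≤ ζ 0
  · left
    rw [hIic]
    have : {w | 1 - y ≤ Z w} = Set.univ := by
      ext w
      simp only [Set.mem_ofPred_eq, Set.mem_univ, iff_true]
      rw [hZdef, profile]; split_ifs
      exacts [hy0.trans (hmono (Nat.zero_le _)), hy0.trans hζ00]
    rw [this, measure_univ]
  -- The last grid point is `1 - 1 / k`, the largest possible error, so every remaining level lies
  -- in some cell.
  obtain ⟨j, hjN, hj, hj1⟩ : ∃ j < N, ζ j < 1 - y ∧ 1 - y ≤ ζ (j + 1) := by
    by_contra! hno
    have : ∀ j ≤ N, ζ j < 1 - y := fun j => by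
      induction j with
      | zero => intro _; exact not_le.1 hy0
      | succ j ih => intro hj; exact hno j (by omega) (ih (by omega))
    have := this N le_rfl
    linarith
  have hZj : ∀ w, w < Q j → 1 - y ≤ Z w := fun w hw => by
    rw [hZdef, profile, if_pos (hw.trans_le (hQa j))]
    exact hj1.trans (hmono (lt_stepIndex hQ hjN hw))
  have hmoment := tailWeight_mul_le_profileMoment hζ0 (fun j => (hζ1 j).trans (by linarith)) hmono
    hQ hQ0 (fun j => (hQa j).trans ha1.le) hjN
  have hφ : ζ (j + 1) ≤ tailWeight (ζ (j + 1)) := by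
    have h1 := hζ1 (j + 1)
    have : 0 ≤ (1 - ζ (j + 1)) * ζ (j + 1) ^ (1 / 4 : ℝ) :=
      mul_nonneg (by linarith) (Real.rpow_nonneg (hζ0 _).le _)
    unfold tailWeight; linarith
  rcases hQP j hjN with hcap | hQj
  · left
    -- A threshold at the cap means that the whole tail has error at least `ζ (j + 1)`. A moment
    -- below `0.51 * a` then forces `ζ (j + 1) ≤ 0.51`, so the core exceeds this level too and the
    -- distribution function equals one.
    have hlow : ζ (j + 1) ≤ 0.51 := by
      by_contra hcon
      rw [hcap] at hmoment
      nlinarith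
    rw [hIic]
    have : {w | 1 - y ≤ Z w} = Set.univ := by
      ext w
      simp only [Set.mem_ofPred_eq, Set.mem_univ, iff_true]
      by_cases hw : w < a
      · exact hZj w (by rwa [hcap])
      · rw [hZcore w (not_lt.1 hw)]; linarith
    rw [this, measure_univ]
  right; right
  have hmark := isProbabilityMeasure_markLaw (k := k) (by omega)
  have hνj := hν fun l => poissonSample_norm_le hk ha0 ha1.le hZ hZ0 hZ1 hx hmom d l
    (x₀ := y) (ζ := ζ j) (by linarith)
  rw [← ofReal_measureReal (μ := poissonSample d (markLaw k)), ← hB₀def, ← hB₁def, ← ENNReal.ofReal_add measureReal_nonneg (by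
    split_ifs <;> positivity)] at hνj
  rw [hIic]
  refine (add_le_add_left hνj _).trans ?_
  rw [← ENNReal.ofReal_add (by
    refine add_nonneg measureReal_nonneg ?_
    split_ifs <;> positivity) hc]
  change tailProb d k a Z (ζ j) + ε ≤ Q j at hQj
  change ENNReal.ofReal (tailProb d k a Z (ζ j) + _ + _) ≤ _
  split_ifs with hζj
  -- The grid ratio matters here: `1.001 * 0.505 < 0.51`, so the core counts at every level for
  -- which a single rival is charged.
  · have hsub : Set.Iio (Q j) ∪ Set.Ici a ⊆ {w | 1 - y ≤ Z w} := by
      rintro w (hw | hw)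
      · exact hZj w hw
      · change 1 - y ≤ Z w
        rw [hZcore w hw]
        have := hζ j
        norm_num at hζj ⊢
        linarith
    refine le_trans ?_ (measure_mono hsub)
    have hdisj : Disjoint (Set.Iio (Q j)) (Set.Ici a) := Set.disjoint_left.2 fun w hw hw' =>
      absurd (Set.mem_Iio.1 hw) (not_lt.2 ((hQa j).trans hw'))
    rw [measure_union hdisj measurableSet_Ici, unifI_Iio ((hQa j).trans ha1.le), unifI_Ici ha0 ha1.le,
      ← ENNReal.ofReal_add (hQ0 j) (by linarith)]
    exact ENNReal.ofReal_le_ofReal (by linarith)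
  · refine le_trans ?_ (measure_mono (fun w hw => hZj w hw : Set.Iio (Q j) ⊆ {w | 1 - y ≤ Z w}))
    rw [unifI_Iio ((hQa j).trans ha1.le)]
    exact ENNReal.ofReal_le_ofReal (by linarith)

end Domination

end TreeColouring
end
noncomputable section
namespace TreeColouring

/-! ### Existence of dominated laws -/

section Existence

theorem tendsto_tailWeight_pow {b q : ℝ} (hq0 : 0 ≤ q) (hq1 : q < 1) :
    Filter.Tendsto (fun n : ℕ => tailWeight (b * q ^ n)) Filter.atTop (nhds 0) := by
  have h1 : Filter.Tendsto (fun n : ℕ => b * q ^ n) Filter.atTop (nhds 0) := by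
    simpa using (tendsto_pow_atTop_nhds_zero_of_lt_one hq0 hq1).const_mul b
  have h2 : Continuous tailWeight := by
    unfold tailWeight
    have : Continuous fun z : ℝ => z ^ (1 / 4 : ℝ) :=
      Real.continuous_rpow_const (by norm_num)
    fun_prop
  have h3 : tailWeight 0 = 0 := by
    rw [tailWeight, Real.zero_rpow (by norm_num)]; norm_num
  rw [← h3]
  exact (h2.tendsto 0).comp h1

/-- A geometric grid with ratio `1.001`, anchored at its largest point `b` and extended downwards
until both the lowest point and its weight are below `δ`; the natural subtraction `N - j` makes it
constant after `N`. -/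
theorem exists_grid {b δ : ℝ} (hb0 : 0 < b) (hδ : 0 < δ) :
    ∃ (ζ : ℕ → ℝ) (N : ℕ), (∀ j, 0 < ζ j) ∧ (∀ j, ζ j ≤ b) ∧ (∀ j, ζ (j + 1) ≤ 1.001 * ζ j) ∧
      Monotone ζ ∧ ζ N = b ∧ ζ 0 ≤ δ ∧ tailWeight (ζ 0) ≤ δ := by
  have hq0 : (0 : ℝ) < 1000 / 1001 := by norm_num
  have hq1 : (1000 / 1001 : ℝ) < 1 := by norm_num
  have hlim : Filter.Tendsto (fun n : ℕ => b * (1000 / 1001 : ℝ) ^ n) Filter.atTop (nhds 0) := by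
    simpa using (tendsto_pow_atTop_nhds_zero_of_lt_one hq0.le hq1).const_mul b
  obtain ⟨N, hN1, hN2⟩ := ((hlim.eventually_le_const hδ).and
    ((tendsto_tailWeight_pow (b := b) hq0.le hq1).eventually_le_const hδ)).exists
  refine ⟨fun j => b * (1000 / 1001 : ℝ) ^ (N - j), N, fun j => by positivity, fun j => ?_,
    fun j => ?_, fun i j hij => ?_, by simp, by simpa using hN1, by simpa using hN2⟩
  · exact mul_le_of_le_one_right hb0.le (pow_le_one₀ hq0.le hq1.le)
  · dsimp only
    by_cases hj : j < N
    · rw [show N - j = (N - (j + 1)) + 1 by omega, pow_succ]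
      have : 0 ≤ b * (1000 / 1001 : ℝ) ^ (N - (j + 1)) := by positivity
      apply le_of_eq
      ring
    · rw [show N - j = 0 by omega, show N - (j + 1) = 0 by omega]
      norm_num; linarith
  · exact mul_le_mul_of_nonneg_left (pow_le_pow_of_le_one hq0.le hq1.le (by omega)) hb0.le

variable {k : ℕ} [NeZero k]

theorem tailProb_nonneg (d : ℝ≥0) (k : ℕ) [NeZero k] (a : ℝ) (Z : ℝ → ℝ) (z : ℝ) :
    0 ≤ tailProb d k a Z z := measureReal_nonneg

/-- Fixes the parameters: core mass `1 / L`, tail moment `I = 1e-3 / L`, margin in the thresholds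
`1e-6 / L`, lattice spacing `1e-7 / L`, with `L = log k`. The three analytic inputs are the number
of rivals `B₀`, the moment factor `B₁`, and the multiplier `d / (k - 1) * B₁ ≤ 0.945` of the tail
recursion. -/
theorem exists_isDominated_of_bounds (hk : 4 ≤ k) (d : ℝ≥0)
    (hL : 10 ^ 9 ≤ Real.log k) (hκ : 4 * ((k : ℝ) - 1)⁻¹ ≤ 1e-4)
    (hU : (1 - 0.51) * (likelihood k 0.51 ^ (1 / 4 : ℝ) - 1) +
      0.51 * ((1 - ((k : ℝ) - 1)⁻¹) * (likelihood k 0.51 ^ (1 / 4 : ℝ) - 1) +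
        ((likelihood k 0.51)⁻¹ ^ (1 / 4 : ℝ) - 1)) ≤ 0.939 - 1)
    (hB₀ : ((k : ℝ) - 1) * Real.exp (-(d * (((k : ℝ) - 1)⁻¹ * (1 - 1 / Real.log k)))) ≤
      (1 + 2e-7) / Real.log k)
    (hB₁ : ((k : ℝ) - 1) * Real.exp (d * (((k : ℝ) - 1)⁻¹ * (-1 + 0.942 / Real.log k))) ≤
      1 / Real.log k)
    (htB₁ : d * ((k : ℝ) - 1)⁻¹ * (((k : ℝ) - 1) *
      Real.exp (d * (((k : ℝ) - 1)⁻¹ * (-1 + 0.942 / Real.log k)))) ≤ 0.945) :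
    ∃ μ, IsDominated 1e-7 k d μ := by
  have hk' : (4 : ℝ) ≤ k := by exact_mod_cast hk
  have hkinv : 1 / (k : ℝ) ≤ 1 / 4 := one_div_le_one_div_of_le (by norm_num) hk'
  have hκ0 : (0 : ℝ) < (k : ℝ) - 1 := by linarith
  set L := Real.log k with hLdef
  have hL0 : 0 < L := by linarith
  have hLi : 1 / L ≤ 1e-9 := by
    rw [div_le_iff₀ hL0]; norm_num; linarith
  have hLi1 : 1 / L ≤ 1 / 2 := hLi.trans (by norm_num)
  have hLi0 : 0 < 1 / L := by positivity
  set I := 1e-3 / L with hIdef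
  have hI0 : 0 < I := by positivity
  -- The rate is `-1` plus the tail part `3 * 1e-3 / L` and the core part `0.939 / L`.
  have hx : -1 + 0.942 / L = -1 + 3 * I + 0.939 * (1 - (1 - 1 / L)) := by
    rw [hIdef]; field_simp; norm_num; ring
  have hx1 : -1 ≤ -1 + 0.942 / L := by
    have : 0 ≤ 0.942 / L := by positivity
    linarith
  set x := -1 + 0.942 / L with hxdef
  set B₀ := ((k : ℝ) - 1) * Real.exp (-(d * (((k : ℝ) - 1)⁻¹ * (1 - 1 / L)))) with hB₀def
  set B₁ := ((k : ℝ) - 1) * Real.exp (d * (((k : ℝ) - 1)⁻¹ * x)) with hB₁def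
  have hB₀0 : 0 ≤ B₀ := mul_nonneg (sub_one_nonneg k) (Real.exp_pos _).le
  have hB₁0 : 0 ≤ B₁ := mul_nonneg (sub_one_nonneg k) (Real.exp_pos _).le
  have ha0 : 0 ≤ 1 - 1 / L := by linarith
  obtain ⟨ζ, N, hζ0, hζb, hζ, hmono, hζN, hζ00, hφ0⟩ :=
    exists_grid (b := 1 - 1 / (k : ℝ)) (δ := 1e-6 / L) (by linarith) (by positivity)
  have hζ1 : ∀ j, ζ j ≤ 1 := fun j => (hζb j).trans (by
    have : 0 < 1 / (k : ℝ) := by positivity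
    linarith)
  have hZ0 : ∀ Q w, 0 < profile ζ N (1 - 1 / L) 0.51 Q w := fun Q w => by
    unfold profile; split_ifs
    exacts [hζ0 _, by norm_num]
  have hZ1 : ∀ Q w, profile ζ N (1 - 1 / L) 0.51 Q w ≤ 1 - 1 / (k : ℝ) := fun Q w => by
    unfold profile; split_ifs
    exacts [hζb _, by norm_num at hkinv ⊢; linarith]
  have hsmallφ : 1e-6 / L ≤ I := by rw [hIdef]; gcongr; norm_num
  have hint : ∀ Q, Antitone Q → (∀ j, 0 ≤ Q j) → (∀ j, Q j ≤ 1 - 1 / L) →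
      profileMoment ζ N Q ≤ I →
      ∫⁻ w in Set.Iio (1 - 1 / L), ENNReal.ofReal
        (tailWeight (profile ζ N (1 - 1 / L) 0.51 Q w)) ∂unifI ≤ ENNReal.ofReal I :=
    fun Q hQ hQ0 hQa hQI => (setLIntegral_tailWeight_profile_le hζ0 hζ1 hmono N (by linarith)
      0.51 hQ hQ0 hQa).trans (ENNReal.ofReal_le_ofReal hQI)
  have hmom : ∀ Q, Antitone Q → (∀ j, 0 ≤ Q j) → (∀ j, Q j ≤ 1 - 1 / L) →
      profileMoment ζ N Q ≤ I → MomentBound k (1 - 1 / L) (profile ζ N (1 - 1 / L) 0.51 Q) x := by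
    intro Q hQ hQ0 hQa hQI e he
    rw [hx]
    exact lintegral_ratioBound_le hk ha0 (by linarith) (measurable_profile _ _ _ _ _) (hZ0 Q) (hZ1 Q)
      hI0.le (hint Q hQ hQ0 hQa hQI) (fun w hw => by rw [profile, if_neg (not_lt.2 hw)]) hU
      (by norm_num) he
  obtain ⟨Q, hQ, hQ0, hQa, hQI, hQP⟩ := exists_fixed_profile (k := k) (by omega) d hζ0 hζb hmono N
    (a := 1 - 1 / L) (z₀ := 0.51) ha0 (by linarith) (by norm_num)
    (by norm_num at hkinv ⊢; linarith) (h := 1e-7 / L) (ε := 1e-6 / L) (I := I) (by positivity)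
    (by positivity) (hφ0.trans hsmallφ) (by
      intro Q hQ hQ0 hQa hQI
      have hΔ : ∀ j, 0 ≤ tailWeight (ζ (j + 1)) - tailWeight (ζ j) := fun j =>
        sub_nonneg.2 (tailWeight_mono (hζ0 j).le (hmono j.le_succ) (hζ1 _))
      have hsum := sum_tailWeight_mul_measure_le hk (measurable_profile _ _ _ _ _) (hZ0 Q) (hZ1 Q)
        hx1 (hmom Q hQ hQ0 hQa hQI) d (fun e he => setLIntegral_tailMarks_ratioBound_le hk
          (measurable_profile _ _ _ _ _) (hZ0 Q) (hZ1 Q) (hint Q hQ hQ0 hQa hQI) he)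
        hζ0 hζ1 hζ hmono N
      have hmark := isProbabilityMeasure_markLaw (k := k) (by omega)
      have hconv : ∀ j, ENNReal.ofReal (tailWeight (ζ (j + 1)) - tailWeight (ζ j)) *
          poissonSample d (markLaw k) {v | ζ j < tailSum (1 - 1 / L)
            (profile ζ N (1 - 1 / L) 0.51 Q) v / (1 + tailSum (1 - 1 / L)
            (profile ζ N (1 - 1 / L) 0.51 Q) v)} =
          ENNReal.ofReal ((tailWeight (ζ (j + 1)) - tailWeight (ζ j)) *
            tailProb d k (1 - 1 / L) (profile ζ N (1 - 1 / L) 0.51 Q) (ζ j)) := fun j => by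
        rw [ENNReal.ofReal_mul (hΔ j), tailProb, ofReal_measureReal]
      rw [Finset.sum_congr rfl fun j _ => hconv j, ← ENNReal.ofReal_sum_of_nonneg fun j _ =>
        mul_nonneg (hΔ j) (tailProb_nonneg _ _ _ _ _), ENNReal.ofReal_le_ofReal_iff (by positivity)] at hsum
      have hsum2 : ∑ j ∈ Finset.range N, (tailWeight (ζ (j + 1)) - tailWeight (ζ j)) *
          (1e-6 / L + 1e-7 / L) ≤ 1e-6 / L + 1e-7 / L := by
        rw [← Finset.sum_mul, Finset.sum_range_sub (fun j => tailWeight (ζ j))]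
        refine mul_le_of_le_one_left (by positivity) ?_
        linarith [tailWeight_le_one (hζ0 N).le (hζ1 N), tailWeight_nonneg (hζ0 0).le (hζ1 0)]
      simp_rw [add_assoc, mul_add _ (tailProb _ _ _ _ _), Finset.sum_add_distrib]
      have heq : 1.001 * 1.054 * (((k : ℝ) - 1) * (d * (((k : ℝ) - 1)⁻¹ *
          (1 + 4 * ((k : ℝ) - 1)⁻¹) * I) * Real.exp (d * (((k : ℝ) - 1)⁻¹ * x)))) =
          1.001 * 1.054 * (1 + 4 * ((k : ℝ) - 1)⁻¹) * (d * ((k : ℝ) - 1)⁻¹ * B₁) * I := by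
        rw [hB₁def]; ring
      rw [heq] at hsum
      have hfac : 1.001 * 1.054 * (1 + 4 * ((k : ℝ) - 1)⁻¹) * (d * ((k : ℝ) - 1)⁻¹ * B₁) * I ≤
          1.001 * 1.054 * 1.0001 * 0.945 * I := by
        gcongr
        norm_num at hκ ⊢; linarith
      -- The contraction: `1.001 * 1.054 * 1.0001 * 0.945` is about `0.9971`. The remaining `2.8e-6
      -- / L` covers the lowest weight, the margin and the rounding.
      have hfin : 1e-6 / L + (1.001 * 1.054 * 1.0001 * 0.945 * I + (1e-6 / L + 1e-7 / L)) ≤ I := by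
        rw [hIdef, show 1e-6 / L + (1.001 * 1.054 * 1.0001 * 0.945 * (1e-3 / L) +
          (1e-6 / L + 1e-7 / L)) =
          (1e-6 + (1.001 * 1.054 * 1.0001 * 0.945 * 1e-3 + (1e-6 + 1e-7))) / L by ring]
        gcongr
        norm_num
      linarith)
  -- Both atypical events have probability of order `1 / L ^ 2`, negligible against `1 / L` since `L
  -- ≥ 10 ^ 9`.
  have hB : B₀ ^ 2 + 4 * B₀ * B₁ ≤ 1e-7 / L := by
    have h1 : B₀ ≤ 2 * (1 / L) := hB₀.trans (by
      rw [← mul_div_assoc]; gcongr; norm_num)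
    calc B₀ ^ 2 + 4 * B₀ * B₁ ≤ (2 * (1 / L)) ^ 2 + 4 * (2 * (1 / L)) * (1 / L) := by gcongr
      _ = 12 * (1 / L) * (1 / L) := by ring
      _ ≤ 12 * 1e-9 * (1 / L) := by gcongr
      _ ≤ 1e-7 * (1 / L) := by gcongr; norm_num
      _ = _ := by ring
  refine ⟨_, isDominated_profile hk d hζ0 hζb hζ hmono hζN
    (hζ00.trans ?_) ha0 (by linarith) hQ hQ0 hQa hQI ?_ hx1
    (hmom Q hQ hQ0 hQa hQI) (by positivity) hQP ?_ ?_⟩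
  · calc 1e-6 / L = 1e-6 * (1 / L) := by ring
      _ ≤ 1e-6 * 1e-9 := by gcongr
      _ ≤ _ := by norm_num
  · have : I ≤ 1e-3 * 1e-9 := by
      calc I = 1e-3 * (1 / L) := by rw [hIdef]; ring
        _ ≤ _ := by gcongr
    have h2 : (0.51 : ℝ) * (1 / 2) ≤ 0.51 * (1 - 1 / L) := by gcongr; linarith
    norm_num at h2 this ⊢
    linarith
  · calc _ ≤ 1e-7 / L + 1e-7 / L := by gcongr
      _ = (1e-7 + 1e-7) / L := by ring
      _ ≤ _ := by gcongr; norm_num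
  · calc _ ≤ (1 + 2e-7) / L + (1e-7 / L + 1e-7 / L) := by gcongr
      _ = (1 + 2e-7 + (1e-7 + 1e-7)) / L := by ring
      _ ≤ (1 + 1e-6) / L := div_le_div_of_nonneg_right (by norm_num) hL0.le
      _ = _ := by ring

/-- In the limit `k → ∞` the likelihood at `0.51` tends to `0.51`, and with `r = 0.51 ^ (1 / 4) ≈
0.845` the left side tends to `r - 1 + 0.51 * (1 / r - 1)`, slightly below `-0.061`. -/
theorem eventually_likelihood_bound :
    ∀ᶠ k : ℕ in Filter.atTop, (1 - 0.51) * (likelihood k 0.51 ^ (1 / 4 : ℝ) - 1) +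
      0.51 * ((1 - ((k : ℝ) - 1)⁻¹) * (likelihood k 0.51 ^ (1 / 4 : ℝ) - 1) +
        ((likelihood k 0.51)⁻¹ ^ (1 / 4 : ℝ) - 1)) ≤ (0.939 - 1 : ℝ) := by
  have h1 : Filter.Tendsto (fun k : ℕ => ((k : ℝ) - 1)⁻¹) Filter.atTop (nhds 0) :=
    (Filter.tendsto_atTop_add_const_right _ (-1) tendsto_natCast_atTop_atTop).inv_tendsto_atTop
  have h2 : Filter.Tendsto (fun k : ℕ => likelihood k 0.51) Filter.atTop (nhds 0.51) := by
    have : Filter.Tendsto (fun k : ℕ => 0.51 / (1 - 0.51 * ((k : ℝ) - 1)⁻¹)) Filter.atTop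
        (nhds (0.51 / (1 - 0.51 * 0))) :=
      tendsto_const_nhds.div (tendsto_const_nhds.sub (h1.const_mul _)) (by norm_num)
    simpa [likelihood, div_eq_mul_inv] using this
  have h3 : Filter.Tendsto (fun k : ℕ => likelihood k 0.51 ^ (1 / 4 : ℝ)) Filter.atTop
      (nhds ((0.51 : ℝ) ^ (1 / 4 : ℝ))) := h2.rpow_const (Or.inl (by norm_num))
  have h4 : Filter.Tendsto (fun k : ℕ => (likelihood k 0.51)⁻¹ ^ (1 / 4 : ℝ)) Filter.atTop
      (nhds ((0.51 : ℝ)⁻¹ ^ (1 / 4 : ℝ))) :=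
    (h2.inv₀ (by norm_num)).rpow_const (Or.inl (by norm_num))
  have h5 := ((h3.sub_const 1).const_mul (1 - 0.51)).add
    ((((tendsto_const_nhds (x := (1 : ℝ))).sub h1).mul (h3.sub_const 1)).add
      (h4.sub_const 1) |>.const_mul 0.51)
  refine h5.eventually_le_const ?_
  have hr1 : (0.51 : ℝ) ^ (1 / 4 : ℝ) ≤ 0.8452 := by
    calc (0.51 : ℝ) ^ (1 / 4 : ℝ) ≤ ((0.8452 : ℝ) ^ (4 : ℕ)) ^ (1 / 4 : ℝ) :=
          Real.rpow_le_rpow (by norm_num) (by norm_num) (by norm_num)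
      _ = 0.8452 := by rw [← Real.rpow_natCast, ← Real.rpow_mul (by norm_num)]; norm_num
  have hr2 : (0.51 : ℝ)⁻¹ ^ (1 / 4 : ℝ) ≤ 1 / 0.845 := by
    calc (0.51 : ℝ)⁻¹ ^ (1 / 4 : ℝ) ≤ ((1 / 0.845 : ℝ) ^ (4 : ℕ)) ^ (1 / 4 : ℝ) :=
          Real.rpow_le_rpow (by norm_num) (by norm_num) (by norm_num)
      _ = 1 / 0.845 := by rw [← Real.rpow_natCast, ← Real.rpow_mul (by norm_num)]; norm_num
  norm_num at hr1 hr2 ⊢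
  linarith

/-- `t * exp (-t * q)` decreases once `t * q ≥ 1`. This reduces every larger degree to the threshold
degree. -/
theorem mul_exp_neg_le {t t₀ q : ℝ} (h0 : 0 < t₀) (ht : t₀ ≤ t) (hq : 1 ≤ q * t₀) :
    t * Real.exp (-(t * q)) ≤ t₀ * Real.exp (-(t₀ * q)) := by
  have h1 : t ≤ t₀ * Real.exp ((t - t₀) * q) := by
    have h2 := Real.add_one_le_exp ((t - t₀) * q)
    have h3 : t ≤ t₀ * ((t - t₀) * q + 1) := by nlinarith
    exact h3.trans (mul_le_mul_of_nonneg_left h2 h0.le)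
  calc t * Real.exp (-(t * q)) ≤ t₀ * Real.exp ((t - t₀) * q) * Real.exp (-(t * q)) := by gcongr
    _ = t₀ * Real.exp (-(t₀ * q)) := by
      rw [mul_assoc, ← Real.exp_add]; congr 2; ring

/-- At the threshold `t₀ = L + log L + 1 - 1e-7` the factor `k * exp (-t₀)` is `exp (-(1 - 1e-7)) /
L`. The core and the tail terms then multiply it by `exp 1` and `L * exp 0.942`, up to `log L / L`.
-/
theorem exists_isDominated :
    ∃ k₀ : ℕ, ∀ (k : ℕ) [NeZero k], k₀ < k → ∀ d : ℝ≥0,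
      (k : ℝ) * (Real.log k + Real.log (Real.log k) + (1 - 1e-7)) ≤ d →
        ∃ μ : Measure ℝ, IsDominated 1e-7 k d μ := by
  have hlog : Filter.Tendsto (fun k : ℕ => Real.log k) Filter.atTop Filter.atTop :=
    Real.tendsto_log_atTop.comp tendsto_natCast_atTop_atTop
  have hinv : Filter.Tendsto (fun k : ℕ => 4 * ((k : ℝ) - 1)⁻¹) Filter.atTop (nhds 0) := by
    simpa [sub_eq_add_neg] using ((Filter.tendsto_atTop_add_const_right _ (-1 : ℝ)
      (tendsto_natCast_atTop_atTop (R := ℝ))).inv_tendsto_atTop).const_mul 4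
  have hloglog : Filter.Tendsto (fun k : ℕ => Real.log (Real.log k) / Real.log k) Filter.atTop
      (nhds 0) := Real.isLittleO_log_id_atTop.tendsto_div_nhds_zero.comp hlog
  obtain ⟨k₀, hk₀⟩ := Filter.eventually_atTop.1 (((hlog.eventually_ge_atTop (10 ^ 9)).and
    (hinv.eventually_le_const (show (0 : ℝ) < 1e-4 by norm_num))).and
    ((hloglog.eventually_le_const (show (0 : ℝ) < 4e-8 by norm_num)).and
    (eventually_likelihood_bound.and (Filter.eventually_ge_atTop 4))))
  refine ⟨k₀, fun k _ hk d hd => ?_⟩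
  obtain ⟨⟨hL, hκ⟩, hll, hU, hk4⟩ := hk₀ k hk.le
  have hk' : (4 : ℝ) ≤ k := by exact_mod_cast hk4
  have hk0 : (0 : ℝ) < k := by linarith
  have hκ0 : (0 : ℝ) < (k : ℝ) - 1 := by linarith
  have hexpL : Real.exp (Real.log k) = k := Real.exp_log hk0
  set L := Real.log k with hLdef
  have hL0 : 0 < L := by linarith
  have hexpll : Real.exp (Real.log L) = L := Real.exp_log hL0
  have hll0 : 0 ≤ Real.log L := Real.log_nonneg (by linarith)
  set y := Real.log L + (1 - 1e-7) with hy
  have hy0 : 0 ≤ y := by norm_num at hy; linarith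
  have hyL : y / L ≤ 5e-8 := by
    rw [div_le_iff₀ hL0] at hll ⊢
    norm_num at hll hy ⊢
    linarith
  set t₀ := L + y with ht₀
  have ht₀L : L ≤ t₀ := by linarith
  have ht₀0 : 0 < t₀ := by linarith
  set t := (d : ℝ) * ((k : ℝ) - 1)⁻¹ with htdef
  have ht : t₀ ≤ t := by
    rw [htdef, ← div_eq_mul_inv, le_div_iff₀ hκ0]
    calc t₀ * ((k : ℝ) - 1) ≤ t₀ * k := by gcongr; linarith
      _ = k * (L + Real.log L + (1 - 1e-7)) := by rw [ht₀, hy]; ring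
      _ ≤ d := hd
  have hLi : 1 / L ≤ 1e-9 := by
    rw [div_le_iff₀ hL0]; norm_num; linarith
  have hLi1 : 1 / L ≤ 1 / 2 := hLi.trans (by norm_num)
  have hLi0 : 0 < 1 / L := by positivity
  have hqt : 1 ≤ (1 - 0.942 / L) * t₀ := by
    have : 0.942 / L ≤ 1 / L := by gcongr; norm_num
    have h2 : (1 : ℝ) / 2 ≤ 1 - 0.942 / L := by linarith
    nlinarith
  -- The multiplier is about `exp (0.942 - 1) = exp (-0.058)`; the errors `1e-7` and those from `y /
  -- L ≤ 5e-8` keep it below `0.945`.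
  have htB₁ : t * (((k : ℝ) - 1) * Real.exp (d * (((k : ℝ) - 1)⁻¹ * (-1 + 0.942 / L)))) ≤ 0.945 := by
    have h1 := mul_exp_neg_le ht₀0 ht hqt
    have hexp : Real.exp (1e-7 + 0.942 * (5e-8) - 0.058) ≤ 0.9448 := by
      have h2 := Real.quadratic_le_exp_of_nonneg (x := 0.0579) (by norm_num)
      have h3 : Real.exp (1e-7 + 0.942 * (5e-8) - 0.058) ≤ Real.exp (-0.0579) :=
        Real.exp_le_exp.2 (by norm_num)
      rw [Real.exp_neg] at h3
      refine h3.trans (inv_le_of_inv_le₀ (by norm_num) (le_trans ?_ h2))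
      norm_num
    calc t * (((k : ℝ) - 1) * Real.exp (d * (((k : ℝ) - 1)⁻¹ * (-1 + 0.942 / L))))
        = ((k : ℝ) - 1) * (t * Real.exp (-(t * (1 - 0.942 / L)))) := by
          rw [htdef]; ring_nf
      _ ≤ k * (t₀ * Real.exp (-(t₀ * (1 - 0.942 / L)))) := by
          gcongr; linarith
      _ = (1 + y / L) * (k * (L * Real.exp (-(t₀ * (1 - 0.942 / L))))) := by
          rw [ht₀]; field_simp
      _ = (1 + y / L) * Real.exp (1e-7 + 0.942 * (y / L) - 0.058) := by
          nth_rw 1 [← hexpL]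
          nth_rw 3 [← hexpll]
          rw [← Real.exp_add, ← Real.exp_add]
          congr 2
          rw [ht₀, hy]
          field_simp
          ring
      _ ≤ (1 + 5e-8) * 0.9448 := by
          refine mul_le_mul (by linarith) (le_trans (Real.exp_le_exp.2 ?_) hexp)
            (Real.exp_pos _).le (by norm_num)
          gcongr
      _ ≤ 0.945 := by norm_num
  refine exists_isDominated_of_bounds hk4 d hL hκ hU ?_ ?_ htB₁
  -- The expected number of rivals times `L` is `exp (1e-7 + y / L)`: shifting the degree below the
  -- critical value costs `1e-7`, the finite size of `L` at most `5e-8`.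
  · have h1 : Real.exp (1e-7 + y / L) ≤ 1 + 2e-7 := by
      have h2 := Real.add_one_le_exp (-(1e-7 + y / L))
      rw [Real.exp_neg] at h2
      have h3 : 1 - 1.5e-7 ≤ (Real.exp (1e-7 + y / L))⁻¹ := by
        refine le_trans ?_ h2
        norm_num at hyL ⊢; linarith
      exact (inv_le_inv₀ (by norm_num) (Real.exp_pos _)).1
        ((by norm_num : (1 + 2e-7 : ℝ)⁻¹ ≤ 1 - 1.5e-7).trans h3)
    rw [le_div_iff₀ hL0]
    calc ((k : ℝ) - 1) * Real.exp (-(d * (((k : ℝ) - 1)⁻¹ * (1 - 1 / L)))) * L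
        = ((k : ℝ) - 1) * Real.exp (-(t * (1 - 1 / L))) * L := by rw [htdef]; ring_nf
      _ ≤ k * Real.exp (-(t₀ * (1 - 1 / L))) * L := by
          have : 0 ≤ 1 - 1 / L := by linarith
          gcongr; linarith
      _ = Real.exp (1e-7 + y / L) := by
          nth_rw 1 [← hexpL]
          nth_rw 3 [← hexpll]
          rw [← Real.exp_add, ← Real.exp_add]
          congr 1
          rw [ht₀, hy]
          field_simp
          ring
      _ ≤ _ := h1
  -- Dividing the bound for `t * B₁` by `t ≥ L` gives the bound for `B₁` itself.
  · have h1 : L ≤ t := ht₀L.trans ht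
    rw [le_div_iff₀ hL0, mul_comm]
    have h2 : 0 ≤ ((k : ℝ) - 1) * Real.exp (d * (((k : ℝ) - 1)⁻¹ * (-1 + 0.942 / L))) := by
      positivity
    refine (mul_le_mul_of_nonneg_right h1 h2).trans (htB₁.trans (by norm_num))

end Existence

end TreeColouring
end
noncomputable section
namespace TreeColouring

/-! ### Splitting a tree at its root -/

section Split

variable {k d n : ℕ} {X : Type*}

/-- The labelling of the tree of height `n + 1` with label `x` at the root and `f i` on the `i`-th
principal subtree. -/
def joinTree (x : X) (f : Fin d → Vertex d n → X) : Vertex d (n + 1) → X := fun v =>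
  match v with
  | ⟨[], _⟩ => x
  | ⟨i :: w, h⟩ => f i ⟨w, Nat.le_of_succ_le_succ h⟩

@[simp] theorem joinTree_root (x : X) (f : Fin d → Vertex d n → X) :
    joinTree x f (root d (n + 1)) = x := rfl

@[simp] theorem joinTree_below (x : X) (f : Fin d → Vertex d n → X) (i : Fin d) (w : Vertex d n) :
    joinTree x f (w.below i) = f i w := rfl

theorem joinTree_split (σ : Vertex d (n + 1) → X) :
    joinTree (σ (root d (n + 1))) (fun i w => σ (w.below i)) = σ := by
  ext ⟨v, hv⟩
  cases v <;> rfl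

/-- The root and the principal subtrees exhaust the tree. -/
def vertexEquiv (d n : ℕ) : Option (Fin d × Vertex d n) ≃ Vertex d (n + 1) where
  toFun o := o.elim (root d (n + 1)) fun p => p.2.below p.1
  invFun v := joinTree none (fun i w => some (i, w)) v
  left_inv o := by cases o <;> rfl
  right_inv v := by
    obtain ⟨v, hv⟩ := v
    cases v <;> rfl

theorem measurable_joinTree [MeasurableSpace X] :
    Measurable fun p : X × (Fin d → Vertex d n → X) => joinTree p.1 p.2 := by
  refine measurable_pi_lambda _ fun v => ?_
  obtain ⟨v, hv⟩ := v
  cases v with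
  | nil => exact measurable_fst
  | cons i w => exact (measurable_pi_apply _).comp ((measurable_pi_apply i).comp measurable_snd)

theorem map_joinTree [MeasurableSpace X] (ν : Measure X) [IsProbabilityMeasure ν] :
    (ν.prod (Measure.pi fun _ : Fin d => Measure.pi fun _ : Vertex d n => ν)).map
      (fun p => joinTree p.1 p.2) = Measure.pi fun _ => ν := by
  refine (Measure.pi_eq fun s hs => ?_).symm
  rw [Measure.map_apply measurable_joinTree (MeasurableSet.univ_pi hs)]
  have : (fun p : X × (Fin d → Vertex d n → X) => joinTree p.1 p.2) ⁻¹' Set.univ.pi s =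
      s (root d (n + 1)) ×ˢ Set.univ.pi fun i => Set.univ.pi fun w : Vertex d n => s (w.below i) := by
    ext ⟨x, f⟩
    simp only [Set.mem_preimage, Set.mem_pi, Set.mem_univ, true_imp_iff, Set.mem_prod]
    constructor
    · exact fun h => ⟨h (root d (n + 1)), fun i w => h (w.below i)⟩
    · rintro ⟨h1, h2⟩ ⟨v, hv⟩
      cases v with
      | nil => exact h1
      | cons i w => exact h2 i ⟨w, Nat.le_of_succ_le_succ hv⟩
  rw [this, Measure.prod_prod, Measure.pi_pi, ← (vertexEquiv d n).prod_comp, Fintype.prod_option,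
    Fintype.prod_prod_type]
  simp_rw [Measure.pi_pi]
  rfl

theorem joinTree_mem_properColourings (c : Fin k) (f : Fin d → Vertex d n → Fin k) :
    joinTree c f ∈ properColourings k d (n + 1) ↔
      ∀ i, f i ∈ properColourings k d n ∧ f i (root d n) ≠ c := by
  constructor
  · intro h i
    refine ⟨fun v w ⟨j, hj⟩ => h (v.below i) (w.below i) ⟨j, ?_⟩, fun hc => ?_⟩
    · change i :: w.1 = i :: v.1 ++ [j]
      rw [hj]; rfl
    · exact h (root d (n + 1)) ((root d n).below i) ⟨i, rfl⟩ hc.symm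
  · rintro h ⟨v, hv⟩ ⟨w, hw⟩ ⟨j, hj⟩
    replace hj : w = v ++ [j] := hj
    subst hj
    cases v with
    | nil => exact fun he => (h j).2 he.symm
    | cons i v => exact (h i).1 ⟨v, _⟩ ⟨v ++ [j], _⟩ ⟨j, rfl⟩

theorem properColourings_nonempty (hk : 2 ≤ k) (d n : ℕ) : (properColourings k d n).Nonempty := by
  -- The parity of the level is a proper colouring with two colours.
  refine ⟨fun v => ⟨v.1.length % 2, by omega⟩, fun v w ⟨i, hi⟩ h => ?_⟩
  have h2 := congrArg Fin.val h
  simp only [hi, List.length_append, List.length_singleton] at h2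
  omega

theorem isProbabilityMeasure_colouringMeasure (hk : 2 ≤ k) (d n : ℕ) :
    IsProbabilityMeasure (colouringMeasure k d n) :=
  isProbabilityMeasure_uniformOn (Set.toFinite _) (properColourings_nonempty hk d n)

theorem isProbabilityMeasure_law (hk : 2 ≤ k) (d n : ℕ) (ξ : Measure ℕ) [IsProbabilityMeasure ξ] :
    IsProbabilityMeasure (law k d n ξ) := by
  have := isProbabilityMeasure_colouringMeasure hk d n
  unfold law; infer_instance

open scoped Classical in
theorem colouringMeasure_singleton (σ : Vertex d n → Fin k) :
    colouringMeasure k d n {σ} =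
      if σ ∈ properColourings k d n then (Measure.count (properColourings k d n))⁻¹ else 0 := by
  rw [colouringMeasure, uniformOn, cond_apply (Set.toFinite _).measurableSet]
  split_ifs with h
  · rw [Set.inter_eq_self_of_subset_right (Set.singleton_subset_iff.2 h), Measure.count_singleton,
      mul_one]
  · rw [Set.inter_singleton_eq_empty.2 h, measure_empty, mul_zero]

/-- The number by which the laws of the colourings of the principal subtrees, conditioned to avoid
the colour of the root, have to be multiplied. -/
def splitConst (k d n : ℕ) : ℝ≥0∞ :=
  (Measure.count (properColourings k d (n + 1)))⁻¹ * Measure.count (properColourings k d n) ^ d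

/-- A colouring is proper exactly if its restrictions to the principal subtrees are proper and avoid
the colour of the root at their own roots. So, given the root colour, uniform counting measure
factorises over the subtrees; `splitConst` converts the normalisations. -/
theorem lintegral_colouringMeasure_succ (hk : 2 ≤ k) (F : (Vertex d (n + 1) → Fin k) → ℝ≥0∞) :
    ∫⁻ σ, F σ ∂(colouringMeasure k d (n + 1)) = splitConst k d n *
      ∑ c, ∫⁻ f, F (joinTree c f) ∂(Measure.pi fun _ : Fin d =>
        (colouringMeasure k d n).restrict {σ | σ (root d n) ≠ c}) := by
  classical
  have hprob := isProbabilityMeasure_colouringMeasure hk d n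
  rw [lintegral_fintype, Finset.mul_sum]
  have hN0 : Measure.count (properColourings k d n) ≠ 0 := by
    rw [Measure.count_ne_zero_iff]; exact properColourings_nonempty hk d n
  have hNt : Measure.count (properColourings k d n) ≠ ∞ :=
    (Measure.count_apply_lt_top.2 (Set.toFinite _)).ne
  have hsing : ∀ c (f : Fin d → Vertex d n → Fin k), (Measure.pi fun _ : Fin d =>
      (colouringMeasure k d n).restrict {σ | σ (root d n) ≠ c}) {f} =
      if joinTree c f ∈ properColourings k d (n + 1) then
        (Measure.count (properColourings k d n))⁻¹ ^ d else 0 := by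
    intro c f
    have h1 : ∀ i, (colouringMeasure k d n).restrict {σ | σ (root d n) ≠ c} {f i} =
        if f i ∈ properColourings k d n ∧ f i (root d n) ≠ c then
          (Measure.count (properColourings k d n))⁻¹ else 0 := by
      intro i
      rw [Measure.restrict_apply (measurableSet_singleton _)]
      by_cases hc : f i (root d n) ≠ c
      · rw [Set.inter_eq_self_of_subset_left (Set.singleton_subset_iff.2 hc),
          colouringMeasure_singleton]
        simp [hc]
      · rw [Set.singleton_inter_eq_empty.2 hc, measure_empty, if_neg (fun h => hc h.2)]
    rw [Measure.pi_singleton, joinTree_mem_properColourings]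
    simp_rw [h1]
    split_ifs with h
    · rw [Finset.prod_congr rfl fun i _ => if_pos (h i)]; simp
    · push Not at h
      obtain ⟨i, hi⟩ := h
      refine Finset.prod_eq_zero (Finset.mem_univ i) (if_neg fun h2 => h2.2 (hi h2.1))
  let e : (Vertex d (n + 1) → Fin k) ≃ Fin k × (Fin d → Vertex d n → Fin k) :=
    { toFun := fun σ => (σ (root d (n + 1)), fun i w => σ (w.below i))
      invFun := fun p => joinTree p.1 p.2
      left_inv := joinTree_split
      right_inv := fun p => rfl }
  rw [← e.symm.sum_comp, Fintype.sum_prod_type]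
  refine Finset.sum_congr rfl fun c _ => ?_
  rw [lintegral_fintype, Finset.mul_sum]
  refine Finset.sum_congr rfl fun f _ => ?_
  change F (joinTree c f) * colouringMeasure k d (n + 1) {joinTree c f} = _
  rw [hsing, colouringMeasure_singleton, splitConst]
  split_ifs
  · rw [mul_left_comm, mul_assoc, ← mul_pow, ENNReal.mul_inv_cancel hN0 hNt]; simp
  · simp

end Split

end TreeColouring
end
noncomputable section
namespace TreeColouring

/-! ### The joint law of colours and randomness, split at the root -/

section LawSplit

variable {k d n : ℕ}

/-- The law of the random variables other than the colour at a single vertex. -/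
def siteLaw (ξ : Measure ℕ) : Measure (Seed × ℕ) :=
  (Measure.pi fun _ => (volume : Measure unitInterval)).prod ξ

instance (ξ : Measure ℕ) [IsProbabilityMeasure ξ] : IsProbabilityMeasure (siteLaw ξ) := by
  unfold siteLaw; infer_instance

/-- The outcome with given colours and given random variables at the vertices. -/
def toOutcome (p : (Vertex d n → Fin k) × (Vertex d n → Seed × ℕ)) : Outcome k d n :=
  (p.1, fun v => (p.2 v).1, fun v => (p.2 v).2)

theorem measurable_toOutcome : Measurable (toOutcome : _ → Outcome k d n) := by
  unfold toOutcome; fun_prop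

theorem law_eq_map (k d n : ℕ) (ξ : Measure ℕ) [IsProbabilityMeasure ξ] :
    law k d n ξ = ((colouringMeasure k d n).prod (Measure.pi fun _ => siteLaw ξ)).map toOutcome := by
  have : IsFiniteMeasure (colouringMeasure k d n) := by
    unfold colouringMeasure; infer_instance
  have h := (measurePreserving_arrowProdEquivProdArrow Seed ℕ (Vertex d n)
    (fun _ => Measure.pi fun _ => (volume : Measure unitInterval)) (fun _ => ξ)).map_eq
  rw [law, ← h]
  conv_lhs => rw [← Measure.map_id (μ := colouringMeasure k d n)]
  rw [Measure.map_prod_map _ _ measurable_id (MeasurableEquiv.measurable _)]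
  rfl

/-- The restriction of an outcome to a principal subtree. -/
def subOutcome (ω : Outcome k d (n + 1)) (i : Fin d) : Outcome k d n :=
  (fun w => ω.1 (w.below i), fun w => ω.2.1 (w.below i), fun w => ω.2.2 (w.below i))

theorem measurable_subOutcome : Measurable (subOutcome : Outcome k d (n + 1) → _) := by
  unfold subOutcome; fun_prop

theorem measurable_rootColour : Measurable (rootColour : Outcome k d n → Fin k) := by
  unfold rootColour; fun_prop

theorem measurableSet_rootColour_ne (c : Fin k) :
    MeasurableSet {ω : Outcome k d n | rootColour ω ≠ c} :=
  (measurable_rootColour (measurableSet_singleton c)).compl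

theorem law_restrict_rootColour_ne (ξ : Measure ℕ) [IsProbabilityMeasure ξ] (c : Fin k) :
    (law k d n ξ).restrict {ω | rootColour ω ≠ c} =
      (((colouringMeasure k d n).restrict {σ | σ (root d n) ≠ c}).prod
        (Measure.pi fun _ => siteLaw ξ)).map toOutcome := by
  have : IsFiniteMeasure (colouringMeasure k d n) := by
    unfold colouringMeasure; infer_instance
  rw [law_eq_map, Measure.restrict_map measurable_toOutcome (measurableSet_rootColour_ne c)]
  congr 1
  conv_rhs => rw [← Measure.restrict_univ (μ := Measure.pi fun _ : Vertex d n => siteLaw ξ)]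
  rw [Measure.prod_restrict]
  congr 1
  ext p
  simp [toOutcome, rootColour]

theorem lintegral_pi_toOutcome (ξ : Measure ℕ) [IsProbabilityMeasure ξ] (c : Fin k)
    {H : (Fin d → Outcome k d n) → ℝ≥0∞} (hH : Measurable H) :
    ∫⁻ ω, H ω ∂(Measure.pi fun _ : Fin d => (law k d n ξ).restrict {ω | rootColour ω ≠ c}) =
      ∫⁻ f, ∫⁻ g, H (fun i => toOutcome (f i, g i))
        ∂(Measure.pi fun _ : Fin d => Measure.pi fun _ : Vertex d n => siteLaw ξ)
        ∂(Measure.pi fun _ : Fin d =>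
          (colouringMeasure k d n).restrict {σ | σ (root d n) ≠ c}) := by
  have : IsFiniteMeasure (colouringMeasure k d n) := by
    unfold colouringMeasure; infer_instance
  set m := (colouringMeasure k d n).restrict {σ | σ (root d n) ≠ c}
  set τ := Measure.pi fun _ : Vertex d n => siteLaw ξ
  have hH2 : Measurable fun z : Fin d → (Vertex d n → Fin k) × (Vertex d n → Seed × ℕ) =>
      H fun i => toOutcome (z i) :=
    hH.comp (measurable_pi_lambda _ fun i => measurable_toOutcome.comp (measurable_pi_apply i))
  rw [law_restrict_rootColour_ne]
  have hpi := Measure.pi_map_pi (μ := fun _ : Fin d => m.prod τ)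
    (f := fun _ => (toOutcome : _ → Outcome k d n)) (fun _ => measurable_toOutcome.aemeasurable)
  rw [← hpi]
  refine (lintegral_map hH (measurable_pi_lambda _ fun i =>
    measurable_toOutcome.comp (measurable_pi_apply i))).trans ?_
  have h := (measurePreserving_arrowProdEquivProdArrow _ _ (Fin d) (fun _ => m) (fun _ => τ)).symm
  exact (h.lintegral_comp hH2).symm.trans (lintegral_prod _ (hH2.comp h.measurable).aemeasurable)

/-- Independence at the root: given the colour `c` of the root, the outcomes on the principal
subtrees are independent copies of `law` restricted to a root colour different from `c`, and
independent of the variables at the root. -/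
theorem lintegral_law_succ (hk : 2 ≤ k) (ξ : Measure ℕ) [IsProbabilityMeasure ξ]
    {Ψ : Fin k → Seed × ℕ → (Fin d → Outcome k d n) → ℝ≥0∞}
    (hΨ : ∀ c, Measurable (Function.uncurry (Ψ c))) :
    ∫⁻ ω, Ψ (rootColour ω) (ω.2.1 (root d (n + 1)), ω.2.2 (root d (n + 1))) (subOutcome ω)
        ∂(law k d (n + 1) ξ) =
      splitConst k d n * ∑ c, ∫⁻ s, ∫⁻ ω, Ψ c s ω
        ∂(Measure.pi fun _ : Fin d => (law k d n ξ).restrict {ω | rootColour ω ≠ c})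
        ∂(siteLaw ξ) := by
  have : ∀ n, IsFiniteMeasure (colouringMeasure k d n) := fun n => by
    unfold colouringMeasure; infer_instance
  have hm : Measurable fun ω : Outcome k d (n + 1) =>
      Ψ (rootColour ω) (ω.2.1 (root d (n + 1)), ω.2.2 (root d (n + 1))) (subOutcome ω) := by
    have h1 : Measurable fun p : Fin k × (Seed × ℕ) × (Fin d → Outcome k d n) =>
        Ψ p.1 p.2.1 p.2.2 := measurable_from_prod_countable_right fun c => hΨ c
    have h2 : Measurable fun ω : Outcome k d (n + 1) => (rootColour ω,
        ((ω.2.1 (root d (n + 1)), ω.2.2 (root d (n + 1))), subOutcome ω)) :=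
      measurable_rootColour.prodMk (Measurable.prodMk (by fun_prop) measurable_subOutcome)
    exact h1.comp h2
  rw [law_eq_map]
  refine (lintegral_map hm measurable_toOutcome).trans
    ((lintegral_prod _ (hm.comp measurable_toOutcome).aemeasurable).trans
      ((lintegral_colouringMeasure_succ hk _).trans ?_))
  congr 1
  refine Finset.sum_congr rfl fun c _ => ?_
  have hz : Measurable fun p : ((Fin d → Vertex d n → Fin k) × (Seed × ℕ)) ×
      (Fin d → Vertex d n → Seed × ℕ) =>
      Ψ c p.1.2 (fun i => toOutcome (p.1.1 i, p.2 i)) := by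
    refine (hΨ c).comp (Measurable.prodMk (by fun_prop) (measurable_pi_lambda _ fun i =>
      measurable_toOutcome.comp (by fun_prop)))
  have h1 : ∀ f : Fin d → Vertex d n → Fin k,
      ∫⁻ t, Ψ (rootColour (toOutcome (joinTree c f, t)))
        ((toOutcome (joinTree c f, t)).2.1 (root d (n + 1)),
          (toOutcome (joinTree c f, t)).2.2 (root d (n + 1)))
        (subOutcome (toOutcome (joinTree c f, t))) ∂(Measure.pi fun _ => siteLaw ξ) =
      ∫⁻ s, ∫⁻ g, Ψ c s (fun i => toOutcome (f i, g i))
        ∂(Measure.pi fun _ : Fin d => Measure.pi fun _ : Vertex d n => siteLaw ξ)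
        ∂(siteLaw ξ) := by
    intro f
    have hmf : Measurable fun t : Vertex d (n + 1) → Seed × ℕ => toOutcome (joinTree c f, t) :=
      measurable_toOutcome.comp (measurable_const.prodMk measurable_id)
    rw [← map_joinTree]
    exact (lintegral_map (hm.comp hmf) measurable_joinTree).trans
      (lintegral_prod _ ((hm.comp hmf).comp measurable_joinTree).aemeasurable)
  have hsw := lintegral_lintegral_swap (μ := Measure.pi fun _ : Fin d =>
    (colouringMeasure k d n).restrict {σ | σ (root d n) ≠ c}) (ν := siteLaw ξ)
    (f := fun f s => ∫⁻ g, Ψ c s (fun i => toOutcome (f i, g i))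
        ∂(Measure.pi fun _ : Fin d => Measure.pi fun _ : Vertex d n => siteLaw ξ))
    hz.lintegral_prod_right'.aemeasurable
  refine (lintegral_congr h1).trans (hsw.trans (lintegral_congr fun s => ?_))
  exact (lintegral_pi_toOutcome ξ c ((hΨ c).comp (measurable_const.prodMk measurable_id))).symm

end LawSplit

end TreeColouring
end
noncomputable section
namespace TreeColouring

/-! ### The distributional transform and the reduction of one law to another -/

section Rank

/-- The distributional transform: the randomised rank of `y` with respect to `μ`. -/
def rank (μ : Measure ℝ) (y u : ℝ) : ℝ :=
  μ.real (Set.Iio y) + u * (μ.real (Set.Iic y) - μ.real (Set.Iio y))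

variable {μ : Measure ℝ} [IsProbabilityMeasure μ]

theorem real_Iio_le_real_Iic (μ : Measure ℝ) [IsProbabilityMeasure μ] (y : ℝ) :
    μ.real (Set.Iio y) ≤ μ.real (Set.Iic y) :=
  measureReal_mono Set.Iio_subset_Iic_self

theorem rank_le {y u : ℝ} (hu : u ≤ 1) : rank μ y u ≤ μ.real (Set.Iic y) := by
  have := real_Iio_le_real_Iic μ y
  unfold rank; nlinarith

theorem le_rank {y u : ℝ} (hu : 0 ≤ u) : μ.real (Set.Iio y) ≤ rank μ y u := by
  have := real_Iio_le_real_Iic μ y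
  unfold rank; nlinarith

theorem measurable_rank (μ : Measure ℝ) [IsProbabilityMeasure μ] :
    Measurable fun p : ℝ × unitInterval => rank μ p.1 p.2 := by
  have h1 : Measurable fun y => μ.real (Set.Iio y) :=
    Monotone.measurable fun a b hab => measureReal_mono (Set.Iio_subset_Iio hab)
  have h2 : Measurable fun y => μ.real (Set.Iic y) :=
    Monotone.measurable fun a b hab => measureReal_mono (Set.Iic_subset_Iic.2 hab)
  unfold rank
  exact (h1.comp measurable_fst).add ((measurable_subtype_coe.comp measurable_snd).mul
    ((h2.comp measurable_fst).sub (h1.comp measurable_fst)))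

theorem volume_unitInterval_mul_le {m r : ℝ} (hm : 0 < m) (hr0 : 0 ≤ r) (hr : r ≤ m) :
    volume {u : unitInterval | (u : ℝ) * m ≤ r} = ENNReal.ofReal (r / m) := by
  have h : {u : unitInterval | (u : ℝ) * m ≤ r} =
      Set.Iic ⟨r / m, by positivity, (div_le_one hm).2 hr⟩ := by
    ext u
    simp only [Set.mem_ofPred_eq, Set.mem_Iic, ← Subtype.coe_le_coe]
    rw [le_div_iff₀ hm]
  rw [h, unitInterval.volume_Iic]

/-- With `q` the `t`-quantile of `μ`, take everything strictly left of `q` together with the part of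
the atom at `q` that fills the mass up to exactly `t`. Sandwiching this region between strict and
weak sublevel sets of `rank` avoids all case distinctions about atoms and gaps. -/
theorem exists_quantile_region {t : ℝ} (h0 : 0 < t) (h1 : t < 1) :
    ∃ R : Set (ℝ × unitInterval), (μ.prod volume) R = ENNReal.ofReal t ∧
      (∀ p ∈ R, rank μ p.1 p.2 ≤ t) ∧ ∀ p, rank μ p.1 p.2 < t → p ∈ R := by
  have hmono : Monotone fun y => μ.real (Set.Iic y) :=
    fun a b hab => measureReal_mono (Set.Iic_subset_Iic.2 hab)
  set S := {y : ℝ | t ≤ μ.real (Set.Iic y)} with hS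
  have hne : S.Nonempty := by
    obtain ⟨y, hy⟩ := ((tendsto_cdf_atTop μ).eventually_const_le h1).exists
    exact ⟨y, by simpa [hS, ← cdf_eq_real] using hy⟩
  have hbdd : BddBelow S := by
    obtain ⟨y, hy⟩ := ((tendsto_cdf_atBot μ).eventually_lt_const h0).exists
    refine ⟨y, fun z hz => le_of_not_gt fun hzy => ?_⟩
    have h2 : t ≤ μ.real (Set.Iic z) := hz
    have h3 := hmono hzy.le
    simp only at h3
    rw [cdf_eq_real] at hy
    linarith
  set q := sInf S with hq
  have hlt : ∀ y < q, μ.real (Set.Iic y) < t := fun y hy =>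
    not_le.1 fun h => absurd (csInf_le hbdd (show y ∈ S from h)) (not_le.2 hy)
  have hge : t ≤ μ.real (Set.Iic q) := by
    rw [← cdf_eq_real]
    have hc := ((cdf μ).right_continuous q).mono (Set.Ioi_subset_Ici_self)
    refine ge_of_tendsto hc (eventually_nhdsWithin_of_forall fun y hy => ?_)
    obtain ⟨z, hz, hzy⟩ := exists_lt_of_csInf_lt hne (hq ▸ hy : sInf S < y)
    rw [cdf_eq_real]
    exact (show t ≤ μ.real (Set.Iic z) from hz).trans (hmono hzy.le)
  have hIio : μ.real (Set.Iio q) ≤ t := by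
    have hun : Set.Iio q = ⋃ n : ℕ, Set.Iic (q - 1 / ((n : ℝ) + 1)) := by
      ext y
      simp only [Set.mem_Iio, Set.mem_iUnion, Set.mem_Iic]
      constructor
      · intro hy
        obtain ⟨n, hn⟩ := exists_nat_one_div_lt (sub_pos.2 hy)
        exact ⟨n, by linarith⟩
      · rintro ⟨n, hn⟩
        have : 0 < 1 / ((n : ℝ) + 1) := by positivity
        linarith
    have hmon : Monotone fun n : ℕ => Set.Iic (q - 1 / ((n : ℝ) + 1)) := fun a b hab => by
      refine Set.Iic_subset_Iic.2 ?_
      have : 1 / ((b : ℝ) + 1) ≤ 1 / ((a : ℝ) + 1) := by gcongr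
      linarith
    rw [Measure.real, hun, hmon.measure_iUnion]
    refine ENNReal.toReal_le_of_le_ofReal h0.le (iSup_le fun n => ?_)
    rw [← ofReal_measureReal]
    refine ENNReal.ofReal_le_ofReal (hlt _ ?_).le
    have : 0 < 1 / ((n : ℝ) + 1) := by positivity
    linarith
  set g := μ.real (Set.Iio q) with hg
  set m := μ.real (Set.Iic q) - g with hm
  have hmeq : μ.real {q} = m := by
    have hun : Set.Iic q = Set.Iio q ∪ {q} := by simp
    have := measureReal_union (μ := μ) (s₁ := Set.Iio q) (s₂ := {q}) (by simp)
      (measurableSet_singleton q)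
    rw [← hun] at this
    rw [hm, this]; ring
  refine ⟨Set.Iio q ×ˢ Set.univ ∪ {q} ×ˢ {u : unitInterval | (u : ℝ) * m ≤ t - g}, ?_, ?_, ?_⟩
  · rw [measure_union, Measure.prod_prod, Measure.prod_prod, measure_univ, mul_one,
      ← ofReal_measureReal (μ := μ), ← ofReal_measureReal (μ := μ), hmeq, ← hg]
    -- Without an atom at `q` the left part already has mass `t`; otherwise the required portion of
    -- the atom is `(t - g) / m`.
    · rcases (sub_nonneg.2 (real_Iio_le_real_Iic μ q) : 0 ≤ m).eq_or_lt with h | h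
      · have h0 : m = 0 := h.symm
        have : g = t := by linarith
        rw [h0, this]; simp
      · rw [volume_unitInterval_mul_le h (by linarith) (by linarith), ← ENNReal.ofReal_mul h.le,
          ← ENNReal.ofReal_add measureReal_nonneg (mul_nonneg h.le
            (div_nonneg (by linarith) h.le)), mul_div_cancel₀ _ h.ne']
        congr 1; ring
    · refine Set.disjoint_left.2 fun p hp hp' => ?_
      have h1 : p.1 < q := hp.1
      have h2 : p.1 = q := hp'.1
      exact absurd h2 h1.ne
    · refine (measurableSet_singleton q).prod (measurableSet_le ?_ measurable_const)
      exact measurable_subtype_coe.mul_const m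
  · rintro ⟨y, u⟩ (h | h)
    · exact (rank_le u.2.2).trans (hlt y h.1).le
    · obtain ⟨h1, h2⟩ := h
      simp only [Set.mem_singleton_iff] at h1
      subst h1
      change (u : ℝ) * m ≤ t - g at h2
      change g + u * m ≤ t
      linarith
  · rintro ⟨y, u⟩ h
    simp only at h
    rcases lt_trichotomy y q with hy | hy | hy
    · exact Or.inl ⟨hy, Set.mem_univ _⟩
    · right
      subst hy
      refine ⟨rfl, ?_⟩
      change (u : ℝ) * m ≤ t - g
      change g + u * m < t at h
      linarith
    · have h2 : μ.real (Set.Iic q) ≤ μ.real (Set.Iio y) :=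
        measureReal_mono (Set.Iic_subset_Iio.2 hy)
      have h3 := le_rank (μ := μ) (y := y) u.2.1
      linarith

theorem rank_le_one (p : ℝ × unitInterval) : rank μ p.1 p.2 ≤ 1 :=
  (rank_le p.2.2.2).trans measureReal_le_one

/-- The distributional transform is uniform. -/
theorem measure_rank_le {t : ℝ} (h0 : 0 ≤ t) (h1 : t ≤ 1) :
    (μ.prod (volume : Measure unitInterval)) {p | rank μ p.1 p.2 ≤ t} = ENNReal.ofReal t := by
  have hle : ∀ s, 0 < s → s < 1 → (μ.prod (volume : Measure unitInterval))
      {p | rank μ p.1 p.2 < s} ≤ ENNReal.ofReal s := fun s hs0 hs1 => by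
    obtain ⟨R, hR, -, hR2⟩ := exists_quantile_region (μ := μ) hs0 hs1
    rw [← hR]
    exact measure_mono fun p hp => hR2 p hp
  rcases h1.eq_or_lt with rfl | h1
  · rw [show {p : ℝ × unitInterval | rank μ p.1 p.2 ≤ 1} = Set.univ by
      ext p; simpa using rank_le_one p, measure_univ, ENNReal.ofReal_one]
  refine le_antisymm ?_ ?_
  · have hlim : Filter.Tendsto (fun s => ENNReal.ofReal s) (nhdsWithin t (Set.Ioi t))
        (nhds (ENNReal.ofReal t)) :=
      (ENNReal.continuous_ofReal.tendsto t).mono_left nhdsWithin_le_nhds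
    refine ge_of_tendsto hlim ?_
    filter_upwards [Ioo_mem_nhdsGT h1] with s hs
    refine (measure_mono fun p hp => ?_).trans (hle s (h0.trans_lt hs.1) hs.2)
    exact lt_of_le_of_lt hp hs.1
  · rcases h0.eq_or_lt with rfl | h0
    · simp
    · obtain ⟨R, hR, hR1, -⟩ := exists_quantile_region (μ := μ) h0 h1
      rw [← hR]
      exact measure_mono fun p hp => hR1 p hp

end Rank

section Reduce

variable {k : ℕ} [NeZero k] {μ₁ μ : Measure ℝ} [IsProbabilityMeasure μ]
  (hμ : μ (Set.Icc (1 / (k : ℝ)) 1) = 1)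

theorem one_div_natCast_le_one (k : ℕ) [NeZero k] : 1 / (k : ℝ) ≤ 1 := by
  rw [div_le_one (by have := NeZero.pos k; positivity)]
  exact_mod_cast (NeZero.one_le : 1 ≤ k)

include hμ in
-- The quantile function is the lower adjoint of the distribution function; right continuity ensures
-- that the infimum is attained. Everything about `reduceFn` follows from this equivalence.
theorem reduceFn_le_iff {y u : ℝ} (hu : rank μ₁ y u ≤ 1) (x : ℝ) :
    reduceFn k μ₁ μ y u ≤ x ↔ 1 / (k : ℝ) ≤ x ∧ rank μ₁ y u ≤ μ.real (Set.Iic x) := by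
  have hmono : Monotone fun y => μ.real (Set.Iic y) :=
    fun a b hab => measureReal_mono (Set.Iic_subset_Iic.2 hab)
  have hbdd : BddBelow {x : ℝ | 1 / (k : ℝ) ≤ x ∧ rank μ₁ y u ≤ μ.real (Set.Iic x)} :=
    ⟨1 / (k : ℝ), fun x hx => hx.1⟩
  have h1 : μ.real (Set.Iic 1) = 1 := by
    have : μ (Set.Iic 1) = 1 :=
      le_antisymm prob_le_one (hμ.symm.le.trans (measure_mono fun x hx => hx.2))
    rw [Measure.real, this, ENNReal.toReal_one]
  have hne : {x : ℝ | 1 / (k : ℝ) ≤ x ∧ rank μ₁ y u ≤ μ.real (Set.Iic x)}.Nonempty :=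
    ⟨1, one_div_natCast_le_one k, by rw [h1]; exact hu⟩
  change sInf {x : ℝ | 1 / (k : ℝ) ≤ x ∧ rank μ₁ y u ≤ μ.real (Set.Iic x)} ≤ x ↔ _
  constructor
  · intro h
    refine ⟨(le_csInf hne fun x hx => hx.1).trans h, ?_⟩
    rw [← cdf_eq_real μ]
    have hc := ((cdf μ).right_continuous x).mono (Set.Ioi_subset_Ici_self)
    refine ge_of_tendsto hc (eventually_nhdsWithin_of_forall fun z hz => ?_)
    obtain ⟨w, hw, hwz⟩ := exists_lt_of_csInf_lt hne (h.trans_lt hz)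
    rw [cdf_eq_real]
    exact hw.2.trans (hmono hwz.le)
  · exact fun h => csInf_le hbdd h

include hμ in
theorem one_div_le_reduceFn {y u : ℝ} (hu : rank μ₁ y u ≤ 1) :
    1 / (k : ℝ) ≤ reduceFn k μ₁ μ y u :=
  ((reduceFn_le_iff hμ hu _).1 le_rfl).1

variable [IsProbabilityMeasure μ₁]

include hμ in
theorem measurable_reduceFn :
    Measurable fun p : ℝ × unitInterval => reduceFn k μ₁ μ p.1 p.2 := by
  refine measurable_of_Iic fun x => ?_
  have : (fun p : ℝ × unitInterval => reduceFn k μ₁ μ p.1 p.2) ⁻¹' Set.Iic x =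
      {p | 1 / (k : ℝ) ≤ x ∧ rank μ₁ p.1 p.2 ≤ μ.real (Set.Iic x)} := by
    ext p
    exact reduceFn_le_iff hμ (rank_le_one p) x
  rw [this]
  by_cases hx : 1 / (k : ℝ) ≤ x
  · simp only [hx, true_and]
    exact measurableSet_le (measurable_rank μ₁) measurable_const
  · simp only [hx, false_and, Set.ofPred_false]
    exact MeasurableSet.empty

include hμ in
/-- The reduction turns `μ₁` into `μ`. -/
theorem map_reduceFn :
    (μ₁.prod (volume : Measure unitInterval)).map (fun p => reduceFn k μ₁ μ p.1 p.2) = μ := by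
  have hm := measurable_reduceFn (μ₁ := μ₁) hμ
  have := Measure.isProbabilityMeasure_map (μ := μ₁.prod (volume : Measure unitInterval))
    hm.aemeasurable
  refine Measure.ext_of_Iic _ _ fun x => ?_
  rw [Measure.map_apply hm measurableSet_Iic]
  have hset : (fun p : ℝ × unitInterval => reduceFn k μ₁ μ p.1 p.2) ⁻¹' Set.Iic x =
      {p | 1 / (k : ℝ) ≤ x ∧ rank μ₁ p.1 p.2 ≤ μ.real (Set.Iic x)} := by
    ext p
    exact reduceFn_le_iff hμ (rank_le_one p) x
  rw [hset]
  by_cases hx : 1 / (k : ℝ) ≤ x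
  · simp only [hx, true_and]
    rw [measure_rank_le measureReal_nonneg measureReal_le_one, ofReal_measureReal]
  · simp only [hx, false_and, Set.ofPred_false, measure_empty]
    refine le_antisymm zero_le ?_
    have h2 : μ (Set.Icc (1 / (k : ℝ)) 1)ᶜ = 0 := by
      rw [prob_compl_eq_one_sub measurableSet_Icc, hμ, tsub_self]
    rw [← h2]
    exact measure_mono fun z hz hz' => hx (hz'.1.trans hz)

/-- `μ₁` is stochastically at least as large as `μ`. -/
def Dominates (μ₁ μ : Measure ℝ) : Prop := ∀ x, μ₁ (Set.Iic x) ≤ μ (Set.Iic x)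

include hμ in
-- The rank of `y` is at most the distribution function of `μ₁` at `y`, hence by domination at most
-- that of `μ` at `y`. This is where domination enters the algorithm: beliefs only have to be
-- weakened, never strengthened.
theorem reduceFn_le (hd : Dominates μ₁ μ) {y u : ℝ} (hy : 1 / (k : ℝ) ≤ y) (hu : u ≤ 1) :
    reduceFn k μ₁ μ y u ≤ y := by
  have h1 := rank_le (μ := μ₁) (y := y) hu
  exact (reduceFn_le_iff hμ (h1.trans measureReal_le_one) y).2 ⟨hy, h1.trans
    (ENNReal.toReal_mono (measure_ne_top _ _) (hd y))⟩

include hμ in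
theorem mixWeight_mem (hd : Dominates μ₁ μ) {y u : ℝ} (hy : 1 / (k : ℝ) ≤ y) (hu : u ≤ 1) :
    mixWeight k μ₁ μ y u ∈ Set.Icc (0 : ℝ) 1 := by
  have hk : (0 : ℝ) < k := by have := NeZero.pos k; positivity
  have h1 := reduceFn_le hμ hd hy hu
  have h2 := one_div_le_reduceFn (k := k) hμ ((rank_le (μ := μ₁) (y := y) hu).trans measureReal_le_one)
  rw [div_le_iff₀ hk] at hy h2
  unfold mixWeight
  constructor
  · exact div_nonneg (mul_nonneg hk.le (by linarith)) (by linarith)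
  · refine div_le_one_of_le₀ ?_ (by linarith)
    nlinarith

include hμ in
theorem mixWeight_spec (hd : Dominates μ₁ μ) {y u : ℝ} (hy : 1 / (k : ℝ) ≤ y) (hu : u ≤ 1) :
    (1 - mixWeight k μ₁ μ y u) * y + mixWeight k μ₁ μ y u / k = reduceFn k μ₁ μ y u := by
  have hk : (0 : ℝ) < k := by have := NeZero.pos k; positivity
  have h1 := reduceFn_le hμ hd hy hu
  have h2 := one_div_le_reduceFn (k := k) hμ ((rank_le (μ := μ₁) (y := y) hu).trans measureReal_le_one)
  unfold mixWeight
  -- At `y = 1 / k` the weight is a division by zero with value `0`; the identity still holds,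
  -- because the reduced value is pinched between `1 / k` and `y`.
  rcases hy.eq_or_lt with h | h
  · subst h
    have : reduceFn k μ₁ μ (1 / (k : ℝ)) u = 1 / k := le_antisymm h1 h2
    rw [this]; simp
  · have h3 : (k : ℝ) * y - 1 ≠ 0 := by
      rw [div_lt_iff₀ hk] at h
      linarith
    field_simp
    ring

include hμ in
theorem measurable_mixWeight :
    Measurable fun p : ℝ × unitInterval => mixWeight k μ₁ μ p.1 p.2 := by
  have := measurable_reduceFn (μ₁ := μ₁) hμ
  unfold mixWeight
  fun_prop

end Reduce

end TreeColouring
end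
noncomputable section
namespace TreeColouring

/-! ### Integrals over the uniform variables at a vertex -/

section Sampling

theorem volume_floor_eq {N : ℕ} (hN : 0 < N) (i : Fin N) :
    (volume : Measure unitInterval) {u | min ⌊(u : ℝ) * N⌋₊ (N - 1) = i} = (N : ℝ≥0∞)⁻¹ := by
  have hN' : (0 : ℝ) < N := by exact_mod_cast hN
  have hi := i.2
  have hi' : ((i : ℕ) : ℝ) + 1 ≤ N := by exact_mod_cast hi
  let a : unitInterval := ⟨(i : ℕ) / (N : ℝ), by positivity, (div_le_one hN').2 (by linarith)⟩
  let b : unitInterval := ⟨((i : ℕ) + 1) / (N : ℝ), by positivity, (div_le_one hN').2 hi'⟩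
  have hval : ENNReal.ofReal ((b : ℝ) - a) = (N : ℝ≥0∞)⁻¹ := by
    have : (b : ℝ) - a = (N : ℝ)⁻¹ := by simp only [a, b]; field_simp; ring
    rw [this, ENNReal.ofReal_inv_of_pos hN', ENNReal.ofReal_natCast]
  refine le_antisymm ?_ ?_
  · rw [← hval, ← unitInterval.volume_Icc]
    refine measure_mono fun u hu => ?_
    replace hu : min ⌊(u : ℝ) * N⌋₊ (N - 1) = i := hu
    have h0 : (0 : ℝ) ≤ (u : ℝ) * N := mul_nonneg u.2.1 hN'.le
    constructor
    · have h1 : (i : ℕ) ≤ ⌊(u : ℝ) * N⌋₊ := hu ▸ min_le_left _ _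
      rw [← Subtype.coe_le_coe]
      exact (div_le_iff₀ hN').2 ((Nat.le_floor_iff h0).1 h1)
    · rw [← Subtype.coe_le_coe]
      refine (le_div_iff₀ hN').2 ?_
      rcases lt_or_ge ⌊(u : ℝ) * N⌋₊ (N - 1) with h | h
      · have h1 := Nat.lt_floor_add_one ((u : ℝ) * N)
        rw [min_eq_left h.le] at hu
        rw [hu] at h1
        exact h1.le
      -- The cap `N - 1` matters only at the endpoint `u = 1`.
      · rw [min_eq_right h] at hu
        have h2 : (i : ℕ) + 1 = N := by omega
        have h3 : ((i : ℕ) : ℝ) + 1 = N := by exact_mod_cast h2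
        rw [h3]
        have := u.2.2
        nlinarith
  · rw [← hval, ← unitInterval.volume_Ico]
    refine measure_mono fun u hu => ?_
    obtain ⟨h1, h2⟩ := hu
    rw [← Subtype.coe_le_coe] at h1
    rw [← Subtype.coe_lt_coe] at h2
    replace h1 := (div_le_iff₀ hN').1 h1
    replace h2 := (lt_div_iff₀ hN').1 h2
    have h3 : ⌊(u : ℝ) * N⌋₊ = i := by
      rw [Nat.floor_eq_iff (mul_nonneg u.2.1 hN'.le)]
      exact ⟨h1, h2⟩
    change min ⌊(u : ℝ) * N⌋₊ (N - 1) = i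
    rw [h3, min_eq_left (by omega)]

theorem measurable_pick {α : Type*} [MeasurableSpace α] (S : Finset α) (hS : S.Nonempty) :
    Measurable (pick S hS) := by
  have h1 : Measurable fun u : unitInterval =>
      (⟨min ⌊(u : ℝ) * S.card⌋₊ (S.card - 1), lt_of_le_of_lt (min_le_right _ _)
        (Nat.sub_lt hS.card_pos one_pos)⟩ : Fin S.card) := by
    refine Measurable.of_discrete (f := fun i : ℕ => (⟨min i (S.card - 1),
      lt_of_le_of_lt (min_le_right _ _) (Nat.sub_lt hS.card_pos one_pos)⟩ : Fin S.card)) |>.comp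
      (Nat.measurable_floor.comp (measurable_subtype_coe.mul_const _))
  exact (Measurable.of_discrete (f := fun i : Fin S.card => ((S.equivFin.symm i : S) : α))).comp h1

theorem lintegral_pick {α : Type*} (S : Finset α) (hS : S.Nonempty) (g : α → ℝ≥0∞) :
    ∫⁻ u, g (pick S hS u) = (S.card : ℝ≥0∞)⁻¹ * ∑ x ∈ S, g x := by
  set j : unitInterval → Fin S.card := fun u => ⟨min ⌊(u : ℝ) * S.card⌋₊ (S.card - 1),
    lt_of_le_of_lt (min_le_right _ _) (Nat.sub_lt hS.card_pos one_pos)⟩ with hj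
  have hjm : Measurable j :=
    Measurable.of_discrete (f := fun i : ℕ => (⟨min i (S.card - 1),
      lt_of_le_of_lt (min_le_right _ _) (Nat.sub_lt hS.card_pos one_pos)⟩ : Fin S.card)) |>.comp
      (Nat.measurable_floor.comp (measurable_subtype_coe.mul_const _))
  have h1 : ∫⁻ u, g (pick S hS u) =
      ∫⁻ i, g (S.equivFin.symm i : S) ∂((volume : Measure unitInterval).map j) :=
    (lintegral_map (μ := (volume : Measure unitInterval))
      (f := fun i : Fin S.card => g (S.equivFin.symm i : S)) (Measurable.of_discrete) hjm).symm
  rw [h1, lintegral_fintype, Finset.mul_sum, ← Finset.sum_coe_sort S,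
    ← S.equivFin.symm.sum_comp]
  refine Finset.sum_congr rfl fun i _ => ?_
  rw [Measure.map_apply hjm (measurableSet_singleton i), mul_comm]
  congr 1
  rw [← volume_floor_eq hS.card_pos i]
  congr 1
  ext u
  simp [hj, Fin.ext_iff]

variable {k : ℕ}

/-- The weight of `l` under the uniform law on the maximising coordinates of `x`. -/
def maxWeight (x : Fin k → ℝ) (l : Fin k) : ℝ≥0∞ :=
  open scoped Classical in if l ∈ argmaxSet x then ((argmaxSet x).card : ℝ≥0∞)⁻¹ else 0

/-- The weight of `π` under the uniform law on the permutations that fix `l`. -/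
def fixWeight (l : Fin k) (π : Equiv.Perm (Fin k)) : ℝ :=
  if π l = l then
    ((Finset.univ.filter fun τ : Equiv.Perm (Fin k) => τ l = l).card : ℝ)⁻¹ else 0

/-- The weight of `π` under the mixture, with weight `p`, of the uniform law on all permutations
and the unit mass at the identity. -/
def blendWeight (p : ℝ) (π : Equiv.Perm (Fin k)) : ℝ :=
  (if π = 1 then 1 - p else 0) + p * (Fintype.card (Equiv.Perm (Fin k)) : ℝ)⁻¹

theorem lintegral_pick_argmaxSet [NeZero k] (x : Fin k → ℝ) (g : Fin k → ℝ≥0∞) :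
    ∫⁻ u, g (pick (argmaxSet x) (argmaxSet_nonempty x) u) = ∑ l, maxWeight x l * g l := by
  classical
  rw [lintegral_pick, Finset.mul_sum]
  simp_rw [maxWeight, ite_mul, zero_mul]
  rw [← Finset.sum_filter]
  simp

theorem lintegral_samplePermFixing (l : Fin k) (g : Equiv.Perm (Fin k) → ℝ≥0∞) :
    ∫⁻ u, g (samplePermFixing l u) = ∑ π, ENNReal.ofReal (fixWeight l π) * g π := by
  have hne : (Finset.univ.filter fun π : Equiv.Perm (Fin k) => π l = l).Nonempty := ⟨1, by simp⟩
  refine (lintegral_pick _ hne g).trans ?_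
  rw [Finset.mul_sum, Finset.sum_filter]
  refine Finset.sum_congr rfl fun π _ => ?_
  unfold fixWeight
  split_ifs with h
  · rw [ENNReal.ofReal_inv_of_pos, ENNReal.ofReal_natCast]
    exact_mod_cast Finset.card_pos.2 ⟨π, by simpa using h⟩
  · simp

theorem lintegral_samplePermMix {p : ℝ} (hp : p ∈ Set.Icc (0 : ℝ) 1)
    (g : Equiv.Perm (Fin k) → ℝ≥0∞) :
    ∫⁻ u, ∫⁻ u', g (samplePermMix p u u') = ∑ π, ENNReal.ofReal (blendWeight p π) * g π := by
  have h1 : ∀ u : unitInterval, ∫⁻ u', g (samplePermMix p u u') =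
      Set.indicator {u : unitInterval | (u : ℝ) < p} (fun _ =>
        ((Fintype.card (Equiv.Perm (Fin k)) : ℕ) : ℝ≥0∞)⁻¹ * ∑ π, g π) u +
      Set.indicator {u : unitInterval | (u : ℝ) < p}ᶜ (fun _ => g 1) u := by
    intro u
    unfold samplePermMix
    by_cases h : (u : ℝ) < p
    · simp only [h, if_true]
      rw [lintegral_pick, Set.indicator_of_mem (show u ∈ {u : unitInterval | (u : ℝ) < p} from h),
        Set.indicator_of_notMem (show u ∉ {u : unitInterval | (u : ℝ) < p}ᶜ from fun h2 => h2 h),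
        add_zero]
      rfl
    · simp only [h, if_false]
      rw [Set.indicator_of_notMem (show u ∉ {u : unitInterval | (u : ℝ) < p} from h),
        Set.indicator_of_mem (show u ∈ {u : unitInterval | (u : ℝ) < p}ᶜ from h)]
      simp
  have hm : MeasurableSet {u : unitInterval | (u : ℝ) < p} :=
    measurableSet_lt measurable_subtype_coe measurable_const
  have hv : (volume : Measure unitInterval) {u : unitInterval | (u : ℝ) < p} =
      ENNReal.ofReal p := by
    have : {u : unitInterval | (u : ℝ) < p} = Set.Iio ⟨p, hp⟩ := by
      ext u; exact Iff.rfl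
    rw [this, unitInterval.volume_Iio]
  rw [lintegral_congr h1, lintegral_add_left (measurable_const.indicator hm),
    lintegral_indicator hm, lintegral_indicator hm.compl, setLIntegral_const, setLIntegral_const,
    prob_compl_eq_one_sub hm, hv]
  have h2 : ∀ π : Equiv.Perm (Fin k), ENNReal.ofReal (blendWeight p π) * g π =
      (if π = 1 then ENNReal.ofReal (1 - p) * g 1 else 0) +
        ENNReal.ofReal p * (((Fintype.card (Equiv.Perm (Fin k)) : ℕ) : ℝ≥0∞)⁻¹ * g π) := by
    intro π
    unfold blendWeight
    rw [ENNReal.ofReal_add (by split_ifs <;> linarith [hp.2])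
      (mul_nonneg hp.1 (by positivity)), add_mul, ENNReal.ofReal_mul hp.1,
      ENNReal.ofReal_inv_of_pos (by exact_mod_cast Fintype.card_pos), ENNReal.ofReal_natCast,
      mul_assoc]
    congr 1
    split_ifs with h
    · rw [h]
    · simp
  simp_rw [h2]
  rw [Finset.sum_add_distrib, Finset.sum_ite_eq' Finset.univ, if_pos (Finset.mem_univ _),
    ← Finset.mul_sum, ← Finset.mul_sum, add_comm]
  congr 1
  · rw [mul_comm, ENNReal.ofReal_sub _ hp.1, ENNReal.ofReal_one]
  · rw [mul_comm]

/-- The law of the uniform variables at a vertex. -/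
def seedLaw : Measure Seed := Measure.pi fun _ => (volume : Measure unitInterval)

instance : IsProbabilityMeasure seedLaw := by unfold seedLaw; infer_instance

theorem lintegral_seedLaw {H : Seed → ℝ≥0∞} (hH : Measurable H) :
    ∫⁻ U, H U ∂seedLaw = ∫⁻ u0, ∫⁻ u1, ∫⁻ u2, ∫⁻ u3, ∫⁻ u4 : unitInterval,
      H ![u0, u1, u2, u3, u4] := by
  let T : unitInterval × unitInterval × unitInterval × unitInterval × unitInterval → Seed :=
    fun p => ![p.1, p.2.1, p.2.2.1, p.2.2.2.1, p.2.2.2.2]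
  have hT : Measurable T := measurable_pi_lambda _ fun i => by
    fin_cases i
    · exact measurable_fst
    · exact measurable_snd.fst
    · exact measurable_snd.snd.fst
    · exact measurable_snd.snd.snd.fst
    · exact measurable_snd.snd.snd.snd
  have h1 : seedLaw = (volume.prod (volume.prod (volume.prod (volume.prod volume)))).map T := by
    refine Measure.pi_eq fun s hs => ?_
    rw [Measure.map_apply hT (MeasurableSet.univ_pi hs)]
    have : T ⁻¹' Set.univ.pi s = s 0 ×ˢ s 1 ×ˢ s 2 ×ˢ s 3 ×ˢ s 4 := by
      ext p
      simp [T, Set.mem_pi, Fin.forall_fin_succ, Fin.succ]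
    rw [this, Measure.prod_prod, Measure.prod_prod, Measure.prod_prod, Measure.prod_prod,
      Fin.prod_univ_five]
    ring
  have hHT := hH.comp hT
  rw [h1]
  refine (lintegral_map hH hT).trans ((lintegral_prod _ hHT.aemeasurable).trans ?_)
  refine lintegral_congr fun u0 => ?_
  have h0 : Measurable fun q => H (T (u0, q)) := hHT.comp (measurable_const.prodMk measurable_id)
  refine (lintegral_prod _ h0.aemeasurable).trans (lintegral_congr fun u1 => ?_)
  have h1 : Measurable fun q => H (T (u0, u1, q)) := h0.comp (measurable_const.prodMk measurable_id)
  refine (lintegral_prod _ h1.aemeasurable).trans (lintegral_congr fun u2 => ?_)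
  have h2 : Measurable fun q => H (T (u0, u1, u2, q)) :=
    h1.comp (measurable_const.prodMk measurable_id)
  exact lintegral_prod _ h2.aemeasurable

end Sampling

/-! ### Averages over permutations -/

section Averages

variable {k : ℕ}

theorem sum_starVec (hk : 2 ≤ k) (y : ℝ) (l : Fin k) : ∑ m, starVec k y l m = 1 := by
  have hk' : (2 : ℝ) ≤ k := by exact_mod_cast hk
  unfold starVec
  rw [Finset.sum_ite, Finset.sum_const, Finset.sum_const, Finset.filter_eq', if_pos (Finset.mem_univ _),
    Finset.filter_ne', Finset.card_singleton, Finset.card_erase_of_mem (Finset.mem_univ _),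
    Finset.card_univ, Fintype.card_fin, nsmul_eq_mul, nsmul_eq_mul, Nat.cast_sub (by omega)]
  push_cast
  have : (k : ℝ) - 1 ≠ 0 := by linarith
  field_simp
  ring

/-- Averaging over the permutations that fix `m` keeps the entry at `m` and, by conjugation-free
symmetry under transpositions of two other colours, makes all other entries equal. Total mass one
determines their common value. -/
theorem sum_fixWeight (hk : 2 ≤ k) (x : Fin k → ℝ) (hx : ∑ m, x m = 1) (m c : Fin k) :
    ∑ π, fixWeight m π * x (π c) = starVec k (x m) m c := by
  have hk' : (2 : ℝ) ≤ k := by exact_mod_cast hk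
  set N := (Finset.univ.filter fun τ : Equiv.Perm (Fin k) => τ m = m).card with hN
  have hN0 : (0 : ℝ) < N := by exact_mod_cast Finset.card_pos.2 ⟨1, by simp⟩
  set T : Fin k → ℝ := fun c => ∑ π, fixWeight m π * x (π c) with hT
  have htot : ∑ π, fixWeight m π = 1 := by
    simp_rw [fixWeight]
    rw [← Finset.sum_filter, Finset.sum_const, nsmul_eq_mul, ← hN, mul_inv_cancel₀ hN0.ne']
  have hfix : ∀ π : Equiv.Perm (Fin k), fixWeight m π * x (π m) = fixWeight m π * x m := by
    intro π
    unfold fixWeight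
    split_ifs with h
    · rw [h]
    · simp
  have hm : T m = x m := by
    simp only [hT, hfix]
    rw [← Finset.sum_mul, htot, one_mul]
  have hswap : ∀ c c', c ≠ m → c' ≠ m → T c = T c' := by
    intro c c' hc hc'
    simp only [hT]
    rw [← Equiv.sum_comp (Equiv.mulRight (Equiv.swap c c'))]
    refine Finset.sum_congr rfl fun π _ => ?_
    simp only [Equiv.coe_mulRight, Equiv.Perm.mul_apply, Equiv.swap_apply_left, fixWeight,
      Equiv.swap_apply_of_ne_of_ne hc.symm hc'.symm]
  have hsum : ∑ c, T c = 1 := by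
    simp only [hT]
    rw [Finset.sum_comm]
    simp_rw [← Finset.mul_sum]
    rw [← htot]
    refine Finset.sum_congr rfl fun π _ => ?_
    rw [Equiv.sum_comp π x, hx, mul_one]
  unfold starVec
  split_ifs with h
  · rw [h]; exact hm
  · rw [eq_div_iff (by linarith)]
    rw [← Finset.add_sum_erase _ _ (Finset.mem_univ m), hm,
      Finset.sum_congr rfl fun c' hc' => hswap c' c (Finset.ne_of_mem_erase hc') h,
      Finset.sum_const, Finset.card_erase_of_mem (Finset.mem_univ _), Finset.card_univ,
      Fintype.card_fin, nsmul_eq_mul, Nat.cast_sub (by omega)] at hsum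
    push_cast at hsum
    change T c * _ = _
    linarith

theorem sum_perm_apply (x : Fin k → ℝ) (hx : ∑ m, x m = 1) (c : Fin k) :
    ∑ π : Equiv.Perm (Fin k), (Fintype.card (Equiv.Perm (Fin k)) : ℝ)⁻¹ * x (π c) = 1 / k := by
  set N := (Fintype.card (Equiv.Perm (Fin k)) : ℝ) with hN
  have hN0 : N ≠ 0 := by rw [hN]; exact_mod_cast Fintype.card_ne_zero
  have hk0 : (k : ℝ) ≠ 0 := by have := c.pos; positivity
  set T : Fin k → ℝ := fun c => ∑ π : Equiv.Perm (Fin k), N⁻¹ * x (π c) with hT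
  have hswap : ∀ c', T c' = T c := by
    intro c'
    simp only [hT]
    rw [← Equiv.sum_comp (Equiv.mulRight (Equiv.swap c' c))]
    refine Finset.sum_congr rfl fun π _ => ?_
    simp only [Equiv.coe_mulRight, Equiv.Perm.mul_apply, Equiv.swap_apply_left]
  have hsum : ∑ c, T c = 1 := by
    simp only [hT]
    rw [Finset.sum_comm]
    simp_rw [← Finset.mul_sum]
    have h1 : ∀ π : Equiv.Perm (Fin k), ∑ c, x (π c) = 1 := fun π => by
      rw [Equiv.sum_comp π x, hx]
    simp_rw [h1]
    rw [Finset.sum_const, Finset.card_univ, nsmul_eq_mul, mul_one, ← hN, inv_mul_cancel₀ hN0]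
  rw [Finset.sum_congr rfl fun c' _ => hswap c', Finset.sum_const, Finset.card_univ,
    Fintype.card_fin, nsmul_eq_mul] at hsum
  change T c = _
  rw [eq_div_iff hk0]
  linarith

theorem sum_blendWeight (x : Fin k → ℝ) (hx : ∑ m, x m = 1) (p : ℝ) (c : Fin k) :
    ∑ π, blendWeight p π * x (π c) = (1 - p) * x c + p / k := by
  unfold blendWeight
  simp_rw [add_mul, ite_mul, zero_mul, mul_assoc]
  rw [Finset.sum_add_distrib, Finset.sum_ite_eq' Finset.univ, if_pos (Finset.mem_univ _),
    ← Finset.mul_sum, sum_perm_apply x hx c]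
  simp [div_eq_mul_inv]

theorem blend_starVec (hk : 2 ≤ k) (y p : ℝ) (l c : Fin k) :
    (1 - p) * starVec k y l c + p / k = starVec k ((1 - p) * y + p / k) l c := by
  have hk' : (2 : ℝ) ≤ k := by exact_mod_cast hk
  have : (k : ℝ) - 1 ≠ 0 := by linarith
  unfold starVec
  split_ifs
  · rfl
  · field_simp; ring

/-- The inner average makes the vector star-shaped with peak at `l`, and the outer mixture moves it
towards the uniform vector, keeping the shape. The colour fixed by `π₁` is `π₂.symm l`, since `l` is
the colour reported after `π₂` has acted. -/
theorem sum_blend_fix (hk : 2 ≤ k) (x : Fin k → ℝ) (hx : ∑ m, x m = 1) (p : ℝ) (l c : Fin k) :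
    ∑ π₂, ∑ π₁, blendWeight p π₂ * fixWeight (π₂.symm l) π₁ * x (π₂ (π₁ c)) =
      starVec k ((1 - p) * x l + p / k) l c := by
  have h1 : ∀ π₂ : Equiv.Perm (Fin k),
      ∑ π₁, blendWeight p π₂ * fixWeight (π₂.symm l) π₁ * x (π₂ (π₁ c)) =
        blendWeight p π₂ * starVec k (x l) l (π₂ c) := by
    intro π₂
    simp_rw [mul_assoc]
    rw [← Finset.mul_sum, sum_fixWeight hk (fun m => x (π₂ m)) (by rw [Equiv.sum_comp π₂ x, hx])]
    simp [starVec, Equiv.eq_symm_apply]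
  simp_rw [h1]
  rw [sum_blendWeight _ (sum_starVec hk _ _), blend_starVec hk]

theorem fixWeight_nonneg (l : Fin k) (π : Equiv.Perm (Fin k)) : 0 ≤ fixWeight l π := by
  unfold fixWeight; split_ifs <;> positivity

theorem blendWeight_nonneg {p : ℝ} (hp : p ∈ Set.Icc (0 : ℝ) 1) (π : Equiv.Perm (Fin k)) :
    0 ≤ blendWeight p π := by
  unfold blendWeight
  refine add_nonneg ?_ (mul_nonneg hp.1 (by positivity))
  split_ifs <;> linarith [hp.2]

end Averages

end TreeColouring
end
noncomputable section
namespace TreeColouring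

/-! ### Mixing an exchangeable observation down to a smaller belief -/

section Argmax

variable {k : ℕ}

theorem measurable_comp_argmaxSet {β : Type*} [MeasurableSpace β] (g : Finset (Fin k) → β) :
    Measurable fun x : Fin k → ℝ => g (argmaxSet x) := by
  let _ : MeasurableSpace (Finset (Fin k)) := ⊤
  have hg : Measurable g := fun _ _ => trivial
  refine hg.comp (measurable_to_countable' fun S => ?_)
  have h1 : ∀ l : Fin k, MeasurableSet {x : Fin k → ℝ | l ∈ argmaxSet x} := by
    intro l
    have : {x : Fin k → ℝ | l ∈ argmaxSet x} = ⋂ m, {x | x m ≤ x l} := by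
      ext x; simp [argmaxSet]
    rw [this]
    exact MeasurableSet.iInter fun m =>
      measurableSet_le (measurable_pi_apply m) (measurable_pi_apply l)
  have h2 : argmaxSet ⁻¹' {S} = ⋂ l, {x : Fin k → ℝ | l ∈ argmaxSet x ↔ l ∈ S} := by
    ext x; simp [Finset.ext_iff]
  rw [h2]
  refine MeasurableSet.iInter fun l => ?_
  by_cases hl : l ∈ S
  · simpa [hl] using h1 l
  · simp only [hl, iff_false]
    exact (h1 l).compl

theorem measurable_maxWeight (l : Fin k) : Measurable fun x : Fin k → ℝ => maxWeight x l := by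
  classical
  exact measurable_comp_argmaxSet fun S => if l ∈ S then (S.card : ℝ≥0∞)⁻¹ else 0

theorem mem_argmaxSet {x : Fin k → ℝ} {l : Fin k} : l ∈ argmaxSet x ↔ ∀ m, x m ≤ x l := by
  simp [argmaxSet]

theorem maxWeight_apply_perm {x y : Fin k → ℝ} (τ : Equiv.Perm (Fin k)) (h : ∀ c, y (τ c) = x c)
    (l : Fin k) : maxWeight y (τ l) = maxWeight x l := by
  classical
  have hS : argmaxSet y = (argmaxSet x).map τ.toEmbedding := by
    ext m
    obtain ⟨m, rfl⟩ := τ.surjective m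
    rw [Finset.mem_map_equiv, Equiv.symm_apply_apply, mem_argmaxSet, mem_argmaxSet, h]
    constructor
    · exact fun H c => by rw [← h]; exact H _
    · intro H c
      obtain ⟨c, rfl⟩ := τ.surjective c
      rw [h]; exact H c
  unfold maxWeight
  simp only [hS, Finset.mem_map_equiv, Equiv.symm_apply_apply, Finset.card_map]

theorem norm_eq_of_mem_argmaxSet {x : Fin k → ℝ} (h0 : ∀ c, 0 ≤ x c) {l : Fin k}
    (hl : l ∈ argmaxSet x) : ‖x‖ = x l := by
  refine le_antisymm ((pi_norm_le_iff_of_nonneg (h0 l)).2 fun m => ?_) ?_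
  · rw [Real.norm_of_nonneg (h0 m)]; exact mem_argmaxSet.1 hl m
  · exact (le_abs_self _).trans (norm_le_pi_norm x l)

theorem norm_apply_perm {x y : Fin k → ℝ} (τ : Equiv.Perm (Fin k)) (h : ∀ c, y (τ c) = x c) :
    ‖y‖ = ‖x‖ := by
  refine le_antisymm ((pi_norm_le_iff_of_nonneg (norm_nonneg _)).2 fun m => ?_)
    ((pi_norm_le_iff_of_nonneg (norm_nonneg _)).2 fun m => ?_)
  · obtain ⟨m, rfl⟩ := τ.surjective m
    rw [h]; exact norm_le_pi_norm x m
  · rw [← h]; exact norm_le_pi_norm y _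

theorem sum_maxWeight [NeZero k] (x : Fin k → ℝ) : ∑ l, maxWeight x l = 1 := by
  have h := lintegral_pick_argmaxSet x fun _ => 1
  simpa using h.symm

end Argmax

section Blend

variable {k : ℕ} {Z : Type*} [MeasurableSpace Z] {A : Measure Z}
  {act : Equiv.Perm (Fin k) → Z → Z} {P : Z → Fin k → ℝ}

/-- Substitute `act τ z` for `z` and `τ l` for `l`; the choice of a maximising colour is
equivariant. -/
theorem lintegral_maxWeight_act (τ : Equiv.Perm (Fin k)) (hm : Measurable (act τ))
    (hA : A.map (act τ) = A) (hP : Measurable P) (hPact : ∀ z c, P (act τ z) (τ c) = P z c)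
    {Ψ : Fin k → Z → ℝ≥0∞} (hΨ : ∀ l, Measurable (Ψ l)) :
    ∫⁻ z, ∑ l, maxWeight (P z) l * Ψ (τ l) (act τ z) ∂A =
      ∫⁻ z, ∑ l, maxWeight (P z) l * Ψ l z ∂A := by
  have hG : Measurable fun z => ∑ l, maxWeight (P z) l * Ψ l z :=
    Finset.measurable_fun_sum _ fun l _ => ((measurable_maxWeight l).comp hP).mul (hΨ l)
  conv_rhs => rw [← hA]
  rw [lintegral_map hG hm]
  refine lintegral_congr fun z => ?_
  rw [← Equiv.sum_comp τ fun l => maxWeight (P (act τ z)) l * Ψ l (act τ z)]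
  exact Finset.sum_congr rfl fun l _ => by rw [maxWeight_apply_perm τ (hPact z)]

theorem fixWeight_eq_zero {l : Fin k} {π : Equiv.Perm (Fin k)} (h : π l ≠ l) :
    fixWeight l π = 0 := if_neg h

theorem measurable_blendWeight (π : Equiv.Perm (Fin k)) :
    Measurable fun p : ℝ => blendWeight p π := by
  unfold blendWeight
  split_ifs <;> fun_prop

/-- The posterior after a uniform maximising colour `l` has been reported, the observation has been
mixed by a permutation fixing `l`, and all has been mixed by a permutation of weight `p`. -/
theorem lintegral_blend (hk : 2 ≤ k) (hm : ∀ τ, Measurable (act τ)) (hA : ∀ τ, A.map (act τ) = A)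
    (hP : Measurable P) (hPact : ∀ τ z c, P (act τ z) (τ c) = P z c)
    {p : Z → ℝ} (hp : Measurable p) (hpact : ∀ τ z, p (act τ z) = p z)
    (hae : ∀ᵐ z ∂A, (∀ c, 0 ≤ P z c) ∧ ∑ c, P z c = 1 ∧ p z ∈ Set.Icc (0 : ℝ) 1)
    {Φ : Fin k → Z → ℝ≥0∞} (hΦ : ∀ l, Measurable (Φ l)) (c : Fin k) :
    ∫⁻ z, ENNReal.ofReal (P z c) * ∑ l, maxWeight (P z) l * ∑ π₁, ENNReal.ofReal (fixWeight l π₁) *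
        ∑ π₂, ENNReal.ofReal (blendWeight (p z) π₂) * Φ (π₂ l) (act (π₂ * π₁) z) ∂A =
      ∫⁻ z, ∑ l, maxWeight (P z) l * (Φ l z *
        ENNReal.ofReal (starVec k ((1 - p z) * ‖P z‖ + p z / k) l c)) ∂A := by
  -- `Ψ` is the integrand in the coordinates after the permutation `π₂ * π₁`: the entry at `c` has
  -- moved to `π₂ (π₁ c)`, and the original maximising colour is `π₂.symm l` because `π₁` fixes it.
  let Ψ : Equiv.Perm (Fin k) → Equiv.Perm (Fin k) → Fin k → Z → ℝ≥0∞ := fun π₁ π₂ l z =>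
    ENNReal.ofReal (P z (π₂ (π₁ c))) * ENNReal.ofReal (fixWeight (π₂.symm l) π₁) *
      ENNReal.ofReal (blendWeight (p z) π₂) * Φ l z
  have hΨ : ∀ π₁ π₂ l, Measurable (Ψ π₁ π₂ l) := fun π₁ π₂ l =>
    ((((measurable_pi_apply _).comp hP).ennreal_ofReal.mul_const _).mul
      ((measurable_blendWeight π₂).comp hp).ennreal_ofReal).mul (hΦ l)
  have hw : ∀ l, Measurable fun z => maxWeight (P z) l := fun l => (measurable_maxWeight l).comp hP
  have h1 : ∀ z, ENNReal.ofReal (P z c) * ∑ l, maxWeight (P z) l *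
      ∑ π₁, ENNReal.ofReal (fixWeight l π₁) *
        ∑ π₂, ENNReal.ofReal (blendWeight (p z) π₂) * Φ (π₂ l) (act (π₂ * π₁) z) =
      ∑ π₁, ∑ π₂, ∑ l, maxWeight (P z) l * Ψ π₁ π₂ ((π₂ * π₁) l) (act (π₂ * π₁) z) := by
    intro z
    rw [Finset.mul_sum]
    have h2 : ∀ l, ENNReal.ofReal (P z c) * (maxWeight (P z) l *
        ∑ π₁, ENNReal.ofReal (fixWeight l π₁) *
        ∑ π₂, ENNReal.ofReal (blendWeight (p z) π₂) * Φ (π₂ l) (act (π₂ * π₁) z)) =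
        ∑ π₁, ∑ π₂, maxWeight (P z) l * Ψ π₁ π₂ ((π₂ * π₁) l) (act (π₂ * π₁) z) := by
      intro l
      simp_rw [Finset.mul_sum]
      refine Finset.sum_congr rfl fun π₁ _ => Finset.sum_congr rfl fun π₂ _ => ?_
      have h3 : P (act (π₂ * π₁) z) (π₂ (π₁ c)) = P z c := hPact (π₂ * π₁) z c
      simp only [Ψ, Equiv.Perm.mul_apply, Equiv.symm_apply_apply, hpact, h3]
      -- Permutations `π₁` that move `l` have weight zero on both sides, so only the case in which
      -- `π₂ * π₁` sends `l` to `π₂ l` matters.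
      by_cases h : π₁ l = l
      · rw [h]; ring
      · rw [fixWeight_eq_zero h, fixWeight_eq_zero fun h4 => h (π₁.injective h4)]
        simp
    simp_rw [h2]
    rw [Finset.sum_comm]
    refine Finset.sum_congr rfl fun π₁ _ => Finset.sum_comm
  have hS : ∀ π₁ π₂, Measurable fun z =>
      ∑ l, maxWeight (P z) l * Ψ π₁ π₂ ((π₂ * π₁) l) (act (π₂ * π₁) z) := fun π₁ π₂ =>
    Finset.measurable_fun_sum _ fun l _ => (hw l).mul ((hΨ π₁ π₂ _).comp (hm _))
  have hS' : ∀ π₁ π₂, Measurable fun z => ∑ l, maxWeight (P z) l * Ψ π₁ π₂ l z := fun π₁ π₂ =>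
    Finset.measurable_fun_sum _ fun l _ => (hw l).mul (hΨ π₁ π₂ _)
  have h5 : ∫⁻ z, ∑ π₁, ∑ π₂, ∑ l, maxWeight (P z) l *
      Ψ π₁ π₂ ((π₂ * π₁) l) (act (π₂ * π₁) z) ∂A =
      ∫⁻ z, ∑ π₁, ∑ π₂, ∑ l, maxWeight (P z) l * Ψ π₁ π₂ l z ∂A := by
    rw [lintegral_finsetSum _ fun π₁ _ => Finset.measurable_fun_sum _ fun π₂ _ => hS π₁ π₂,
      lintegral_finsetSum _ fun π₁ _ => Finset.measurable_fun_sum _ fun π₂ _ => hS' π₁ π₂]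
    refine Finset.sum_congr rfl fun π₁ _ => ?_
    rw [lintegral_finsetSum _ fun π₂ _ => hS π₁ π₂, lintegral_finsetSum _ fun π₂ _ => hS' π₁ π₂]
    exact Finset.sum_congr rfl fun π₂ _ =>
      lintegral_maxWeight_act (π₂ * π₁) (hm _) (hA _) hP (hPact _) (hΨ π₁ π₂)
  rw [lintegral_congr h1, h5]
  refine lintegral_congr_ae (hae.mono fun z ⟨h0, hsum, hpz⟩ => ?_)
  have h6 : ∀ l, maxWeight (P z) l * (Φ l z *
      ENNReal.ofReal (starVec k ((1 - p z) * ‖P z‖ + p z / k) l c)) =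
      ∑ π₁, ∑ π₂, maxWeight (P z) l * Ψ π₁ π₂ l z := by
    intro l
    by_cases hl : l ∈ argmaxSet (P z)
    · rw [norm_eq_of_mem_argmaxSet h0 hl, ← sum_blend_fix hk _ hsum,
        ENNReal.ofReal_sum_of_nonneg fun π₂ _ => Finset.sum_nonneg fun π₁ _ =>
          mul_nonneg (mul_nonneg (blendWeight_nonneg hpz _) (fixWeight_nonneg _ _)) (h0 _),
        Finset.mul_sum, Finset.mul_sum, Finset.sum_comm]
      refine Finset.sum_congr rfl fun π₂ _ => ?_
      rw [ENNReal.ofReal_sum_of_nonneg fun π₁ _ =>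
          mul_nonneg (mul_nonneg (blendWeight_nonneg hpz _) (fixWeight_nonneg _ _)) (h0 _),
        Finset.mul_sum, Finset.mul_sum]
      refine Finset.sum_congr rfl fun π₁ _ => ?_
      rw [ENNReal.ofReal_mul (mul_nonneg (blendWeight_nonneg hpz _) (fixWeight_nonneg _ _)),
        ENNReal.ofReal_mul (blendWeight_nonneg hpz _)]
      simp only [Ψ]
      ring
    · have : maxWeight (P z) l = 0 := if_neg hl
      simp [this]
  simp_rw [h6]
  exact (Finset.sum_congr rfl fun π₁ _ => Finset.sum_comm).trans Finset.sum_comm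

end Blend

end TreeColouring
end
noncomputable section
namespace TreeColouring

/-! ### Calibrated rules -/

section StarVec

variable {k : ℕ}

theorem norm_starVec (hk : 2 ≤ k) {y : ℝ} (hy : y ∈ Set.Icc (1 / (k : ℝ)) 1) (l : Fin k) :
    ‖starVec k y l‖ = y := by
  have hk' : (2 : ℝ) ≤ k := by exact_mod_cast hk
  have h1 : (1 - y) / ((k : ℝ) - 1) ≤ y := by
    have := hy.1
    rw [div_le_iff₀ (by linarith)] at this ⊢
    linarith
  have h0 : 0 ≤ (1 - y) / ((k : ℝ) - 1) := div_nonneg (by linarith [hy.2]) (by linarith)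
  have hl : starVec k y l l = y := if_pos rfl
  refine (norm_eq_of_mem_argmaxSet (l := l) (fun c => ?_) (mem_argmaxSet.2 fun m => ?_)).trans hl
  · unfold starVec; split_ifs <;> linarith
  · rw [hl]; unfold starVec; split_ifs <;> linarith

theorem starVec_nonneg (hk : 2 ≤ k) {y : ℝ} (hy : y ∈ Set.Icc (1 / (k : ℝ)) 1) (l c : Fin k) :
    0 ≤ starVec k y l c := by
  have hk' : (2 : ℝ) ≤ k := by exact_mod_cast hk
  have h0 : 0 ≤ (1 - y) / ((k : ℝ) - 1) := div_nonneg (by linarith [hy.2]) (by linarith)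
  have h1 : 0 ≤ 1 / (k : ℝ) := by positivity
  unfold starVec; split_ifs <;> linarith [hy.1]

theorem starVec_one_div (hk : 2 ≤ k) (l c : Fin k) : starVec k (1 / (k : ℝ)) l c = 1 / k := by
  have hk' : (2 : ℝ) ≤ k := by exact_mod_cast hk
  have : (k : ℝ) - 1 ≠ 0 := by linarith
  unfold starVec
  split_ifs
  · rfl
  · field_simp

theorem starVec_apply_perm (y : ℝ) (π : Equiv.Perm (Fin k)) (l c : Fin k) :
    starVec k y (π l) (π c) = starVec k y l c := by
  simp [starVec]

theorem lintegral_symmLift_shift [NeZero k] (μ : Measure ℝ) [SFinite μ] (j : Fin k)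
    {F : (Fin k → ℝ) → ℝ≥0∞} (hF : Measurable F) :
    ∫⁻ x, F (fun m => x (m - j)) ∂(symmLift k μ) = ∫⁻ x, F x ∂(symmLift k μ) := by
  have hs : Measurable fun x : Fin k → ℝ => fun m => x (m - j) := by fun_prop
  have hFs : Measurable fun x : Fin k → ℝ => F fun m => x (m - j) := hF.comp hs
  rw [lintegral_symmLift μ hF, lintegral_symmLift μ hFs]
  refine lintegral_congr fun y => ?_
  congr 1
  rw [← Equiv.sum_comp (Equiv.addRight j) fun l => F (starVec k y l)]
  refine Finset.sum_congr rfl fun l _ => ?_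
  congr 1
  ext m
  by_cases hm : m = l + j <;> simp [starVec, sub_eq_iff_eq_add, hm]

/-- The law of the posterior vector of an offspring, with the colours read relative to a vertex of
colour `c`. -/
def childLaw (k : ℕ) [NeZero k] (c : Fin k) (ν : Measure (Fin k → ℝ)) : Measure (Fin k → ℝ) :=
  ((nonzeroUnif k).prod (tilt k c ν)).map fun z m => z.2 (m - z.1)

theorem measurable_childShift [NeZero k] :
    Measurable fun z : Fin k × (Fin k → ℝ) => fun m => z.2 (m - z.1) :=
  measurable_pi_lambda _ fun m => measurable_shift m

theorem ae_symmLift [NeZero k] (hk : 2 ≤ k) {μ : Measure ℝ} [IsProbabilityMeasure μ]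
    (hμ : μ (Set.Icc (1 / (k : ℝ)) 1) = 1) :
    ∀ᵐ x ∂(symmLift k μ), (∀ c, 0 ≤ x c) ∧ ∑ c, x c = 1 := by
  have hms : MeasurableSet {x : Fin k → ℝ | (∀ c, 0 ≤ x c) ∧ ∑ c, x c = 1} :=
    (MeasurableSet.iInter fun c => measurableSet_le measurable_const (measurable_pi_apply c)).congr
      (s := ⋂ c, {x : Fin k → ℝ | 0 ≤ x c}) (t := {x | ∀ c, 0 ≤ x c}) (by ext; simp) |>.inter
      (measurableSet_eq_fun (by fun_prop) measurable_const)
  have hae : ∀ᵐ y ∂μ, y ∈ Set.Icc (1 / (k : ℝ)) 1 := by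
    rw [← prob_compl_eq_zero_iff measurableSet_Icc] at hμ
    exact hμ
  rw [symmLift, ae_map_iff (measurable_starVec k).aemeasurable hms]
  have : ∀ᵐ z ∂(μ.prod (uniformOn (Set.univ : Set (Fin k)))), z.1 ∈ Set.Icc (1 / (k : ℝ)) 1 :=
    Measure.quasiMeasurePreserving_fst.ae hae
  exact this.mono fun z hz => ⟨fun c => starVec_nonneg hk hz _ _, sum_starVec hk _ _⟩

/-- Conditioning an offspring on a colour different from `c` amounts to choosing its colour
uniformly among the others: `1 - x c` is the sum of `x (c + j)` over `j ≠ 0`, and `symmLift` is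
invariant under cyclic shifts, which convert each summand into the tilt at `c`. -/
theorem withDensity_symmLift [NeZero k] (hk : 2 ≤ k) {μ : Measure ℝ} [IsProbabilityMeasure μ]
    (hμ : μ (Set.Icc (1 / (k : ℝ)) 1) = 1) (c : Fin k) :
    (symmLift k μ).withDensity (fun x => ENNReal.ofReal (1 - x c)) =
      ENNReal.ofReal (1 - 1 / (k : ℝ)) • childLaw k c (symmLift k μ) := by
  have hk' : (2 : ℝ) ≤ k := by exact_mod_cast hk
  have := isProbabilityMeasure_nonzeroUnif hk
  have : SFinite (symmLift k μ) := by unfold symmLift; infer_instance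
  have : SFinite (tilt k c (symmLift k μ)) := by unfold tilt; infer_instance
  refine Measure.ext_of_lintegral _ fun F hF => ?_
  have hFs : Measurable fun z : Fin k × (Fin k → ℝ) => F fun m => z.2 (m - z.1) :=
    hF.comp measurable_childShift
  rw [lintegral_smul_measure, childLaw, lintegral_map hF measurable_childShift,
    lintegral_prod _ hFs.aemeasurable,
    lintegral_withDensity_eq_lintegral_mul _ (by fun_prop) hF, lintegral_nonzeroUnif]
  have h1 : ∀ j : Fin k, ∫⁻ x, F (fun m => x (m - j)) ∂(tilt k c (symmLift k μ)) =
      ∫⁻ x, ENNReal.ofReal (k * x (c + j)) * F x ∂(symmLift k μ) := by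
    intro j
    have hs : Measurable fun x : Fin k → ℝ => fun m => x (m - j) := by fun_prop
    have hFj : Measurable fun x : Fin k → ℝ => F fun m => x (m - j) := hF.comp hs
    rw [lintegral_tilt c _ hFj, ← lintegral_symmLift_shift μ j
      (F := fun x => ENNReal.ofReal (k * x (c + j)) * F x) (by fun_prop)]
    simp
  simp_rw [h1]
  rw [← lintegral_finsetSum _ (fun j _ => by fun_prop), smul_eq_mul, ← mul_assoc,
    ← lintegral_const_mul _ (by fun_prop)]
  refine lintegral_congr_ae ((ae_symmLift hk hμ).mono fun x ⟨h0, hsum⟩ => ?_)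
  simp only [Pi.mul_apply]
  rw [← Finset.sum_mul, ← mul_assoc]
  congr 1
  rw [← ENNReal.ofReal_sum_of_nonneg fun j _ => mul_nonneg (by positivity) (h0 _),
    ← Finset.mul_sum]
  have h2 : ∑ j ∈ Finset.univ.erase (0 : Fin k), x (c + j) = 1 - x c := by
    have h3 : ∑ j : Fin k, x (c + j) = 1 := by
      rw [← hsum]; exact Equiv.sum_comp (Equiv.addLeft c) x
    rw [← Finset.add_sum_erase _ _ (Finset.mem_univ (0 : Fin k)), add_zero] at h3
    linarith
  have h4 : (((k - 1 : ℕ) : ℝ≥0∞))⁻¹ = ENNReal.ofReal ((k : ℝ) - 1)⁻¹ := by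
    rw [ENNReal.ofReal_inv_of_pos (by linarith), ← ENNReal.ofReal_natCast, Nat.cast_sub (by omega)]
    simp
  have h5 : 0 ≤ 1 - 1 / (k : ℝ) := by
    rw [sub_nonneg, div_le_one (by linarith)]; linarith
  have h6 : 0 ≤ ((k : ℝ) - 1)⁻¹ := inv_nonneg.2 (by linarith)
  rw [h2, h4, ← ENNReal.ofReal_mul h5, ← ENNReal.ofReal_mul (mul_nonneg h5 h6)]
  congr 1
  have : (k : ℝ) - 1 ≠ 0 := by linarith
  field_simp

theorem isProbabilityMeasure_symmLift [NeZero k] (μ : Measure ℝ) [IsProbabilityMeasure μ] :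
    IsProbabilityMeasure (symmLift k μ) := by
  have : IsProbabilityMeasure (uniformOn (Set.univ : Set (Fin k))) :=
    isProbabilityMeasure_uniformOn (Set.toFinite _) Set.univ_nonempty
  exact Measure.isProbabilityMeasure_map (measurable_starVec k).aemeasurable

theorem isProbabilityMeasure_tilt_symmLift [NeZero k] (hk : 2 ≤ k) (μ : Measure ℝ)
    [IsProbabilityMeasure μ] (hμ : μ (Set.Icc (1 / (k : ℝ)) 1) = 1) (c : Fin k) :
    IsProbabilityMeasure (tilt k c (symmLift k μ)) := by
  have := isProbabilityMeasure_symmLift (k := k) μ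
  have h1 : ∀ j, ∫⁻ x, ENNReal.ofReal (k * x j) ∂(symmLift k μ) =
      ∫⁻ x, ENNReal.ofReal (k * x c) ∂(symmLift k μ) := by
    intro j
    rw [← lintegral_symmLift_shift μ (j - c) (F := fun x => ENNReal.ofReal (k * x j))
      (by fun_prop)]
    simp
  have h2 : ∑ j, ∫⁻ x, ENNReal.ofReal (k * x j) ∂(symmLift k μ) = k := by
    rw [← lintegral_finsetSum _ (fun j _ => by fun_prop)]
    have : ∀ᵐ x ∂(symmLift k μ), ∑ j, ENNReal.ofReal (k * x j) = k :=
      (ae_symmLift hk hμ).mono fun x ⟨h0, hsum⟩ => by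
        rw [← ENNReal.ofReal_sum_of_nonneg fun j _ => mul_nonneg (by positivity) (h0 _),
          ← Finset.mul_sum, hsum, mul_one, ENNReal.ofReal_natCast]
    rw [lintegral_congr_ae this, lintegral_const, measure_univ, mul_one]
  simp_rw [h1] at h2
  rw [Finset.sum_const, Finset.card_univ, Fintype.card_fin, nsmul_eq_mul] at h2
  refine ⟨?_⟩
  rw [tilt, withDensity_apply _ MeasurableSet.univ, Measure.restrict_univ]
  have hk0 : (k : ℝ≥0∞) ≠ 0 := by exact_mod_cast (by omega : k ≠ 0)
  exact (ENNReal.mul_right_inj hk0 (ENNReal.natCast_ne_top k)).1 (h2.trans (mul_one _).symm)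

theorem isProbabilityMeasure_childLaw [NeZero k] (hk : 2 ≤ k) (μ : Measure ℝ)
    [IsProbabilityMeasure μ] (hμ : μ (Set.Icc (1 / (k : ℝ)) 1) = 1) (c : Fin k) :
    IsProbabilityMeasure (childLaw k c (symmLift k μ)) := by
  have := isProbabilityMeasure_nonzeroUnif hk
  have := isProbabilityMeasure_tilt_symmLift hk μ hμ c
  exact Measure.isProbabilityMeasure_map measurable_childShift.aemeasurable

end StarVec

/-! ### Consequences of calibration -/

section Calibrated

variable {k d n : ℕ}

theorem measurable_permute (π : Equiv.Perm (Fin k)) :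
    Measurable (Entry.permute π : Entry k → Entry k) := by
  refine measurable_fun_sum ?_ ?_
  · exact measurable_inl.comp
      (measurable_fst.prodMk ((Measurable.of_discrete (f := π)).comp measurable_snd))
  · exact measurable_inr

/-- Permute the colours in an array. -/
def permuteInfo (π : Equiv.Perm (Fin k)) (b : Info k d n) : Info k d n := fun v => (b v).permute π

theorem measurable_permuteInfo (π : Equiv.Perm (Fin k)) :
    Measurable (permuteInfo π : Info k d n → Info k d n) :=
  measurable_pi_lambda _ fun v => (measurable_permute π).comp (measurable_pi_apply v)

/-- The array all of whose entries are erased. -/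
def erasedInfo : Info k d n := fun _ => Sum.inr ()

theorem permuteInfo_erasedInfo (π : Equiv.Perm (Fin k)) :
    permuteInfo π (erasedInfo : Info k d n) = erasedInfo := rfl

/-- The law of the array that the rule `B` produces. -/
def infoLaw (ξ : Measure ℕ) (B : InfoRule k d n) : Measure (Info k d n) :=
  (law k d n ξ).map (observed B)

/-- The rule `B` has posterior `s`, which is symmetric in the colours, and the largest entry of the
posterior has law `μ`. -/
structure Calibrated (ξ : Measure ℕ) (μ : Measure ℝ) (B : InfoRule k d n)
    (s : Info k d n → Fin k → ℝ) : Prop where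
  measurable_observed : Measurable (observed B)
  measurable : Measurable s
  permute : ∀ π b c, s (permuteInfo π b) (π c) = s b c
  star : ∀ b, ∃ y ∈ Set.Icc (1 / (k : ℝ)) 1, ∃ l, s b = starVec k y l
  erased : ∀ c, s erasedInfo c = 1 / k
  posterior : ∀ c, ((law k d n ξ).restrict {ω | rootColour ω = c}).map (observed B) =
    (infoLaw ξ B).withDensity fun b => ENNReal.ofReal (s b c)
  invariant : ∀ π, (infoLaw ξ B).map (permuteInfo π) = infoLaw ξ B
  map_norm : (infoLaw ξ B).map (fun b => ‖s b‖) = μ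

variable {ξ : Measure ℕ} {μ : Measure ℝ} {B : InfoRule k d n}
  {s : Info k d n → Fin k → ℝ}

namespace Calibrated

variable (h : Calibrated ξ μ B s) (hk : 2 ≤ k)

include h

theorem measurable_apply (c : Fin k) : Measurable fun b => s b c :=
  (measurable_pi_apply c).comp h.measurable

include hk

theorem isProbabilityMeasure_infoLaw [IsProbabilityMeasure ξ] : IsProbabilityMeasure (infoLaw ξ B) := by
  have := isProbabilityMeasure_law hk d n ξ
  exact Measure.isProbabilityMeasure_map h.measurable_observed.aemeasurable

theorem nonneg (b : Info k d n) (c : Fin k) : 0 ≤ s b c := by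
  obtain ⟨y, hy, l, hs⟩ := h.star b
  rw [hs]; exact starVec_nonneg hk hy l c

theorem sum_eq_one (b : Info k d n) : ∑ c, s b c = 1 := by
  obtain ⟨y, hy, l, hs⟩ := h.star b
  rw [hs]; exact sum_starVec hk y l

theorem le_one (b : Info k d n) (c : Fin k) : s b c ≤ 1 := by
  rw [← h.sum_eq_one hk b]
  exact Finset.single_le_sum (f := s b) (fun c _ => h.nonneg hk b c) (Finset.mem_univ c)

variable [IsProbabilityMeasure ξ]

/-- Invariance under transpositions makes the integral independent of the colour, and the integrals
sum to one; so the colour of the root is uniform. -/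
theorem lintegral_apply (c : Fin k) :
    ∫⁻ b, ENNReal.ofReal (s b c) ∂(infoLaw ξ B) = ENNReal.ofReal (1 / k) := by
  have := h.isProbabilityMeasure_infoLaw hk
  have hk0 : (k : ℝ) ≠ 0 := by positivity
  have h1 : ∀ j, ∫⁻ b, ENNReal.ofReal (s b j) ∂(infoLaw ξ B) =
      ∫⁻ b, ENNReal.ofReal (s b c) ∂(infoLaw ξ B) := by
    intro j
    conv_lhs => rw [← h.invariant (Equiv.swap c j)]
    rw [lintegral_map (h.measurable_apply j).ennreal_ofReal (measurable_permuteInfo _)]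
    refine lintegral_congr fun b => ?_
    rw [← h.permute (Equiv.swap c j) b c, Equiv.swap_apply_left]
  have h2 : ∑ j, ∫⁻ b, ENNReal.ofReal (s b j) ∂(infoLaw ξ B) = 1 := by
    rw [← lintegral_finsetSum _ (fun j _ => (h.measurable_apply j).ennreal_ofReal)]
    have : ∀ b, ∑ j, ENNReal.ofReal (s b j) = 1 := fun b => by
      rw [← ENNReal.ofReal_sum_of_nonneg fun j _ => h.nonneg hk b j, h.sum_eq_one hk,
        ENNReal.ofReal_one]
    simp_rw [this]
    simp
  simp_rw [h1] at h2
  rw [Finset.sum_const, Finset.card_univ, Fintype.card_fin, nsmul_eq_mul] at h2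
  have hk0 : (k : ℝ≥0∞) ≠ 0 := by exact_mod_cast (by omega : k ≠ 0)
  refine (ENNReal.mul_right_inj hk0 (ENNReal.natCast_ne_top k)).1 (h2.trans ?_)
  rw [← ENNReal.ofReal_natCast, ← ENNReal.ofReal_mul (by positivity), mul_one_div_cancel (by positivity),
    ENNReal.ofReal_one]

/-- Subtract the `posterior` identity from the total law; the subtracted measure is finite. -/
theorem map_restrict_ne (c : Fin k) :
    ((law k d n ξ).restrict {ω | rootColour ω ≠ c}).map (observed B) =
      (infoLaw ξ B).withDensity fun b => ENNReal.ofReal (1 - s b c) := by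
  have := h.isProbabilityMeasure_infoLaw hk
  have hE := measurableSet_rootColour_ne (k := k) (d := d) (n := n) c
  have hcompl : {ω : Outcome k d n | rootColour ω ≠ c}ᶜ = {ω | rootColour ω = c} := by
    ext; simp
  refine Measure.ext fun S hS => ?_
  have h1 : infoLaw ξ B S = ((law k d n ξ).restrict {ω | rootColour ω ≠ c}).map (observed B) S +
      (infoLaw ξ B).withDensity (fun b => ENNReal.ofReal (s b c)) S := by
    rw [← h.posterior, ← Measure.add_apply, ← Measure.map_add _ _ h.measurable_observed,
      ← hcompl, Measure.restrict_add_restrict_compl hE]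
    rfl
  have h2 : infoLaw ξ B S = (infoLaw ξ B).withDensity (fun b => ENNReal.ofReal (1 - s b c)) S +
      (infoLaw ξ B).withDensity (fun b => ENNReal.ofReal (s b c)) S := by
    have hm : Measurable fun b => ENNReal.ofReal (1 - s b c) :=
      (measurable_const.sub (h.measurable_apply c)).ennreal_ofReal
    rw [← Measure.add_apply, ← withDensity_add_left hm]
    have : ((fun b => ENNReal.ofReal (1 - s b c)) + fun b => ENNReal.ofReal (s b c)) = 1 := by
      ext b
      simp only [Pi.add_apply, Pi.one_apply]
      rw [← ENNReal.ofReal_add (by linarith [h.le_one hk b c]) (h.nonneg hk b c)]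
      simp
    rw [this, withDensity_one]
  have h3 : (infoLaw ξ B).withDensity (fun b => ENNReal.ofReal (s b c)) S ≠ ∞ := by
    rw [← h.posterior]
    exact measure_ne_top _ _
  exact (ENNReal.add_left_inj h3).1 (h1.symm.trans h2)

/-- Both kernels have the same integral over every measurable set of arrays. The algorithm uses
`belief`, defined only almost everywhere; the analysis uses the explicit version `s`. -/
theorem belief_ae [NeZero k] : ∀ᵐ b ∂(infoLaw ξ B), belief ξ B b = s b := by
  have := h.isProbabilityMeasure_infoLaw hk
  have := isProbabilityMeasure_law hk d n ξ
  have h1 : ∀ c, (fun b => condDistrib rootColour (observed B) (law k d n ξ) b {c})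
      =ᵐ[infoLaw ξ B] fun b => ENNReal.ofReal (s b c) := by
    intro c
    refine ae_eq_of_forall_setLIntegral_eq_of_sigmaFinite
      (Kernel.measurable_coe _ (measurableSet_singleton c))
      (h.measurable_apply c).ennreal_ofReal fun S hS _ => ?_
    rw [← withDensity_apply (fun b => ENNReal.ofReal (s b c)) hS, ← h.posterior c, Measure.map_apply h.measurable_observed hS,
      infoLaw, setLIntegral_map hS (Kernel.measurable_coe _ (measurableSet_singleton c))
      h.measurable_observed, setLIntegral_preimage_condDistrib h.measurable_observed
        measurable_rootColour.aemeasurable (measurableSet_singleton c) hS,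
      Measure.restrict_apply (h.measurable_observed hS)]
    rfl
  filter_upwards [ae_all_iff.2 h1] with b hb
  ext c
  rw [belief, Measure.real, hb, ENNReal.toReal_ofReal (h.nonneg hk b c)]

/-- A star-shaped vector is determined by its peak height and peak colour. Averaging over the cyclic
shifts, under which the law of the array is invariant, makes the peak colour uniform and independent
of the height. -/
theorem map_eq_symmLift [NeZero k] [IsProbabilityMeasure μ] :
    (infoLaw ξ B).map s = symmLift k μ := by
  have := h.isProbabilityMeasure_infoLaw hk
  refine Measure.ext_of_lintegral _ fun F hF => ?_
  have hFs := hF.comp h.measurable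
  have h1 : ∀ j : Fin k, ∫⁻ b, F (s b) ∂(infoLaw ξ B) =
      ∫⁻ b, F (s (permuteInfo (Equiv.addRight j) b)) ∂(infoLaw ξ B) := by
    intro j
    conv_lhs => rw [← h.invariant (Equiv.addRight j)]
    exact lintegral_map hFs (measurable_permuteInfo _)
  have hk0 : (k : ℝ≥0∞) ≠ 0 := by exact_mod_cast (by omega : k ≠ 0)
  have hG : Measurable fun y => (k : ℝ≥0∞)⁻¹ * ∑ l, F (starVec k y l) :=
    (Finset.measurable_fun_sum _ fun l _ => hF.comp ((measurable_starVec k).comp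
      (measurable_id.prodMk measurable_const))).const_mul _
  rw [lintegral_map hF h.measurable, lintegral_symmLift μ hF, ← h.map_norm,
    lintegral_map hG (show Measurable fun b => ‖s b‖ from measurable_norm.comp h.measurable)]
  have h2 : ∫⁻ b, F (s b) ∂(infoLaw ξ B) =
      (k : ℝ≥0∞)⁻¹ * ∑ j : Fin k, ∫⁻ b, F (s (permuteInfo (Equiv.addRight j) b)) ∂(infoLaw ξ B) := by
    simp_rw [← h1]
    rw [Finset.sum_const, Finset.card_univ, Fintype.card_fin, nsmul_eq_mul, ← mul_assoc,
      ENNReal.inv_mul_cancel hk0 (ENNReal.natCast_ne_top k), one_mul]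
  have h3 : ∀ j : Fin k, Measurable fun b => F (s (permuteInfo (Equiv.addRight j) b)) := fun j =>
    hFs.comp (measurable_permuteInfo _)
  rw [h2, ← lintegral_finsetSum _ fun j _ => h3 j,
    ← lintegral_const_mul _ (Finset.measurable_fun_sum _ fun j _ => h3 j)]
  refine lintegral_congr fun b => ?_
  congr 1
  obtain ⟨y, hy, l, hs⟩ := h.star b
  rw [hs, norm_starVec hk hy, ← Equiv.sum_comp (Equiv.addLeft l) fun l => F (starVec k y l)]
  refine Finset.sum_congr rfl fun j _ => ?_
  congr 1
  ext m
  obtain ⟨m, rfl⟩ := (Equiv.addRight j).surjective m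
  rw [h.permute, hs]
  exact (starVec_apply_perm y (Equiv.addRight j) l m).symm

end Calibrated

end Calibrated

end TreeColouring
end
noncomputable section
namespace TreeColouring

/-! ### The arrays of the retained offspring -/

section Product

theorem pi_withDensity {ι : Type*} [Fintype ι] {X : ι → Type*} [∀ i, MeasurableSpace (X i)]
    (ρ : ∀ i, Measure (X i)) [∀ i, IsProbabilityMeasure (ρ i)] {g : ∀ i, X i → ℝ≥0∞}
    (hg : ∀ i, Measurable (g i)) [∀ i, SigmaFinite ((ρ i).withDensity (g i))] :
    Measure.pi (fun i => (ρ i).withDensity (g i)) =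
      (Measure.pi ρ).withDensity fun a => ∏ i, g i (a i) := by
  refine Measure.pi_eq fun S hS => ?_
  rw [withDensity_apply _ (MeasurableSet.univ_pi hS), ← lintegral_indicator
    (MeasurableSet.univ_pi hS)]
  have h1 : ∀ a : (i : ι) → X i, (Set.univ.pi S).indicator (fun a => ∏ i, g i (a i)) a =
      ∏ i, (S i).indicator (g i) (a i) := by
    classical
    intro a
    by_cases ha : a ∈ Set.univ.pi S
    · rw [Set.indicator_of_mem ha]
      exact Finset.prod_congr rfl fun i _ =>
        (Set.indicator_of_mem (ha i (Set.mem_univ i)) _).symm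
    · rw [Set.indicator_of_notMem ha]
      simp only [Set.mem_univ_pi, not_forall] at ha
      obtain ⟨i, hi⟩ := ha
      exact (Finset.prod_eq_zero (Finset.mem_univ i) (Set.indicator_of_notMem hi _)).symm
  have hm : ∀ i, Measurable ((S i).indicator (g i)) := fun i => (hg i).indicator (hS i)
  rw [lintegral_congr h1]
  refine (lintegral_prod_eq_prod_lintegral_of_indepFun Finset.univ
    (fun i (a : (i : ι) → X i) => (S i).indicator (g i) (a i))
    (iIndepFun_pi fun i => (hm i).aemeasurable)
    fun i => (hm i).comp (measurable_pi_apply i)).trans ?_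
  refine Finset.prod_congr rfl fun i _ => ?_
  rw [withDensity_apply _ (hS i), ← lintegral_indicator (hS i),
    ← (measurePreserving_eval ρ i).lintegral_comp (hm i)]

end Product

/-! ### Posterior before Alice acts at a vertex -/

section Retained

variable {k d n : ℕ}

/-- Keep the arrays of the first `D` offspring and erase the others. -/
def eraseInfo (D : ℕ) (b : Fin d → Info k d n) : Fin d → Info k d n := fun i =>
  if i.val < D then b i else erasedInfo

theorem measurable_eraseInfo :
    Measurable fun z : ℕ × (Fin d → Info k d n) => eraseInfo z.1 z.2 := by
  refine measurable_from_prod_countable_right fun D => measurable_pi_lambda _ fun i => ?_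
  by_cases hi : i.val < D
  · simpa [eraseInfo, hi] using measurable_pi_apply i
  · simp [eraseInfo, hi]

theorem measurable_eraseInfo_right (D : ℕ) :
    Measurable (eraseInfo D : (Fin d → Info k d n) → _) :=
  measurable_eraseInfo.comp (measurable_const.prodMk measurable_id)

/-- The law of the arrays of the offspring, those not retained being erased, if the arrays of the
offspring are independent of law `M`. -/
def retainedLaw (ξ : Measure ℕ) (M : Measure (Info k d n)) : Measure (Fin d → Info k d n) :=
  (ξ.prod (Measure.pi fun _ => M)).map fun z => eraseInfo z.1 z.2

/-- The unnormalised posterior of colour `c` given the arrays `a` of the offspring. -/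
def survival (s : Info k d n → Fin k → ℝ) (a : Fin d → Info k d n) (c : Fin k) : ℝ :=
  ∏ i, (1 - s (a i) c)

/-- The posterior given the arrays `a` of the offspring. -/
def prior (s : Info k d n → Fin k → ℝ) (a : Fin d → Info k d n) : Fin k → ℝ := fun c =>
  survival s a c / ∑ m, survival s a m

/-- Permute the colours in all arrays. -/
def permuteFamily (π : Equiv.Perm (Fin k)) (a : Fin d → Info k d n) : Fin d → Info k d n :=
  fun i => permuteInfo π (a i)

theorem measurable_permuteFamily (π : Equiv.Perm (Fin k)) :
    Measurable (permuteFamily π : (Fin d → Info k d n) → _) :=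
  measurable_pi_lambda _ fun i => (measurable_permuteInfo π).comp (measurable_pi_apply i)

theorem permuteFamily_eraseInfo (π : Equiv.Perm (Fin k)) (D : ℕ) (b : Fin d → Info k d n) :
    permuteFamily π (eraseInfo D b) = eraseInfo D (permuteFamily π b) := by
  ext i : 1
  unfold permuteFamily eraseInfo
  split_ifs
  · rfl
  · exact permuteInfo_erasedInfo π

/-- The law of the arrays of the offspring. -/
def familyLaw (ξ : Measure ℕ) (B : InfoRule k d n) (s : Info k d n → Fin k → ℝ) :
    Measure (Fin d → Info k d n) :=
  (retainedLaw ξ (infoLaw ξ B)).withDensity fun a =>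
    splitConst k d n * ENNReal.ofReal (∑ m, survival s a m)

variable {ξ : Measure ℕ} [IsProbabilityMeasure ξ] {μ : Measure ℝ} {B : InfoRule k d n}
  {s : Info k d n → Fin k → ℝ}

namespace Calibrated

variable (h : Calibrated ξ μ B s) (hk : 2 ≤ k)

include h in
omit [IsProbabilityMeasure ξ] in
theorem measurable_survival (c : Fin k) : Measurable fun a : Fin d → Info k d n => survival s a c :=
  Finset.measurable_fun_prod _ fun i _ =>
    measurable_const.sub ((h.measurable_apply c).comp (measurable_pi_apply i))

include h in
omit [IsProbabilityMeasure ξ] in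
theorem measurable_prior : Measurable (prior s : (Fin d → Info k d n) → _) :=
  measurable_pi_lambda _ fun c => (h.measurable_survival c).div
    (Finset.measurable_fun_sum _ fun m _ => h.measurable_survival m)

include h in
omit [IsProbabilityMeasure ξ] in
theorem survival_permute (π : Equiv.Perm (Fin k)) (a : Fin d → Info k d n) (c : Fin k) :
    survival s (permuteFamily π a) (π c) = survival s a c := by
  simp only [survival, permuteFamily, h.permute]

include h in
omit [IsProbabilityMeasure ξ] in
theorem sum_survival_permute (π : Equiv.Perm (Fin k)) (a : Fin d → Info k d n) :
    ∑ c, survival s (permuteFamily π a) c = ∑ c, survival s a c := by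
  rw [← Equiv.sum_comp π]
  simp only [h.survival_permute]

include h in
omit [IsProbabilityMeasure ξ] in
theorem prior_permute (π : Equiv.Perm (Fin k)) (a : Fin d → Info k d n) (c : Fin k) :
    prior s (permuteFamily π a) (π c) = prior s a c := by
  rw [prior, prior, h.survival_permute, h.sum_survival_permute]

include h in
omit [IsProbabilityMeasure ξ] in
theorem measurable_density : Measurable fun a : Fin d → Info k d n =>
    splitConst k d n * ENNReal.ofReal (∑ m, survival s a m) :=
  (Finset.measurable_fun_sum _ fun m _ => h.measurable_survival m).ennreal_ofReal.const_mul _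

include h hk

omit [IsProbabilityMeasure ξ] in
theorem survival_nonneg (a : Fin d → Info k d n) (c : Fin k) : 0 ≤ survival s a c :=
  Finset.prod_nonneg fun i _ => by linarith [h.le_one hk (a i) c]

omit [IsProbabilityMeasure ξ] in
-- An erased array has posterior `1 / k`, so its factor `1 - 1 / k` is common to all colours and
-- cancels on normalisation. Retaining `D` offspring is thus the same as erasing the others.
theorem priorBelief_eq_prior (D : ℕ) (b : Fin d → Info k d n) :
    priorBelief D (fun i => s (b i)) = prior s (eraseInfo D b) := by
  have hk' : (2 : ℝ) ≤ k := by exact_mod_cast hk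
  set N := (Finset.univ.filter fun i : Fin d => ¬ i.val < D).card
  have hne : (1 - 1 / (k : ℝ)) ^ N ≠ 0 := pow_ne_zero _ (by
    rw [sub_ne_zero, ne_eq, eq_div_iff (by linarith)]; linarith)
  have h1 : ∀ c, survival s (eraseInfo D b) c =
      (∏ i with i.val < D, (1 - s (b i) c)) * (1 - 1 / (k : ℝ)) ^ N := by
    intro c
    rw [survival, ← Finset.prod_filter_mul_prod_filter_not Finset.univ fun i : Fin d => i.val < D]
    congr 1
    · refine Finset.prod_congr rfl fun i hi => ?_
      rw [eraseInfo, if_pos (Finset.mem_filter.1 hi).2]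
    · rw [← Finset.prod_const]
      refine Finset.prod_congr rfl fun i hi => ?_
      rw [eraseInfo, if_neg (Finset.mem_filter.1 hi).2, h.erased]
  ext c
  simp only [priorBelief, prior, h1]
  rw [← Finset.sum_mul, mul_div_mul_right _ _ hne]

theorem measure_rootColour_ne (c : Fin k) :
    law k d n ξ {ω | rootColour ω ≠ c} = ENNReal.ofReal (1 - 1 / (k : ℝ)) := by
  have := isProbabilityMeasure_law hk d n ξ
  have h1 : law k d n ξ {ω | rootColour ω = c} = ENNReal.ofReal (1 / (k : ℝ)) := by
    rw [← h.lintegral_apply hk c, ← setLIntegral_univ, ← withDensity_apply _ MeasurableSet.univ,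
      ← h.posterior c, Measure.map_apply h.measurable_observed MeasurableSet.univ]
    simp
  have h2 : {ω : Outcome k d n | rootColour ω ≠ c} = {ω | rootColour ω = c}ᶜ := by ext; simp
  have h3 : MeasurableSet {ω : Outcome k d n | rootColour ω = c} :=
    measurable_rootColour (measurableSet_singleton c)
  rw [h2, prob_compl_eq_one_sub h3, h1,
    ENNReal.ofReal_sub _ (by positivity), ENNReal.ofReal_one]

/-- Erasing an offspring conditioned to avoid `c` leaves a point mass of weight `1 - 1 / k`, which
is the value of the density `1 - s b c` at the erased array. So density and erasure commute factor
by factor. -/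
theorem lintegral_eraseInfo (D : ℕ) (c : Fin k) {H : (Fin d → Info k d n) → ℝ≥0∞}
    (hH : Measurable H) :
    ∫⁻ b, H (eraseInfo D b) ∂(Measure.pi fun _ : Fin d =>
      (infoLaw ξ B).withDensity fun b => ENNReal.ofReal (1 - s b c)) =
    ∫⁻ b, ENNReal.ofReal (survival s (eraseInfo D b) c) * H (eraseInfo D b)
      ∂(Measure.pi fun _ : Fin d => infoLaw ξ B) := by
  have hM := h.isProbabilityMeasure_infoLaw hk
  have hlaw := isProbabilityMeasure_law hk d n ξ
  set M := infoLaw ξ B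
  set g : Info k d n → ℝ≥0∞ := fun b => ENNReal.ofReal (1 - s b c) with hg
  have hgm : Measurable g := (measurable_const.sub (h.measurable_apply c)).ennreal_ofReal
  set f : Fin d → Info k d n → Info k d n := fun i b => if i.val < D then b else erasedInfo with hf
  have hfm : ∀ i, Measurable (f i) := fun i => by
    simp only [hf]; split_ifs
    · exact measurable_id
    · exact measurable_const
  have hfin : IsFiniteMeasure (M.withDensity g) := by
    rw [hg, ← h.map_restrict_ne hk c]; infer_instance
  have huniv : M.withDensity g Set.univ = ENNReal.ofReal (1 - 1 / (k : ℝ)) := by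
    rw [hg, ← h.map_restrict_ne hk c, Measure.map_apply h.measurable_observed MeasurableSet.univ,
      ← h.measure_rootColour_ne hk c]
    simp
  have h1 : ∀ i, (M.withDensity g).map (f i) = (M.map (f i)).withDensity g := by
    intro i
    by_cases hi : i.val < D
    · simp [hf, hi]
    · simp only [hf, hi, if_false]
      rw [Measure.map_const, Measure.map_const, hM.measure_univ, one_smul, dirac_withDensity' hgm,
        huniv, hg]
      simp only [h.erased]
  have hfin2 : ∀ i, IsFiniteMeasure ((M.map (f i)).withDensity g) := fun i => by
    rw [← h1]; infer_instance
  have hpr : ∀ i, IsProbabilityMeasure (M.map (f i)) := fun i =>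
    Measure.isProbabilityMeasure_map (hfm i).aemeasurable
  have h2 : (Measure.pi fun _ : Fin d => M.withDensity g).map (eraseInfo D) =
      (Measure.pi fun i => M.map (f i)).withDensity fun a => ∏ i, g (a i) := by
    have := Measure.pi_map_pi (μ := fun _ : Fin d => M.withDensity g) (f := f)
      fun i => (hfm i).aemeasurable
    rw [show (eraseInfo D : (Fin d → Info k d n) → _) = fun x i => f i (x i) from rfl, this]
    simp_rw [h1]
    exact pi_withDensity _ fun _ => hgm
  have h3 : (Measure.pi fun _ : Fin d => M).map (eraseInfo D) = Measure.pi fun i => M.map (f i) :=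
    Measure.pi_map_pi (μ := fun _ : Fin d => M) (f := f) fun i => (hfm i).aemeasurable
  have hprod : ∀ a : Fin d → Info k d n, ∏ i, g (a i) = ENNReal.ofReal (survival s a c) := by
    intro a
    rw [survival, ENNReal.ofReal_prod_of_nonneg fun i _ => by linarith [h.le_one hk (a i) c]]
  have hem := measurable_eraseInfo_right (k := k) (d := d) (n := n) D
  have hsm := (h.measurable_survival c).ennreal_ofReal
  have hmul : Measurable fun a : Fin d → Info k d n => ENNReal.ofReal (survival s a c) * H a :=
    hsm.mul hH
  refine (lintegral_map hH hem).symm.trans ?_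
  refine Eq.trans ?_ (lintegral_map hmul hem)
  rw [h2, h3]
  simp_rw [hprod]
  rw [lintegral_withDensity_eq_lintegral_mul _ hsm hH]
  rfl

theorem lintegral_retainedLaw (c : Fin k) {H : (Fin d → Info k d n) → ℝ≥0∞}
    (hH : Measurable H) :
    ∫⁻ D, ∫⁻ b, H (eraseInfo D b) ∂(Measure.pi fun _ : Fin d =>
      (infoLaw ξ B).withDensity fun b => ENNReal.ofReal (1 - s b c)) ∂ξ =
    ∫⁻ a, ENNReal.ofReal (survival s a c) * H a ∂(retainedLaw ξ (infoLaw ξ B)) := by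
  have hM := h.isProbabilityMeasure_infoLaw hk
  have hmul : Measurable fun a : Fin d → Info k d n => ENNReal.ofReal (survival s a c) * H a :=
    (h.measurable_survival c).ennreal_ofReal.mul hH
  simp_rw [h.lintegral_eraseInfo hk _ c hH]
  rw [retainedLaw, lintegral_map hmul measurable_eraseInfo]
  exact (lintegral_prod _ (hmul.comp measurable_eraseInfo).aemeasurable).symm

omit [IsProbabilityMeasure ξ] in
-- `familyLaw` is the marginal law of the arrays, obtained by summing the weights `survival` over
-- the colours; dividing by that sum is Bayes' rule. Where the sum vanishes every `survival` does,
-- so the division by zero is harmless.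
theorem lintegral_familyLaw (c : Fin k) {H : (Fin d → Info k d n) → ℝ≥0∞} (hH : Measurable H) :
    ∫⁻ a, ENNReal.ofReal (prior s a c) * H a ∂(familyLaw ξ B s) =
      splitConst k d n *
        ∫⁻ a, ENNReal.ofReal (survival s a c) * H a ∂(retainedLaw ξ (infoLaw ξ B)) := by
  have hpm : Measurable fun a : Fin d → Info k d n => ENNReal.ofReal (prior s a c) :=
    ((measurable_pi_apply c).comp h.measurable_prior).ennreal_ofReal
  have hmul : Measurable fun a : Fin d → Info k d n => ENNReal.ofReal (prior s a c) * H a :=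
    hpm.mul hH
  rw [familyLaw, lintegral_withDensity_eq_lintegral_mul _ h.measurable_density hmul,
    ← lintegral_const_mul _ (show Measurable fun a : Fin d → Info k d n =>
      ENNReal.ofReal (survival s a c) * H a from
      (h.measurable_survival c).ennreal_ofReal.mul hH)]
  refine lintegral_congr fun a => ?_
  simp only [Pi.mul_apply]
  have h0 : 0 ≤ ∑ m, survival s a m := Finset.sum_nonneg fun m _ => h.survival_nonneg hk a m
  have : ENNReal.ofReal (survival s a c) =
      ENNReal.ofReal (∑ m, survival s a m) * ENNReal.ofReal (prior s a c) := by
    rw [← ENNReal.ofReal_mul h0, prior]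
    rcases h0.eq_or_lt with h1 | h1
    · rw [← h1, zero_mul]
      have := (Finset.sum_eq_zero_iff_of_nonneg fun m _ => h.survival_nonneg hk a m).1 h1.symm c
        (Finset.mem_univ c)
      rw [this]
    · rw [mul_div_cancel₀ _ h1.ne']
  rw [this]
  ring

omit [IsProbabilityMeasure ξ] in
theorem ae_familyLaw : ∀ᵐ a ∂(familyLaw ξ B s), (∀ c, 0 ≤ prior s a c) ∧ ∑ c, prior s a c = 1 := by
  rw [familyLaw, ae_withDensity_iff (h.measurable_density)]
  refine Filter.Eventually.of_forall fun a ha => ⟨fun c => div_nonneg (h.survival_nonneg hk a c)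
    (Finset.sum_nonneg fun m _ => h.survival_nonneg hk a m), ?_⟩
  have h1 : ∑ m, survival s a m ≠ 0 := fun h0 => ha (by rw [h0]; simp)
  simp only [prior]
  rw [← Finset.sum_div, div_self h1]

/-- The arrays are independent with invariant laws, erased arrays are fixed points, and the density
is symmetric in the colours. -/
theorem map_permute_familyLaw (π : Equiv.Perm (Fin k)) :
    (familyLaw ξ B s).map (permuteFamily π) = familyLaw ξ B s := by
  have hM := h.isProbabilityMeasure_infoLaw hk
  have hm := measurable_permuteFamily (k := k) (d := d) (n := n) π
  have h1 : (retainedLaw ξ (infoLaw ξ B)).map (permuteFamily π) = retainedLaw ξ (infoLaw ξ B) := by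
    have h2 : (Measure.pi fun _ : Fin d => infoLaw ξ B).map (permuteFamily π) =
        Measure.pi fun _ : Fin d => infoLaw ξ B := by
      have := Measure.pi_map_pi (μ := fun _ : Fin d => infoLaw ξ B)
        (f := fun _ => permuteInfo π) fun i => (measurable_permuteInfo π).aemeasurable
      simp only [h.invariant] at this
      exact this
    rw [retainedLaw, Measure.map_map hm measurable_eraseInfo]
    have h3 : (ξ.prod (Measure.pi fun _ : Fin d => infoLaw ξ B)).map
        (Prod.map id (permuteFamily π)) = ξ.prod (Measure.pi fun _ : Fin d => infoLaw ξ B) := by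
      rw [← Measure.map_prod_map _ _ measurable_id hm, h2, Measure.map_id]
    conv_rhs => rw [← h3]
    rw [Measure.map_map measurable_eraseInfo (measurable_id.prodMap hm)]
    congr 1
    ext z : 1
    exact permuteFamily_eraseInfo π z.1 z.2
  refine Measure.ext_of_lintegral _ fun F hF => ?_
  have hd := h.measurable_density
  have hFm : Measurable fun a : Fin d → Info k d n => F (permuteFamily π a) := hF.comp hm
  rw [lintegral_map hF hm, familyLaw, lintegral_withDensity_eq_lintegral_mul _ hd hFm,
    lintegral_withDensity_eq_lintegral_mul _ hd hF]
  conv_rhs => rw [← h1]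
  rw [lintegral_map (hd.mul hF) hm]
  refine lintegral_congr fun a => ?_
  simp only [Pi.mul_apply, h.sum_survival_permute]

theorem map_pi_observed (c : Fin k) :
    (Measure.pi fun _ : Fin d => (law k d n ξ).restrict {ω | rootColour ω ≠ c}).map
      (fun ω i => observed B (ω i)) = Measure.pi fun _ : Fin d =>
      (infoLaw ξ B).withDensity fun b => ENNReal.ofReal (1 - s b c) := by
  have := isProbabilityMeasure_law hk d n ξ
  rw [Measure.pi_map_pi fun _ => h.measurable_observed.aemeasurable]
  simp_rw [h.map_restrict_ne hk c]

/-- The joint law of the colour of the root, the uniform variables at the root and the retained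
arrays of the offspring. -/
theorem lintegral_law_family (c : Fin k) {G : Seed → (Fin d → Info k d n) → ℝ≥0∞}
    (hG : Measurable (Function.uncurry G)) :
    ∫⁻ ω in {ω | rootColour ω = c}, G (ω.2.1 (root d (n + 1)))
        (eraseInfo (ω.2.2 (root d (n + 1))) fun i => observed B (subOutcome ω i))
        ∂(law k d (n + 1) ξ) =
      ∫⁻ a, ENNReal.ofReal (prior s a c) * ∫⁻ U, G U a ∂seedLaw ∂(familyLaw ξ B s) := by
  have hM := h.isProbabilityMeasure_infoLaw hk
  have hlaw := isProbabilityMeasure_law hk d n ξ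
  have hobs : Measurable fun (ω : Fin d → Outcome k d n) (i : Fin d) => observed B (ω i) :=
    measurable_pi_lambda _ fun i => h.measurable_observed.comp (measurable_pi_apply i)
  have hcore : Measurable fun z : (Seed × ℕ) × (Fin d → Outcome k d n) =>
      G z.1.1 (eraseInfo z.1.2 fun i => observed B (z.2 i)) :=
    hG.comp (measurable_fst.fst.prodMk (measurable_eraseInfo.comp
      (measurable_fst.snd.prodMk (hobs.comp measurable_snd))))
  let Ψ : Fin k → Seed × ℕ → (Fin d → Outcome k d n) → ℝ≥0∞ := fun c' t ω =>
    if c' = c then G t.1 (eraseInfo t.2 fun i => observed B (ω i)) else 0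
  have hΨ : ∀ c', Measurable (Function.uncurry (Ψ c')) := by
    intro c'
    by_cases hc : c' = c
    · simpa [Ψ, hc, Function.uncurry_def] using hcore
    · simp [Ψ, hc, Function.uncurry_def]
  have hset : MeasurableSet {ω : Outcome k d (n + 1) | rootColour ω = c} :=
    measurable_rootColour (measurableSet_singleton c)
  have h1 : ∫⁻ ω in {ω | rootColour ω = c}, G (ω.2.1 (root d (n + 1)))
        (eraseInfo (ω.2.2 (root d (n + 1))) fun i => observed B (subOutcome ω i))
        ∂(law k d (n + 1) ξ) =
      ∫⁻ ω, Ψ (rootColour ω) (ω.2.1 (root d (n + 1)), ω.2.2 (root d (n + 1))) (subOutcome ω)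
        ∂(law k d (n + 1) ξ) := by
    rw [← lintegral_indicator hset]
    refine lintegral_congr fun ω => ?_
    by_cases hc : rootColour ω = c
    · rw [Set.indicator_of_mem (show ω ∈ {ω : Outcome k d (n + 1) | rootColour ω = c} from hc)]
      exact (if_pos hc).symm
    · rw [Set.indicator_of_notMem (show ω ∉ {ω : Outcome k d (n + 1) | rootColour ω = c} from hc)]
      exact (if_neg hc).symm
  have hGU : Measurable fun a => ∫⁻ U, G U a ∂seedLaw :=
    (hG.comp measurable_swap).lintegral_prod_right'
  rw [h1, lintegral_law_succ hk ξ hΨ, h.lintegral_familyLaw hk c hGU,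
    Finset.sum_eq_single c (fun c' _ hc => by simp [Ψ, hc]) (by simp)]
  congr 1
  simp only [Ψ, if_true]
  have h2 : ∀ t : Seed × ℕ, ∫⁻ ω, G t.1 (eraseInfo t.2 fun i => observed B (ω i))
      ∂(Measure.pi fun _ : Fin d => (law k d n ξ).restrict {ω | rootColour ω ≠ c}) =
      ∫⁻ b, G t.1 (eraseInfo t.2 b) ∂(Measure.pi fun _ : Fin d =>
        (infoLaw ξ B).withDensity fun b => ENNReal.ofReal (1 - s b c)) := by
    intro t
    rw [← h.map_pi_observed hk c]
    exact (lintegral_map (f := fun b => G t.1 (eraseInfo t.2 b))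
      (hG.comp (measurable_const.prodMk (measurable_eraseInfo_right t.2))) hobs).symm
  simp_rw [h2]
  have hsf : SFinite ((infoLaw ξ B).withDensity fun b => ENNReal.ofReal (1 - s b c)) := by
    infer_instance
  have hfin : IsFiniteMeasure ((infoLaw ξ B).withDensity fun b => ENNReal.ofReal (1 - s b c)) := by
    rw [← h.map_restrict_ne hk c]; infer_instance
  have h3 : Measurable fun t : Seed × ℕ => ∫⁻ b, G t.1 (eraseInfo t.2 b)
      ∂(Measure.pi fun _ : Fin d =>
        (infoLaw ξ B).withDensity fun b => ENNReal.ofReal (1 - s b c)) := by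
    have : Measurable fun z : (Seed × ℕ) × (Fin d → Info k d n) =>
        G z.1.1 (eraseInfo z.1.2 z.2) :=
      hG.comp (measurable_fst.fst.prodMk (measurable_eraseInfo.comp
        (measurable_fst.snd.prodMk measurable_snd)))
    exact this.lintegral_prod_right'
  have h4 : ∀ U, ∫⁻ D, ∫⁻ b, G U (eraseInfo D b) ∂(Measure.pi fun _ : Fin d =>
        (infoLaw ξ B).withDensity fun b => ENNReal.ofReal (1 - s b c)) ∂ξ =
      ∫⁻ a, ENNReal.ofReal (survival s a c) * G U a ∂(retainedLaw ξ (infoLaw ξ B)) := fun U =>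
    h.lintegral_retainedLaw hk c (H := G U) (hG.comp (measurable_const.prodMk measurable_id))
  refine (lintegral_prod _ h3.aemeasurable).trans ?_
  have hR : SFinite (retainedLaw ξ (infoLaw ξ B)) := by unfold retainedLaw; infer_instance
  change ∫⁻ U, _ ∂seedLaw = _
  simp_rw [h4]
  rw [lintegral_lintegral_swap (((h.measurable_survival c).ennreal_ofReal.comp measurable_snd).mul
    hG).aemeasurable]
  refine lintegral_congr fun a => ?_
  exact lintegral_const_mul _ (hG.comp (measurable_id.prodMk measurable_const))

/-- Transfers null sets one level down: restricting the law on a subtree to avoiding a colour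
creates no new sets of positive measure. -/
theorem ae_subOutcome {p : Info k d n → Prop} (hp : ∀ᵐ b ∂(infoLaw ξ B), p b) :
    ∀ᵐ ω ∂(law k d (n + 1) ξ), ∀ i, p (observed B (subOutcome ω i)) := by
  have hlaw := isProbabilityMeasure_law hk d n ξ
  rw [ae_all_iff]
  intro i
  obtain ⟨T, hT, hTm, hT0⟩ := exists_measurable_superset_of_null (ae_iff.1 hp)
  have hTind : Measurable (T.indicator (1 : Info k d n → ℝ≥0∞)) := measurable_one.indicator hTm
  have h1 : ∫⁻ ω, T.indicator 1 (observed B (subOutcome ω i)) ∂(law k d (n + 1) ξ) = 0 := by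
    have hΨ : ∀ c : Fin k, Measurable (Function.uncurry
        fun (_ : Seed × ℕ) (ω : Fin d → Outcome k d n) =>
          T.indicator (1 : Info k d n → ℝ≥0∞) (observed B (ω i))) := fun c =>
      hTind.comp (h.measurable_observed.comp ((measurable_pi_apply i).comp measurable_snd))
    refine (lintegral_law_succ hk ξ (Ψ := fun _ _ ω => T.indicator 1 (observed B (ω i))) hΨ).trans ?_
    have hnull : ∀ c : Fin k, ∫⁻ ω, T.indicator (1 : Info k d n → ℝ≥0∞) (observed B (ω i))
        ∂(Measure.pi fun _ : Fin d => (law k d n ξ).restrict {ω | rootColour ω ≠ c}) = 0 := by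
      intro c
      have h2 : ∀ᵐ ω ∂((law k d n ξ).restrict {ω | rootColour ω ≠ c}), observed B ω ∉ T := by
        have h4 : ∀ᵐ b ∂(infoLaw ξ B), b ∉ T := measure_eq_zero_iff_ae_notMem.1 hT0
        exact ae_restrict_of_ae (ae_of_ae_map h.measurable_observed.aemeasurable h4)
      have h3 := (Measure.quasiMeasurePreserving_eval (fun _ : Fin d =>
        (law k d n ξ).restrict {ω | rootColour ω ≠ c}) i).ae h2
      rw [lintegral_congr_ae (h3.mono fun ω hω => Set.indicator_of_notMem hω _), lintegral_zero]
    simp [hnull]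
  have hm : Measurable fun ω : Outcome k d (n + 1) => observed B (subOutcome ω i) :=
    h.measurable_observed.comp ((measurable_pi_apply i).comp measurable_subOutcome)
  replace h1 := (lintegral_eq_zero_iff (hTind.comp hm)).1 h1
  filter_upwards [h1] with ω hω
  by_contra hn
  have hmem : observed B (subOutcome ω i) ∈ T := hT hn
  simp [Set.indicator_of_mem hmem] at hω

end Calibrated

end Retained

end TreeColouring
end
noncomputable section
namespace TreeColouring

/-! ### One step of the algorithm -/

section Measurability

variable {k : ℕ}

instance : MeasurableSpace (Equiv.Perm (Fin k)) := ⊤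

instance : DiscreteMeasurableSpace (Equiv.Perm (Fin k)) := ⟨fun _ => trivial⟩

theorem measurable_pick_argmaxSet [NeZero k] :
    Measurable fun z : (Fin k → ℝ) × unitInterval =>
      pick (argmaxSet z.1) (argmaxSet_nonempty z.1) z.2 := by
  let _ : MeasurableSpace (Finset (Fin k)) := ⊤
  have : DiscreteMeasurableSpace (Finset (Fin k)) := ⟨fun _ => trivial⟩
  classical
  let g : Finset (Fin k) × unitInterval → Fin k := fun z =>
    if hS : z.1.Nonempty then pick z.1 hS z.2 else 0
  have hg : Measurable g := by
    refine measurable_from_prod_countable_right fun S => ?_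
    by_cases hS : S.Nonempty
    · simpa [g, hS] using measurable_pick S hS
    · simp [g, hS]
  have h1 : Measurable fun z : (Fin k → ℝ) × unitInterval => g (argmaxSet z.1, z.2) :=
    hg.comp (((measurable_comp_argmaxSet id).comp measurable_fst).prodMk measurable_snd)
  have h2 : (fun z : (Fin k → ℝ) × unitInterval =>
      pick (argmaxSet z.1) (argmaxSet_nonempty z.1) z.2) = fun z => g (argmaxSet z.1, z.2) := by
    ext z : 1
    simp [g, argmaxSet_nonempty z.1]
  rw [h2]; exact h1

theorem measurable_samplePermFixing :
    Measurable fun z : Fin k × unitInterval => samplePermFixing z.1 z.2 := by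
  refine measurable_from_prod_countable_right fun l => ?_
  have hne : (Finset.univ.filter fun π : Equiv.Perm (Fin k) => π l = l).Nonempty := ⟨1, by simp⟩
  exact measurable_pick _ hne

theorem measurable_ite_pick {α : Type*} [MeasurableSpace α] (S : Finset α) (hS : S.Nonempty)
    (x : α) : Measurable fun z : ℝ × unitInterval × unitInterval =>
      open scoped Classical in if (z.2.1 : ℝ) < z.1 then pick S hS z.2.2 else x := by
  refine Measurable.ite ?_ ((measurable_pick _ _).comp measurable_snd.snd) measurable_const
  exact measurableSet_lt (measurable_subtype_coe.comp measurable_snd.fst) measurable_fst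

theorem measurable_samplePermMix :
    Measurable fun z : ℝ × unitInterval × unitInterval =>
      (samplePermMix z.1 z.2.1 z.2.2 : Equiv.Perm (Fin k)) :=
  measurable_ite_pick Finset.univ Finset.univ_nonempty 1

end Measurability

attribute [local irreducible] pick samplePermFixing samplePermMix

section MixStep

variable {k d n : ℕ} {Y : Type*} [MeasurableSpace Y]

/-- The array given out at a vertex at which the observation `a` of the part of the tree below has
led to the posterior `x`. -/
def mixStep [NeZero k] (μ₁ μ : Measure ℝ) (act : Equiv.Perm (Fin k) → Y → Y)
    (J : Entry k → Y → Info k d n) (x : Fin k → ℝ) (U : Seed) (a : Y) : Info k d n :=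
  let l := pick (argmaxSet x) (argmaxSet_nonempty x) (U 0)
  let p := mixWeight k μ₁ μ ‖x‖ (U 1)
  let π₁ := samplePermFixing l (U 2)
  let π₂ := samplePermMix p (U 3) (U 4)
  J (Sum.inl (p, π₂ l)) (act (π₂ * π₁) a)

omit [MeasurableSpace Y] in
theorem mixStep_vec [NeZero k] (μ₁ μ : Measure ℝ) (act : Equiv.Perm (Fin k) → Y → Y)
    (J : Entry k → Y → Info k d n) (x : Fin k → ℝ) (u0 u1 u2 u3 u4 : unitInterval) (a : Y) :
    mixStep μ₁ μ act J x ![u0, u1, u2, u3, u4] a =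
      J (Sum.inl (mixWeight k μ₁ μ ‖x‖ u1, samplePermMix (mixWeight k μ₁ μ ‖x‖ u1) u3 u4
          (pick (argmaxSet x) (argmaxSet_nonempty x) u0)))
        (act (samplePermMix (mixWeight k μ₁ μ ‖x‖ u1) u3 u4 *
          samplePermFixing (pick (argmaxSet x) (argmaxSet_nonempty x) u0) u2) a) := rfl

theorem measurable_mixStep [NeZero k] {μ₁ μ : Measure ℝ} [IsProbabilityMeasure μ₁]
    [IsProbabilityMeasure μ] (hμ : μ (Set.Icc (1 / (k : ℝ)) 1) = 1)
    {act : Equiv.Perm (Fin k) → Y → Y} (hact : ∀ τ, Measurable (act τ))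
    {J : Entry k → Y → Info k d n} (hJ : Measurable (Function.uncurry J)) :
    Measurable fun z : (Fin k → ℝ) × Seed × Y => mixStep μ₁ μ act J z.1 z.2.1 z.2.2 := by
  have hU : ∀ i : Fin 5, Measurable fun z : (Fin k → ℝ) × Seed × Y => z.2.1 i := fun i =>
    (measurable_pi_apply i).comp measurable_snd.fst
  have hl : Measurable fun z : (Fin k → ℝ) × Seed × Y =>
      pick (argmaxSet z.1) (argmaxSet_nonempty z.1) (z.2.1 0) :=
    measurable_pick_argmaxSet.comp (measurable_fst.prodMk (hU 0))
  have hp : Measurable fun z : (Fin k → ℝ) × Seed × Y => mixWeight k μ₁ μ ‖z.1‖ (z.2.1 1) :=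
    (measurable_mixWeight hμ).comp (measurable_fst.norm.prodMk (hU 1))
  have h1 : Measurable fun z : (Fin k → ℝ) × Seed × Y =>
      samplePermFixing (pick (argmaxSet z.1) (argmaxSet_nonempty z.1) (z.2.1 0)) (z.2.1 2) :=
    measurable_samplePermFixing.comp (hl.prodMk (hU 2))
  have h2 : Measurable fun z : (Fin k → ℝ) × Seed × Y =>
      (samplePermMix (mixWeight k μ₁ μ ‖z.1‖ (z.2.1 1)) (z.2.1 3) (z.2.1 4) :
        Equiv.Perm (Fin k)) :=
    measurable_samplePermMix.comp (hp.prodMk ((hU 3).prodMk (hU 4)))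
  have hK : Measurable fun q : (Fin k × Equiv.Perm (Fin k) × Equiv.Perm (Fin k)) × ℝ × Y =>
      J (Sum.inl (q.2.1, q.1.2.2 q.1.1)) (act (q.1.2.2 * q.1.2.1) q.2.2) := by
    refine measurable_from_prod_countable_right fun t => ?_
    have h3 : Measurable fun q : ℝ × Y =>
        ((Sum.inl (q.1, t.2.2 t.1) : Entry k), act (t.2.2 * t.2.1) q.2) :=
      (measurable_inl.comp (measurable_fst.prodMk measurable_const)).prodMk
        ((hact _).comp measurable_snd)
    exact hJ.comp h3
  exact hK.comp ((hl.prodMk (h1.prodMk h2)).prodMk (hp.prodMk measurable_snd.snd))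

end MixStep

attribute [local irreducible] mixStep mixWeight

/-! ### The explicit posterior after mixing -/

section Posterior

variable {k : ℕ}

/-- The posterior given the entry `e` at a vertex, where `y` was the largest entry of the posterior
before that entry was drawn. -/
def blendPost (y : ℝ) (e : Entry k) : Fin k → ℝ :=
  Sum.elim (fun e => starVec k (max (1 / (k : ℝ)) (min 1 ((1 - e.1) * y + e.1 / k))) e.2)
    (fun _ _ => 1 / (k : ℝ)) e

theorem measurable_blendPost : Measurable fun z : ℝ × Entry k => blendPost z.1 z.2 := by
  have h : Measurable fun z : Entry k × ℝ => blendPost z.2 z.1 := by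
    refine (MeasurableEquiv.sumProdDistrib (ℝ × Fin k) Unit ℝ).symm.measurable_comp_iff.1 ?_
    refine measurable_fun_sum ?_ ?_
    · exact (measurable_starVec k).comp (f := fun z : (ℝ × Fin k) × ℝ =>
        (max (1 / (k : ℝ)) (min 1 ((1 - z.1.1) * z.2 + z.1.1 / k)), z.1.2)) (by fun_prop)
    · exact measurable_const
  exact h.comp measurable_swap

theorem blendPost_permute (y : ℝ) (e : Entry k) (π : Equiv.Perm (Fin k)) (c : Fin k) :
    blendPost y (e.permute π) (π c) = blendPost y e c := by
  rcases e with e | e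
  · exact starVec_apply_perm _ π e.2 c
  · rfl

/-- The clamping to `[1/k, 1]` in `blendPost` makes the star shape hold for every entry, also for
those that never occur; on the range of the algorithm it changes nothing. -/
theorem blendPost_star [NeZero k] (hk : 2 ≤ k) (y : ℝ) (e : Entry k) :
    ∃ z ∈ Set.Icc (1 / (k : ℝ)) 1, ∃ l, blendPost y e = starVec k z l := by
  rcases e with e | e
  · exact ⟨_, ⟨le_max_left _ _, max_le (one_div_natCast_le_one k) (min_le_left _ _)⟩, e.2, rfl⟩
  · refine ⟨1 / k, ⟨le_rfl, one_div_natCast_le_one k⟩, 0, ?_⟩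
    ext c
    exact (starVec_one_div hk 0 c).symm

theorem blendPost_inl {y p : ℝ} (h : (1 - p) * y + p / k ∈ Set.Icc (1 / (k : ℝ)) 1) (l : Fin k) :
    blendPost y (Sum.inl (p, l)) = starVec k ((1 - p) * y + p / k) l := by
  change starVec k (max (1 / (k : ℝ)) (min 1 ((1 - p) * y + p / k))) l = _
  rw [min_eq_right h.2, max_eq_right h.1]

theorem norm_mem_of_sum_eq_one [NeZero k] {x : Fin k → ℝ} (h0 : ∀ c, 0 ≤ x c)
    (h1 : ∑ c, x c = 1) : ‖x‖ ∈ Set.Icc (1 / (k : ℝ)) 1 := by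
  have hk : (0 : ℝ) < k := by have := NeZero.pos k; positivity
  constructor
  · rw [div_le_iff₀ hk, ← h1]
    calc ∑ c, x c ≤ ∑ _c : Fin k, ‖x‖ :=
          Finset.sum_le_sum fun c _ => (le_abs_self _).trans (norm_le_pi_norm x c)
      _ = ‖x‖ * k := by simp [mul_comm]
  · refine (pi_norm_le_iff_of_nonneg zero_le_one).2 fun c => ?_
    rw [Real.norm_of_nonneg (h0 c), ← h1]
    exact Finset.single_le_sum (fun c _ => h0 c) (Finset.mem_univ c)

end Posterior

/-! ### A mixing step preserves calibration -/

section Step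

variable {k d n : ℕ} [NeZero k] {Y : Type*} [MeasurableSpace Y] {A : Measure Y} [SFinite A]
  {μ₁ μ : Measure ℝ} [IsProbabilityMeasure μ₁] [IsProbabilityMeasure μ]
  {act : Equiv.Perm (Fin k) → Y → Y} {J : Entry k → Y → Info k d n} {P : Y → Fin k → ℝ}

/-- The integral of `F` over the array that is given out. -/
def stepIntegral (A : Measure Y) (μ₁ μ : Measure ℝ) (J : Entry k → Y → Info k d n)
    (P : Y → Fin k → ℝ) (F : Info k d n → ℝ≥0∞) : ℝ≥0∞ :=
  ∫⁻ z, ∑ l, maxWeight (P z.1) l *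
    F (J (Sum.inl (mixWeight k μ₁ μ ‖P z.1‖ z.2, l)) z.1) ∂(A.prod (volume : Measure unitInterval))

variable (hk : 2 ≤ k) (hμ : μ (Set.Icc (1 / (k : ℝ)) 1) = 1) (hd : Dominates μ₁ μ)
  (hact : ∀ τ, Measurable (act τ)) (hA : ∀ τ, A.map (act τ) = A)
  (hJ : Measurable (Function.uncurry J))
  (hP : Measurable P) (hPact : ∀ τ a c, P (act τ a) (τ c) = P a c)
  (hae : ∀ᵐ a ∂A, (∀ c, 0 ≤ P a c) ∧ ∑ c, P a c = 1)

include hμ hd hact hJ in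
-- The five uniform variables are integrated out one by one. Only the one that determines the mixing
-- weight remains, since that weight is part of the output.
theorem lintegral_seedLaw_mixStep {a : Y} {x : Fin k → ℝ} (hx : 1 / (k : ℝ) ≤ ‖x‖)
    {F : Info k d n → ℝ≥0∞} (hF : Measurable F) :
    ∫⁻ U, F (mixStep μ₁ μ act J x U a) ∂seedLaw = ∫⁻ u : unitInterval,
      ∑ l, maxWeight x l * ∑ π₁, ENNReal.ofReal (fixWeight l π₁) *
        ∑ π₂, ENNReal.ofReal (blendWeight (mixWeight k μ₁ μ ‖x‖ u) π₂) *
          F (J (Sum.inl (mixWeight k μ₁ μ ‖x‖ u, π₂ l)) (act (π₂ * π₁) a)) := by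
  have hxa : Measurable fun U : Seed => (x, U, a) :=
    measurable_const.prodMk (measurable_id.prodMk measurable_const)
  have hm0 : Measurable fun U => mixStep μ₁ μ act J x U a :=
    (measurable_mixStep hμ hact hJ).comp hxa
  have hm : Measurable fun U => F (mixStep μ₁ μ act J x U a) :=
    hF.comp hm0
  have hp : Measurable fun u : unitInterval => mixWeight k μ₁ μ ‖x‖ u :=
    (measurable_mixWeight hμ).comp (measurable_const.prodMk measurable_id)
  let g : Fin k → unitInterval → ℝ≥0∞ := fun l u =>
    ∑ π₁, ENNReal.ofReal (fixWeight l π₁) *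
      ∑ π₂, ENNReal.ofReal (blendWeight (mixWeight k μ₁ μ ‖x‖ u) π₂) *
        F (J (Sum.inl (mixWeight k μ₁ μ ‖x‖ u, π₂ l)) (act (π₂ * π₁) a))
  have hg : ∀ l, Measurable (g l) := fun l =>
    Finset.measurable_fun_sum _ fun π₁ _ => Measurable.const_mul
      (Finset.measurable_fun_sum _ fun π₂ _ =>
        ((measurable_blendWeight π₂).comp hp).ennreal_ofReal.mul
          (hF.comp (hJ.comp ((measurable_inl.comp (hp.prodMk measurable_const)).prodMk
            measurable_const)))) _
  rw [lintegral_seedLaw hm]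
  have h1 : ∀ u0 u1 : unitInterval, ∫⁻ u2, ∫⁻ u3, ∫⁻ u4 : unitInterval,
      F (mixStep μ₁ μ act J x ![u0, u1, u2, u3, u4] a) =
      g (pick (argmaxSet x) (argmaxSet_nonempty x) u0) u1 := by
    intro u0 u1
    simp only [mixStep_vec]
    set l := pick (argmaxSet x) (argmaxSet_nonempty x) u0 with hl
    have h2 : ∀ u2 : unitInterval, ∫⁻ u3, ∫⁻ u4 : unitInterval,
        F (J (Sum.inl (mixWeight k μ₁ μ ‖x‖ u1, samplePermMix (mixWeight k μ₁ μ ‖x‖ u1) u3 u4 l))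
          (act (samplePermMix (mixWeight k μ₁ μ ‖x‖ u1) u3 u4 * samplePermFixing l u2) a)) =
        ∑ π₂, ENNReal.ofReal (blendWeight (mixWeight k μ₁ μ ‖x‖ u1) π₂) *
          F (J (Sum.inl (mixWeight k μ₁ μ ‖x‖ u1, π₂ l))
            (act (π₂ * samplePermFixing l u2) a)) := fun u2 =>
      lintegral_samplePermMix (mixWeight_mem hμ hd hx u1.2.2) fun π₂ =>
        F (J (Sum.inl (mixWeight k μ₁ μ ‖x‖ u1, π₂ l)) (act (π₂ * samplePermFixing l u2) a))
    simp_rw [h2]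
    exact lintegral_samplePermFixing l fun π₁ =>
      ∑ π₂, ENNReal.ofReal (blendWeight (mixWeight k μ₁ μ ‖x‖ u1) π₂) *
        F (J (Sum.inl (mixWeight k μ₁ μ ‖x‖ u1, π₂ l)) (act (π₂ * π₁) a))
  simp_rw [h1]
  rw [lintegral_pick_argmaxSet x fun l => ∫⁻ u1, g l u1,
    lintegral_finsetSum _ fun l _ => (hg l).const_mul _]
  exact Finset.sum_congr rfl fun l _ => (lintegral_const_mul _ (hg l)).symm

include hμ hJ hP in
theorem measurable_stepIntegrand (l : Fin k) {F : Info k d n → ℝ≥0∞} (hF : Measurable F) :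
    Measurable fun z : Y × unitInterval =>
      F (J (Sum.inl (mixWeight k μ₁ μ ‖P z.1‖ z.2, l)) z.1) := by
  have hp : Measurable fun z : Y × unitInterval => mixWeight k μ₁ μ ‖P z.1‖ z.2 :=
    (measurable_mixWeight hμ).comp ((hP.comp measurable_fst).norm.prodMk measurable_snd)
  exact hF.comp (hJ.comp
    ((measurable_inl.comp (hp.prodMk measurable_const)).prodMk measurable_fst))

include hae in
omit [NeZero k] [SFinite A] in
theorem ae_prod_posterior : ∀ᵐ z ∂(A.prod (volume : Measure unitInterval)),
    (∀ c, 0 ≤ P z.1 c) ∧ ∑ c, P z.1 c = 1 :=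
  Measure.quasiMeasurePreserving_fst.ae hae

include hμ hd in
theorem reduceFn_mem {y : ℝ} (hy : y ∈ Set.Icc (1 / (k : ℝ)) 1) (u : unitInterval) :
    (1 - mixWeight k μ₁ μ y u) * y + mixWeight k μ₁ μ y u / k ∈ Set.Icc (1 / (k : ℝ)) 1 := by
  rw [mixWeight_spec hμ hd hy.1 u.2.2]
  exact ⟨one_div_le_reduceFn hμ (rank_le_one (y, u)),
    (reduceFn_le hμ hd hy.1 u.2.2).trans hy.2⟩

include hact hA in
omit [NeZero k] in
theorem map_prod_act (τ : Equiv.Perm (Fin k)) :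
    (A.prod (volume : Measure unitInterval)).map (fun z => (act τ z.1, z.2)) =
      A.prod volume := by
  have := Measure.map_prod_map A (volume : Measure unitInterval) (hact τ) measurable_id
  rw [hA, Measure.map_id] at this
  exact this.symm

include hk hμ hd hact hA hJ hP hPact hae in
-- Bayes' rule for the output: weighting with the posterior before the step equals weighting with
-- `s` after it. The change of variables is legitimate because norms of posteriors, and hence the
-- mixing weights, do not change under permutations of the colours.
theorem lintegral_mixStep {s : Info k d n → Fin k → ℝ}
    (hs : ∀ p l a, s (J (Sum.inl (p, l)) a) = blendPost ‖P a‖ (Sum.inl (p, l)))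
    {F : Info k d n → ℝ≥0∞} (hF : Measurable F) (c : Fin k) :
    ∫⁻ a, ENNReal.ofReal (P a c) * ∫⁻ U, F (mixStep μ₁ μ act J (P a) U a) ∂seedLaw ∂A =
      stepIntegral A μ₁ μ J P fun b => F b * ENNReal.ofReal (s b c) := by
  have hp : Measurable fun z : Y × unitInterval => mixWeight k μ₁ μ ‖P z.1‖ z.2 :=
    (measurable_mixWeight hμ).comp ((hP.comp measurable_fst).norm.prodMk measurable_snd)
  have hpP : Measurable fun z : Y × unitInterval => P z.1 := hP.comp measurable_fst
  have hactz : ∀ τ, Measurable fun z : Y × unitInterval => (act τ z.1, z.2) := fun τ =>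
    ((hact τ).comp measurable_fst).prodMk measurable_snd
  have hae2 : ∀ᵐ z ∂(A.prod (volume : Measure unitInterval)), (∀ c, 0 ≤ P z.1 c) ∧
      ∑ c, P z.1 c = 1 ∧ mixWeight k μ₁ μ ‖P z.1‖ z.2 ∈ Set.Icc (0 : ℝ) 1 :=
    (ae_prod_posterior hae).mono fun z ⟨h0, h1⟩ =>
      ⟨h0, h1, mixWeight_mem hμ hd (norm_mem_of_sum_eq_one h0 h1).1 z.2.2.2⟩
  have key := lintegral_blend (A := A.prod (volume : Measure unitInterval))
    (act := fun τ z => (act τ z.1, z.2)) (P := fun z => P z.1)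
    (p := fun z => mixWeight k μ₁ μ ‖P z.1‖ z.2)
    (Φ := fun l z => F (J (Sum.inl (mixWeight k μ₁ μ ‖P z.1‖ z.2, l)) z.1))
    hk hactz (map_prod_act hact hA) hpP (fun τ z => hPact τ z.1) hp
    (fun τ z => by rw [norm_apply_perm τ (hPact τ z.1)]) hae2
    (fun l => measurable_stepIntegrand hμ hJ hP l hF) c
  have h1 : ∫⁻ a, ENNReal.ofReal (P a c) * ∫⁻ U, F (mixStep μ₁ μ act J (P a) U a) ∂seedLaw ∂A =
      ∫⁻ a, ∫⁻ u, ENNReal.ofReal (P a c) * ∑ l, maxWeight (P a) l *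
        ∑ π₁, ENNReal.ofReal (fixWeight l π₁) *
        ∑ π₂, ENNReal.ofReal (blendWeight (mixWeight k μ₁ μ ‖P a‖ u) π₂) *
          F (J (Sum.inl (mixWeight k μ₁ μ ‖P (act (π₂ * π₁) a)‖ u, π₂ l)) (act (π₂ * π₁) a))
          ∂(volume : Measure unitInterval) ∂A := by
    refine lintegral_congr_ae (hae.mono fun a ⟨h0, h1⟩ => ?_)
    simp only
    rw [lintegral_seedLaw_mixStep hμ hd hact hJ (norm_mem_of_sum_eq_one h0 h1).1 hF,
      lintegral_const_mul' _ _ ENNReal.ofReal_ne_top]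
    simp_rw [norm_apply_perm _ (hPact _ a)]
  have hq : ∀ (l : Fin k) (π₁ π₂ : Equiv.Perm (Fin k)), Measurable fun z : Y × unitInterval =>
      F (J (Sum.inl (mixWeight k μ₁ μ ‖P (act (π₂ * π₁) z.1)‖ z.2, π₂ l))
        (act (π₂ * π₁) z.1)) := by
    intro l π₁ π₂
    generalize π₂ * π₁ = τ
    generalize π₂ l = l'
    have h5 := (measurable_stepIntegrand (μ₁ := μ₁) hμ hJ hP l' hF).comp (hactz τ)
    exact h5
  have hmeas : Measurable fun z : Y × unitInterval => ENNReal.ofReal (P z.1 c) *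
      ∑ l, maxWeight (P z.1) l * ∑ π₁, ENNReal.ofReal (fixWeight l π₁) *
        ∑ π₂, ENNReal.ofReal (blendWeight (mixWeight k μ₁ μ ‖P z.1‖ z.2) π₂) *
          F (J (Sum.inl (mixWeight k μ₁ μ ‖P (act (π₂ * π₁) z.1)‖ z.2, π₂ l))
            (act (π₂ * π₁) z.1)) := by
    refine ((measurable_pi_apply c).comp hpP).ennreal_ofReal.mul
      (Finset.measurable_fun_sum _ fun l _ => ((measurable_maxWeight l).comp hpP).mul
        (Finset.measurable_fun_sum _ fun π₁ _ => Measurable.const_mul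
          (Finset.measurable_fun_sum _ fun π₂ _ =>
            ((measurable_blendWeight π₂).comp hp).ennreal_ofReal.mul ?_) _))
    exact hq l π₁ π₂
  rw [h1]
  refine (lintegral_prod _ hmeas.aemeasurable).symm.trans (key.trans ?_)
  unfold stepIntegral
  refine lintegral_congr_ae ((ae_prod_posterior hae).mono fun z ⟨h0, h1⟩ => ?_)
  simp only
  refine Finset.sum_congr rfl fun l _ => ?_
  rw [hs, blendPost_inl (reduceFn_mem hμ hd (norm_mem_of_sum_eq_one h0 h1) z.2)]

include hμ hact hA hJ hP hPact in
theorem stepIntegral_permute (hJact : ∀ τ e a, permuteInfo τ (J e a) = J (e.permute τ) (act τ a))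
    (τ : Equiv.Perm (Fin k)) {F : Info k d n → ℝ≥0∞} (hF : Measurable F) :
    stepIntegral A μ₁ μ J P (fun b => F (permuteInfo τ b)) = stepIntegral A μ₁ μ J P F := by
  have := lintegral_maxWeight_act (A := A.prod (volume : Measure unitInterval))
    (act := fun τ z => (act τ z.1, z.2)) (P := fun z => P z.1) τ
    (((hact τ).comp measurable_fst).prodMk measurable_snd) (map_prod_act hact hA τ)
    (hP.comp measurable_fst) (fun z => hPact τ z.1)
    (Ψ := fun l z => F (J (Sum.inl (mixWeight k μ₁ μ ‖P z.1‖ z.2, l)) z.1))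
    (fun l => measurable_stepIntegrand hμ hJ hP l hF)
  refine Eq.trans (lintegral_congr fun z => ?_) this
  refine Finset.sum_congr rfl fun l _ => ?_
  simp only
  rw [hJact, norm_apply_perm τ (hPact τ z.1)]
  rfl

include hk hμ hd hP hae in
-- The height of the new peak is `reduceFn` of the old one and an independent uniform variable,
-- which turns the law `μ₁` into `μ`.
theorem stepIntegral_norm (hnorm : A.map (fun a => ‖P a‖) = μ₁) {s : Info k d n → Fin k → ℝ}
    (hs : ∀ p l a, s (J (Sum.inl (p, l)) a) = blendPost ‖P a‖ (Sum.inl (p, l)))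
    {F : ℝ → ℝ≥0∞} (hF : Measurable F) :
    stepIntegral A μ₁ μ J P (fun b => F ‖s b‖) = ∫⁻ y, F y ∂μ := by
  have h1 : stepIntegral A μ₁ μ J P (fun b => F ‖s b‖) =
      ∫⁻ z, F (reduceFn k μ₁ μ ‖P z.1‖ z.2) ∂(A.prod (volume : Measure unitInterval)) := by
    refine lintegral_congr_ae ((ae_prod_posterior hae).mono fun z ⟨h0, h1⟩ => ?_)
    have hy := norm_mem_of_sum_eq_one h0 h1
    have hr := reduceFn_mem hμ hd hy z.2
    simp only [hs]
    simp_rw [blendPost_inl hr, norm_starVec hk hr, mixWeight_spec hμ hd hy.1 z.2.2.2]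
    rw [← Finset.sum_mul, sum_maxWeight, one_mul]
  have hPn : Measurable fun a => ‖P a‖ := hP.norm
  have h2 := Measure.map_prod_map A (volume : Measure unitInterval) hPn measurable_id
  rw [hnorm, Measure.map_id] at h2
  have hFr : Measurable fun p : ℝ × unitInterval => F (reduceFn k μ₁ μ p.1 p.2) :=
    hF.comp (measurable_reduceFn hμ)
  rw [h1]
  conv_rhs => rw [← map_reduceFn (μ₁ := μ₁) hμ, lintegral_map hF (measurable_reduceFn hμ), h2]
  exact (lintegral_map hFr (hPn.prodMap measurable_id)).symm

include hk hμ hd hact hA hJ hP hPact hae in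
/-- A rule whose joint law with the colour of the root is that of a step of the algorithm is
calibrated. -/
theorem Calibrated.of_mixStep (hnorm : A.map (fun a => ‖P a‖) = μ₁)
    (hJact : ∀ τ e a, permuteInfo τ (J e a) = J (e.permute τ) (act τ a))
    {ξ : Measure ℕ} [IsProbabilityMeasure ξ] {B : InfoRule k d n} (hB : Measurable (observed B))
    {s : Info k d n → Fin k → ℝ} (hsm : Measurable s)
    (hs : ∀ p l a, s (J (Sum.inl (p, l)) a) = blendPost ‖P a‖ (Sum.inl (p, l)))
    (hperm : ∀ π b c, s (permuteInfo π b) (π c) = s b c)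
    (hstar : ∀ b, ∃ y ∈ Set.Icc (1 / (k : ℝ)) 1, ∃ l, s b = starVec k y l)
    (herased : ∀ c, s erasedInfo c = 1 / k)
    (hjoint : ∀ c (F : Info k d n → ℝ≥0∞), Measurable F →
      ∫⁻ ω in {ω | rootColour ω = c}, F (observed B ω) ∂(law k d n ξ) =
        ∫⁻ a, ENNReal.ofReal (P a c) * ∫⁻ U, F (mixStep μ₁ μ act J (P a) U a) ∂seedLaw ∂A) :
    Calibrated ξ μ B s := by
  have h1 : ∀ c (F : Info k d n → ℝ≥0∞), Measurable F →
      ∫⁻ ω in {ω | rootColour ω = c}, F (observed B ω) ∂(law k d n ξ) =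
        stepIntegral A μ₁ μ J P fun b => F b * ENNReal.ofReal (s b c) := fun c F hF => by
    rw [hjoint c F hF, lintegral_mixStep hk hμ hd hact hA hJ hP hPact hae hs hF]
  have hsc : ∀ c, Measurable fun b => ENNReal.ofReal (s b c) := fun c =>
    ((measurable_pi_apply c).comp hsm).ennreal_ofReal
  -- Sum the joint law over the colours; the entries of `s` add up to one.
  have h2 : ∀ F : Info k d n → ℝ≥0∞, Measurable F →
      ∫⁻ ω, F (observed B ω) ∂(law k d n ξ) = stepIntegral A μ₁ μ J P F := by
    intro F hF
    have hsplit : ∫⁻ ω, F (observed B ω) ∂(law k d n ξ) =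
        ∑ c, ∫⁻ ω in {ω | rootColour ω = c}, F (observed B ω) ∂(law k d n ξ) := by
      have hmc : ∀ c : Fin k, MeasurableSet {ω : Outcome k d n | rootColour ω = c} := fun c =>
        measurable_rootColour (measurableSet_singleton c)
      simp_rw [← lintegral_indicator (hmc _)]
      have hFB : Measurable fun ω => F (observed B ω) := hF.comp hB
      rw [← lintegral_finsetSum _ fun c _ => hFB.indicator (hmc c)]
      refine lintegral_congr fun ω => ?_
      simp [Set.indicator_apply]
    rw [hsplit]
    simp_rw [h1 _ F hF]
    unfold stepIntegral
    have hmeas : ∀ c, Measurable fun z : Y × unitInterval => ∑ l, maxWeight (P z.1) l *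
        (F (J (Sum.inl (mixWeight k μ₁ μ ‖P z.1‖ z.2, l)) z.1) * ENNReal.ofReal
          (s (J (Sum.inl (mixWeight k μ₁ μ ‖P z.1‖ z.2, l)) z.1) c)) := fun c =>
      Finset.measurable_fun_sum _ fun l _ =>
        ((measurable_maxWeight l).comp (hP.comp measurable_fst)).mul
          (measurable_stepIntegrand hμ hJ hP l (hF.mul (hsc c)))
    rw [← lintegral_finsetSum _ fun c _ => hmeas c]
    refine lintegral_congr fun z => ?_
    rw [Finset.sum_comm]
    refine Finset.sum_congr rfl fun l _ => ?_
    rw [← Finset.mul_sum, ← Finset.mul_sum]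
    obtain ⟨y, hy, l', hl'⟩ := hstar (J (Sum.inl (mixWeight k μ₁ μ ‖P z.1‖ z.2, l)) z.1)
    rw [hl', ← ENNReal.ofReal_sum_of_nonneg fun c _ => starVec_nonneg hk hy l' c,
      sum_starVec hk, ENNReal.ofReal_one, mul_one]
  refine ⟨hB, hsm, hperm, hstar, herased, fun c => ?_, fun π => ?_, ?_⟩
  · refine Measure.ext_of_lintegral _ fun F hF => ?_
    rw [lintegral_map hF hB, h1 c F hF, lintegral_withDensity_eq_lintegral_mul _ (hsc c) hF,
      infoLaw, lintegral_map ((hsc c).mul hF) hB]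
    refine Eq.trans ?_ (h2 _ ((hsc c).mul hF)).symm
    congr 1
    ext b
    exact mul_comm _ _
  · refine Measure.ext_of_lintegral _ fun F hF => ?_
    have hm := measurable_permuteInfo (k := k) (d := d) (n := n) π
    rw [lintegral_map hF hm, infoLaw, lintegral_map hF hB, h2 F hF]
    refine (lintegral_map (hF.comp hm) hB).trans ((h2 _ (hF.comp hm)).trans ?_)
    exact stepIntegral_permute hμ hact hA hJ hP hPact hJact π hF
  · refine Measure.ext_of_lintegral _ fun F hF => ?_
    have hn : Measurable fun b => ‖s b‖ := hsm.norm
    rw [lintegral_map hF hn, infoLaw]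
    refine (lintegral_map (hF.comp hn) hB).trans ((h2 _ (hF.comp hn)).trans ?_)
    exact stepIntegral_norm hk hμ hd hP hae hnorm hs hF

end Step

end TreeColouring
end
noncomputable section
namespace TreeColouring

/-! ### The tree of height zero -/

section Leaf

variable {k d : ℕ}

instance : Unique (Vertex d 0) where
  default := root d 0
  uniq v := Subtype.ext (List.length_eq_zero_iff.1 (Nat.le_zero.1 v.2))

theorem lintegral_colouringMeasure_zero (g : Fin k → ℝ≥0∞) :
    ∫⁻ σ, g (σ (root d 0)) ∂(colouringMeasure k d 0) = (k : ℝ≥0∞)⁻¹ * ∑ c, g c := by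
  classical
  have h1 : properColourings k d 0 = ((Finset.univ : Finset (Vertex d 0 → Fin k)) : Set _) := by
    rw [Finset.coe_univ, Set.eq_univ_iff_forall]
    rintro σ v w ⟨i, hi⟩
    have := w.2
    rw [hi] at this
    simp at this
  rw [colouringMeasure, h1, lintegral_uniformOn, Finset.card_univ, Fintype.card_fun,
    Fintype.card_fin, Fintype.card_unique, pow_one]
  congr 1
  exact Equiv.sum_comp (Equiv.funUnique (Vertex d 0) (Fin k)) g

theorem lintegral_law_zero (ξ : Measure ℕ) [IsProbabilityMeasure ξ] {g : Fin k → Seed → ℝ≥0∞}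
    (hg : ∀ c, Measurable (g c)) :
    ∫⁻ ω, g (rootColour ω) (ω.2.1 (root d 0)) ∂(law k d 0 ξ) =
      (k : ℝ≥0∞)⁻¹ * ∑ c, ∫⁻ U, g c U ∂seedLaw := by
  have : IsFiniteMeasure (colouringMeasure k d 0) := by
    unfold colouringMeasure; infer_instance
  have hm : Measurable fun ω : Outcome k d 0 => g (rootColour ω) (ω.2.1 (root d 0)) := by
    have h1 : Measurable fun p : Fin k × Seed => g p.1 p.2 :=
      measurable_from_prod_countable_right hg
    exact h1.comp (measurable_rootColour.prodMk (by fun_prop))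
  rw [law]
  refine (lintegral_prod _ hm.aemeasurable).trans ?_
  have h2 : ∀ σ : Vertex d 0 → Fin k, ∫⁻ y : (Vertex d 0 → Seed) × (Vertex d 0 → ℕ),
      g (rootColour (σ, y)) (y.1 (root d 0))
      ∂((Measure.pi fun _ => Measure.pi fun _ => (volume : Measure unitInterval)).prod
        (Measure.pi fun _ => ξ)) = ∫⁻ U, g (σ (root d 0)) U ∂seedLaw := by
    intro σ
    have h3 : MeasurePreserving (fun y : (Vertex d 0 → Seed) × (Vertex d 0 → ℕ) =>
        y.1 (root d 0)) ((Measure.pi fun _ => Measure.pi fun _ =>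
          (volume : Measure unitInterval)).prod (Measure.pi fun _ => ξ)) seedLaw :=
      (measurePreserving_eval (fun _ : Vertex d 0 => seedLaw) (root d 0)).comp
        measurePreserving_fst
    exact h3.lintegral_comp (hg (σ (root d 0)))
  rw [lintegral_congr h2]
  exact lintegral_colouringMeasure_zero fun c => ∫⁻ U, g c U ∂seedLaw

theorem starVec_one (a c : Fin k) : starVec k 1 a c = if c = a then 1 else 0 := by
  simp [starVec]

theorem argmaxSet_starVec_one (a : Fin k) : argmaxSet (starVec k 1 a) = {a} := by
  ext l
  rw [mem_argmaxSet, Finset.mem_singleton]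
  constructor
  · intro h
    by_contra hl
    have := h a
    rw [starVec_one, starVec_one, if_pos rfl, if_neg hl] at this
    linarith
  · rintro rfl m
    rw [starVec_one, starVec_one, if_pos rfl]
    split_ifs <;> norm_num

theorem dominates_dirac_one {μ : Measure ℝ} [IsProbabilityMeasure μ]
    (hμ : μ (Set.Icc (1 / (k : ℝ)) 1) = 1) : Dominates (Measure.dirac 1) μ := by
  intro x
  by_cases hx : 1 ≤ x
  · have h1 : μ (Set.Iic x) = 1 :=
      le_antisymm prob_le_one (hμ.symm.le.trans (measure_mono fun y hy => hy.2.trans hx))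
    rw [h1]; exact prob_le_one
  · rw [Measure.dirac_apply' _ measurableSet_Iic, Set.indicator_of_notMem (by simpa using hx)]
    exact zero_le

theorem pick_singleton {α : Type*} (a : α) (h : ({a} : Finset α).Nonempty) (u : unitInterval) :
    pick {a} h u = a :=
  Finset.mem_singleton.1 ((({a} : Finset α).equivFin.symm _).2)

variable [NeZero k] {μ : Measure ℝ} [IsProbabilityMeasure μ]

omit [IsProbabilityMeasure μ] in
theorem mixStep_leaf (hk : 2 ≤ k) (a : Fin k) (U : Seed) :
    mixStep (Measure.dirac 1) μ (fun τ a => τ a) (fun e _ _ => e) (starVec k 1 a) U a =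
      (fun _ => Sum.inl (mixWeight k (Measure.dirac 1) μ 1 (U 1),
        samplePermMix (mixWeight k (Measure.dirac 1) μ 1 (U 1)) (U 3) (U 4) a) : Info k d 0) := by
  have hp : ∀ u, pick (argmaxSet (starVec k 1 a)) (argmaxSet_nonempty _) u = a := by
    intro u
    have h : ∀ (S : Finset (Fin k)) (hS : S.Nonempty), S = {a} → pick S hS u = a := by
      rintro S hS rfl
      exact pick_singleton a hS u
    exact h _ _ (argmaxSet_starVec_one a)
  have hn : ‖starVec k 1 a‖ = 1 := norm_starVec hk ⟨one_div_natCast_le_one k, le_rfl⟩ a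
  simp only [mixStep, hp, hn]

attribute [local irreducible] pick samplePermFixing samplePermMix mixStep mixWeight

omit [NeZero k] in
theorem lintegral_uniformOn_univ (f : Fin k → ℝ≥0∞) :
    ∫⁻ a, f a ∂(uniformOn (Set.univ : Set (Fin k))) = (k : ℝ≥0∞)⁻¹ * ∑ a, f a := by
  have := lintegral_uniformOn (Finset.univ : Finset (Fin k)) f
  simpa using this

theorem measurable_leafEntry (hk : 2 ≤ k) (hμ : μ (Set.Icc (1 / (k : ℝ)) 1) = 1) :
    Measurable fun q : Fin k × Seed =>
      (fun _ => Sum.inl (mixWeight k (Measure.dirac 1) μ 1 (q.2 1),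
        samplePermMix (mixWeight k (Measure.dirac 1) μ 1 (q.2 1)) (q.2 3) (q.2 4) q.1) :
          Info k d 0) := by
  refine measurable_from_prod_countable_right fun a => ?_
  have h1 : Measurable fun U : Seed => (starVec k 1 a, U, a) :=
    measurable_const.prodMk (measurable_id.prodMk measurable_const)
  have h2 := (measurable_mixStep (n := 0) (d := d) (μ₁ := Measure.dirac 1) hμ
    (act := fun τ (a : Fin k) => τ a) (fun _ => Measurable.of_discrete)
    (J := fun e _ _ => e) (measurable_pi_lambda _ fun _ => measurable_fst)).comp h1
  have h3 : (fun U : Seed => (fun _ => Sum.inl (mixWeight k (Measure.dirac 1) μ 1 (U 1),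
      samplePermMix (mixWeight k (Measure.dirac 1) μ 1 (U 1)) (U 3) (U 4) a) : Info k d 0)) =
      fun U => mixStep (Measure.dirac 1) μ (fun τ a => τ a) (fun e _ _ => e)
        (starVec k 1 a) U a := by
    ext U : 1
    exact (mixStep_leaf hk a U).symm
  rw [h3]
  exact h2

theorem measurable_leafStep (hk : 2 ≤ k) (hμ : μ (Set.Icc (1 / (k : ℝ)) 1) = 1) :
    Measurable fun x : (Leaf d 0 → Fin k) × (Vertex d 0 → Seed) × (Vertex d 0 → ℕ) =>
      leafStep k d μ x.1 x.2.1 x.2.2 := by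
  have h2 : Measurable fun x : (Leaf d 0 → Fin k) × (Vertex d 0 → Seed) × (Vertex d 0 → ℕ) =>
      (x.1 ⟨[], rfl⟩, x.2.1 (root d 0)) := by fun_prop
  exact (measurable_leafEntry hk hμ).comp h2

/-- A leaf is a mixing step in which the observation is the colour itself: posterior a unit vector,
`μ₁` the unit mass at one, and the reported maximising colour the true one. The permutation fixing
that colour is immaterial, as there is nothing below to permute. -/
theorem calibrated_leafStep (hk : 2 ≤ k) (hμ : μ (Set.Icc (1 / (k : ℝ)) 1) = 1) (ξ : Measure ℕ)
    [IsProbabilityMeasure ξ] :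
    Calibrated ξ μ (leafStep k d μ) fun b => blendPost 1 (b (root d 0)) := by
  have hprob : IsProbabilityMeasure (uniformOn (Set.univ : Set (Fin k))) :=
    isProbabilityMeasure_uniformOn (Set.toFinite _) Set.univ_nonempty
  have hnorm1 : ∀ a : Fin k, ‖starVec k 1 a‖ = 1 := fun a =>
    norm_starVec hk ⟨one_div_natCast_le_one k, le_rfl⟩ a
  have hmix : ∀ a : Fin k, Measurable fun U : Seed =>
      (fun _ => Sum.inl (mixWeight k (Measure.dirac 1) μ 1 (U 1),
        samplePermMix (mixWeight k (Measure.dirac 1) μ 1 (U 1)) (U 3) (U 4) a) : Info k d 0) :=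
    fun a => (measurable_leafEntry hk hμ).comp (measurable_const.prodMk measurable_id)
  have hobs : ∀ ω : Outcome k d 0, observed (leafStep k d μ) ω =
      fun _ => Sum.inl (mixWeight k (Measure.dirac 1) μ 1 (ω.2.1 (root d 0) 1),
        samplePermMix (mixWeight k (Measure.dirac 1) μ 1 (ω.2.1 (root d 0) 1))
          (ω.2.1 (root d 0) 3) (ω.2.1 (root d 0) 4) (rootColour ω)) := fun ω => rfl
  have hB : Measurable (observed (leafStep k d μ)) := by
    have h2 : Measurable fun ω : Outcome k d 0 => (rootColour ω, ω.2.1 (root d 0)) :=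
      measurable_rootColour.prodMk (by fun_prop)
    exact (measurable_leafEntry hk hμ).comp h2
  refine Calibrated.of_mixStep (A := uniformOn (Set.univ : Set (Fin k)))
    (μ₁ := Measure.dirac 1) (act := fun τ a => τ a) (J := fun e _ _ => e)
    (P := fun a => starVec k 1 a) hk hμ (dominates_dirac_one hμ) (fun _ => Measurable.of_discrete)
    (fun τ => ?_) (measurable_pi_lambda _ fun _ => measurable_fst) Measurable.of_discrete
    (fun τ a c => starVec_apply_perm 1 τ a c)
    (Filter.Eventually.of_forall fun a => ⟨fun c => starVec_nonneg hk
      ⟨one_div_natCast_le_one k, le_rfl⟩ a c, sum_starVec hk 1 a⟩) ?_ (fun τ e a => rfl) hB ?_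
    (fun p l a => by simp only [hnorm1]) (fun π b c => blendPost_permute 1 _ π c)
    (fun b => blendPost_star hk 1 _) (fun c => rfl) ?_
  · refine Measure.ext_of_lintegral _ fun F hF => ?_
    rw [lintegral_map hF Measurable.of_discrete, lintegral_uniformOn_univ,
      lintegral_uniformOn_univ, Equiv.sum_comp τ F]
  · simp only [hnorm1]
    rw [Measure.map_const, measure_univ, one_smul]
  · have h1 : Measurable fun b : Info k d 0 => ((1 : ℝ), b (root d 0)) :=
      measurable_const.prodMk (measurable_pi_apply _)
    exact measurable_blendPost.comp h1
  · intro c F hF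
    have hset : MeasurableSet {ω : Outcome k d 0 | rootColour ω = c} :=
      measurable_rootColour (measurableSet_singleton c)
    let g : Fin k → Seed → ℝ≥0∞ := fun c' U => if c' = c then
      F (fun _ => Sum.inl (mixWeight k (Measure.dirac 1) μ 1 (U 1),
        samplePermMix (mixWeight k (Measure.dirac 1) μ 1 (U 1)) (U 3) (U 4) c')) else 0
    have hg : ∀ c', Measurable (g c') := by
      intro c'
      by_cases hc : c' = c
      · simp only [g, hc, if_true]
        exact hF.comp (hmix c)
      · simp [g, hc]
    have h1 : ∫⁻ ω in {ω | rootColour ω = c}, F (observed (leafStep k d μ) ω) ∂(law k d 0 ξ) =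
        ∫⁻ ω, g (rootColour ω) (ω.2.1 (root d 0)) ∂(law k d 0 ξ) := by
      rw [← lintegral_indicator hset]
      refine lintegral_congr fun ω => ?_
      simp only [Set.indicator_apply, Set.mem_ofPred_eq, hobs, g]
    rw [h1, lintegral_law_zero ξ hg, lintegral_uniformOn_univ]
    congr 1
    refine Finset.sum_congr rfl fun a _ => ?_
    simp only [mixStep_leaf hk, starVec_one, g]
    by_cases hc : a = c
    · simp [hc]
    · simp [hc, Ne.symm hc]

end Leaf

end TreeColouring
end
noncomputable section
namespace TreeColouring

/-! ### The law of the largest entry of the posterior -/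

section PiLemmas

theorem pi_smul_const {X : Type*} [MeasurableSpace X] (d : ℕ) (r : ℝ≥0∞) (hr : r ≠ ∞)
    (ρ : Measure X) [IsProbabilityMeasure ρ] :
    Measure.pi (fun _ : Fin d => r • ρ) = r ^ d • Measure.pi fun _ : Fin d => ρ := by
  have : IsFiniteMeasure (r • ρ) := Measure.smul_finite ρ hr
  refine Measure.pi_eq fun S _ => ?_
  simp only [Measure.smul_apply, smul_eq_mul, Measure.pi_pi]
  rw [Finset.prod_mul_distrib, Finset.prod_const, Finset.card_univ, Fintype.card_fin]

theorem map_castLE_pi {X : Type*} [MeasurableSpace X] {D d : ℕ} (hD : D ≤ d)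
    (ρ : Measure X) [IsProbabilityMeasure ρ] :
    (Measure.pi fun _ : Fin d => ρ).map (fun x (j : Fin D) => x (Fin.castLE hD j)) =
      Measure.pi fun _ : Fin D => ρ := by
  classical
  have hm : Measurable fun (x : Fin d → X) (j : Fin D) => x (Fin.castLE hD j) :=
    measurable_pi_lambda _ fun j => measurable_pi_apply _
  refine (Measure.pi_eq fun S hS => ?_).symm
  rw [Measure.map_apply hm (MeasurableSet.univ_pi hS)]
  have h1 : (fun (x : Fin d → X) (j : Fin D) => x (Fin.castLE hD j)) ⁻¹' Set.univ.pi S =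
      Set.univ.pi fun i : Fin d => if h : i.val < D then S ⟨i.val, h⟩ else Set.univ := by
    ext x
    simp only [Set.mem_preimage, Set.mem_univ_pi]
    constructor
    · intro h i
      split_ifs with hi
      · exact h ⟨i.val, hi⟩
      · exact Set.mem_univ _
    · intro h j
      have := h (Fin.castLE hD j)
      rwa [dif_pos (show (Fin.castLE hD j).val < D from j.2)] at this
  rw [h1, Measure.pi_pi]
  have h2 : ∀ i : Fin d, ρ (if h : i.val < D then S ⟨i.val, h⟩ else Set.univ) =
      if h : i.val < D then ρ (S ⟨i.val, h⟩) else 1 := by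
    intro i
    split_ifs <;> simp
  simp_rw [h2]
  obtain ⟨e, rfl⟩ := Nat.exists_eq_add_of_le hD
  rw [Fin.prod_univ_add]
  simp

end PiLemmas

/-! ### Identification with the distributional recursion -/

section NormLaw

variable {k d n : ℕ}

theorem measurable_priorBelief (D : ℕ) :
    Measurable fun x : Fin d → Fin k → ℝ => priorBelief D x := by
  have h : ∀ c : Fin k, Measurable fun x : Fin d → Fin k → ℝ =>
      ∏ i with i.val < D, (1 - x i c) := fun c =>
    Finset.measurable_fun_prod _ fun i _ => measurable_const.sub
      ((measurable_pi_apply c).comp (measurable_pi_apply i))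
  exact measurable_pi_lambda _ fun c => (h c).div (Finset.measurable_fun_sum _ fun m _ => h m)

theorem priorBelief_castLE {D : ℕ} (hD : D ≤ d) (x : Fin d → Fin k → ℝ) :
    priorBelief D x = priorBelief D fun j : Fin D => x (Fin.castLE hD j) := by
  have h : ∀ c, ∏ i with i.val < D, (1 - x i c) =
      ∏ j : Fin D with j.val < D, (1 - x (Fin.castLE hD j) c) := by
    intro c
    obtain ⟨e, rfl⟩ := Nat.exists_eq_add_of_le hD
    rw [Finset.prod_filter, Finset.prod_filter, Fin.prod_univ_add]
    simp
    rfl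
  ext c
  simp only [priorBelief, h]

theorem priorBelief_shift [NeZero k] {D : ℕ} (z : Fin D → Fin k × (Fin k → ℝ)) :
    priorBelief D (fun i m => (z i).2 (m - (z i).1)) = combine k z := by
  have h : (Finset.univ.filter fun i : Fin D => i.val < D) = Finset.univ := by
    ext i; simp
  ext c
  simp only [priorBelief, combine, h]

variable {ξ : Measure ℕ} [IsProbabilityMeasure ξ] {μ : Measure ℝ} [IsProbabilityMeasure μ]
  {B : InfoRule k d n} {s : Info k d n → Fin k → ℝ} [NeZero k]

namespace Calibrated

variable (h : Calibrated ξ μ B s) (hk : 2 ≤ k) (hμ : μ (Set.Icc (1 / (k : ℝ)) 1) = 1)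

include h hk

omit [IsProbabilityMeasure μ] [NeZero k] in
-- Total mass one on both sides of the splitting at the root: each of the `k` root colours has
-- probability `1 / k`, and each subtree avoids it with probability `1 - 1 / k`.
theorem splitConst_mul : splitConst k d n * ENNReal.ofReal (1 - 1 / (k : ℝ)) ^ d =
    (k : ℝ≥0∞)⁻¹ := by
  have hlaw := isProbabilityMeasure_law hk d n ξ
  have hlaw' := isProbabilityMeasure_law hk d (n + 1) ξ
  have h1 := lintegral_law_succ (d := d) (n := n) hk ξ (Ψ := fun _ _ _ => 1)
    fun _ => measurable_const
  have h2 : ∀ c : Fin k, ∫⁻ _ : Seed × ℕ, ∫⁻ _ : Fin d → Outcome k d n, 1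
      ∂(Measure.pi fun _ : Fin d => (law k d n ξ).restrict {ω | rootColour ω ≠ c})
      ∂(siteLaw ξ) = ENNReal.ofReal (1 - 1 / (k : ℝ)) ^ d := by
    intro c
    rw [lintegral_const, lintegral_const, Measure.pi_univ, (inferInstance :
      IsProbabilityMeasure (siteLaw ξ)).measure_univ, mul_one, one_mul]
    simp [h.measure_rootColour_ne hk c]
  simp_rw [h2] at h1
  rw [lintegral_const, measure_univ, mul_one, Finset.sum_const, Finset.card_univ,
    Fintype.card_fin, nsmul_eq_mul] at h1
  refine ENNReal.eq_inv_of_mul_eq_one_left ?_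
  rw [h1]
  ring

include hμ in
theorem map_withDensity (c : Fin k) :
    ((infoLaw ξ B).withDensity fun b => ENNReal.ofReal (1 - s b c)).map s =
      ENNReal.ofReal (1 - 1 / (k : ℝ)) • childLaw k c (symmLift k μ) := by
  rw [← withDensity_symmLift hk hμ c, ← h.map_eq_symmLift hk]
  refine Measure.ext_of_lintegral _ fun F hF => ?_
  have hg : Measurable fun x : Fin k → ℝ => ENNReal.ofReal (1 - x c) := by fun_prop
  have hgs : Measurable fun b => ENNReal.ofReal (1 - s b c) := hg.comp h.measurable
  have hFs : Measurable fun b => F (s b) := hF.comp h.measurable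
  rw [lintegral_map hF h.measurable, lintegral_withDensity_eq_lintegral_mul _ hgs hFs,
    lintegral_withDensity_eq_lintegral_mul _ hg hF, lintegral_map (hg.mul hF) h.measurable]
  rfl

include hμ in
-- Only the first `D` offspring matter. Their posterior vectors are independent of law `childLaw`, a
-- tilted vector read relative to a uniform nonzero shift, which is the input of `combine`. All `d`
-- offspring contribute a mass `1 - 1 / k`.
theorem measure_prior_mem (c : Fin k) {D : ℕ} (hD : D ≤ d) {E : Set (Fin k → ℝ)}
    (hE : MeasurableSet E) :
    (Measure.pi fun _ : Fin d => (infoLaw ξ B).withDensity fun b => ENNReal.ofReal (1 - s b c))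
        {b | prior s (eraseInfo D b) ∈ E} = ENNReal.ofReal (1 - 1 / (k : ℝ)) ^ d *
      (Measure.pi fun _ : Fin D => (nonzeroUnif k).prod (tilt k c (symmLift k μ)))
        (combine k ⁻¹' E) := by
  have := isProbabilityMeasure_nonzeroUnif hk
  have := isProbabilityMeasure_tilt_symmLift hk μ hμ c
  have := isProbabilityMeasure_childLaw hk μ hμ c
  have hsm : Measurable fun (b : Fin d → Info k d n) (i : Fin d) => s (b i) :=
    measurable_pi_lambda _ fun i => h.measurable.comp (measurable_pi_apply i)
  have hlaw := isProbabilityMeasure_law hk d n ξ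
  have hfin : IsFiniteMeasure ((infoLaw ξ B).withDensity fun b => ENNReal.ofReal (1 - s b c)) := by
    rw [← h.map_restrict_ne hk c]; infer_instance
  have hpb := measurable_priorBelief (k := k) (d := d) D
  have hpb' := measurable_priorBelief (k := k) (d := D) D
  have hcast : Measurable fun (x : Fin d → Fin k → ℝ) (j : Fin D) => x (Fin.castLE hD j) :=
    measurable_pi_lambda _ fun j => measurable_pi_apply _
  have hshift : Measurable fun (z : Fin D → Fin k × (Fin k → ℝ)) (i : Fin D) (m : Fin k) =>
      (z i).2 (m - (z i).1) :=
    measurable_pi_lambda _ fun i => measurable_childShift.comp (measurable_pi_apply i)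
  have h1 : {b : Fin d → Info k d n | prior s (eraseInfo D b) ∈ E} =
      (fun b i => s (b i)) ⁻¹' ((fun x => priorBelief D x) ⁻¹' E) := by
    ext b
    simp [h.priorBelief_eq_prior hk D b]
  have hr : (ENNReal.ofReal (1 - 1 / (k : ℝ))) ≠ ∞ := ENNReal.ofReal_ne_top
  have hfin2 : IsFiniteMeasure
      (((infoLaw ξ B).withDensity fun b => ENNReal.ofReal (1 - s b c)).map s) := by infer_instance
  rw [h1, ← Measure.map_apply hsm (hpb hE), Measure.pi_map_pi fun _ => h.measurable.aemeasurable]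
  simp_rw [h.map_withDensity hk hμ c]
  rw [pi_smul_const d _ hr, Measure.smul_apply, smul_eq_mul]
  congr 1
  have h2 : ((fun x : Fin d → Fin k → ℝ => priorBelief D x) ⁻¹' E) =
      (fun (x : Fin d → Fin k → ℝ) (j : Fin D) => x (Fin.castLE hD j)) ⁻¹'
        ((fun x => priorBelief D x) ⁻¹' E) := by
    ext x
    simp only [Set.mem_preimage]
    rw [priorBelief_castLE hD x]
  rw [h2, ← Measure.map_apply hcast (hpb' hE), map_castLE_pi hD]
  unfold childLaw
  have h3 : IsProbabilityMeasure (((nonzeroUnif k).prod (tilt k c (symmLift k μ))).map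
      fun z m => z.2 (m - z.1)) := isProbabilityMeasure_childLaw hk μ hμ c
  rw [← Measure.pi_map_pi fun _ => measurable_childShift.aemeasurable,
    Measure.map_apply hshift (hpb' hE)]
  congr 1
  ext z
  simp only [Set.mem_preimage]
  rw [priorBelief_shift]

include hμ in
-- Decompose according to the colour of the root and the number `D` of retained offspring. Each
-- colour yields one summand of `treeOpSymm`. No mass lies on `D > d`, which the tree could not
-- accommodate.
theorem map_norm_familyLaw (hξ : ∀ D, d < D → ξ {D} = 0) :
    (familyLaw ξ B s).map (fun a => ‖prior s a‖) = maxOp k ξ μ := by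
  have hlaw := isProbabilityMeasure_law hk d n ξ
  have hn : Measurable fun a : Fin d → Info k d n => ‖prior s a‖ := h.measurable_prior.norm
  refine Measure.ext fun E hE => ?_
  have hE' : MeasurableSet {x : Fin k → ℝ | ‖x‖ ∈ E} := measurable_norm hE
  set T : Set (Fin d → Info k d n) := {a | ‖prior s a‖ ∈ E} with hT
  have hTm : MeasurableSet T := hn hE
  have hind : Measurable (T.indicator (1 : (Fin d → Info k d n) → ℝ≥0∞)) :=
    measurable_one.indicator hTm
  have hpm : ∀ c, Measurable fun a : Fin d → Info k d n => ENNReal.ofReal (prior s a c) :=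
    fun c => ((measurable_pi_apply c).comp h.measurable_prior).ennreal_ofReal
  have h1 : familyLaw ξ B s T = ∑ c, ∫⁻ a, ENNReal.ofReal (prior s a c) * T.indicator 1 a
      ∂(familyLaw ξ B s) := by
    have hpi : ∀ c, Measurable fun a : Fin d → Info k d n =>
        ENNReal.ofReal (prior s a c) * T.indicator 1 a := fun c => (hpm c).mul hind
    rw [← lintegral_finsetSum _ fun c _ => hpi c, ← lintegral_indicator_one hTm]
    refine lintegral_congr_ae ((h.ae_familyLaw hk).mono fun a ⟨h0, hsum⟩ => ?_)
    simp only
    rw [← Finset.sum_mul, ← ENNReal.ofReal_sum_of_nonneg fun c _ => h0 c, hsum, ENNReal.ofReal_one,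
      one_mul]
  have h2 : ∀ c, ∫⁻ a, ENNReal.ofReal (prior s a c) * T.indicator 1 a ∂(familyLaw ξ B s) =
      (k : ℝ≥0∞)⁻¹ * treeOp k ξ (tilt k c (symmLift k μ)) {x | ‖x‖ ∈ E} := by
    intro c
    rw [h.lintegral_familyLaw hk c hind, ← h.lintegral_retainedLaw hk c hind, lintegral_countable',
      treeOp_apply k ξ _ hE', ← h.splitConst_mul hk, mul_assoc]
    congr 1
    rw [← ENNReal.tsum_mul_left]
    refine tsum_congr fun D => ?_
    rcases le_or_gt D d with hD | hD
    · have h3 : ∫⁻ b, T.indicator (1 : (Fin d → Info k d n) → ℝ≥0∞) (eraseInfo D b)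
          ∂(Measure.pi fun _ : Fin d =>
            (infoLaw ξ B).withDensity fun b => ENNReal.ofReal (1 - s b c)) =
          (Measure.pi fun _ : Fin d =>
            (infoLaw ξ B).withDensity fun b => ENNReal.ofReal (1 - s b c))
            {b | prior s (eraseInfo D b) ∈ {x : Fin k → ℝ | ‖x‖ ∈ E}} :=
        lintegral_indicator_one (measurable_eraseInfo_right D hTm)
      rw [h3, h.measure_prior_mem hk hμ c hD hE']
      ring
    · rw [hξ D hD]; simp
  rw [Measure.map_apply hn hE]
  change familyLaw ξ B s T = _
  rw [h1, maxOp, Measure.map_apply measurable_norm hE, treeOpSymm, Measure.smul_apply,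
    Measure.finsetSum_apply, smul_eq_mul, Finset.mul_sum]
  exact Finset.sum_congr rfl fun c _ => h2 c

end Calibrated

end NormLaw

end TreeColouring
end
noncomputable section
namespace TreeColouring

/-! ### The algorithm is calibrated -/

section Inner

variable {k d n : ℕ} [NeZero k] {ξ : Measure ℕ} [IsProbabilityMeasure ξ] {μ : Measure ℝ}
  [IsProbabilityMeasure μ]

theorem isProbabilityMeasure_maxOp (hk : 2 ≤ k) (hμ : μ (Set.Icc (1 / (k : ℝ)) 1) = 1) :
    IsProbabilityMeasure (maxOp k ξ μ) := by
  have := isProbabilityMeasure_nonzeroUnif hk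
  have h1 : ∀ c, treeOp k ξ (tilt k c (symmLift k μ)) Set.univ = 1 := by
    intro c
    have := isProbabilityMeasure_tilt_symmLift hk μ hμ c
    rw [treeOp_apply k ξ _ MeasurableSet.univ]
    simp only [Set.preimage_univ, measure_univ, mul_one]
    simpa using (lintegral_countable' (μ := ξ) fun _ : ℕ => (1 : ℝ≥0∞)).symm
  have hk0 : (k : ℝ≥0∞) ≠ 0 := by exact_mod_cast (by omega : k ≠ 0)
  refine ⟨?_⟩
  rw [maxOp, Measure.map_apply measurable_norm MeasurableSet.univ, Set.preimage_univ, treeOpSymm,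
    Measure.smul_apply, Measure.finsetSum_apply, smul_eq_mul, Finset.sum_congr rfl fun c _ => h1 c]
  simp [ENNReal.inv_mul_cancel hk0 (ENNReal.natCast_ne_top k)]

omit [IsProbabilityMeasure μ] in
-- Erased entries are fixed by permutations of the colours, so the arrays can be erased before they
-- are permuted.
theorem innerStep_eq_mixStep (B : InfoRule k d n) (η : Leaf d (n + 1) → Fin k)
    (U : Vertex d (n + 1) → Seed) (D : Vertex d (n + 1) → ℕ) :
    innerStep k d n μ ξ B η U D = mixStep (maxOp k ξ μ) μ permuteFamily joinTree
      (priorBelief (D (root d (n + 1))) fun i => belief ξ B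
        (B (fun w => η (w.below i)) (fun w => U (w.below i)) fun w => D (w.below i)))
      (U (root d (n + 1)))
      (eraseInfo (D (root d (n + 1))) fun i =>
        B (fun w => η (w.below i)) (fun w => U (w.below i)) fun w => D (w.below i)) := by
  ext ⟨v, hv⟩ : 1
  cases v with
  | nil => rfl
  | cons i w =>
    by_cases hi : i.val < D (root d (n + 1))
    · simp only [innerStep, mixStep, joinTree, permuteFamily, permuteInfo, eraseInfo, hi, if_true]
    · simp only [innerStep, mixStep, joinTree, permuteFamily, permuteInfo, eraseInfo, hi, if_false]
      rfl

theorem measurable_belief (B : InfoRule k d n) : Measurable (belief ξ B) :=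
  measurable_pi_lambda _ fun c =>
    (Kernel.measurable_coe _ (measurableSet_singleton c)).ennreal_toReal

attribute [local irreducible] mixStep innerStep

theorem measurable_innerStep (hk : 2 ≤ k) (hμ : μ (Set.Icc (1 / (k : ℝ)) 1) = 1)
    {B : InfoRule k d n} (hB : Measurable fun x : (Leaf d n → Fin k) × (Vertex d n → Seed) ×
      (Vertex d n → ℕ) => B x.1 x.2.1 x.2.2) :
    Measurable fun x : (Leaf d (n + 1) → Fin k) × (Vertex d (n + 1) → Seed) ×
      (Vertex d (n + 1) → ℕ) => innerStep k d n μ ξ B x.1 x.2.1 x.2.2 := by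
  have := isProbabilityMeasure_maxOp (ξ := ξ) hk hμ
  simp_rw [innerStep_eq_mixStep]
  have hsub : Measurable fun (x : (Leaf d (n + 1) → Fin k) × (Vertex d (n + 1) → Seed) ×
      (Vertex d (n + 1) → ℕ)) (i : Fin d) =>
      B (fun w => x.1 (w.below i)) (fun w => x.2.1 (w.below i)) fun w => x.2.2 (w.below i) := by
    refine measurable_pi_lambda _ fun i => ?_
    have h1 : Measurable fun x : (Leaf d (n + 1) → Fin k) × (Vertex d (n + 1) → Seed) ×
        (Vertex d (n + 1) → ℕ) => ((fun w : Leaf d n => x.1 (w.below i)),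
          (fun w : Vertex d n => x.2.1 (w.below i)), fun w : Vertex d n => x.2.2 (w.below i)) := by
      fun_prop
    exact hB.comp h1
  have hD : Measurable fun x : (Leaf d (n + 1) → Fin k) × (Vertex d (n + 1) → Seed) ×
      (Vertex d (n + 1) → ℕ) => x.2.2 (root d (n + 1)) := by fun_prop
  have hU : Measurable fun x : (Leaf d (n + 1) → Fin k) × (Vertex d (n + 1) → Seed) ×
      (Vertex d (n + 1) → ℕ) => x.2.1 (root d (n + 1)) := by fun_prop
  have hp : Measurable fun z : ℕ × (Fin d → Info k d n) =>
      priorBelief z.1 fun i => belief ξ B (z.2 i) := by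
    refine measurable_from_prod_countable_right fun D => ?_
    have h1 : Measurable fun (b : Fin d → Info k d n) (i : Fin d) => belief ξ B (b i) :=
      measurable_pi_lambda _ fun i => (measurable_belief B).comp (measurable_pi_apply i)
    exact (measurable_priorBelief D).comp h1
  have hJ : Measurable (Function.uncurry
      (joinTree : Entry k → (Fin d → Info k d n) → Info k d (n + 1))) := measurable_joinTree
  exact (measurable_mixStep (μ₁ := maxOp k ξ μ) hμ measurable_permuteFamily hJ).comp
    ((hp.comp (hD.prodMk hsub)).prodMk (hU.prodMk (measurable_eraseInfo.comp (hD.prodMk hsub))))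

omit [NeZero k] in
theorem measurable_observed_of_rule {B : InfoRule k d n} (hB : Measurable fun x : (Leaf d n → Fin k) ×
      (Vertex d n → Seed) × (Vertex d n → ℕ) => B x.1 x.2.1 x.2.2) : Measurable (observed B) := by
  have h1 : Measurable fun ω : Outcome k d n => ((fun w : Leaf d n => ω.1 w.toVertex), ω.2) := by
    fun_prop
  exact hB.comp h1

omit [NeZero k] in
theorem measurable_blendPost_comp {X : Type*} [MeasurableSpace X] {f : X → ℝ} {g : X → Entry k}
    (hf : Measurable f) (hg : Measurable g) : Measurable fun x => blendPost (f x) (g x) :=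
  measurable_blendPost.comp (hf.prodMk hg)

omit [NeZero k] in
theorem permuteInfo_joinTree (τ : Equiv.Perm (Fin k)) (e : Entry k) (a : Fin d → Info k d n) :
    permuteInfo τ (joinTree e a) = joinTree (e.permute τ) (permuteFamily τ a) := by
  ext ⟨v, hv⟩ : 1
  cases v <;> rfl

/-- The posterior can be read off from the permuted arrays that Bob sees: permuting all colours does
not change the height of the peak of `prior`, and together with the disclosed weight and colour this
height determines the star-shaped vector. -/
theorem Calibrated.innerStep (hk : 2 ≤ k) (hμ : μ (Set.Icc (1 / (k : ℝ)) 1) = 1)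
    (hd : Dominates (maxOp k ξ μ) μ) (hξ : ∀ D, d < D → ξ {D} = 0) {B : InfoRule k d n}
    (hB : Measurable fun x : (Leaf d n → Fin k) × (Vertex d n → Seed) × (Vertex d n → ℕ) =>
      B x.1 x.2.1 x.2.2)
    {s : Info k d n → Fin k → ℝ} (h : Calibrated ξ μ B s) :
    Calibrated ξ μ (innerStep k d n μ ξ B) fun b =>
      blendPost ‖prior s fun i w => b (w.below i)‖ (b (root d (n + 1))) := by
  have hprob := isProbabilityMeasure_maxOp (ξ := ξ) hk hμ
  have hM := h.isProbabilityMeasure_infoLaw hk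
  have hsf : SFinite (familyLaw (d := d) ξ B s) := by
    unfold familyLaw retainedLaw; infer_instance
  have hJ : Measurable (Function.uncurry
      (joinTree : Entry k → (Fin d → Info k d n) → Info k d (n + 1))) := measurable_joinTree
  have hsub : Measurable fun (b : Info k d (n + 1)) (i : Fin d) (w : Vertex d n) =>
      b (w.below i) := by fun_prop
  have hobs : Measurable (observed (TreeColouring.innerStep k d n μ ξ B)) :=
    measurable_observed_of_rule (measurable_innerStep hk hμ hB)
  refine Calibrated.of_mixStep (A := familyLaw ξ B s) (μ₁ := maxOp k ξ μ) (act := permuteFamily)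
    (J := joinTree) (P := prior s) hk hμ hd measurable_permuteFamily (h.map_permute_familyLaw hk)
    hJ h.measurable_prior h.prior_permute (h.ae_familyLaw hk) (h.map_norm_familyLaw hk hμ hξ)
    permuteInfo_joinTree hobs ?_
    (fun p l a => rfl) (fun π b c => ?_) (fun b => blendPost_star hk _ _) (fun c => rfl) ?_
  · exact measurable_blendPost_comp (h.measurable_prior.comp hsub).norm
      (measurable_pi_apply (root d (n + 1)))
  · have h1 : ‖prior s fun (i : Fin d) w => permuteInfo π b (w.below i)‖ =
        ‖prior s fun (i : Fin d) w => b (w.below i)‖ :=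
      norm_apply_perm π (h.prior_permute π fun (i : Fin d) w => b (w.below i))
    simp only [h1]
    exact blendPost_permute _ _ π c
  · intro c F hF
    have hG : Measurable (Function.uncurry fun (U : Seed) (a : Fin d → Info k d n) =>
        F (mixStep (maxOp k ξ μ) μ permuteFamily joinTree (prior s a) U a)) := by
      have h1 : Measurable fun z : Seed × (Fin d → Info k d n) => (prior s z.2, z.1, z.2) :=
        (h.measurable_prior.comp measurable_snd).prodMk (measurable_fst.prodMk measurable_snd)
      have h2 : Measurable fun z : Seed × (Fin d → Info k d n) =>
          mixStep (maxOp k ξ μ) μ permuteFamily joinTree (prior s z.2) z.1 z.2 :=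
        (measurable_mixStep (μ₁ := maxOp k ξ μ) hμ measurable_permuteFamily hJ).comp h1
      exact hF.comp h2
    rw [← h.lintegral_law_family hk c hG]
    refine lintegral_congr_ae (ae_restrict_of_ae ?_)
    -- Almost surely the beliefs used by the algorithm at all offspring agree with the explicit
    -- posterior `s`.
    filter_upwards [h.ae_subOutcome hk (h.belief_ae hk)] with ω hω
    have h3 : observed (TreeColouring.innerStep k d n μ ξ B) ω =
        mixStep (maxOp k ξ μ) μ permuteFamily joinTree
          (priorBelief (ω.2.2 (root d (n + 1))) fun i => belief ξ B (observed B (subOutcome ω i)))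
          (ω.2.1 (root d (n + 1)))
          (eraseInfo (ω.2.2 (root d (n + 1))) fun i => observed B (subOutcome ω i)) :=
      innerStep_eq_mixStep B _ _ _
    simp_rw [h3, hω]
    rw [h.priorBelief_eq_prior hk _ fun i => observed B (subOutcome ω i)]

theorem measurable_bobInfo (hk : 2 ≤ k) (hμ : μ (Set.Icc (1 / (k : ℝ)) 1) = 1) (n : ℕ) :
    Measurable fun x : (Leaf d n → Fin k) × (Vertex d n → Seed) × (Vertex d n → ℕ) =>
      bobInfo k d μ ξ n x.1 x.2.1 x.2.2 := by
  induction n with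
  | zero => exact measurable_leafStep hk hμ
  | succ n ih => exact measurable_innerStep hk hμ ih

theorem exists_calibrated_bobInfo (hk : 2 ≤ k) (hμ : μ (Set.Icc (1 / (k : ℝ)) 1) = 1)
    (hd : Dominates (maxOp k ξ μ) μ) (hξ : ∀ D, d < D → ξ {D} = 0) (n : ℕ) :
    ∃ s, Calibrated ξ μ (bobInfo k d μ ξ n) s := by
  induction n with
  | zero => exact ⟨_, calibrated_leafStep hk hμ ξ⟩
  | succ n ih =>
    obtain ⟨s, hs⟩ := ih
    exact ⟨_, hs.innerStep hk hμ hd hξ (measurable_bobInfo hk hμ n)⟩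

end Inner

end TreeColouring
end
noncomputable section
namespace TreeColouring

/-! ### Truncating the Poisson law -/

theorem truncPoisson_singleton_of_lt (d' : ℝ≥0) {d D : ℕ} (h : d < D) :
    truncPoisson d' d {D} = 0 := by
  rw [truncPoisson, Measure.map_apply Measurable.of_discrete (MeasurableSet.singleton D)]
  convert measure_empty (μ := poissonMeasure d')
  ext m
  simp only [Set.mem_preimage, Set.mem_singleton_iff, Set.mem_empty_iff_false, iff_false]
  split_ifs <;> omega

theorem lintegral_truncPoisson (d' : ℝ≥0) (d : ℕ) (f : ℕ → ℝ≥0∞) :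
    ∫⁻ b, f b ∂(truncPoisson d' d) = ∫⁻ m, f (if m ≤ d then m else 0) ∂(poissonMeasure d') :=
  lintegral_map Measurable.of_discrete Measurable.of_discrete

/-- The truncated variable and the Poisson variable agree unless the latter exceeds `d`. -/
theorem lintegral_truncPoisson_le (d' : ℝ≥0) (d : ℕ) {f : ℕ → ℝ≥0∞} (hf : ∀ b, f b ≤ 1) :
    ∫⁻ b, f b ∂(truncPoisson d' d) ≤
      ∫⁻ b, f b ∂(poissonMeasure d') + poissonMeasure d' (Set.Ioi d) := by
  rw [lintegral_truncPoisson, ← lintegral_indicator_one (measurableSet_Ioi (a := d)),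
    ← lintegral_add_left Measurable.of_discrete]
  refine lintegral_mono fun m => ?_
  by_cases hm : m ≤ d
  · simp [hm]
  · simp only [hm, if_false, Set.indicator_of_mem (Set.mem_Ioi.2 (not_le.1 hm)), Pi.one_apply]
    exact (hf 0).trans le_add_self

theorem poissonMeasure_singleton_zero_ne (r : ℝ≥0) : poissonMeasure r {0} ≠ 0 := by
  simp [poissonMeasure_singleton, Real.exp_pos]

/-- Truncation moves mass only to zero, which the Poisson law already charges. This covers the
alternative of `DominatesBy` without a margin. -/
theorem lintegral_truncPoisson_eq_zero (d' : ℝ≥0) (d : ℕ) {f : ℕ → ℝ≥0∞}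
    (hf : ∫⁻ b, f b ∂(poissonMeasure d') = 0) : ∫⁻ b, f b ∂(truncPoisson d' d) = 0 := by
  rw [lintegral_eq_zero_iff Measurable.of_discrete] at hf
  have h0 : f 0 = 0 := by
    by_contra h
    exact poissonMeasure_singleton_zero_ne d'
      (measure_mono_null (Set.singleton_subset_iff.2 h) hf)
  rw [lintegral_truncPoisson, lintegral_eq_zero_iff Measurable.of_discrete]
  filter_upwards [hf] with m hm
  split_ifs
  · exact hm
  · exact h0

theorem maxOp_Iic_eq_lintegral (k : ℕ) [NeZero k] (ξ : Measure ℕ) (μ : Measure ℝ) (x : ℝ) :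
    maxOp k ξ μ (Set.Iic x) = ∫⁻ b, (k : ℝ≥0∞)⁻¹ * ∑ l,
      (Measure.pi fun _ : Fin b => (nonzeroUnif k).prod (tilt k l (symmLift k μ)))
        (combine k ⁻¹' {p | ‖p‖ ≤ x}) ∂ξ := by
  rw [lintegral_const_mul _ Measurable.of_discrete,
    lintegral_finsetSum _ fun _ _ => Measurable.of_discrete, maxOp_Iic]
  congr 1
  refine Finset.sum_congr rfl fun l _ => ?_
  rw [treeOp_apply _ _ _ (measurableSet_le measurable_norm measurable_const), lintegral_countable']
  exact tsum_congr fun b => mul_comm _ _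

/-- The distribution function after truncation exceeds the Poisson one by at most the tail
probability, which the margin `ε` absorbs. -/
theorem dominates_truncPoisson {k : ℕ} [NeZero k] (hk : 2 ≤ k) {μ : Measure ℝ}
    [IsProbabilityMeasure μ] (hμ : μ (Set.Icc (1 / (k : ℝ)) 1) = 1) {d' : ℝ≥0} {d : ℕ} {ε : ℝ}
    (hε : poissonMeasure d' (Set.Ioi d) ≤ ENNReal.ofReal ε)
    (h : DominatesBy ε (maxOp k (poissonMeasure d') μ) μ) :
    Dominates (maxOp k (truncPoisson d' d) μ) μ := by
  have := isProbabilityMeasure_nonzeroUnif hk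
  have hprob := isProbabilityMeasure_maxOp (ξ := truncPoisson d' d) hk hμ
  have ht := isProbabilityMeasure_tilt_symmLift hk μ hμ
  have hk0 : (k : ℝ≥0∞) ≠ 0 := by exact_mod_cast (by omega : k ≠ 0)
  intro x
  rcases h x with h1 | h0 | h2
  · exact h1 ▸ prob_le_one
  · rw [maxOp_Iic_eq_lintegral] at h0 ⊢
    rw [lintegral_truncPoisson_eq_zero d' d h0]
    exact zero_le
  · refine le_trans ?_ ((add_le_add_right hε _).trans h2)
    rw [maxOp_Iic_eq_lintegral, maxOp_Iic_eq_lintegral]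
    refine lintegral_truncPoisson_le d' d fun b => ?_
    calc _ ≤ (k : ℝ≥0∞)⁻¹ * ∑ _l : Fin k, 1 := by
          gcongr with l
          exact prob_le_one
      _ = 1 := by simp [ENNReal.inv_mul_cancel hk0 (ENNReal.natCast_ne_top k)]

/-! ### The advantage of a calibrated rule -/

theorem iSup_abs_starVec_sub {k : ℕ} (hk : 2 ≤ k) {y : ℝ} (hy : y ∈ Set.Icc (1 / (k : ℝ)) 1)
    (l₀ : Fin k) : ⨆ l, |starVec k y l₀ l - 1 / (k : ℝ)| = y - 1 / k := by
  have hk' : (2 : ℝ) ≤ k := by exact_mod_cast hk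
  have h0 : 0 ≤ y - 1 / (k : ℝ) := sub_nonneg.2 hy.1
  have : Nonempty (Fin k) := ⟨l₀⟩
  refine le_antisymm (ciSup_le fun l => ?_) ?_
  · by_cases hl : l = l₀
    · simp only [starVec, hl, if_true, abs_of_nonneg h0, le_refl]
    · have h1 : (1 - y) / ((k : ℝ) - 1) - 1 / k = -((y - 1 / k) / (k - 1)) := by
        have : (k : ℝ) - 1 ≠ 0 := by linarith
        field_simp
        ring
      simp only [starVec, hl, if_false, h1, abs_neg]
      rw [abs_of_nonneg (div_nonneg h0 (by linarith))]
      exact div_le_self h0 (by linarith)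
  · refine le_ciSup_of_le (Finite.bddAbove_range _) l₀ ?_
    simp only [starVec, if_true]
    exact le_abs_self _

section Advantage

variable {k d n : ℕ} [NeZero k] {ξ : Measure ℕ} [IsProbabilityMeasure ξ] {μ : Measure ℝ}
  {B : InfoRule k d n} {s : Info k d n → Fin k → ℝ}

/-- The conditional expectations are the entries of a star-shaped vector, whose largest deviation
from `1 / k` is at its peak; the peak has law `μ`. -/
theorem Calibrated.advantage_eq (hk : 2 ≤ k) (h : Calibrated ξ μ B s) :
    advantage ξ B = ∫ y, (y - 1 / (k : ℝ)) ∂μ := by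
  have hlaw := isProbabilityMeasure_law hk d n ξ
  have hn : Measurable fun b => ‖s b‖ := h.measurable.norm
  have hcond : ∀ᵐ ω ∂(law k d n ξ), ∀ l,
      condExp (MeasurableSpace.comap (observed B) inferInstance) (law k d n ξ)
        (Set.indicator (rootColour ⁻¹' {l}) (fun _ => (1 : ℝ))) ω = s (observed B ω) l := by
    refine ae_all_iff.2 fun l => ?_
    filter_upwards [condDistrib_ae_eq_condExp (μ := law k d n ξ) h.measurable_observed
      measurable_rootColour (measurableSet_singleton l),
      ae_of_ae_map h.measurable_observed.aemeasurable (h.belief_ae hk)] with ω h1 h2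
    rw [← h1, ← h2]
    rfl
  conv_rhs => rw [← h.map_norm]
  rw [integral_map hn.aemeasurable (by fun_prop), infoLaw,
    integral_map h.measurable_observed.aemeasurable (hn.sub_const _).aestronglyMeasurable,
    advantage]
  refine integral_congr_ae (hcond.mono fun ω hω => ?_)
  obtain ⟨y, hy, l, hl⟩ := h.star (observed B ω)
  simp only [hω, hl, norm_starVec hk hy, iSup_abs_starVec_sub hk hy]

end Advantage

theorem integral_sub_pos {μ : Measure ℝ} [IsProbabilityMeasure μ] {a b : ℝ}
    (hμ : μ (Set.Icc a b) = 1) (hne : μ ≠ Measure.dirac a) : 0 < ∫ y, (y - a) ∂μ := by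
  have hae : ∀ᵐ y ∂μ, y ∈ Set.Icc a b := by
    rw [← prob_compl_eq_zero_iff measurableSet_Icc] at hμ
    exact hμ
  have h0 : 0 ≤ᵐ[μ] fun y => y - a := hae.mono fun y hy => sub_nonneg.2 hy.1
  have hint : Integrable (fun y => y - a) μ :=
    Integrable.of_bound (by fun_prop) (b - a) (hae.mono fun y hy => by
      rw [Real.norm_eq_abs, abs_of_nonneg (sub_nonneg.2 hy.1)]
      linarith [hy.2])
  refine lt_of_le_of_ne (integral_nonneg_of_ae h0) fun h => hne ?_
  have h1 := (integral_eq_zero_iff_of_nonneg_ae h0 hint).1 h.symm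
  have h2 : (fun y : ℝ => y) =ᵐ[μ] fun _ => a := h1.mono fun y hy => sub_eq_zero.1 hy
  calc μ = μ.map fun y => y := Measure.map_id'.symm
    _ = μ.map fun _ => a := Measure.map_congr h2
    _ = Measure.dirac a := by simp

end TreeColouring
end
-- Assembly of both statements
theorem mainTheorem5 :
    ∃ β₀ : ℝ, β₀ < 1 ∧ ∃ c : ℝ, 0 < c ∧ ∃ k₀ : ℕ,
      -- the constants are those of the stochastic dominance theorem
      (∀ (k : ℕ) [NeZero k], k₀ < k → ∀ d : ℝ≥0,
        (k : ℝ) * (Real.log k + Real.log (Real.log k) + β₀) ≤ d →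
        ∃ μ : Measure ℝ, TreeColouring.IsDominated c k d μ) ∧
      -- the reconstruction statement on the regular tree
      (∀ βs : ℝ, β₀ < βs → βs < 1 →
        ∀ (k : ℕ) [NeZero k], 2 ≤ k → ∀ d d' : ℕ, d' = ⌊(d : ℝ) - (βs - β₀) * k⌋₊ →
        ∀ μ : Measure ℝ, TreeColouring.IsDominated c k d' μ →
        poissonMeasure (d' : ℝ≥0) (Set.Ioi d) < ENNReal.ofReal (c / (k * Real.log k)) →
        (∀ n : ℕ, Measurable (fun x : (TreeColouring.Leaf d n → Fin k) ×
            (TreeColouring.Vertex d n → TreeColouring.Seed) × (TreeColouring.Vertex d n → ℕ) =>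
          TreeColouring.bobInfo k d μ (TreeColouring.truncPoisson d' d) n x.1 x.2.1 x.2.2)) ∧
        0 < Filter.liminf (fun n : ℕ =>
          TreeColouring.advantage (TreeColouring.truncPoisson d' d)
            (TreeColouring.bobInfo k d μ (TreeColouring.truncPoisson d' d) n)) Filter.atTop) := by
  obtain ⟨k₀, hk₀⟩ := TreeColouring.exists_isDominated
  refine ⟨1 - 1e-7, by norm_num, 1e-7, by norm_num, k₀, hk₀, ?_⟩
  intro βs _ _ k _ hk d d' _ μ hdom htail
  have hprob := hdom.isProbabilityMeasure
  have hε : (1e-7 : ℝ) / (k * Real.log k) ≤ 1e-7 / Real.log k := by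
    have hk' : (2 : ℝ) ≤ k := by exact_mod_cast hk
    have hlog : 0 < Real.log k := Real.log_pos (by linarith)
    exact div_le_div_of_nonneg_left (by norm_num) hlog (by nlinarith)
  have hd := TreeColouring.dominates_truncPoisson hk hdom.supported
    (htail.le.trans (ENNReal.ofReal_le_ofReal hε)) hdom.dominates
  refine ⟨fun n => TreeColouring.measurable_bobInfo hk hdom.supported n, ?_⟩
  -- The advantage does not depend on the height, so the lower limit is that of a constant sequence.
  have hadv : ∀ n, TreeColouring.advantage (TreeColouring.truncPoisson d' d)
      (TreeColouring.bobInfo k d μ (TreeColouring.truncPoisson d' d) n) =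
        ∫ y, (y - 1 / (k : ℝ)) ∂μ := by
    intro n
    obtain ⟨s, hs⟩ := TreeColouring.exists_calibrated_bobInfo hk hdom.supported hd
      (fun D => TreeColouring.truncPoisson_singleton_of_lt _) n
    exact hs.advantage_eq hk
  simp_rw [hadv, Filter.liminf_const]
  exact TreeColouring.integral_sub_pos hdom.supported hdom.nontrivial
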